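/- **Setting.** Let $\Omega=\mathbb T^3=\mathbb R^3/\mathbb Z^3$ or $\Omega=\mathbb R^3$, and let $a>0$, $\gamma>1$, $\mu>0$, $\varepsilon>0$, $\kappa\in(0,1)$, $T>0$ and, if $\Omega=\mathbb R^3$, $\overline\varrho>0$. Put $p(s)=a s^\gamma$, $P(s)=\frac{a}{\gamma-1}s^\gamma$, $\beta=\sqrt{\kappa/(1-\kappa)}$, $\theta=\sqrt{\kappa(1-\kappa)}$, $H(s|r)=P(s)-P(r)-P'(r)(s-r)$ and $h(s|r)=p(s)-p(r)-p'(r)(s-r)$. Let $\Pi(s)=P(s)$ if $\Omega=\mathbb T^3$ and $\Pi(s)=H(s|\overline\varrho)$ if $\Omega=\mathbb R^3$. We write $(\nabla z)_{ij}=\partial_j z_i$, $\mathbb D z$ and $\mathbb A z$ for the symmetric and antisymmetric part of $\nabla z$, and $A:B=\sum_{i,j}A_{ij}B_{ij}$. Let $G\in C^1(\Omega)$; if $\Omega=\mathbb R^3$, let $\nabla G\in L^2\cap L^\infty$. **Solutions.** A weak $\kappa$-entropy solution $(\varrho,\mathbf v,\mathbf w)$ of the two-velocity system with initial data $(\varrho_0,\mathbf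 v_0,\mathbf w_0)$, where $\varrho_0\ge0$ and $\varrho_0(|\mathbf v_0|^2+|\mathbf w_0|^2)$, $\Pi(\varrho_0)\in L^1(\Omega)$, consists of measurable fields with the following properties, where $\mathbf u=\mathbf v-\beta\mathbf w$. 1. *Regularity.* $\varrho\ge0$; $\Pi(\varrho)\in L^\infty(0,T;L^1(\Omega))$; $\sqrt\varrho\,\mathbf v$, $\sqrt\varrho\,\mathbf w$, $\sqrt\varrho\,\nabla\log\varrho:=2\nabla\sqrt\varrho\in L^\infty(0,T;L^2(\Omega))$; $\nabla\varrho^{\gamma/2}=\frac\gamma2\varrho^{\gamma/2}\nabla\log\varrho\in L^2((0,T)\times\Omega)$; gradients are distributional. We write $\nabla\varrho=\varrho\nabla\log\varrho$. 2. *Barred quantities.* For a field $\mathbf z$ with $\sqrt\varrho\,\mathbf z\in L^\infty(0,T;L^2)$ let $[\varrho\nabla\mathbf z]$ be the distribution $\nabla(\varrho\mathbf z)-2\sqrt\varrho\,\mathbf z\otimes\nabla\sqrt\varrho$ on $(0,T)\times\Omega$, and $[\varrho\mathbb D\mathbf z]$, $[\varrho\mathbb A\mathbf z]$ its symmetric and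 antisymmetric part. There are matrix fields $\overline{\sqrt\varrho\nabla\mathbf u}$, $\mathbb S=\overline{\sqrt\varrho(\sqrt{1-\kappa}\,\mathbb D\mathbf v-\sqrt\kappa\,\nabla\mathbf w)}$ and $\overline{\sqrt\varrho\,\mathbb A\mathbf v}$ in $L^2((0,T)\times\Omega)$, the last two being part of the solution, with $\sqrt\varrho\,\overline{\sqrt\varrho\nabla\mathbf u}=[\varrho\nabla\mathbf u]$, $\sqrt\varrho\,\mathbb S=\sqrt{1-\kappa}\,[\varrho\mathbb D\mathbf v]-\sqrt\kappa\,[\varrho\nabla\mathbf w]$ and $\sqrt\varrho\,\overline{\sqrt\varrho\,\mathbb A\mathbf v}=[\varrho\mathbb A\mathbf v]$ as distributions. Moreover $[\varrho\mathbb A\mathbf w]=0$, that is, $[\varrho\mathbb D\mathbf w]=[\varrho\nabla\mathbf w]$. 3. *Equations.* For all $\phi\in C_c^\infty([0,T)\times\Omega)$ and $\boldsymbol\phi\in C_c^\infty([0,T)\times\Omega;\mathbb R^3)$, $$\int_0^T\!\!\int_\Omega(\varrho\,\partial_t\phi+\varrho\mathbf u\cdot\nabla\phi)\,dx\,dt=-\int_\Omega\varrho_0\phi(0)\,dx,$$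 $$\int_0^T\!\!\int_\Omega\Big(\varrho\mathbf v\cdot\partial_t\boldsymbol\phi+\varrho\mathbf v\otimes\mathbf u:\nabla\boldsymbol\phi+\tfrac1{\varepsilon^2}p(\varrho)\,\mathrm{div}\,\boldsymbol\phi\Big)-2\mu\int_0^T\!\!\int_\Omega\sqrt\varrho\Big(\sqrt{1-\kappa}\,\mathbb S:\mathbb D\boldsymbol\phi+\kappa\,\overline{\sqrt\varrho\,\mathbb A\mathbf v}:\mathbb A\boldsymbol\phi\Big)=-\tfrac1{\varepsilon^2}\int_0^T\!\!\int_\Omega\varrho\nabla G\cdot\boldsymbol\phi-\int_\Omega\varrho_0\mathbf v_0\cdot\boldsymbol\phi(0),$$ $$\int_0^T\!\!\int_\Omega\big(\varrho\mathbf w\cdot\partial_t\boldsymbol\phi+\varrho\mathbf w\otimes\mathbf u:\nabla\boldsymbol\phi\big)+2\mu\int_0^T\!\!\int_\Omega\sqrt\varrho\Big(\sqrt\kappa\,\mathbb S:\mathbb D\boldsymbol\phi-\theta\,\overline{\sqrt\varrho\,\mathbb A\mathbf v}:\mathbb A\boldsymbol\phi\Big)=-\int_\Omega\varrho_0\mathbf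 w_0\cdot\boldsymbol\phi(0).$$ 4. *$\kappa$-entropy inequality.* For almost every $t\in(0,T)$, $$\int_\Omega\Big(\varrho\tfrac{|\mathbf v|^2+|\mathbf w|^2}2+\tfrac1{\varepsilon^2}\Pi(\varrho)\Big)(t)+2\mu\int_0^t\!\!\int_\Omega\Big(\kappa|\overline{\sqrt\varrho\,\mathbb A\mathbf v}|^2+|\mathbb S|^2\Big)+\tfrac{2\kappa\mu}{\varepsilon^2}\int_0^t\!\!\int_\Omega\tfrac{p'(\varrho)}\varrho|\nabla\varrho|^2\le\int_\Omega\Big(\varrho_0\tfrac{|\mathbf v_0|^2+|\mathbf w_0|^2}2+\tfrac1{\varepsilon^2}\Pi(\varrho_0)\Big)+\tfrac1{\varepsilon^2}\int_0^t\!\!\int_\Omega\varrho\nabla G\cdot\mathbf v.$$ **Test triples.** Let $r\in C^1([0,T]\times\Omega)$, $r>0$, and $\mathbf V,\mathbf W\in C^1([0,T]\times\Omega;\mathbb R^3)$. If $\Omega=\mathbb R^3$, suppose also that $r(t,x)\to\overline\varrho$ as $|x|\to\infty$ for each $t\in[0,T]$, and that $r-\overline\varrho$, $\mathbf V$, $\mathbf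 W$ and their first-order derivatives in $(t,x)$ are bounded and square integrable on $(0,T)\times\mathbb R^3$. Put $\mathbf U=\mathbf V-\beta\mathbf W$, $\mathbb B_{\mathbb A}=\overline{\sqrt\varrho\,\mathbb A\mathbf v}-\sqrt\varrho\,\mathbb A\mathbf V$, $\mathbb Q=\sqrt{1-\kappa}\,\mathbb D\mathbf V-\sqrt\kappa\,\mathbb D\mathbf W$, $\mathbb B_{\mathbb D}=\mathbb S-\sqrt\varrho\,\mathbb Q$, and $$\mathscr E(\tau)=\frac12\int_\Omega\varrho\big(|\mathbf v-\mathbf V|^2+|\mathbf w-\mathbf W|^2\big)(\tau)\,dx+\frac1{\varepsilon^2}\int_\Omega H(\varrho|r)(\tau)\,dx;$$ $\mathscr E(0)$, when subtracted below, is formed with $(\varrho_0,\mathbf v_0,\mathbf w_0)$. **Claim.** (a) All integrals below converge absolutely, and for almost every $\tau\in(0,T)$ $$\begin{aligned}&\mathscr E(\tau)-\mathscr E(0)+2\kappa\mu\int_0^\tau\!\!\int_\Omega|\mathbb B_{\mathbb A}|^2+2\mu\int_0^\tau\!\!\int_\Omega|\mathbb B_{\mathbb D}|^2+\tfrac{2\kappa\mu}{\varepsilon^2}\int_0^\tau\!\!\int_\Omega\varrho\big(p'(\varrho)\nabla\log\varrho-p'(r)\nabla\log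 r\big)\cdot(\nabla\log\varrho-\nabla\log r)\\&\le\int_0^\tau\!\!\int_\Omega\varrho\big[(\mathbf u\cdot\nabla)\mathbf W\cdot(\mathbf W-\mathbf w)+(\mathbf u\cdot\nabla)\mathbf V\cdot(\mathbf V-\mathbf v)\big]+\int_0^\tau\!\!\int_\Omega\varrho\big(\partial_t\mathbf W\cdot(\mathbf W-\mathbf w)+\partial_t\mathbf V\cdot(\mathbf V-\mathbf v)\big)\\&\quad+\tfrac1{\varepsilon^2}\int_0^\tau\!\!\int_\Omega\partial_tP'(r)(r-\varrho)-\tfrac1{\varepsilon^2}\int_0^\tau\!\!\int_\Omega\nabla P'(r)\cdot(\varrho\mathbf u-r\mathbf U)+\tfrac1{\varepsilon^2}\int_0^\tau\!\!\int_\Omega(p(r)-p(\varrho))\,\mathrm{div}\,\mathbf U\\&\quad-\tfrac\kappa{\varepsilon^2}\int_0^\tau\!\!\int_\Omega p'(\varrho)\nabla\varrho\cdot\Big(2\mu\tfrac{\nabla r}r-\tfrac1\theta\mathbf W\Big)-2\mu\int_0^\tau\!\!\int_\Omega\sqrt\varrho\,\mathbb Q:\mathbb B_{\mathbb D}-2\kappa\mu\int_0^\tau\!\!\int_\Omega\sqrt\varrho\,\mathbb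 A\mathbf V:\mathbb B_{\mathbb A}\\&\quad+\tfrac{2\kappa\mu}{\varepsilon^2}\int_0^\tau\!\!\int_\Omega\tfrac\varrho r\,p'(r)\nabla r\cdot\Big(\tfrac{\nabla r}r-\nabla\log\varrho\Big)+2\theta\mu\int_0^\tau\!\!\int_\Omega\sqrt\varrho\,\mathbb A\mathbf W:\overline{\sqrt\varrho\,\mathbb A\mathbf v}+\tfrac1{\varepsilon^2}\int_0^\tau\!\!\int_\Omega\varrho\nabla G\cdot(\mathbf v-\mathbf V).\end{aligned}$$ If the solution is given by a representative for which $\varrho$, $\varrho\mathbf v$, $\varrho\mathbf w$ are locally integrable on $\Omega$ at each time and continuous in $t\in[0,T]$ in the sense of distributions on $\Omega$, then the inequality holds for every $\tau\in[0,T]$. (b) Suppose in addition that $\sqrt\varrho\,\mathbf w=2\theta\mu\sqrt\varrho\,\nabla\log\varrho$ almost everywhere, that $\partial_tr+\mathrm{div}(r\mathbf U)=0$, and that $\mathbf W=2\theta\mu\nabla\log r$. Then, in the same sense, the inequality in (a) holds with its right-hand side replaced by $$\begin{aligned}\mathcal R(\tau)=&\int_0^\tau\!\!\int_\Omega\varrho((\mathbf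 u-\mathbf U)\cdot\nabla)\mathbf W\cdot(\mathbf W-\mathbf w)+\int_0^\tau\!\!\int_\Omega\varrho((\mathbf u-\mathbf U)\cdot\nabla)\mathbf V\cdot(\mathbf V-\mathbf v)\\&+\int_0^\tau\!\!\int_\Omega\varrho(\mathbf W-\mathbf w)\cdot(\partial_t\mathbf W+\mathbf U\cdot\nabla\mathbf W)+\int_0^\tau\!\!\int_\Omega\varrho(\mathbf V-\mathbf v)\cdot(\partial_t\mathbf V+\mathbf U\cdot\nabla\mathbf V)\\&-\tfrac1{\varepsilon^2}\int_0^\tau\!\!\int_\Omega h(\varrho|r)\,\mathrm{div}\,\mathbf U+\tfrac1{\varepsilon^2}\int_0^\tau\!\!\int_\Omega\varrho(\nabla G-\nabla P'(r))\cdot(\mathbf v-\mathbf V)\\&-2\mu\int_0^\tau\!\!\int_\Omega\sqrt\varrho\,\mathbb Q:\mathbb B_{\mathbb D}-2\kappa\mu\int_0^\tau\!\!\int_\Omega\sqrt\varrho\,\mathbb A\mathbf V:\mathbb B_{\mathbb A},\end{aligned}$$ and also $$\begin{aligned}&\mathscr E(\tau)-\mathscr E(0)+2\kappa\mu\int_0^\tau\!\!\int_\Omega|\mathbb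 B_{\mathbb A}|^2+2\mu\int_0^\tau\!\!\int_\Omega|\mathbb B_{\mathbb D}|^2+\tfrac{2\kappa\mu}{\varepsilon^2}\int_0^\tau\!\!\int_\Omega\varrho p'(\varrho)|\nabla\log\varrho-\nabla\log r|^2\\&\le\mathcal R(\tau)+\tfrac{2\kappa\mu}{\varepsilon^2}\int_0^\tau\!\!\int_\Omega h(\varrho|r)\,\Delta\log r+\tfrac{2\kappa\mu}{\varepsilon^2}\int_0^\tau\!\!\int_\Omega\Big(\varrho\big(p'(\varrho)-p'(r)\big)-p''(r)\,r\,(\varrho-r)\Big)|\nabla\log r|^2.\end{aligned}$$ -/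

import Mathlib

open MeasureTheory Set Filter Topology

namespace KEntropy

noncomputable section

/-- Euclidean three-space. -/
abbrev E : Type := EuclideanSpace ℝ (Fin 3)

/-- Real `3 × 3` matrices. -/
abbrev Mat : Type := Matrix (Fin 3) (Fin 3) ℝ

/-- The Frobenius product `A : B`. -/
def ddot (A B : Mat) : ℝ := ∑ i, ∑ j, A i j * B i j

/-- The `j`-th unit vector. -/
def unitVec (j : Fin 3) : E := EuclideanSpace.single j 1

/-! ### The spatial domain -/

/-- The two spatial domains: the torus `ℝ³ / ℤ³` and the whole space `ℝ³`. -/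
inductive Dom where
  | torus
  | space

/-- Functions on the torus are the functions on `ℝ³` that are `1`-periodic in each coordinate.
There is no condition for the whole space. -/
def Dom.Per {F : Type*} (dom : Dom) (f : E → F) : Prop :=
  match dom with
  | .torus => ∀ (j : Fin 3) (x : E), f (x + unitVec j) = f x
  | .space => True

/-- The set over which one integrates: a periodicity cell, or the whole space. -/
def Dom.cell (dom : Dom) : Set E :=
  match dom with
  | .torus => {x | ∀ i, x i ∈ Ico (0 : ℝ) 1}
  | .space => univ

/-- `∫₀^τ ∫_Ω f dx dt`. -/
def stInt (dom : Dom) (τ : ℝ) (f : ℝ → E → ℝ) : ℝ :=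
  ∫ z in Ioo 0 τ ×ˢ dom.cell, f z.1 z.2

/-- Absolute integrability on `(0,T) × Ω`. -/
def StIntegrable (dom : Dom) (T : ℝ) (f : ℝ → E → ℝ) : Prop :=
  IntegrableOn (fun z : ℝ × E => f z.1 z.2) (Ioo 0 T ×ˢ dom.cell)

/-- Measurability on `(0,T) × ℝ³`, up to null sets. -/
def StMeas {F : Type*} [TopologicalSpace F] (T : ℝ) (f : ℝ → E → F) : Prop :=
  AEStronglyMeasurable (fun z : ℝ × E => f z.1 z.2) (volume.restrict (Ioo 0 T ×ˢ univ))

/-- `f ∈ L^∞(0,T; L¹(Ω))` (joint measurability is required separately). -/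
def LInfL1 (dom : Dom) (T : ℝ) (f : ℝ → E → ℝ) : Prop :=
  ∃ C : ℝ, ∀ᵐ t ∂(volume.restrict (Ioo 0 T)),
    IntegrableOn (f t) dom.cell ∧ ∫ x in dom.cell, |f t x| ≤ C

/-! ### Classical differential operators -/

section Calculus

variable {F : Type*} [NormedAddCommGroup F] [NormedSpace ℝ F]

/-- Time derivative. -/
def dt (f : ℝ → E → F) (t : ℝ) (x : E) : F := deriv (fun s => f s x) t

/-- Spatial partial derivative in the direction of the `j`-th unit vector. -/
def pd (j : Fin 3) (f : E → F) (x : E) : F := fderiv ℝ f x (unitVec j)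

end Calculus

/-- `(∇V)ᵢⱼ = ∂ⱼ Vᵢ`. -/
def jac (V : E → E) (x : E) : Mat := Matrix.of fun i j => pd j V x i

/-- Symmetric part of the gradient. -/
def symGrad (V : E → E) (x : E) : Mat := (1 / 2 : ℝ) • (jac V x + (jac V x).transpose)

/-- Antisymmetric part of the gradient. -/
def skewGrad (V : E → E) (x : E) : Mat := (1 / 2 : ℝ) • (jac V x - (jac V x).transpose)

/-- Divergence. -/
def divg (V : E → E) (x : E) : ℝ := (jac V x).trace

/-- Laplacian of a scalar function. -/
def lapl (f : E → ℝ) (x : E) : ℝ := ∑ i, pd i (pd i f) x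

/-- `(u · ∇) V`. -/
def convect (u : E) (V : E → E) (x : E) : E := ∑ j, u j • pd j V x

/-! ### Parameters and the pressure law -/

/-- The constants: the pressure law is `a ϱ^γ`, `μ` is the viscosity, `ε` the Mach and Froude
number, `κ` the entropy parameter, `T` the final time, `ρbar` the far-field density (used only on
the whole space). -/
structure Params where
  a : ℝ
  γ : ℝ
  μ : ℝ
  ε : ℝ
  κ : ℝ
  T : ℝ
  ρbar : ℝ
  a_pos : 0 < a
  one_lt_γ : 1 < γ
  μ_pos : 0 < μ
  ε_pos : 0 < ε
  κ_pos : 0 < κ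
  κ_lt_one : κ < 1
  T_pos : 0 < T
  ρbar_pos : 0 < ρbar

namespace Params

variable (c : Params)

/-- `√(κ / (1 - κ))`. -/
def β : ℝ := √(c.κ / (1 - c.κ))

/-- `√(κ (1 - κ))`. -/
def θ : ℝ := √(c.κ * (1 - c.κ))

/-- Pressure `p`. -/
def p (s : ℝ) : ℝ := c.a * s ^ c.γ

/-- `p'`. -/
def dp (s : ℝ) : ℝ := c.a * c.γ * s ^ (c.γ - 1)

/-- `p''`. -/
def ddp (s : ℝ) : ℝ := c.a * c.γ * (c.γ - 1) * s ^ (c.γ - 2)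

/-- Pressure potential `P`. -/
def P (s : ℝ) : ℝ := c.a / (c.γ - 1) * s ^ c.γ

/-- `P'`. -/
def dP (s : ℝ) : ℝ := c.a / (c.γ - 1) * c.γ * s ^ (c.γ - 1)

/-- `P(s) - P(r) - P'(r)(s - r)`. -/
def relP (s r : ℝ) : ℝ := c.P s - c.P r - c.dP r * (s - r)

/-- `p(s) - p(r) - p'(r)(s - r)`. -/
def relp (s r : ℝ) : ℝ := c.p s - c.p r - c.dp r * (s - r)

/-- The potential energy density in the entropy: `P(ϱ)` on the torus, and
`P(ϱ) - P(ρbar) - P'(ρbar)(ϱ - ρbar)` on the whole space. -/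
def pot (dom : Dom) (s : ℝ) : ℝ :=
  match dom with
  | .torus => c.P s
  | .space => c.relP s c.ρbar

end Params

/-! ### Test functions of the weak formulation -/

/-- `φ ∈ C_c^∞([0,T) × Ω; F)`. -/
structure IsTest {F : Type*} [NormedAddCommGroup F] [NormedSpace ℝ F]
    (dom : Dom) (T : ℝ) (φ : ℝ → E → F) : Prop where
  smooth : ContDiff ℝ ((⊤ : ℕ∞) : WithTop ℕ∞) (fun z : ℝ × E => φ z.1 z.2)
  per : ∀ t, dom.Per (φ t)
  time : ∃ T' < T, ∀ t x, T' ≤ t → φ t x = 0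
  supp : dom = .space → ∃ R : ℝ, ∀ t x, R ≤ ‖x‖ → φ t x = 0

/-- `φ ∈ C_c^∞((0,T) × Ω; F)`. -/
structure IsInteriorTest {F : Type*} [NormedAddCommGroup F] [NormedSpace ℝ F]
    (dom : Dom) (T : ℝ) (φ : ℝ → E → F) : Prop extends IsTest dom T φ where
  init : ∃ δ > 0, ∀ t x, t ≤ δ → φ t x = 0

/-- `ψ ∈ C_c^∞(Ω; F)`. -/
structure IsSpaceTest {F : Type*} [NormedAddCommGroup F] [NormedSpace ℝ F]
    (dom : Dom) (ψ : E → F) : Prop where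
  smooth : ContDiff ℝ ((⊤ : ℕ∞) : WithTop ℕ∞) ψ
  per : dom.Per ψ
  supp : dom = .space → ∃ R : ℝ, ∀ x, R ≤ ‖x‖ → ψ x = 0

/-- `g` is the spatial gradient of `f` in the sense of distributions on `(0,T) × Ω`. -/
def HasWeakGrad (dom : Dom) (T : ℝ) (f : ℝ → E → ℝ) (g : ℝ → E → E) : Prop :=
  ∀ φ : ℝ → E → ℝ, IsInteriorTest dom T φ → ∀ j : Fin 3,
    stInt dom T (fun t x => f t x * pd j (φ t) x) = - stInt dom T (fun t x => g t x j * φ t x)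

/-- The `(i,j)` entry of the matrix-valued distribution `∇(ϱz) - 2 √ϱ z ⊗ ∇√ϱ` (which is `ϱ ∇z`
for regular `ϱ > 0` and `z`), tested with `φ`. Here `l` stands for `∇ log ϱ`, so that
`2 √ϱ z ⊗ ∇√ϱ = ϱ z ⊗ l`. -/
def rhoGrad (dom : Dom) (T : ℝ) (ρ : ℝ → E → ℝ) (l z : ℝ → E → E) (i j : Fin 3)
    (φ : ℝ → E → ℝ) : ℝ :=
  - stInt dom T (fun t x => ρ t x * z t x i * pd j (φ t) x)
    - stInt dom T (fun t x => ρ t x * z t x i * l t x j * φ t x)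

/-! ### Weak solutions -/

/-- Initial data. -/
structure Data where
  ρ : E → ℝ
  v : E → E
  w : E → E

/-- The fields that make up a weak solution. The values of `v`, `w`, `l` where `ρ = 0` never
matter. -/
structure Fields where
  /-- the density `ϱ` -/
  ρ : ℝ → E → ℝ
  v : ℝ → E → E
  w : ℝ → E → E
  /-- the field `∇ log ϱ`, meaningful when multiplied by `√ϱ` -/
  l : ℝ → E → E
  /-- the field `√ϱ (√(1-κ) 𝔻v - √κ ∇w)` with a bar -/
  S : ℝ → E → Mat
  /-- the field `√ϱ 𝔸v` with a bar -/
  A : ℝ → E → Mat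

/-- The transport velocity `u = v - √(κ/(1-κ)) w`. -/
def Fields.u (s : Fields) (c : Params) (t : ℝ) (x : E) : E := s.v t x - c.β • s.w t x

/-- Density of the `κ`-entropy. -/
def entropyDens (dom : Dom) (c : Params) (ρ : ℝ) (v w : E) : ℝ :=
  ρ * (‖v‖ ^ 2 / 2 + ‖w‖ ^ 2 / 2) + 1 / c.ε ^ 2 * c.pot dom ρ

/-- The external potential: `G ∈ C¹(Ω)`, with bounded and square integrable gradient on the whole
space. -/
structure IsPotential (dom : Dom) (G : E → ℝ) : Prop where
  smooth : ContDiff ℝ 1 G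
  per : dom.Per G
  decay : dom = .space →
    (∃ C : ℝ, ∀ x, ‖gradient G x‖ ≤ C) ∧ Integrable (fun x => ‖gradient G x‖ ^ 2)

/-- Weak `κ`-entropy solutions `(ϱ, v, w)` of the two-velocity system on `(0,T) × Ω` with initial
data `d`. -/
structure IsSolution (dom : Dom) (c : Params) (G : E → ℝ) (d : Data) (s : Fields) : Prop where
  -- initial data of finite entropy
  data_nonneg : ∀ x, 0 ≤ d.ρ x
  data_per : dom.Per d.ρ ∧ dom.Per d.v ∧ dom.Per d.w
  data_meas : AEStronglyMeasurable d.ρ volume ∧ AEStronglyMeasurable d.v volume ∧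
    AEStronglyMeasurable d.w volume
  data_kin : IntegrableOn (fun x => d.ρ x * (‖d.v x‖ ^ 2 / 2 + ‖d.w x‖ ^ 2 / 2)) dom.cell
  data_pot : IntegrableOn (fun x => c.pot dom (d.ρ x)) dom.cell
  -- the fields are functions on `Ω`, and measurable
  per : ∀ t, dom.Per (s.ρ t) ∧ dom.Per (s.v t) ∧ dom.Per (s.w t) ∧ dom.Per (s.l t) ∧
    dom.Per (s.S t) ∧ dom.Per (s.A t)
  meas : StMeas c.T s.ρ ∧ StMeas c.T s.v ∧ StMeas c.T s.w ∧ StMeas c.T s.l ∧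
    StMeas c.T s.S ∧ StMeas c.T s.A
  -- regularity
  nonneg : ∀ t x, 0 ≤ s.ρ t x
  reg_pot : LInfL1 dom c.T (fun t x => c.pot dom (s.ρ t x))
  reg_v : LInfL1 dom c.T (fun t x => s.ρ t x * ‖s.v t x‖ ^ 2)
  reg_w : LInfL1 dom c.T (fun t x => s.ρ t x * ‖s.w t x‖ ^ 2)
  -- `√ϱ l = 2 ∇√ϱ ∈ L^∞(0,T; L²)`
  reg_l : LInfL1 dom c.T (fun t x => s.ρ t x * ‖s.l t x‖ ^ 2)
  grad_sqrt : HasWeakGrad dom c.T (fun t x => √(s.ρ t x))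
    (fun t x => (1 / 2 * √(s.ρ t x)) • s.l t x)
  -- `(γ/2) ϱ^(γ/2) l = ∇ϱ^(γ/2) ∈ L²(0,T; L²)`
  reg_grad_pow : StIntegrable dom c.T
    (fun t x => ‖(c.γ / 2 * s.ρ t x ^ (c.γ / 2)) • s.l t x‖ ^ 2)
  grad_pow : HasWeakGrad dom c.T (fun t x => s.ρ t x ^ (c.γ / 2))
    (fun t x => (c.γ / 2 * s.ρ t x ^ (c.γ / 2)) • s.l t x)
  -- `√ϱ ∇u` with a bar is in `L²(0,T; L²)`
  reg_u : ∃ B : ℝ → E → Mat, StMeas c.T B ∧ (∀ t, dom.Per (B t)) ∧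
    StIntegrable dom c.T (fun t x => ddot (B t x) (B t x)) ∧
    ∀ φ : ℝ → E → ℝ, IsInteriorTest dom c.T φ → ∀ i j,
      stInt dom c.T (fun t x => √(s.ρ t x) * B t x i j * φ t x)
        = rhoGrad dom c.T s.ρ s.l (s.u c) i j φ
  -- the other barred quantities, in the sense of distributions
  reg_S : StIntegrable dom c.T (fun t x => ddot (s.S t x) (s.S t x))
  reg_A : StIntegrable dom c.T (fun t x => ddot (s.A t x) (s.A t x))
  bar_S : ∀ φ : ℝ → E → ℝ, IsInteriorTest dom c.T φ → ∀ i j,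
    stInt dom c.T (fun t x => √(s.ρ t x) * s.S t x i j * φ t x)
      = √(1 - c.κ) * (1 / 2 * (rhoGrad dom c.T s.ρ s.l s.v i j φ
          + rhoGrad dom c.T s.ρ s.l s.v j i φ))
        - √c.κ * rhoGrad dom c.T s.ρ s.l s.w i j φ
  bar_A : ∀ φ : ℝ → E → ℝ, IsInteriorTest dom c.T φ → ∀ i j,
    stInt dom c.T (fun t x => √(s.ρ t x) * s.A t x i j * φ t x)
      = 1 / 2 * (rhoGrad dom c.T s.ρ s.l s.v i j φ - rhoGrad dom c.T s.ρ s.l s.v j i φ)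
  -- `√ϱ 𝔸w = 0`, i.e. `√ϱ 𝔻w = √ϱ ∇w`, with bars
  bar_w : ∀ φ : ℝ → E → ℝ, IsInteriorTest dom c.T φ → ∀ i j,
    rhoGrad dom c.T s.ρ s.l s.w i j φ = rhoGrad dom c.T s.ρ s.l s.w j i φ
  -- continuity equation
  continuity : ∀ φ : ℝ → E → ℝ, IsTest dom c.T φ →
    stInt dom c.T (fun t x => s.ρ t x * dt φ t x
        + s.ρ t x * inner ℝ (s.u c t x) (gradient (φ t) x))
      = - ∫ x in dom.cell, d.ρ x * φ 0 x
  -- equation for `v`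
  momentum_v : ∀ φ : ℝ → E → E, IsTest dom c.T φ →
    stInt dom c.T (fun t x => s.ρ t x * inner ℝ (s.v t x) (dt φ t x)
        + s.ρ t x * inner ℝ (s.v t x) (convect (s.u c t x) (φ t) x)
        + 1 / c.ε ^ 2 * c.p (s.ρ t x) * divg (φ t) x)
      - 2 * c.μ * stInt dom c.T (fun t x =>
          √(1 - c.κ) * √(s.ρ t x) * ddot (s.S t x) (symGrad (φ t) x)
            + c.κ * √(s.ρ t x) * ddot (s.A t x) (skewGrad (φ t) x))
      = - (1 / c.ε ^ 2) * stInt dom c.T (fun t x =>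
            s.ρ t x * inner ℝ (gradient G x) (φ t x))
        - ∫ x in dom.cell, d.ρ x * inner ℝ (d.v x) (φ 0 x)
  -- equation for `w`
  momentum_w : ∀ φ : ℝ → E → E, IsTest dom c.T φ →
    stInt dom c.T (fun t x => s.ρ t x * inner ℝ (s.w t x) (dt φ t x)
        + s.ρ t x * inner ℝ (s.w t x) (convect (s.u c t x) (φ t) x))
      + 2 * c.μ * stInt dom c.T (fun t x =>
          √c.κ * √(s.ρ t x) * ddot (s.S t x) (symGrad (φ t) x)
            - c.θ * √(s.ρ t x) * ddot (s.A t x) (skewGrad (φ t) x))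
      = - ∫ x in dom.cell, d.ρ x * inner ℝ (d.w x) (φ 0 x)
  -- `κ`-entropy inequality; `p'(ϱ)/ϱ |∇ϱ|² = ϱ p'(ϱ) |l|²`
  entropy : ∀ᵐ t ∂(volume.restrict (Ioo 0 c.T)),
    (∫ x in dom.cell, entropyDens dom c (s.ρ t x) (s.v t x) (s.w t x))
      + 2 * c.μ * stInt dom t (fun t' x =>
          c.κ * ddot (s.A t' x) (s.A t' x) + ddot (s.S t' x) (s.S t' x))
      + 2 * (c.κ * c.μ / c.ε ^ 2) * stInt dom t (fun t' x =>
          s.ρ t' x * c.dp (s.ρ t' x) * ‖s.l t' x‖ ^ 2)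
    ≤ (∫ x in dom.cell, entropyDens dom c (d.ρ x) (d.v x) (d.w x))
      + 1 / c.ε ^ 2 * stInt dom t (fun t' x =>
          s.ρ t' x * inner ℝ (gradient G x) (s.v t' x))

/-- The time slices of `(ϱ, ϱv, ϱw)` are locally integrable and depend continuously on
`t ∈ [0,T]` in the sense of distributions on `Ω`. This singles out, for every single time, the
slice of a solution, which is otherwise determined for almost every time only. -/
structure IsWeaklyContinuous (dom : Dom) (c : Params) (s : Fields) : Prop where
  loc : ∀ t ∈ Icc 0 c.T, LocallyIntegrable (s.ρ t) ∧
    LocallyIntegrable (fun x => s.ρ t x • s.v t x) ∧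
    LocallyIntegrable (fun x => s.ρ t x • s.w t x)
  cont_ρ : ∀ ψ : E → ℝ, IsSpaceTest dom ψ →
    ContinuousOn (fun t => ∫ x in dom.cell, s.ρ t x * ψ x) (Icc 0 c.T)
  cont_v : ∀ ψ : E → E, IsSpaceTest dom ψ →
    ContinuousOn (fun t => ∫ x in dom.cell, s.ρ t x * inner ℝ (s.v t x) (ψ x)) (Icc 0 c.T)
  cont_w : ∀ ψ : E → E, IsSpaceTest dom ψ →
    ContinuousOn (fun t => ∫ x in dom.cell, s.ρ t x * inner ℝ (s.w t x) (ψ x)) (Icc 0 c.T)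

/-- The relation `√ϱ w = 2 √(κ(1-κ)) μ √ϱ ∇ log ϱ`. -/
def IsLogGradient (c : Params) (s : Fields) : Prop :=
  ∀ᵐ z : ℝ × E ∂(volume.restrict (Ioo 0 c.T ×ˢ univ)),
    √(s.ρ z.1 z.2) • s.w z.1 z.2 = (2 * c.θ * c.μ) • √(s.ρ z.1 z.2) • s.l z.1 z.2

/-! ### Test triples -/

/-- `f` and its first derivatives are bounded and square integrable on `(0,T) × ℝ³`. -/
structure IsDecaying {F : Type*} [NormedAddCommGroup F] [NormedSpace ℝ F]
    (T : ℝ) (f : ℝ → E → F) : Prop where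
  bdd : ∃ C : ℝ, ∀ t ∈ Ioo 0 T, ∀ x,
    ‖f t x‖ ≤ C ∧ ‖dt f t x‖ ≤ C ∧ ‖fderiv ℝ (f t) x‖ ≤ C
  sq : StIntegrable .space T
    (fun t x => ‖f t x‖ ^ 2 + ‖dt f t x‖ ^ 2 + ‖fderiv ℝ (f t) x‖ ^ 2)

/-- A state `(r, V, W)` to compare with. -/
structure Triple where
  r : ℝ → E → ℝ
  V : ℝ → E → E
  W : ℝ → E → E

/-- `U = V - √(κ/(1-κ)) W`. -/
def Triple.U (q : Triple) (c : Params) (t : ℝ) (x : E) : E := q.V t x - c.β • q.W t x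

/-- `(r, V, W)` is of class `C¹` on `[0,T] × Ω` with `r > 0`. On the whole space, `r → ρbar` at
infinity, and `r - ρbar`, `V`, `W` decay as in `IsDecaying`. -/
structure IsTestTriple (dom : Dom) (c : Params) (q : Triple) : Prop where
  smooth_r : ContDiffOn ℝ 1 (fun z : ℝ × E => q.r z.1 z.2) (Icc 0 c.T ×ˢ univ)
  smooth_V : ContDiffOn ℝ 1 (fun z : ℝ × E => q.V z.1 z.2) (Icc 0 c.T ×ˢ univ)
  smooth_W : ContDiffOn ℝ 1 (fun z : ℝ × E => q.W z.1 z.2) (Icc 0 c.T ×ˢ univ)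
  per : ∀ t ∈ Icc 0 c.T, dom.Per (q.r t) ∧ dom.Per (q.V t) ∧ dom.Per (q.W t)
  pos : ∀ t ∈ Icc 0 c.T, ∀ x, 0 < q.r t x
  far : dom = .space → ∀ t ∈ Icc 0 c.T, Tendsto (q.r t) (cocompact E) (𝓝 c.ρbar)
  decay : dom = .space → IsDecaying c.T (fun t x => q.r t x - c.ρbar) ∧
    IsDecaying c.T q.V ∧ IsDecaying c.T q.W

/-- `∂ₜ r + div (r U) = 0` and `W = 2 √(κ(1-κ)) μ ∇ log r`. -/
structure IsReduced (c : Params) (q : Triple) : Prop where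
  continuity : ∀ t ∈ Ioo 0 c.T, ∀ x,
    dt q.r t x + divg (fun y => q.r t y • q.U c t y) x = 0
  logGrad : ∀ t ∈ Icc 0 c.T, ∀ x,
    q.W t x = (2 * c.θ * c.μ) • gradient (fun y => Real.log (q.r t y)) x

/-! ### The relative entropy functional -/

/-- Density of the relative `κ`-entropy. -/
def relDens (c : Params) (ρ : ℝ) (v w : E) (r : ℝ) (V W : E) : ℝ :=
  1 / 2 * (ρ * (‖v - V‖ ^ 2 + ‖w - W‖ ^ 2)) + 1 / c.ε ^ 2 * c.relP ρ r

/-- Density of the relative entropy of the solution at time `τ`. -/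
def relDensAt (c : Params) (s : Fields) (q : Triple) (τ : ℝ) (x : E) : ℝ :=
  relDens c (s.ρ τ x) (s.v τ x) (s.w τ x) (q.r τ x) (q.V τ x) (q.W τ x)

/-- Density of the relative entropy of the initial data. -/
def relDensInit (c : Params) (d : Data) (q : Triple) (x : E) : ℝ :=
  relDens c (d.ρ x) (d.v x) (d.w x) (q.r 0 x) (q.V 0 x) (q.W 0 x)

/-- The inequality `ℰ(τ) - ℰ(0) + ∑ ∫₀^τ∫_Ω lhs ≤ ∑ ∫₀^τ∫_Ω rhs` at the time `τ`, with
`ℰ(τ)` finite. -/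
def RelIneqAt (dom : Dom) (c : Params) (d : Data) (s : Fields) (q : Triple)
    (lhs rhs : List (ℝ → E → ℝ)) (τ : ℝ) : Prop :=
  IntegrableOn (relDensAt c s q τ) dom.cell ∧
    (∫ x in dom.cell, relDensAt c s q τ x) - (∫ x in dom.cell, relDensInit c d q x)
      + (lhs.map (stInt dom τ)).sum ≤ (rhs.map (stInt dom τ)).sum

/-- All integrals in the inequality converge absolutely, and the inequality holds for almost every
`τ ∈ (0,T)`, and for every `τ ∈ [0,T]` when the solution is given by its weakly continuous
representative. -/
def RelIneq (dom : Dom) (c : Params) (d : Data) (s : Fields) (q : Triple)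
    (lhs rhs : List (ℝ → E → ℝ)) : Prop :=
  (∀ f ∈ lhs ++ rhs, StIntegrable dom c.T f) ∧
  IntegrableOn (relDensInit c d q) dom.cell ∧
  (∀ᵐ τ ∂(volume.restrict (Ioo 0 c.T)), RelIneqAt dom c d s q lhs rhs τ) ∧
  (IsWeaklyContinuous dom c s → ∀ τ ∈ Icc 0 c.T, RelIneqAt dom c d s q lhs rhs τ)

/-! ### The terms of the inequalities -/

section Terms

variable (c : Params) (G : E → ℝ) (s : Fields) (q : Triple)

/-- `∇ log r`. -/
def gradLogR (t : ℝ) (x : E) : E := gradient (fun y => Real.log (q.r t y)) x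

/-- `∇ P'(r)`. -/
def gradPR (t : ℝ) (x : E) : E := gradient (fun y => c.dP (q.r t y)) x

/-- `√(1-κ) 𝔻V - √κ 𝔻W`. -/
def symVW (t : ℝ) (x : E) : Mat :=
  √(1 - c.κ) • symGrad (q.V t) x - √c.κ • symGrad (q.W t) x

/-- `√ϱ 𝔻(√(1-κ)(v - V) - √κ (w - W))` with a bar. -/
def barSym (t : ℝ) (x : E) : Mat := s.S t x - √(s.ρ t x) • symVW c q t x

/-- `√ϱ 𝔸(v - V)` with a bar. -/
def barSkew (t : ℝ) (x : E) : Mat := s.A t x - √(s.ρ t x) • skewGrad (q.V t) x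

/-- The viscous dissipation on the left-hand side. -/
def viscousTerms : List (ℝ → E → ℝ) :=
  [fun t x => 2 * c.κ * c.μ * ddot (barSkew s q t x) (barSkew s q t x),
   fun t x => 2 * c.μ * ddot (barSym c s q t x) (barSym c s q t x)]

/-- `2κμ/ε² ϱ (p'(ϱ)∇log ϱ - p'(r)∇log r) · (∇log ϱ - ∇log r)`. -/
def pressureTerm (t : ℝ) (x : E) : ℝ :=
  2 * (c.κ * c.μ / c.ε ^ 2) * (s.ρ t x *
    inner ℝ (c.dp (s.ρ t x) • s.l t x - c.dp (q.r t x) • gradLogR q t x)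
      (s.l t x - gradLogR q t x))

/-- `2κμ/ε² ϱ p'(ϱ) |∇log ϱ - ∇log r|²`. -/
def reducedPressureTerm (t : ℝ) (x : E) : ℝ :=
  2 * (c.κ * c.μ / c.ε ^ 2) *
    (s.ρ t x * c.dp (s.ρ t x) * ‖s.l t x - gradLogR q t x‖ ^ 2)

/-- `2μ √ϱ (√(1-κ) 𝔻V - √κ 𝔻W) : √ϱ 𝔻(√(1-κ)(V - v) - √κ (W - w))`, the last factor with a
bar. -/
def symTerm (t : ℝ) (x : E) : ℝ :=
  2 * c.μ * (√(s.ρ t x) * ddot (symVW c q t x) (- barSym c s q t x))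

/-- `2κμ √ϱ 𝔸V : √ϱ 𝔸(V - v)`, the last factor with a bar. -/
def skewTerm (t : ℝ) (x : E) : ℝ :=
  2 * c.κ * c.μ * (√(s.ρ t x) * ddot (skewGrad (q.V t) x) (- barSkew s q t x))

/-- The right-hand side for general test triples. -/
def generalTerms : List (ℝ → E → ℝ) :=
  [fun t x => s.ρ t x *
      (inner ℝ (convect (s.u c t x) (q.W t) x) (q.W t x - s.w t x)
        + inner ℝ (convect (s.u c t x) (q.V t) x) (q.V t x - s.v t x)),
   fun t x => s.ρ t x *
      (inner ℝ (dt q.W t x) (q.W t x - s.w t x) + inner ℝ (dt q.V t x) (q.V t x - s.v t x)),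
   fun t x => 1 / c.ε ^ 2 * (dt (fun t' y => c.dP (q.r t' y)) t x * (q.r t x - s.ρ t x)),
   fun t x => - (1 / c.ε ^ 2) *
      inner ℝ (gradPR c q t x) (s.ρ t x • s.u c t x - q.r t x • q.U c t x),
   fun t x => 1 / c.ε ^ 2 * ((c.p (q.r t x) - c.p (s.ρ t x)) * divg (q.U c t) x),
   fun t x => - (c.κ / c.ε ^ 2) *
      inner ℝ ((c.dp (s.ρ t x) * s.ρ t x) • s.l t x)
        ((2 * c.μ / q.r t x) • gradient (q.r t) x - (1 / c.θ) • q.W t x),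
   symTerm c s q,
   skewTerm c s q,
   fun t x => 2 * (c.κ * c.μ / c.ε ^ 2) * (s.ρ t x / q.r t x * c.dp (q.r t x) *
      inner ℝ (gradient (q.r t) x) ((1 / q.r t x) • gradient (q.r t) x - s.l t x)),
   fun t x => 2 * c.θ * c.μ * (√(s.ρ t x) * ddot (skewGrad (q.W t) x) (s.A t x)),
   fun t x => 1 / c.ε ^ 2 * (s.ρ t x * inner ℝ (gradient G x) (s.v t x - q.V t x))]

/-- The right-hand side for test triples as in `IsReduced`. -/
def reducedTerms : List (ℝ → E → ℝ) :=
  [fun t x => s.ρ t x *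
      inner ℝ (convect (s.u c t x - q.U c t x) (q.W t) x) (q.W t x - s.w t x),
   fun t x => s.ρ t x *
      inner ℝ (convect (s.u c t x - q.U c t x) (q.V t) x) (q.V t x - s.v t x),
   fun t x => s.ρ t x *
      inner ℝ (q.W t x - s.w t x) (dt q.W t x + convect (q.U c t x) (q.W t) x),
   fun t x => s.ρ t x *
      inner ℝ (q.V t x - s.v t x) (dt q.V t x + convect (q.U c t x) (q.V t) x),
   fun t x => - (1 / c.ε ^ 2) * (c.relp (s.ρ t x) (q.r t x) * divg (q.U c t) x),
   fun t x => 1 / c.ε ^ 2 * (s.ρ t x *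
      inner ℝ (gradient G x - gradPR c q t x) (s.v t x - q.V t x)),
   symTerm c s q,
   skewTerm c s q]

/-- The additional terms on the right-hand side when the pressure dissipation on the left-hand side
is `reducedPressureTerm`. -/
def extraTerms : List (ℝ → E → ℝ) :=
  [fun t x => 2 * (c.κ * c.μ / c.ε ^ 2) *
      (c.relp (s.ρ t x) (q.r t x) * lapl (fun y => Real.log (q.r t y)) x),
   fun t x => 2 * (c.κ * c.μ / c.ε ^ 2) *
      ((s.ρ t x * (c.dp (s.ρ t x) - c.dp (q.r t x))
        - c.ddp (q.r t x) * q.r t x * (s.ρ t x - q.r t x)) * ‖gradLogR q t x‖ ^ 2)]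

end Terms

end

end KEntropy

/-! The relative entropy is the entropy plus quantities whose evolution is given by equalities.
Pointwise, `½ϱ|v-V|² + ½ϱ|w-W|² = ½ϱ(|v|²+|w|²) - ϱ(v·V + w·W) + ½ϱ(|V|²+|W|²)`, and `H(ϱ|r) =
H(ϱ|ϱbar) - (ϱ-ϱbar)(P'(r)-P'(ϱbar)) + H(ϱbar|r)`. The first pieces make up the entropy, whose
inequality is assumed. The others come from the continuity equation tested with `|V|²`, `|W|²` and
`P'(r)-P'(ϱbar)`, from the equations for `v` and `w` tested with `V` and `W`, and from the
fundamental theorem of calculus for `H(ϱbar|r)`. Two integrals of divergences are added, those of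
`(p(r)-p(ϱbar))U` and, with the factor `β`, of `(p(ϱ)-p(ϱbar))W`. They turn the pressure terms into
`(p(r)-p(ϱ)) div U`. The viscous terms are a completed square (`viscous_identity`), and `κ/θ = β`
fixes the `W` part of the pressure flux. What remains is pointwise algebra, done in
`IsSolution.bal_relDens`.

Analysis enters in making `V`, `W` and functions of `r` admissible: they are only `C¹` up to the
boundary in time and have no compact support in `ℝ³`. All equations are brought to the scalar form
`WeakEq`. Mollification, a shift in time and a cut-off in space enlarge the class of tests
(`eq_of_contDiff`, `eq_mul`, `eq_time_mul`), and the resulting distributional derivative in time is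
integrated to almost every `τ` (`ae_eq`). Constants are not integrable on `ℝ³`, so far-field values
are subtracted throughout. The entropy controls `η = ϱ^(γ/2) - ϱbar^(γ/2)` in `L²`, and `ϱ-ϱbar`,
`p(ϱ)-p(ϱbar)` are bounded by multiples of `η² + |η|`; hence they pair with everything bounded and
square integrable (`Good` against `Tame`). On the torus `ϱbar` is an arbitrary positive number and
the same algebra is used. The gradients of `ϱ` and `p(ϱ)` come from those of `√ϱ` and `ϱ^(γ/2)` by
the rule for squares (`weakGrad_sq`).

For the special triples of (b), the Hessian of `log r` is symmetric, so `𝔸W = 0`; the continuity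
equation for `r` evaluates `∂ₜP'(r)`; and `ϱw = 2θμ ϱ∇log ϱ` with `θβ = κ` cancels the rest
pointwise (`generalTerms_sum_eq`). The last inequality adds the vanishing integral of
`div(h(ϱ|r)∇log r)` (`bal_extra`).

For every `τ`, the relative entropy density is convex in `(ϱ, ϱv, ϱw)` and is a supremum of affine
minorants. With smooth coefficients these pass to the limit under weak continuity; mollifying
truncated optimal coefficients and Fatou's lemma then give lower semicontinuity
(`IsSolution.relDens_lsc`). The remaining integrals are continuous in `τ`, and good times are dense.
-/

namespace KEntropy
noncomputable section

/-! ### Mollification -/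

open scoped Convolution ContDiff

set_option linter.unusedSectionVars false

section Mollify

variable {X : Type*} [NormedAddCommGroup X] [NormedSpace ℝ X] [FiniteDimensional ℝ X]
  [MeasureSpace X] [BorelSpace X] [(volume : Measure X).IsAddHaarMeasure]
  {F : Type*} [NormedAddCommGroup F] [NormedSpace ℝ F] [CompleteSpace F]

/-- A bump function supported in the ball of radius `1 / (n + 1)`. -/
def bump (X : Type*) [NormedAddCommGroup X] [NormedSpace ℝ X] (n : ℕ) : ContDiffBump (0 : X) where
  rIn := 1 / (2 * ((n : ℝ) + 1))
  rOut := 1 / ((n : ℝ) + 1)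
  rIn_pos := by positivity
  rIn_lt_rOut := by
    apply one_div_lt_one_div_of_lt <;> [positivity; linarith [(n.cast_nonneg : (0 : ℝ) ≤ n)]]

/-- The normalized bump function. -/
def kern (X : Type*) [NormedAddCommGroup X] [NormedSpace ℝ X] [FiniteDimensional ℝ X]
    [MeasureSpace X] [BorelSpace X] [(volume : Measure X).IsAddHaarMeasure] (n : ℕ) : X → ℝ :=
  (bump X n).normed volume

/-- Convolution with the normalized bump function. -/
def mollify (n : ℕ) (g : X → F) (x : X) : F := ∫ y, kern X n y • g (x - y)

theorem mollify_eq_convolution (n : ℕ) (g : X → F) :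
    mollify n g = (bump X n).normed volume ⋆[ContinuousLinearMap.lsmul ℝ ℝ, volume] g := rfl

theorem bump_rOut_tendsto : Tendsto (fun n => (bump X n).rOut) atTop (𝓝 0) :=
  tendsto_one_div_add_atTop_nhds_zero_nat

theorem bump_rOut_le_one (n : ℕ) : (bump X n).rOut ≤ 1 := by
  change 1 / ((n : ℝ) + 1) ≤ 1
  rw [div_le_one (by positivity)]
  linarith [(n.cast_nonneg : (0 : ℝ) ≤ n)]

theorem kern_nonneg (n : ℕ) (y : X) : 0 ≤ kern X n y := (bump X n).nonneg_normed y

theorem kern_continuous (n : ℕ) : Continuous (kern X n) := (bump X n).continuous_normed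

theorem kern_integrable (n : ℕ) : Integrable (kern X n) := (bump X n).integrable_normed

theorem kern_integral (n : ℕ) : ∫ y, kern X n y = 1 := (bump X n).integral_normed

theorem kern_neg (n : ℕ) (y : X) : kern X n (-y) = kern X n y := (bump X n).normed_neg y

theorem kern_eq_zero {n : ℕ} {y : X} (hy : (bump X n).rOut ≤ ‖y‖) : kern X n y = 0 := by
  have := (bump X n).support_normed_eq (μ := volume)
  by_contra h
  have h2 : y ∈ Function.support (kern X n) := h
  rw [kern, this] at h2
  simp at h2
  linarith

theorem mollify_contDiff {n : ℕ} {g : X → F} (hg : LocallyIntegrable g) :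
    ContDiff ℝ ∞ (mollify n g) := by
  rw [mollify_eq_convolution]
  exact (bump X n).hasCompactSupport_normed.contDiff_convolution_left _
    (bump X n).contDiff_normed hg

theorem mollify_tendsto {g : X → F} (hg : Continuous g) (x : X) :
    Tendsto (fun n => mollify n g x) atTop (𝓝 (g x)) :=
  ContDiffBump.convolution_tendsto_right_of_continuous bump_rOut_tendsto hg x

theorem mollify_tendsto_ae {g : X → F} (hg : LocallyIntegrable g) :
    ∀ᵐ x, Tendsto (fun n => mollify n g x) atTop (𝓝 (g x)) := by
  -- The outer radius of `bump` is exactly twice the inner one. This bounded ratio lets the kernels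
  -- be compared with averages over balls, so that Lebesgue points are points of convergence.
  refine ContDiffBump.ae_convolution_tendsto_right_of_locallyIntegrable (K := 2)
    bump_rOut_tendsto (Eventually.of_forall fun n => ?_) hg
  change 1 / ((n : ℝ) + 1) ≤ 2 * (1 / (2 * ((n : ℝ) + 1)))
  apply le_of_eq
  field_simp

theorem norm_mollify_sub_le {n : ℕ} {g : X → F} {x : X} {δ : ℝ}
    (hg : AEStronglyMeasurable g)
    (h : ∀ y, dist y x < (bump X n).rOut → dist (g y) (g x) ≤ δ) :
    dist (mollify n g x) (g x) ≤ δ :=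
  (bump X n).dist_normed_convolution_le hg fun y hy => h y hy

theorem norm_mollify_le {n : ℕ} {g : X → F} {x : X} {C : ℝ}
    (h : ∀ y, ‖y‖ < (bump X n).rOut → ‖g (x - y)‖ ≤ C) : ‖mollify n g x‖ ≤ C := by
  have h1 : ‖mollify n g x‖ ≤ ∫ y, kern X n y * C := by
    refine norm_integral_le_of_norm_le ((kern_integrable n).mul_const C)
      (Eventually.of_forall fun y => ?_)
    rw [norm_smul, Real.norm_of_nonneg (kern_nonneg n y)]
    by_cases hy : ‖y‖ < (bump X n).rOut
    · exact mul_le_mul_of_nonneg_left (h y hy) (kern_nonneg n y)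
    · simp [kern_eq_zero (not_lt.1 hy)]
  rwa [integral_mul_const, kern_integral, one_mul] at h1

theorem mollify_eq_zero {n : ℕ} {g : X → F} {x : X}
    (h : ∀ y, ‖y‖ < (bump X n).rOut → g (x - y) = 0) : mollify n g x = 0 := by
  have := norm_mollify_le (n := n) (g := g) (x := x) (C := 0) fun y hy => by simp [h y hy]
  simpa using this

theorem mollify_add_period {n : ℕ} {g : X → F} {p : X} (h : ∀ x, g (x + p) = g x) (x : X) :
    mollify n g (x + p) = mollify n g x := by
  simp only [mollify]
  congr 1; ext y
  rw [add_sub_right_comm, h]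

theorem mollify_nonneg {n : ℕ} {g : X → ℝ} (h : ∀ x, 0 ≤ g x) (x : X) : 0 ≤ mollify n g x :=
  integral_nonneg fun y => mul_nonneg (kern_nonneg n y) (h _)

theorem mollify_congr {n : ℕ} {g h : X → F} {x : X}
    (hgh : ∀ y, ‖y‖ < (bump X n).rOut → g (x - y) = h (x - y)) : mollify n g x = mollify n h x := by
  simp only [mollify]
  congr 1; ext y
  by_cases hy : ‖y‖ < (bump X n).rOut
  · rw [hgh y hy]
  · simp [kern_eq_zero (not_lt.1 hy)]

/-- The derivative is put on `g`, not on the kernel, so that derivatives of mollified test functions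
converge and inherit the local bounds of those of `g`. -/
theorem mollify_hasFDerivAt {n : ℕ} {g : X → F} (hg : ContDiff ℝ 1 g) (x : X) :
    HasFDerivAt (mollify n g) (mollify n (fderiv ℝ g) x) x := by
  have hg' : Continuous (fderiv ℝ g) := hg.continuous_fderiv one_ne_zero
  -- Radius 2: the point of differentiation moves by less than 1, and the kernel has support in the
  -- unit ball.
  obtain ⟨C, hC⟩ := (isCompact_closedBall x 2).exists_bound_of_continuousOn hg'.continuousOn
  refine hasFDerivAt_integral_of_dominated_of_fderiv_le (s := Metric.ball x 1)
    (F' := fun z y => kern X n y • fderiv ℝ g (z - y)) (bound := fun y => kern X n y * C)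
    (Metric.ball_mem_nhds x one_pos) ?_ ?_ ?_ ?_ ?_ ?_
  · refine Eventually.of_forall fun z => Continuous.aestronglyMeasurable ?_
    exact (kern_continuous n).smul (hg.continuous.comp (continuous_const.sub continuous_id))
  · refine Continuous.integrable_of_hasCompactSupport ?_ ?_
    · exact (kern_continuous n).smul (hg.continuous.comp (continuous_const.sub continuous_id))
    · exact HasCompactSupport.smul_right (bump X n).hasCompactSupport_normed
  · exact Continuous.aestronglyMeasurable
      ((kern_continuous n).smul (hg'.comp (continuous_const.sub continuous_id)))
  · refine Eventually.of_forall fun y z hz => ?_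
    rw [norm_smul, Real.norm_of_nonneg (kern_nonneg n y)]
    by_cases hy : ‖y‖ < (bump X n).rOut
    · refine mul_le_mul_of_nonneg_left (hC _ ?_) (kern_nonneg n y)
      have := bump_rOut_le_one (X := X) n
      have h2 : ‖z - x‖ < 1 := by simpa [dist_eq_norm] using hz
      rw [mem_closedBall_iff_norm, sub_right_comm]
      linarith [norm_sub_le (z - x) y]
    · simp [kern_eq_zero (not_lt.1 hy)]
  · exact (kern_integrable n).mul_const C
  · refine Eventually.of_forall fun y z _ => ?_
    have h1 := ((hg.differentiable one_ne_zero) (z - y)).hasFDerivAt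
    have h2 := h1.comp z ((hasFDerivAt_id z).sub_const y)
    exact h2.const_smul (kern X n y)

end Mollify

/-- Needed to mollify jointly in time and space. -/
instance : (volume : Measure (ℝ × E)).IsAddHaarMeasure :=
  inferInstanceAs (Measure.IsAddHaarMeasure (volume.prod volume))

end
end KEntropy

namespace KEntropy
noncomputable section
open scoped ContDiff Pointwise

/-! ### The spatial domain: periodicity cell, translations, cut-off functions -/

/-- The lattice `ℤ³`. -/
def lattice : AddSubgroup E :=
  (Submodule.span ℤ (range (EuclideanSpace.basisFun (Fin 3) ℝ).toBasis)).toAddSubgroup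

instance : Countable lattice := by
  have : Countable (Submodule.span ℤ (range (EuclideanSpace.basisFun (Fin 3) ℝ).toBasis)) :=
    inferInstance
  exact this

theorem cell_torus : Dom.torus.cell =
    ZSpan.fundamentalDomain (EuclideanSpace.basisFun (Fin 3) ℝ).toBasis := by
  ext x
  simp [Dom.cell, ZSpan.mem_fundamentalDomain]

theorem cell_measurableSet (dom : Dom) : MeasurableSet dom.cell := by
  cases dom
  · rw [cell_torus]; exact ZSpan.fundamentalDomain_measurableSet _
  · exact MeasurableSet.univ

/-- The cube has points of norm at most `√3`; 2 is a convenient larger radius. It makes conditions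
of the form "vanishes for `‖x‖ > R`", with `R ≥ 2`, void on the torus, so that both domains share
one argument. -/
theorem cell_torus_subset : Dom.torus.cell ⊆ Metric.closedBall 0 2 := by
  intro x hx
  rw [mem_closedBall_zero_iff, EuclideanSpace.norm_eq, Real.sqrt_le_left (by norm_num)]
  simp only [Fin.sum_univ_three, Real.norm_eq_abs, sq_abs]
  have h := fun i => hx i
  nlinarith [(h 0).1, (h 0).2, (h 1).1, (h 1).2, (h 2).1, (h 2).2]

/-- Periodic functions are invariant under the lattice. -/
theorem per_lattice {F : Type*} {f : E → F} (hf : Dom.torus.Per f) {k : E} (hk : k ∈ lattice)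
    (x : E) : f (x + k) = f x := by
  have hk' : k ∈ Submodule.span ℤ (range (EuclideanSpace.basisFun (Fin 3) ℝ).toBasis) := hk
  induction hk' using Submodule.span_induction generalizing x with
  | mem y hy =>
    obtain ⟨j, rfl⟩ := hy
    have := hf j x
    simpa [unitVec] using this
  | zero => simp
  | add a b ha hb iha ihb =>
    rw [← add_assoc, ihb hb, iha ha]
  | smul n a ha iha =>
    induction n using Int.induction_on generalizing x with
    | zero => simp
    | succ i ih =>
      rw [add_smul, one_smul, ← add_assoc, iha ha,
        ih (lattice.zsmul_mem ha _)]
    | pred i ih =>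
      have h1 := iha ha (x + (-(i : ℤ) - 1) • a)
      rw [add_assoc, ← add_one_zsmul, sub_add_cancel] at h1
      rw [← h1, ih (lattice.zsmul_mem ha _)]

/-- A translate of a fundamental domain is again a fundamental domain, and an invariant function has
the same integral over both. -/
theorem setIntegral_add_of_fundamentalDomain {G F : Type*} [NormedAddCommGroup F] [NormedSpace ℝ F]
    [AddCommGroup G] [MeasurableSpace G] [MeasurableAdd G] (μ : Measure G)
    [μ.IsAddLeftInvariant] {Λ : AddSubgroup G} [Countable Λ] {s : Set G}
    (hs : IsAddFundamentalDomain Λ s μ) {f : G → F} (hf : ∀ k ∈ Λ, ∀ x, f (x + k) = f x) (y : G) :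
    ∫ x in s, f (x + y) ∂μ = ∫ x in s, f x ∂μ := by
  have h1 : IsAddFundamentalDomain Λ (y +ᵥ s) μ := hs.vadd_of_comm y
  have h2 := h1.setIntegral_eq hs (f := f) (fun k x => by
    rw [show k +ᵥ x = x + (k : G) from add_comm _ _]; exact hf k k.2 x)
  rw [← h2]
  have h3 := (measurePreserving_add_left μ y).setIntegral_preimage_emb
    (MeasurableEquiv.addLeft y).measurableEmbedding f (y +ᵥ s)
  rw [← h3]
  have : (fun x => y + x) ⁻¹' (y +ᵥ s) = s := by
    ext x; simp [mem_vadd_set_iff_neg_vadd_mem]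
  rw [this]
  simp only [add_comm]

theorem integral_cell_add {F : Type*} [NormedAddCommGroup F] [NormedSpace ℝ F] {dom : Dom}
    {f : E → F} (hf : dom.Per f) (y : E) :
    ∫ x in dom.cell, f (x + y) = ∫ x in dom.cell, f x := by
  cases dom
  · have h : IsAddFundamentalDomain lattice Dom.torus.cell volume := by
      rw [cell_torus]
      exact ZSpan.isAddFundamentalDomain _ volume
    exact setIntegral_add_of_fundamentalDomain volume h (fun k hk x => per_lattice hf hk x) y
  · simp [Dom.cell, integral_add_right_eq_self]

/-- The lattice `{0} × ℤ³`. -/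
def stripLattice : AddSubgroup (ℝ × E) := lattice.map (AddMonoidHom.inr ℝ E)

instance : Countable stripLattice :=
  (countable_coe_iff.1 (inferInstance : Countable lattice)).image _ |>.to_subtype

/-- Only space is periodic, so the domain for the action on space-time is the unbounded strip `ℝ ×
cell`. Translations that also move time are then allowed, as needed for mollification in space-time.
-/
theorem strip_fundamentalDomain :
    IsAddFundamentalDomain stripLattice (univ ×ˢ Dom.torus.cell) (volume : Measure (ℝ × E)) := by
  refine IsAddFundamentalDomain.mk'
    (MeasurableSet.univ.prod (cell_measurableSet _)).nullMeasurableSet fun z => ?_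
  obtain ⟨k, hk, hk'⟩ := ZSpan.exist_unique_vadd_mem_fundamentalDomain
    (EuclideanSpace.basisFun (Fin 3) ℝ).toBasis z.2
  rw [← cell_torus] at hk
  refine ⟨⟨(0, (k : E)), ⟨(k : E), k.2, rfl⟩⟩, ⟨mem_univ _, hk⟩, ?_⟩
  rintro ⟨_, ⟨k', hk1, rfl⟩⟩ ⟨-, hk2⟩
  have := hk' ⟨k', hk1⟩ (by rw [← cell_torus]; exact hk2)
  subst this
  rfl

theorem integral_strip_add {F : Type*} [NormedAddCommGroup F] [NormedSpace ℝ F] {dom : Dom}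
    {f : ℝ × E → F} (hf : ∀ t, dom.Per fun x => f (t, x)) (y : ℝ × E) :
    ∫ z in univ ×ˢ dom.cell, f (z + y) = ∫ z in univ ×ˢ dom.cell, f z := by
  cases dom
  · refine setIntegral_add_of_fundamentalDomain volume strip_fundamentalDomain (fun k hk z => ?_) y
    obtain ⟨k', hk1, rfl⟩ := hk
    have := per_lattice (hf z.1) hk1 z.2
    simpa [Prod.add_def] using this
  · simp [Dom.cell, integral_add_right_eq_self]

/-- On the torus a ball is covered by finitely many lattice translates of the cell, over each of
which `f` is as integrable as over the cell. Mollification near the boundary of the cell needs this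
control outside of it. -/
theorem integrableOn_strip_ball {dom : Dom} {T : ℝ} {f : ℝ × E → ℝ}
    (hf : ∀ t, dom.Per fun x => f (t, x))
    (hi : ∀ R, IntegrableOn f (Ioo 0 T ×ˢ (dom.cell ∩ Metric.closedBall 0 R))) (R : ℝ) :
    IntegrableOn f (Ioo 0 T ×ˢ Metric.closedBall 0 R) := by
  cases dom
  · have hi' : IntegrableOn f (Ioo 0 T ×ˢ Dom.torus.cell) := by
      have := hi 2
      rwa [inter_eq_left.2 cell_torus_subset] at this
    set b := (EuclideanSpace.basisFun (Fin 3) ℝ).toBasis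
    -- A point of norm at most `R` differs from its lattice part by a point of the cell, of norm at
    -- most 2.
    have hfin : ((lattice : Set E) ∩ Metric.closedBall 0 (R + 2)).Finite := by
      have : DiscreteTopology lattice :=
        (inferInstance : DiscreteTopology (Submodule.span ℤ (range b)))
      rw [inter_comm]
      exact Metric.finite_isBounded_inter_isClosed this.isDiscrete Metric.isBounded_closedBall
        AddSubgroup.isClosed_of_discrete
    have hcov : Ioo 0 T ×ˢ Metric.closedBall (0 : E) R ⊆
        ⋃ k ∈ ((lattice : Set E) ∩ Metric.closedBall 0 (R + 2)),
          (fun z : ℝ × E => z + (0, -k)) ⁻¹' (Ioo 0 T ×ˢ Dom.torus.cell) := by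
      rintro ⟨t, x⟩ ⟨ht, hx⟩
      simp only [mem_iUnion, exists_prop]
      have hc : x + -(ZSpan.floor b x : E) ∈ Dom.torus.cell := by
        rw [cell_torus, ← sub_eq_add_neg]
        exact ZSpan.fract_mem_fundamentalDomain b x
      refine ⟨(ZSpan.floor b x : E), ⟨(ZSpan.floor b x).2, ?_⟩, by simpa using ht, hc⟩
      have h2 := cell_torus_subset hc
      rw [mem_closedBall_zero_iff] at h2 hx ⊢
      have : (ZSpan.floor b x : E) = x - (x + -(ZSpan.floor b x : E)) := by abel
      rw [this]
      exact (norm_sub_le _ _).trans (add_le_add hx h2)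
    refine IntegrableOn.mono_set ?_ hcov
    rw [integrableOn_finite_biUnion hfin]
    intro k hk
    have hfk : f = fun z => f (z + (0, -k)) := by
      ext z
      have := per_lattice (hf z.1) (lattice.neg_mem hk.1) z.2
      simpa [Prod.add_def] using this.symm
    rw [hfk]
    exact ((measurePreserving_add_right volume ((0 : ℝ), -k)).integrableOn_comp_preimage
      (MeasurableEquiv.addRight _).measurableEmbedding).2 hi'
  · simpa [Dom.cell] using hi R

/-- Cut-off functions: constant on the torus, exhausting the whole space. -/
theorem exists_cutoff (dom : Dom) : ∃ χ : ℕ → E → ℝ, (∀ n, ContDiff ℝ ∞ (χ n)) ∧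
    (∀ n, dom.Per (χ n)) ∧ (∀ n, dom = .space → ∃ R : ℝ, ∀ x, R ≤ ‖x‖ → χ n x = 0) ∧
    (∀ n x, 0 ≤ χ n x ∧ χ n x ≤ 1) ∧ (∀ (n : ℕ) x, ‖x‖ ≤ n → χ n x = 1) ∧
    ∃ C, ∀ n x, ‖fderiv ℝ (χ n) x‖ ≤ C := by
  cases dom
  · refine ⟨fun _ _ => 1, fun _ => contDiff_const, fun _ _ _ => rfl, nofun,
      fun _ _ => ⟨zero_le_one, le_rfl⟩, fun _ _ _ => rfl, 0, fun _ _ => by simp⟩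
  · let b : ContDiffBump (0 : E) := ⟨1, 2, by norm_num, by norm_num⟩
    have hb : ContDiff ℝ ∞ (b : E → ℝ) := b.contDiff
    obtain ⟨C, hC⟩ := (b.hasCompactSupport.fderiv (𝕜 := ℝ)).exists_bound_of_continuous
      (hb.continuous_fderiv (by simp))
    -- A rescaled fixed bump: its gradient is at most `C / (n + 1)`. Only the uniform bound `C` is
    -- recorded, since the gradients also vanish on growing balls and limits are taken by dominated
    -- convergence.
    refine ⟨fun n x => b ((1 / ((n : ℝ) + 1)) • x), fun n => hb.comp (contDiff_const_smul _),
      fun _ => trivial, fun n _ => ⟨2 * (n + 1), fun x hx => ?_⟩,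
      fun n x => ⟨b.nonneg, b.le_one⟩, fun n x hx => ?_, C, fun n x => ?_⟩
    · apply b.zero_of_le_dist
      have hn : (0 : ℝ) < n + 1 := by positivity
      rw [dist_zero_right, norm_smul, Real.norm_of_nonneg (by positivity), one_div,
        ← div_eq_inv_mul, le_div_iff₀ hn]
      exact hx
    · apply b.one_of_mem_closedBall
      have hn : (0 : ℝ) < n + 1 := by positivity
      rw [mem_closedBall_zero_iff, norm_smul, Real.norm_of_nonneg (by positivity), one_div,
        ← div_eq_inv_mul, div_le_iff₀ hn]
      change ‖x‖ ≤ 1 * _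
      linarith
    · have h1 : fderiv ℝ (fun x => b ((1 / ((n : ℝ) + 1)) • x)) x =
          (1 / ((n : ℝ) + 1)) • fderiv ℝ b ((1 / ((n : ℝ) + 1)) • x) :=
        fderiv_comp_smul _
      rw [h1, norm_smul, Real.norm_of_nonneg (by positivity)]
      have hn : 1 / ((n : ℝ) + 1) ≤ 1 := by
        rw [div_le_one (by positivity)]; linarith [(n.cast_nonneg : (0 : ℝ) ≤ n)]
      have := hC ((1 / ((n : ℝ) + 1)) • x)
      exact (mul_le_of_le_one_left (norm_nonneg _) hn).trans this

theorem fderiv_cutoff_eq_zero {χ : ℕ → E → ℝ} (h : ∀ (n : ℕ) x, ‖x‖ ≤ n → χ n x = 1) {n : ℕ} {x : E}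
    (hx : ‖x‖ < n) : fderiv ℝ (χ n) x = 0 := by
  have : χ n =ᶠ[𝓝 x] fun _ => 1 := by
    filter_upwards [(isOpen_lt continuous_norm continuous_const).mem_nhds hx] with y hy
    exact h n y (le_of_lt hy)
  rw [this.fderiv_eq]; simp

end
end KEntropy

namespace KEntropy
noncomputable section
open scoped ContDiff

/-! ### Scalar weak equations and their extension to `C¹` test functions -/

/-- The integrand of a weak equation. -/
def wform (f0 : ℝ × E → ℝ) (f : Fin 3 → ℝ × E → ℝ) (g : ℝ × E → ℝ)
    (D : ℝ × E → ℝ × E →L[ℝ] ℝ) (φ : ℝ × E → ℝ) (z : ℝ × E) : ℝ :=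
  f0 z * D z (1, 0) + ∑ j, f j z * D z (0, unitVec j) + g z * φ z

/-- The equation `∂ₜ f0 + div f = g` with initial value `fi`, in the sense of distributions on
`[0,T) × Ω`. -/
structure WeakEq (dom : Dom) (T : ℝ) (f0 : ℝ × E → ℝ) (f : Fin 3 → ℝ × E → ℝ) (g : ℝ × E → ℝ)
    (fi : E → ℝ) : Prop where
  int_f0 : ∀ R, IntegrableOn f0 (Ioo 0 T ×ˢ (dom.cell ∩ Metric.closedBall 0 R))
  int_f : ∀ j R, IntegrableOn (f j) (Ioo 0 T ×ˢ (dom.cell ∩ Metric.closedBall 0 R))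
  int_g : ∀ R, IntegrableOn g (Ioo 0 T ×ˢ (dom.cell ∩ Metric.closedBall 0 R))
  int_fi : ∀ R, IntegrableOn fi (dom.cell ∩ Metric.closedBall 0 R)
  eq : ∀ φ : ℝ × E → ℝ, IsTest dom T (fun t x => φ (t, x)) →
    ∫ z in Ioo 0 T ×ˢ dom.cell, wform f0 f g (fderiv ℝ φ) φ z
      = - ∫ x in dom.cell, fi x * φ (0, x)

theorem norm_unitVec (j : Fin 3) : ‖unitVec j‖ = 1 := by simp [unitVec]

theorem norm_timeDir : ‖((1 : ℝ), (0 : E))‖ = 1 := by simp [Prod.norm_def]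

theorem norm_spaceDir (j : Fin 3) : ‖((0 : ℝ), unitVec j)‖ = 1 := by
  simp [Prod.norm_def, norm_unitVec]

theorem abs_wform_le {f0 : ℝ × E → ℝ} {f : Fin 3 → ℝ × E → ℝ} {g : ℝ × E → ℝ}
    {D : ℝ × E → ℝ × E →L[ℝ] ℝ} {φ : ℝ × E → ℝ} {z : ℝ × E} {C : ℝ} (hD : ‖D z‖ ≤ C)
    (hφ : |φ z| ≤ C) : ‖wform f0 f g D φ z‖ ≤ (|f0 z| + ∑ j, |f j z| + |g z|) * C := by
  have hv : ∀ e : ℝ × E, ‖e‖ = 1 → |D z e| ≤ C := fun e he => by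
    have := (D z).le_opNorm e
    rw [he, mul_one] at this
    exact this.trans hD
  rw [wform, Real.norm_eq_abs, add_mul, add_mul, Finset.sum_mul]
  refine (abs_add_le _ _).trans (add_le_add ((abs_add_le _ _).trans (add_le_add ?_ ?_)) ?_)
  · rw [abs_mul]; exact mul_le_mul_of_nonneg_left (hv _ norm_timeDir) (abs_nonneg _)
  · refine (Finset.abs_sum_le_sum_abs _ _).trans (Finset.sum_le_sum fun j _ => ?_)
    rw [abs_mul]; exact mul_le_mul_of_nonneg_left (hv _ (norm_spaceDir j)) (abs_nonneg _)
  · rw [abs_mul]; exact mul_le_mul_of_nonneg_left hφ (abs_nonneg _)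

namespace WeakEq

variable {dom : Dom} {T : ℝ} {f0 : ℝ × E → ℝ} {f : Fin 3 → ℝ × E → ℝ} {g : ℝ × E → ℝ} {fi : E → ℝ}

theorem aesm_of_local {f : ℝ × E → ℝ}
    (h : ∀ R, IntegrableOn f (Ioo 0 T ×ˢ (dom.cell ∩ Metric.closedBall 0 R))) :
    AEStronglyMeasurable f (volume.restrict (Ioo 0 T ×ˢ dom.cell)) := by
  have hU : Ioo 0 T ×ˢ dom.cell =
      ⋃ n : ℕ, Ioo 0 T ×ˢ (dom.cell ∩ Metric.closedBall 0 (n : ℝ)) := by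
    ext z
    simp only [mem_prod, mem_iUnion, mem_inter_iff, mem_closedBall_zero_iff]
    obtain ⟨n, hn⟩ := exists_nat_ge ‖z.2‖
    exact ⟨fun h => ⟨n, h.1, h.2, hn⟩, fun ⟨_, h1, h2, _⟩ => ⟨h1, h2⟩⟩
  rw [hU, aestronglyMeasurable_iUnion_iff]
  exact fun n => (h n).aestronglyMeasurable

theorem aesm_data (h : WeakEq dom T f0 f g fi) :
    AEStronglyMeasurable fi (volume.restrict dom.cell) := by
  have hU : dom.cell = ⋃ n : ℕ, dom.cell ∩ Metric.closedBall 0 (n : ℝ) := by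
    ext z
    simp only [mem_iUnion, mem_inter_iff, mem_closedBall_zero_iff]
    obtain ⟨n, hn⟩ := exists_nat_ge ‖z‖
    exact ⟨fun h => ⟨n, h, hn⟩, fun ⟨_, h1, _⟩ => h1⟩
  rw [hU, aestronglyMeasurable_iUnion_iff]
  exact fun n => (h.int_fi n).aestronglyMeasurable

theorem wform_aesm (h : WeakEq dom T f0 f g fi) {D : ℝ × E → ℝ × E →L[ℝ] ℝ} {φ : ℝ × E → ℝ}
    (hD : AEStronglyMeasurable D (volume.restrict (Ioo 0 T ×ˢ dom.cell)))
    (hφ : AEStronglyMeasurable φ (volume.restrict (Ioo 0 T ×ˢ dom.cell))) :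
    AEStronglyMeasurable (wform f0 f g D φ) (volume.restrict (Ioo 0 T ×ˢ dom.cell)) := by
  have hv : ∀ e : ℝ × E,
      AEStronglyMeasurable (fun z => D z e) (volume.restrict (Ioo 0 T ×ˢ dom.cell)) :=
    fun e => (ContinuousLinearMap.apply ℝ ℝ e).continuous.comp_aestronglyMeasurable hD
  refine (((aesm_of_local h.int_f0).mul (hv _)).add ?_).add
    ((aesm_of_local h.int_g).mul hφ)
  exact Finset.aestronglyMeasurable_fun_sum _
    fun j _ => (aesm_of_local (h.int_f j)).mul (hv _)

/-- Passage to the limit in the integrand. -/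
theorem tendsto_integral (h : WeakEq dom T f0 f g fi) {Dn : ℕ → ℝ × E → ℝ × E →L[ℝ] ℝ}
    {φn : ℕ → ℝ × E → ℝ} {D : ℝ × E → ℝ × E →L[ℝ] ℝ} {φ : ℝ × E → ℝ} {C R : ℝ}
    (mD : ∀ n, AEStronglyMeasurable (Dn n) (volume.restrict (Ioo 0 T ×ˢ dom.cell)))
    (mφ : ∀ n, AEStronglyMeasurable (φn n) (volume.restrict (Ioo 0 T ×ˢ dom.cell)))
    (bd : ∀ n, ∀ z ∈ Ioo 0 T ×ˢ dom.cell, ‖z.2‖ ≤ R → ‖Dn n z‖ ≤ C ∧ |φn n z| ≤ C)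
    (van : ∀ n, ∀ z ∈ Ioo 0 T ×ˢ dom.cell, R < ‖z.2‖ → Dn n z = 0 ∧ φn n z = 0)
    (lim : ∀ z ∈ Ioo 0 T ×ˢ dom.cell, Tendsto (fun n => Dn n z) atTop (𝓝 (D z)) ∧
      Tendsto (fun n => φn n z) atTop (𝓝 (φ z))) :
    Tendsto (fun n => ∫ z in Ioo 0 T ×ˢ dom.cell, wform f0 f g (Dn n) (φn n) z) atTop
      (𝓝 (∫ z in Ioo 0 T ×ˢ dom.cell, wform f0 f g D φ z)) := by
  have hmeas : MeasurableSet (Ioo 0 T ×ˢ dom.cell) :=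
    measurableSet_Ioo.prod (cell_measurableSet dom)
  set S : Set (ℝ × E) := Ioo 0 T ×ˢ (dom.cell ∩ Metric.closedBall 0 R)
  have hS : MeasurableSet S :=
    measurableSet_Ioo.prod ((cell_measurableSet dom).inter measurableSet_closedBall)
  -- The fields are only locally integrable, so the dominating function must carry the indicator of
  -- a bounded set that contains all supports.
  refine tendsto_integral_of_dominated_convergence
    (bound := S.indicator fun z => (|f0 z| + ∑ j, |f j z| + |g z|) * C) ?_ ?_ ?_ ?_
  · exact fun n => h.wform_aesm (mD n) (mφ n)
  · rw [integrable_indicator_iff hS]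
    have : IntegrableOn (fun z => (|f0 z| + ∑ j, |f j z| + |g z|) * C) S := by
      refine Integrable.mul_const (((h.int_f0 R).abs.add ?_).add (h.int_g R).abs) C
      exact integrable_finsetSum _ fun j _ => (h.int_f j R).abs
    exact this.mono_measure Measure.restrict_le_self
  · intro n
    filter_upwards [ae_restrict_mem hmeas] with z hz
    by_cases hR : ‖z.2‖ ≤ R
    · rw [indicator_of_mem (show z ∈ S from ⟨hz.1, hz.2, by simpa using hR⟩)]
      exact abs_wform_le (bd n z hz hR).1 (bd n z hz hR).2
    · rw [indicator_of_notMem (fun hS : z ∈ S => hR (by simpa using hS.2.2))]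
      have := van n z hz (not_le.1 hR)
      simp [wform, this.1, this.2]
  · filter_upwards [ae_restrict_mem hmeas] with z hz
    have hv : ∀ e : ℝ × E, Tendsto (fun n => Dn n z e) atTop (𝓝 (D z e)) := fun e =>
      ((ContinuousLinearMap.apply ℝ ℝ e).continuous.tendsto (D z)).comp (lim z hz).1
    exact ((tendsto_const_nhds.mul (hv _)).add (tendsto_finsetSum _ fun j _ =>
      tendsto_const_nhds.mul (hv _))).add (tendsto_const_nhds.mul (lim z hz).2)

theorem tendsto_integral_data (h : WeakEq dom T f0 f g fi)
    {φn : ℕ → E → ℝ} {φ : E → ℝ} {C R : ℝ}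
    (mφ : ∀ n, AEStronglyMeasurable (φn n) (volume.restrict dom.cell))
    (bd : ∀ n, ∀ x ∈ dom.cell, ‖x‖ ≤ R → |φn n x| ≤ C)
    (van : ∀ n, ∀ x ∈ dom.cell, R < ‖x‖ → φn n x = 0)
    (lim : ∀ x ∈ dom.cell, Tendsto (fun n => φn n x) atTop (𝓝 (φ x))) :
    Tendsto (fun n => ∫ x in dom.cell, fi x * φn n x) atTop
      (𝓝 (∫ x in dom.cell, fi x * φ x)) := by
  have hmeas := cell_measurableSet dom
  set S : Set E := dom.cell ∩ Metric.closedBall 0 R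
  have hS : MeasurableSet S := hmeas.inter measurableSet_closedBall
  refine tendsto_integral_of_dominated_convergence
    (bound := S.indicator fun z => |fi z| * C) ?_ ?_ ?_ ?_
  · exact fun n => h.aesm_data.mul (mφ n)
  · rw [integrable_indicator_iff hS]
    have : IntegrableOn (fun z => |fi z| * C) S := (h.int_fi R).abs.mul_const C
    exact this.mono_measure Measure.restrict_le_self
  · intro n
    filter_upwards [ae_restrict_mem hmeas] with x hx
    by_cases hR : ‖x‖ ≤ R
    · rw [indicator_of_mem (show x ∈ S from ⟨hx, by simpa using hR⟩), norm_mul]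
      exact mul_le_mul_of_nonneg_left (bd n x hx hR) (abs_nonneg _)
    · rw [indicator_of_notMem (fun hS : x ∈ S => hR (by simpa using hS.2))]
      simp [van n x hx (not_le.1 hR)]
  · filter_upwards [ae_restrict_mem hmeas] with x hx
    exact tendsto_const_nhds.mul (lim x hx)

/-- Test functions of class `C¹` on the whole of `ℝ × E`. -/
theorem eq_of_contDiff (h : WeakEq dom T f0 f g fi) {φ : ℝ × E → ℝ} (hφ : ContDiff ℝ 1 φ)
    (per : ∀ t, dom.Per fun x => φ (t, x)) (time : ∃ T' < T, ∀ t x, T' ≤ t → φ (t, x) = 0)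
    (supp : dom = .space → ∃ R : ℝ, ∀ t x, R ≤ ‖x‖ → φ (t, x) = 0) :
    ∫ z in Ioo 0 T ×ˢ dom.cell, wform f0 f g (fderiv ℝ φ) φ z
      = - ∫ x in dom.cell, fi x * φ (0, x) := by
  obtain ⟨T', hT', hz⟩ := time
  obtain ⟨R, hR2, hR⟩ : ∃ R : ℝ, 2 ≤ R ∧ (dom = .space → ∀ t x, R ≤ ‖x‖ → φ (t, x) = 0) := by
    cases dom
    · exact ⟨2, le_rfl, nofun⟩
    · obtain ⟨R, hR⟩ := supp rfl
      exact ⟨max 2 R, le_max_left _ _, fun _ t x hx => hR t x ((le_max_right _ _).trans hx)⟩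
  -- Starting the sequence at `N` keeps the kernel radius below `T - T'`, so that the mollified
  -- functions still vanish before `T`.
  obtain ⟨N, hN⟩ := exists_nat_one_div_lt (sub_pos.2 hT')
  set φn : ℕ → ℝ × E → ℝ := fun n => mollify (n + N) φ
  have hrN : ∀ n, (bump (ℝ × E) (n + N)).rOut ≤ 1 / ((N : ℝ) + 1) := fun n => by
    change 1 / (((n + N : ℕ) : ℝ) + 1) ≤ _
    apply one_div_le_one_div_of_le (by positivity)
    push_cast; linarith [(n.cast_nonneg : (0 : ℝ) ≤ n)]
  have hφn : ∀ n, ContDiff ℝ ∞ (φn n) := fun n =>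
    mollify_contDiff hφ.continuous.locallyIntegrable
  have hfd : ∀ n, fderiv ℝ (φn n) = mollify (n + N) (fderiv ℝ φ) := fun n => by
    ext1 z; exact (mollify_hasFDerivAt hφ z).fderiv
  have hφ' : Continuous (fderiv ℝ φ) := hφ.continuous_fderiv one_ne_zero
  have hvan : ∀ n t x, dom = .space → R + 1 ≤ ‖x‖ → φn n (t, x) = 0 := by
    intro n t x hd hx
    refine mollify_eq_zero fun y hy => hR hd _ _ ?_
    have h1 := bump_rOut_le_one (X := ℝ × E) (n + N)
    have h2 := norm_snd_le y
    have h3 := norm_sub_norm_le x y.2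
    linarith
  have htest : ∀ n, IsTest dom T (fun t x => φn n (t, x)) := fun n =>
    { smooth := hφn n
      per := by
        intro t
        cases dom
        · intro j x
          have := mollify_add_period (n := n + N) (g := φ) (p := ((0 : ℝ), unitVec j))
            (fun z => by simpa [Prod.add_def] using per z.1 j z.2) (t, x)
          simpa [Prod.add_def] using this
        · trivial
      time := by
        refine ⟨T' + 1 / ((N : ℝ) + 1), by linarith, fun t x ht => mollify_eq_zero fun y hy => ?_⟩
        refine hz _ _ ?_
        have h2 := (Real.norm_eq_abs _ ▸ norm_fst_le y : |y.1| ≤ ‖y‖)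
        have h3 := le_abs_self y.1
        have h4 := hrN n
        change T' ≤ t - y.1
        linarith
      supp := fun hd => ⟨R + 1, fun t x hx => hvan n t x hd hx⟩ }
  set K : Set (ℝ × E) := Metric.closedBall 0 (|T| + R + 4)
  have hK : IsCompact K := isCompact_closedBall _ _
  obtain ⟨C₁, hC₁⟩ := hK.exists_bound_of_continuousOn hφ.continuous.continuousOn
  obtain ⟨C₂, hC₂⟩ := hK.exists_bound_of_continuousOn hφ'.continuousOn
  have hmemK : ∀ (n : ℕ) (z : ℝ × E), z.1 ∈ Icc 0 T → ‖z.2‖ ≤ R + 2 → ∀ y : ℝ × E,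
      ‖y‖ < (bump (ℝ × E) (n + N)).rOut → z - y ∈ K := by
    intro n z hz1 hz2 y hy
    have h1 := bump_rOut_le_one (X := ℝ × E) (n + N)
    rw [mem_closedBall_zero_iff]
    have h2 : ‖z‖ ≤ |T| + R + 2 := by
      rw [Prod.norm_def]
      refine max_le ?_ (by linarith [abs_nonneg T])
      rw [Real.norm_of_nonneg hz1.1]
      linarith [hz1.2, le_abs_self T]
    linarith [norm_sub_le z y]
  have hoff : ∀ z ∈ Ioo 0 T ×ˢ dom.cell, R + 2 < ‖z.2‖ → dom = .space := by
    rintro z ⟨-, hz2⟩ h2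
    cases dom
    · have := cell_torus_subset hz2
      rw [mem_closedBall_zero_iff] at this
      linarith
    · rfl
  have lim1 := h.tendsto_integral (Dn := fun n => fderiv ℝ (φn n)) (φn := φn) (D := fderiv ℝ φ)
    (φ := φ) (C := max C₁ C₂) (R := R + 2)
    (fun n => ((hφn n).continuous_fderiv (by simp)).aestronglyMeasurable)
    (fun n => (hφn n).continuous.aestronglyMeasurable)
    (fun n z hz hzR => by
      have hm := hmemK n z (Ioo_subset_Icc_self hz.1) hzR
      rw [hfd]
      exact ⟨norm_mollify_le fun y hy => (hC₂ _ (hm y hy)).trans (le_max_right _ _),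
        norm_mollify_le fun y hy => (hC₁ _ (hm y hy)).trans (le_max_left _ _)⟩)
    (fun n z hz hzR => by
      have hd := hoff z hz hzR
      refine ⟨?_, hvan n z.1 z.2 hd (by linarith)⟩
      have : φn n =ᶠ[𝓝 z] fun _ => 0 := by
        filter_upwards [(isOpen_lt continuous_const continuous_snd.norm).mem_nhds hzR] with y hy
        exact hvan n y.1 y.2 hd (by have : R + 2 < ‖y.2‖ := hy; linarith)
      rw [this.fderiv_eq]; simp)
    (fun z _ => by
      simp only [hfd]
      exact ⟨(mollify_tendsto hφ' z).comp (tendsto_add_atTop_nat N),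
        (mollify_tendsto hφ.continuous z).comp (tendsto_add_atTop_nat N)⟩)
  by_cases hT : 0 ≤ T
  · have lim2 := h.tendsto_integral_data (φn := fun n x => φn n (0, x)) (φ := fun x => φ (0, x))
      (C := C₁) (R := R + 2)
      (fun n => ((hφn n).continuous.comp (by fun_prop)).aestronglyMeasurable)
      (fun n x hx hxR => norm_mollify_le fun y hy =>
        hC₁ _ (hmemK n (0, x) ⟨le_rfl, hT⟩ hxR y hy))
      (fun n x hx hxR => by
        have hd : dom = .space := by
          cases dom
          · have := cell_torus_subset hx
            rw [mem_closedBall_zero_iff] at this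
            linarith
          · rfl
        exact hvan n 0 x hd (by linarith))
      (fun x _ => (mollify_tendsto hφ.continuous (0, x)).comp (tendsto_add_atTop_nat N))
    refine tendsto_nhds_unique lim1 ?_
    simp only [fun n => h.eq (φn n) (htest n)]
    exact lim2.neg
  -- For negative `T` the time interval is empty and `φ` already vanishes at time `0`, so both sides
  -- are zero.
  · have h0 : ∀ x, φ (0, x) = 0 := fun x => hz 0 x (by linarith)
    have : Ioo 0 T = ∅ := Ioo_eq_empty (by linarith)
    simp [this, h0]

end WeakEq

end
end KEntropy

namespace KEntropy
noncomputable section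
open scoped ContDiff

/-! ### Test functions of class `C¹` up to the boundary in time -/

section C1

variable {T : ℝ} {F : Type*} [NormedAddCommGroup F] [NormedSpace ℝ F] {ψ : ℝ × E → F}

theorem mem_nhds_strip {z : ℝ × E} (hz : z.1 ∈ Ioo 0 T) :
    Icc 0 T ×ˢ (univ : Set E) ∈ 𝓝 z :=
  prod_mem_nhds (Icc_mem_nhds hz.1 hz.2) univ_mem

theorem contDiffAt_of_strip (hψ : ContDiffOn ℝ 1 ψ (Icc 0 T ×ˢ univ)) {z : ℝ × E}
    (hz : z.1 ∈ Ioo 0 T) : ContDiffAt ℝ 1 ψ z :=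
  hψ.contDiffAt (mem_nhds_strip hz)

theorem continuousOn_fderiv_strip (hψ : ContDiffOn ℝ 1 ψ (Icc 0 T ×ˢ univ)) :
    ContinuousOn (fderiv ℝ ψ) (Ioo 0 T ×ˢ univ) :=
  (hψ.mono (prod_mono_left Ioo_subset_Icc_self)).continuousOn_fderiv_of_isOpen
    (isOpen_Ioo.prod isOpen_univ) le_rfl

/-- On bounded sets, a `C¹` function and its derivative are bounded. -/
theorem exists_bound_strip (hT : 0 < T) (hψ : ContDiffOn ℝ 1 ψ (Icc 0 T ×ˢ univ)) (R : ℝ) :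
    ∃ C, (∀ t ∈ Icc 0 T, ∀ x : E, ‖x‖ ≤ R → ‖ψ (t, x)‖ ≤ C) ∧
      ∀ t ∈ Ioo 0 T, ∀ x : E, ‖x‖ ≤ R → ‖fderiv ℝ ψ (t, x)‖ ≤ C := by
  have hu : UniqueDiffOn ℝ (Icc 0 T ×ˢ (univ : Set E)) :=
    (uniqueDiffOn_Icc hT).prod uniqueDiffOn_univ
  have hK : IsCompact (Icc 0 T ×ˢ Metric.closedBall (0 : E) R) :=
    isCompact_Icc.prod (isCompact_closedBall _ _)
  have hsub : Icc 0 T ×ˢ Metric.closedBall (0 : E) R ⊆ Icc 0 T ×ˢ univ :=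
    prod_mono_right (subset_univ _)
  obtain ⟨C₁, hC₁⟩ := hK.exists_bound_of_continuousOn (hψ.continuousOn.mono hsub)
  -- At `t = 0` and `t = T` the full derivative `fderiv` has no meaning. The bound comes from the
  -- derivative within the closed strip, which is continuous up to the boundary and agrees with
  -- `fderiv` inside.
  obtain ⟨C₂, hC₂⟩ := hK.exists_bound_of_continuousOn
    ((hψ.continuousOn_fderivWithin hu le_rfl).mono hsub)
  refine ⟨max C₁ C₂, fun t ht x hx => (hC₁ (t, x) ⟨ht, by simpa using hx⟩).trans (le_max_left _ _),
    fun t ht x hx => ?_⟩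
  have := hC₂ (t, x) ⟨Ioo_subset_Icc_self ht, by simpa using hx⟩
  rw [fderivWithin_of_mem_nhds (mem_nhds_strip ht)] at this
  exact this.trans (le_max_right _ _)

end C1

namespace WeakEq

variable {dom : Dom} {T : ℝ} {f0 : ℝ × E → ℝ} {f : Fin 3 → ℝ × E → ℝ} {g : ℝ × E → ℝ} {fi : E → ℝ}

/-- Test functions `κ ψ` where `κ` is smooth and `ψ` is of class `C¹` on `[0,T] × E`. -/
theorem eq_mul (h : WeakEq dom T f0 f g fi) (hT : 0 < T) {κ ψ : ℝ × E → ℝ}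
    (hκ : IsTest dom T (fun t x => κ (t, x))) (hψ : ContDiffOn ℝ 1 ψ (Icc 0 T ×ˢ univ))
    (per : ∀ t ∈ Icc 0 T, dom.Per fun x => ψ (t, x)) :
    ∫ z in Ioo 0 T ×ˢ dom.cell,
        wform f0 f g (fun z => κ z • fderiv ℝ ψ z + ψ z • fderiv ℝ κ z) (fun z => κ z * ψ z) z
      = - ∫ x in dom.cell, fi x * (κ (0, x) * ψ (0, x)) := by
  obtain ⟨T₁, hT₁, hz₁⟩ := hκ.time
  set T' := max T₁ 0
  have hT' : T' < T := max_lt hT₁ hT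
  have hz : ∀ t x, T' ≤ t → κ (t, x) = 0 := fun t x ht => hz₁ t x ((le_max_left _ _).trans ht)
  obtain ⟨R, hR2, hR⟩ : ∃ R : ℝ, 2 ≤ R ∧ (dom = .space → ∀ t x, R ≤ ‖x‖ → κ (t, x) = 0) := by
    cases dom
    · exact ⟨2, le_rfl, nofun⟩
    · obtain ⟨R, hR⟩ := hκ.supp rfl
      exact ⟨max 2 R, le_max_left _ _, fun _ t x hx => hR t x ((le_max_right _ _).trans hx)⟩
  have hκs : ContDiff ℝ ∞ κ := hκ.smooth
  have hκ1 : ContDiff ℝ 1 κ := hκs.of_le (by exact_mod_cast le_top)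
  -- The shift `δ n` will be less than `T - T'`: wherever `κ` is not zero and `t ≥ 0`, the shifted
  -- time stays inside `(0,T)`.
  obtain ⟨N, hN⟩ := exists_nat_one_div_lt (sub_pos.2 hT')
  set δ : ℕ → ℝ := fun n => 1 / (((n + N : ℕ) : ℝ) + 1)
  have hδpos : ∀ n, 0 < δ n := fun n => by positivity
  have hδN : ∀ n, δ n ≤ 1 / ((N : ℝ) + 1) := fun n => by
    apply one_div_le_one_div_of_le (by positivity)
    push_cast; linarith [(n.cast_nonneg : (0 : ℝ) ≤ n)]
  have hδ0 : Tendsto δ atTop (𝓝 0) :=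
    (tendsto_one_div_add_atTop_nhds_zero_nat (𝕜 := ℝ)).comp (tendsto_add_atTop_nat N)
  -- `ψ` is not defined usefully for `t < 0`. It is evaluated at `t + δ` and cut off by `ζ`, which
  -- is 0 for `t ≤ -2δ/3` and 1 for `t ≥ -δ/3`. Thus `ζ κ ψ(· + δ)` is `C¹` on all of `ℝ × E` and is
  -- unchanged by `ζ` on the times `t ≥ 0` that enter the equation.
  set ζ : ℕ → ℝ → ℝ := fun n t => Real.smoothTransition (3 * t / δ n + 2)
  have hζ0 : ∀ n t, t ≤ -(2 / 3 * δ n) → ζ n t = 0 := fun n t ht => by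
    apply Real.smoothTransition.zero_of_nonpos
    have : 3 * t / δ n ≤ -2 := by
      rw [div_le_iff₀ (hδpos n)]; linarith
    linarith
  have hζ1 : ∀ n t, -(1 / 3 * δ n) ≤ t → ζ n t = 1 := fun n t ht => by
    apply Real.smoothTransition.one_of_one_le
    have : -1 ≤ 3 * t / δ n := by
      rw [le_div_iff₀ (hδpos n)]; linarith
    linarith
  have hζs : ∀ n, ContDiff ℝ 1 (ζ n) := fun n => by
    refine Real.smoothTransition.contDiff.comp ?_
    exact ((contDiff_const.mul contDiff_id).div_const _).add contDiff_const
  set ψs : ℕ → ℝ × E → ℝ := fun n z => ψ (z + (δ n, 0))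
  set Φ : ℕ → ℝ × E → ℝ := fun n z => ζ n z.1 * κ z * ψs n z
  have hψs : ∀ n (z : ℝ × E), z.1 + δ n ∈ Ioo 0 T → ContDiffAt ℝ 1 (ψs n) z := fun n z hz =>
    (contDiffAt_of_strip hψ (z := z + (δ n, 0)) hz).comp z
      (contDiff_id.add contDiff_const).contDiffAt
  -- Where the shifted time leaves `(0,T)`, one factor vanishes on a neighbourhood: `ζ` for early
  -- times, `κ` for late ones. This is what makes the product smooth there.
  have hΦ0 : ∀ n (z : ℝ × E), z.1 + δ n ∉ Ioo 0 T → ∀ᶠ y in 𝓝 z, Φ n y = 0 := by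
    intro n z hz
    rw [mem_Ioo, not_and_or, not_lt, not_lt] at hz
    rcases hz with hz | hz
    · have h1 : z.1 < -(2 / 3 * δ n) := by linarith [hδpos n]
      filter_upwards [(isOpen_lt continuous_fst continuous_const).mem_nhds h1] with y hy
      simp [Φ, hζ0 n y.1 (le_of_lt hy)]
    · have h1 : T' < z.1 := by linarith [hδN n]
      filter_upwards [(isOpen_lt continuous_const continuous_fst).mem_nhds h1] with y hy
      simp [Φ, show κ y = 0 from hz₁ y.1 y.2 ((le_max_left _ _).trans (le_of_lt hy))]
  have hΦ : ∀ n, ContDiff ℝ 1 (Φ n) := fun n => contDiff_iff_contDiffAt.2 fun z => by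
    by_cases hz : z.1 + δ n ∈ Ioo 0 T
    · exact (((hζs n).comp contDiff_fst).mul hκ1).contDiffAt.mul (hψs n z hz)
    · exact contDiffAt_const.congr_of_eventuallyEq (hΦ0 n z hz)
  have hΦper : ∀ n t, dom.Per fun x => Φ n (t, x) := by
    intro n t
    cases dom
    · intro j x
      by_cases hz : t + δ n ∈ Ioo 0 T
      · have h1 : κ (t, x + unitVec j) = κ (t, x) := hκ.per t j x
        have h2 : ψ (t + δ n, x + unitVec j) = ψ (t + δ n, x) :=
          per _ (Ioo_subset_Icc_self hz) j x
        simp only [Φ, ψs, Prod.mk_add_mk, add_zero, h1, h2]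
      · exact ((hΦ0 n (t, x + unitVec j) hz).self_of_nhds).trans
          ((hΦ0 n (t, x) hz).self_of_nhds).symm
    · trivial
  have key : ∀ n, ∫ z in Ioo 0 T ×ˢ dom.cell, wform f0 f g (fderiv ℝ (Φ n)) (Φ n) z
      = - ∫ x in dom.cell, fi x * Φ n (0, x) := fun n =>
    h.eq_of_contDiff (hΦ n) (hΦper n) ⟨T', hT', fun t x ht => by simp [Φ, hz t x ht]⟩
      (fun hd => by
        obtain ⟨R, hR⟩ := hκ.supp hd
        exact ⟨R, fun t x hx => by simp [Φ, show κ (t, x) = 0 from hR t x hx]⟩)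
  have hlt : ∀ n, ∀ t ∈ Ico 0 T', t + δ n ∈ Ioo 0 T := fun n t ht =>
    ⟨by linarith [ht.1, hδpos n], by linarith [ht.2, hδN n]⟩
  -- away from the support of `κ` everything vanishes
  have hκ0 : ∀ z : ℝ × E, T' < z.1 → κ z = 0 ∧ fderiv ℝ κ z = 0 := by
    intro z hz'
    have : κ =ᶠ[𝓝 z] fun _ => 0 := by
      filter_upwards [(isOpen_lt continuous_const continuous_fst).mem_nhds hz'] with y hy
      exact hz y.1 y.2 (le_of_lt hy)
    exact ⟨this.self_of_nhds, by rw [this.fderiv_eq]; simp⟩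
  -- At the time `T'` itself `κ` need not vanish on a neighbourhood; the derivative is zero by
  -- continuity from later times.
  have hκT : ∀ z : ℝ × E, z.1 = T' → κ z = 0 ∧ fderiv ℝ κ z = 0 := by
    intro z hz'
    refine ⟨hz z.1 z.2 hz'.ge, ?_⟩
    have hc : Continuous (fderiv ℝ κ) := hκ1.continuous_fderiv one_ne_zero
    have hcl : IsClosed {s : ℝ | fderiv ℝ κ (s, z.2) = 0} :=
      isClosed_eq (hc.comp (by fun_prop)) continuous_const
    have hsub : Ioi T' ⊆ {s : ℝ | fderiv ℝ κ (s, z.2) = 0} := fun s hs => (hκ0 (s, z.2) hs).2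
    have := hcl.closure_subset_iff.2 hsub (by rw [closure_Ioi]; exact mem_Ici.2 le_rfl : T' ∈ _)
    rw [← hz'] at this
    exact this
  have hκge : ∀ z : ℝ × E, T' ≤ z.1 → κ z = 0 ∧ fderiv ℝ κ z = 0 := fun z hz' =>
    hz'.eq_or_lt.elim (fun h => hκT z h.symm) (hκ0 z)
  have hΦeq : ∀ n (z : ℝ × E), 0 ≤ z.1 → Φ n z = κ z * ψs n z := fun n z h0 => by
    simp only [Φ]; rw [hζ1 n z.1 (by linarith [hδpos n]), one_mul]
  have hΦfd : ∀ n (z : ℝ × E), 0 ≤ z.1 →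
      fderiv ℝ (Φ n) z = κ z • fderiv ℝ ψ (z + (δ n, 0)) + ψs n z • fderiv ℝ κ z := by
    intro n z h0
    have hev : Φ n =ᶠ[𝓝 z] fun y => κ y * ψs n y := by
      have h1 : -(1 / 3 * δ n) < z.1 := by linarith [hδpos n]
      filter_upwards [(isOpen_lt continuous_const continuous_fst).mem_nhds h1] with y hy
      simp only [Φ]; rw [hζ1 n y.1 (le_of_lt hy), one_mul]
    by_cases hzT : z.1 < T'
    · rw [hev.fderiv_eq, fderiv_fun_mul (hκ1.differentiable one_ne_zero z)
        ((hψs n z (hlt n _ ⟨h0, hzT⟩)).differentiableAt one_ne_zero)]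
      congr 2
      exact fderiv_comp_add_right _
    -- For `t ≥ T'` the derivative of `ψ` at the shifted point may be meaningless, but its
    -- coefficient `κ` is zero. So the product formula persists once the derivative of `Φ n` is
    -- shown to vanish, again by continuity from later times.
    · have hk := hκge z (not_lt.1 hzT)
      rw [hk.1, hk.2]
      have hk2 : ∀ᶠ y in 𝓝 z, T' < y.1 → Φ n y = 0 := Eventually.of_forall fun y hy => by
        simp [Φ, (hκ0 y hy).1]
      have hc : Continuous (fderiv ℝ (Φ n)) := (hΦ n).continuous_fderiv one_ne_zero
      have hcl : IsClosed {s : ℝ | fderiv ℝ (Φ n) (s, z.2) = 0} :=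
        isClosed_eq (hc.comp (by fun_prop)) continuous_const
      have hsub : Ioi T' ⊆ {s : ℝ | fderiv ℝ (Φ n) (s, z.2) = 0} := fun s hs => by
        have : Φ n =ᶠ[𝓝 (s, z.2)] fun _ => 0 := by
          filter_upwards [(isOpen_lt continuous_const continuous_fst).mem_nhds hs] with y hy
          simp [Φ, (hκ0 y hy).1]
        change fderiv ℝ (Φ n) (s, z.2) = 0
        rw [this.fderiv_eq]; simp
      have := hcl.closure_subset_iff.2 hsub
        (by rw [closure_Ioi]; exact mem_Ici.2 (not_lt.1 hzT) : z.1 ∈ _)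
      simpa using this
  obtain ⟨C, hC, hC'⟩ := exists_bound_strip hT hψ (R + 1)
  have hKc : IsCompact (Icc 0 T ×ˢ Metric.closedBall (0 : E) (R + 1)) :=
    isCompact_Icc.prod (isCompact_closedBall _ _)
  obtain ⟨A₁, hA₁⟩ := hKc.exists_bound_of_continuousOn hκ1.continuous.continuousOn
  obtain ⟨A₂, hA₂⟩ := hKc.exists_bound_of_continuousOn
    (hκ1.continuous_fderiv one_ne_zero).continuousOn
  set B : ℝ := |A₁| * |C| + |C| * |A₂|
  have hb : ∀ n (z : ℝ × E), z.1 ∈ Ico 0 T → ‖z.2‖ ≤ R + 1 →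
      ‖fderiv ℝ (Φ n) z‖ ≤ B ∧ |Φ n z| ≤ B := by
    intro n z hz1 hz2
    have hzK : z ∈ Icc 0 T ×ˢ Metric.closedBall (0 : E) (R + 1) :=
      ⟨Ico_subset_Icc_self hz1, by simpa using hz2⟩
    have hB : 0 ≤ B := by positivity
    rw [hΦfd n z hz1.1, hΦeq n z hz1.1]
    by_cases hzT : z.1 < T'
    · have hin := hlt n z.1 ⟨hz1.1, hzT⟩
      have a1 : |κ z| ≤ |A₁| := (hA₁ z hzK).trans (le_abs_self _)
      have a2 : ‖fderiv ℝ κ z‖ ≤ |A₂| := (hA₂ z hzK).trans (le_abs_self _)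
      have e : z + (δ n, (0 : E)) = (z.1 + δ n, z.2) := by simp [Prod.add_def]
      have c1 : |ψs n z| ≤ |C| := by
        simp only [ψs]; rw [e]
        exact (hC _ (Ioo_subset_Icc_self hin) _ hz2).trans (le_abs_self _)
      have c2 : ‖fderiv ℝ ψ (z + (δ n, 0))‖ ≤ |C| := by
        rw [e]; exact (hC' _ hin _ hz2).trans (le_abs_self _)
      constructor
      · refine (norm_add_le _ _).trans (add_le_add ?_ ?_)
        · rw [norm_smul]; exact mul_le_mul a1 c2 (norm_nonneg _) (abs_nonneg _)
        · rw [norm_smul]; exact mul_le_mul c1 a2 (norm_nonneg _) (abs_nonneg _)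
      · rw [abs_mul]
        exact (mul_le_mul a1 c1 (abs_nonneg _) (abs_nonneg _)).trans
          (le_add_of_nonneg_right (by positivity))
    · have hk := hκge z (not_lt.1 hzT)
      rw [hk.1, hk.2]
      simpa using hB
  have hvan : ∀ n (z : ℝ × E), 0 ≤ z.1 → z.2 ∈ dom.cell → R + 1 < ‖z.2‖ →
      fderiv ℝ (Φ n) z = 0 ∧ Φ n z = 0 := by
    intro n z hz0 hz1 hz2
    cases dom
    · have := cell_torus_subset hz1
      rw [mem_closedBall_zero_iff] at this
      linarith
    · have : κ =ᶠ[𝓝 z] fun _ => 0 := by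
        filter_upwards [(isOpen_lt continuous_const continuous_snd.norm).mem_nhds hz2] with y hy
        exact hR rfl y.1 y.2 (by have : R + 1 < ‖y.2‖ := hy; linarith)
      rw [hΦfd n z hz0, hΦeq n z hz0, this.self_of_nhds, this.fderiv_eq]
      simp
  have lim1 := h.tendsto_integral (Dn := fun n => fderiv ℝ (Φ n)) (φn := Φ)
    (D := fun z => κ z • fderiv ℝ ψ z + ψ z • fderiv ℝ κ z) (φ := fun z => κ z * ψ z)
    (C := B) (R := R + 1)
    (fun n => ((hΦ n).continuous_fderiv one_ne_zero).aestronglyMeasurable)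
    (fun n => (hΦ n).continuous.aestronglyMeasurable)
    (fun n z hz hzR => hb n z ⟨hz.1.1.le, hz.1.2⟩ hzR)
    (fun n z hz hzR => hvan n z hz.1.1.le hz.2 hzR)
    (fun z hz => by
      have hsh : Tendsto (fun n => z + (δ n, (0 : E))) atTop (𝓝 z) := by
        have : Tendsto (fun n => z + (δ n, (0 : E))) atTop (𝓝 (z + (0, 0))) :=
          tendsto_const_nhds.add (hδ0.prodMk_nhds tendsto_const_nhds)
        rwa [Prod.mk_zero_zero, add_zero] at this
      have l1 : Tendsto (fun n => fderiv ℝ ψ (z + (δ n, 0))) atTop (𝓝 (fderiv ℝ ψ z)) :=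
        ((continuousOn_fderiv_strip hψ).continuousAt
          (prod_mem_nhds (Ioo_mem_nhds hz.1.1 hz.1.2) univ_mem)).tendsto.comp hsh
      have l2 : Tendsto (fun n => ψs n z) atTop (𝓝 (ψ z)) :=
        (contDiffAt_of_strip hψ hz.1).continuousAt.tendsto.comp hsh
      simp only [hΦfd _ z hz.1.1.le, hΦeq _ z hz.1.1.le]
      exact ⟨(l1.const_smul _).add (l2.smul_const _), l2.const_mul _⟩)
  have lim2 := h.tendsto_integral_data (φn := fun n x => Φ n (0, x))
    (φ := fun x => κ (0, x) * ψ (0, x)) (C := B) (R := R + 1)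
    (fun n => ((hΦ n).continuous.comp (by fun_prop)).aestronglyMeasurable)
    (fun n x hx hxR => (hb n (0, x) ⟨le_rfl, hT⟩ hxR).2)
    (fun n x hx hxR => (hvan n (0, x) le_rfl hx hxR).2)
    (fun x _ => by
      simp only [hΦeq _ (0, x) le_rfl]
      refine Tendsto.const_mul _ ?_
      have h1 : ContinuousWithinAt ψ (Icc 0 T ×ˢ univ) (0, x) :=
        hψ.continuousOn _ ⟨⟨le_rfl, hT.le⟩, mem_univ _⟩
      refine h1.tendsto.comp (tendsto_nhdsWithin_iff.2 ⟨?_, Eventually.of_forall fun n => ?_⟩)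
      · have : Tendsto (fun n => ((0 : ℝ), x) + (δ n, (0 : E))) atTop (𝓝 ((0, x) + (0, 0))) :=
          tendsto_const_nhds.add (hδ0.prodMk_nhds tendsto_const_nhds)
        simpa using this
      · refine ⟨?_, mem_univ _⟩
        have h0T : (0 : ℝ) ≤ T' := le_max_right _ _
        constructor
        · simpa using (hδpos n).le
        · have := hδN n
          simp only [Prod.mk_add_mk, zero_add]
          linarith)
  refine tendsto_nhds_unique lim1 ?_
  simp only [key]
  exact lim2.neg

end WeakEq

end
end KEntropy

namespace KEntropy
noncomputable section
open scoped ContDiff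

/-! ### The weak equations at almost every time -/

/-- A distributional derivative in time with prescribed initial value determines a function. -/
theorem ae_eq_of_weak_deriv {T : ℝ} (hT : 0 < T) {a b : ℝ → ℝ} {a₀ : ℝ}
    (ha : IntegrableOn a (Ioo 0 T)) (hb : IntegrableOn b (Ioo 0 T))
    (h : ∀ η : ℝ → ℝ, ContDiff ℝ ∞ η → (∃ T' < T, ∀ t, T' ≤ t → η t = 0) →
      ∫ t in Ioo 0 T, (deriv η t * a t + η t * b t) = - (η 0 * a₀)) :
    ∀ᵐ τ ∂(volume.restrict (Ioo 0 T)), a τ - a₀ = ∫ t in Ioo 0 τ, b t := by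
  have hbi : IntervalIntegrable b volume 0 T := by
    rw [intervalIntegrable_iff_integrableOn_Ioo_of_le hT.le]; exact hb
  set B : ℝ → ℝ := fun t => ∫ s in (0 : ℝ)..t, b s
  have hBac : AbsolutelyContinuousOnInterval B 0 T :=
    hbi.absolutelyContinuousOnInterval_intervalIntegral (by simp)
  have hBc : ContinuousOn B (Icc 0 T) := by
    have := hBac.continuousOn; rwa [uIcc_of_le hT.le] at this
  have hBi : IntegrableOn B (Ioo 0 T) :=
    (hBc.integrableOn_compact isCompact_Icc).mono_set Ioo_subset_Icc_self
  have hci : IntegrableOn (fun t => a t - (a₀ + B t)) (Ioo 0 T) :=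
    ha.sub ((integrableOn_const (by simp)).add hBi)
  have hB' : ∀ᵐ t, t ∈ uIcc 0 T → deriv B t = b t := by
    filter_upwards [hbi.ae_hasDerivAt_integral] with t ht h2
    exact (ht h2 0 (by simp)).deriv
  -- The lemma of du Bois-Reymond: `a - a₀ - B`, with `B` the primitive of `b`, is orthogonal to
  -- every smooth function with compact support in `(0,T)`.
  have key := isOpen_Ioo.ae_eq_zero_of_integral_contDiff_smul_eq_zero
    (U := Ioo 0 T) (f := fun t => a t - (a₀ + B t)) (μ := volume) hci.locallyIntegrableOn ?_
  · rw [ae_restrict_iff' measurableSet_Ioo]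
    filter_upwards [key] with t ht h2
    have := ht h2
    rw [← integral_Ioc_eq_integral_Ioo, ← intervalIntegral.integral_of_le h2.1.le]
    change _ = B t
    linarith
  · intro ζ hζ hζc hζs
    -- The primitive that vanishes near `T` is admissible as a test function. Its value at `0` is
    -- `-∫ζ`, which is how the initial value `a₀` enters.
    set η : ℝ → ℝ := fun t => ∫ s in T..t, ζ s
    have hηd : ∀ t, HasDerivAt η (ζ t) t := fun t =>
      intervalIntegral.integral_hasDerivAt_right (hζ.continuous.intervalIntegrable _ _)
        (hζ.continuous.stronglyMeasurableAtFilter _ _) hζ.continuous.continuousAt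
    have hηd' : deriv η = ζ := by ext t; exact (hηd t).deriv
    have hη : ContDiff ℝ ∞ η := by
      rw [contDiff_infty_iff_deriv, hηd']
      exact ⟨fun t => (hηd t).differentiableAt, hζ⟩
    obtain ⟨T', hT', hTz⟩ : ∃ T' < T, ∀ t, T' ≤ t → ζ t = 0 := by
      by_cases hne : (tsupport ζ).Nonempty
      · obtain ⟨m, hm, hmax⟩ := hζc.exists_isMaxOn hne continuousOn_id
        refine ⟨(m + T) / 2, by linarith [(hζs hm).2], fun t ht => ?_⟩
        by_contra hne'
        have h1 : t ∈ tsupport ζ := subset_closure hne'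
        have h2 : t ≤ m := hmax h1
        linarith [(hζs hm).2]
      · refine ⟨0, hT, fun t _ => ?_⟩
        by_contra hne'
        exact hne ⟨t, subset_closure hne'⟩
    have hηz : ∀ t, T' ≤ t → η t = 0 := fun t ht => by
      refine intervalIntegral.integral_zero_ae (Eventually.of_forall fun s hs => hTz s ?_)
      rcases le_total T t with h1 | h1
      · rw [uIoc_of_le h1] at hs; linarith [hs.1]
      · rw [uIoc_of_ge h1] at hs; linarith [hs.1]
    have hηac : AbsolutelyContinuousOnInterval η 0 T :=
      ((hη.of_le (by exact_mod_cast le_top : (1 : WithTop ℕ∞) ≤ _)).contDiffOn).absolutelyContinuousOnInterval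
    have ibp := hηac.integral_mul_deriv_eq_deriv_mul hBac
    have e1 : ∫ t in (0 : ℝ)..T, η t * deriv B t = ∫ t in Ioo 0 T, η t * b t := by
      rw [intervalIntegral.integral_of_le hT.le, ← integral_Ioc_eq_integral_Ioo]
      refine setIntegral_congr_ae measurableSet_Ioc ?_
      filter_upwards [hB'] with t ht h2
      rw [ht (by rw [uIcc_of_le hT.le]; exact Ioc_subset_Icc_self h2)]
    have e2 : ∫ t in (0 : ℝ)..T, deriv η t * B t = ∫ t in Ioo 0 T, ζ t * B t := by
      rw [intervalIntegral.integral_of_le hT.le, ← integral_Ioc_eq_integral_Ioo, hηd']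
    have hB0 : B 0 = 0 := intervalIntegral.integral_same
    rw [e1, e2, hηz T hT'.le, hB0] at ibp
    have e3 : ∫ t in Ioo 0 T, ζ t = - η 0 := by
      have : η 0 = ∫ s in T..0, ζ s := rfl
      rw [this, intervalIntegral.integral_symm, intervalIntegral.integral_of_le hT.le,
        integral_Ioc_eq_integral_Ioo, neg_neg]
    have hmul : ∀ {k c : ℝ → ℝ}, Continuous k → IntegrableOn c (Ioo 0 T) →
        IntegrableOn (fun t => k t * c t) (Ioo 0 T) := by
      intro k c hk hc
      obtain ⟨M, hM⟩ := isCompact_Icc.exists_bound_of_continuousOn (s := Icc 0 T) hk.continuousOn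
      refine Integrable.bdd_mul (c := M) hc hk.aestronglyMeasurable ?_
      filter_upwards [ae_restrict_mem measurableSet_Ioo] with t ht
      exact hM t (Ioo_subset_Icc_self ht)
    have main := h η hη ⟨T', hT', hηz⟩
    rw [hηd', integral_add (hmul hζ.continuous ha) (hmul hη.continuous hb)] at main
    have hz : ∫ t, ζ t • (a t - (a₀ + B t)) = ∫ t in Ioo 0 T, ζ t * (a t - (a₀ + B t)) := by
      refine (setIntegral_eq_integral_of_forall_compl_eq_zero fun t ht => ?_).symm
      have : ζ t = 0 := by
        by_contra hne'
        exact ht (hζs (subset_closure hne'))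
      simp [this]
    rw [hz]
    have e4 : ∫ t in Ioo 0 T, ζ t * (a t - (a₀ + B t)) = (∫ t in Ioo 0 T, ζ t * a t)
        - (a₀ * ∫ t in Ioo 0 T, ζ t) - ∫ t in Ioo 0 T, ζ t * B t := by
      rw [← integral_const_mul, ← integral_sub (hmul hζ.continuous ha), ← integral_sub]
      · congr 1; ext t; ring
      · exact (hmul hζ.continuous ha).sub
          ((hmul hζ.continuous (integrableOn_const (by simp : volume (Ioo 0 T) ≠ ⊤)
            (C := (1 : ℝ)))).congr_fun (fun t _ => by ring) measurableSet_Ioo |>.const_mul a₀)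
      · exact hmul hζ.continuous hBi
      · exact ((hmul hζ.continuous (integrableOn_const (by simp : volume (Ioo 0 T) ≠ ⊤)
            (C := (1 : ℝ)))).congr_fun (fun t _ => by ring) measurableSet_Ioo |>.const_mul a₀)
    rw [e4, e3]
    linarith

namespace WeakEq

variable {dom : Dom} {T : ℝ} {f0 : ℝ × E → ℝ} {f : Fin 3 → ℝ × E → ℝ} {g : ℝ × E → ℝ} {fi : E → ℝ}

/-- Test functions `η(t) ψ(t,x)` where `ψ` is of class `C¹` and decays suitably. -/
theorem eq_time_mul (h : WeakEq dom T f0 f g fi) (hT : 0 < T) {ψ : ℝ × E → ℝ}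
    (hψ : ContDiffOn ℝ 1 ψ (Icc 0 T ×ˢ univ)) (per : ∀ t ∈ Icc 0 T, dom.Per fun x => ψ (t, x))
    (h0 : IntegrableOn (fun z => f0 z * ψ z) (Ioo 0 T ×ˢ dom.cell))
    (hf : ∀ j, IntegrableOn (fun z => f j z * ψ z) (Ioo 0 T ×ˢ dom.cell))
    (hb : IntegrableOn (wform f0 f g (fderiv ℝ ψ) ψ) (Ioo 0 T ×ˢ dom.cell))
    (hi : IntegrableOn (fun x => fi x * ψ (0, x)) dom.cell)
    {η : ℝ → ℝ} (hη : ContDiff ℝ ∞ η) (hηT : ∃ T' < T, ∀ t, T' ≤ t → η t = 0) :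
    ∫ z in Ioo 0 T ×ˢ dom.cell,
        (deriv η z.1 * (f0 z * ψ z) + η z.1 * wform f0 f g (fderiv ℝ ψ) ψ z)
      = - (η 0 * ∫ x in dom.cell, fi x * ψ (0, x)) := by
  obtain ⟨χ, hχs, hχp, hχsupp, hχ01, hχ1, Cχ, hCχ⟩ := exists_cutoff dom
  have hη1 : ContDiff ℝ 1 η := hη.of_le (by exact_mod_cast le_top)
  have hηd : ∀ t, HasDerivAt η (deriv η t) t := fun t =>
    (hη1.differentiable one_ne_zero t).hasDerivAt
  have hη' : Continuous (deriv η) := hη1.continuous_deriv le_rfl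
  have hχ1' : ∀ n, ContDiff ℝ 1 (χ n) := fun n => (hχs n).of_le (by exact_mod_cast le_top)
  set κ : ℕ → ℝ × E → ℝ := fun n z => η z.1 * χ n z.2
  have hκ : ∀ n, IsTest dom T (fun t x => κ n (t, x)) := fun n =>
    { smooth := (hη.comp contDiff_fst).mul ((hχs n).comp contDiff_snd)
      per := fun t => by
        cases dom
        · intro j x
          have : χ n (x + unitVec j) = χ n x := hχp n j x
          simp only [κ, this]
        · trivial
      time := by
        obtain ⟨T', h1, h2⟩ := hηT
        exact ⟨T', h1, fun t x ht => by simp [κ, h2 t ht]⟩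
      supp := fun hd => by
        obtain ⟨R, hR⟩ := hχsupp n hd
        exact ⟨R, fun t x hx => by simp [κ, hR x hx]⟩ }
  have key := fun n => h.eq_mul hT (hκ n) hψ per
  have hfd : ∀ n (z : ℝ × E), HasFDerivAt (κ n)
      (η z.1 • (fderiv ℝ (χ n) z.2).comp (ContinuousLinearMap.snd ℝ ℝ E)
        + χ n z.2 • deriv η z.1 • ContinuousLinearMap.fst ℝ ℝ E) z := fun n z => by
    have h1 : HasFDerivAt (fun z : ℝ × E => η z.1)
        (deriv η z.1 • ContinuousLinearMap.fst ℝ ℝ E) z :=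
      (hηd z.1).comp_hasFDerivAt z hasFDerivAt_fst
    have h2 : HasFDerivAt (fun z : ℝ × E => χ n z.2)
        ((fderiv ℝ (χ n) z.2).comp (ContinuousLinearMap.snd ℝ ℝ E)) z :=
      ((hχ1' n).differentiable one_ne_zero z.2).hasFDerivAt.comp z hasFDerivAt_snd
    exact h1.mul h2
  -- With `κ = η χ`, the integrand is `χ` times the desired one, plus a commutator that contains
  -- `∇χ`.
  have hform : ∀ n z, wform f0 f g (fun z => κ n z • fderiv ℝ ψ z + ψ z • fderiv ℝ (κ n) z)
      (fun z => κ n z * ψ z) z = χ n z.2 * (deriv η z.1 * (f0 z * ψ z)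
        + η z.1 * wform f0 f g (fderiv ℝ ψ) ψ z)
        + η z.1 * ∑ j, (f j z * ψ z) * fderiv ℝ (χ n) z.2 (unitVec j) := fun n z => by
    simp only [wform, (hfd n z).fderiv, κ, Fin.sum_univ_three]
    simp
    ring
  obtain ⟨M, hM0, hM⟩ : ∃ M, 0 ≤ M ∧ ∀ t ∈ Ioo 0 T, |η t| ≤ M ∧ |deriv η t| ≤ M := by
    obtain ⟨M₁, hM₁⟩ :=
      isCompact_Icc.exists_bound_of_continuousOn (s := Icc 0 T) hη.continuous.continuousOn
    obtain ⟨M₂, hM₂⟩ :=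
      isCompact_Icc.exists_bound_of_continuousOn (s := Icc 0 T) hη'.continuousOn
    exact ⟨max 0 (max M₁ M₂), le_max_left _ _, fun t ht =>
      ⟨(hM₁ t (Ioo_subset_Icc_self ht)).trans ((le_max_left _ _).trans (le_max_right _ _)),
        (hM₂ t (Ioo_subset_Icc_self ht)).trans ((le_max_right _ _).trans (le_max_right _ _))⟩⟩
  have hCχ0 : 0 ≤ Cχ := (norm_nonneg _).trans (hCχ 0 0)
  have hmeas : MeasurableSet (Ioo 0 T ×ˢ dom.cell) :=
    measurableSet_Ioo.prod (cell_measurableSet dom)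
  have lim1 : Tendsto (fun n => ∫ z in Ioo 0 T ×ˢ dom.cell,
      (χ n z.2 * (deriv η z.1 * (f0 z * ψ z) + η z.1 * wform f0 f g (fderiv ℝ ψ) ψ z)
        + η z.1 * ∑ j, (f j z * ψ z) * fderiv ℝ (χ n) z.2 (unitVec j))) atTop
      (𝓝 (∫ z in Ioo 0 T ×ˢ dom.cell,
        (deriv η z.1 * (f0 z * ψ z) + η z.1 * wform f0 f g (fderiv ℝ ψ) ψ z))) := by
    -- The commutator is dominated by `|f ψ|` times the uniform bound of the cut-off gradients, and
    -- at each point it is eventually zero. No decay rate of the gradients is needed.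
    refine tendsto_integral_of_dominated_convergence
      (bound := fun z => (M * |f0 z * ψ z| + M * |wform f0 f g (fderiv ℝ ψ) ψ z|)
        + M * ∑ j, |f j z * ψ z| * Cχ) ?_ ?_ ?_ ?_
    · intro n
      have c1 : Continuous fun z : ℝ × E => χ n z.2 := (hχ1' n).continuous.comp continuous_snd
      have c2 : Continuous fun z : ℝ × E => deriv η z.1 := hη'.comp continuous_fst
      have c3 : Continuous fun z : ℝ × E => η z.1 := hη.continuous.comp continuous_fst
      have c4 : ∀ j, Continuous fun z : ℝ × E => fderiv ℝ (χ n) z.2 (unitVec j) := fun j =>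
        (((hχ1' n).continuous_fderiv one_ne_zero).comp continuous_snd).clm_apply continuous_const
      refine (c1.aestronglyMeasurable.mul ((c2.aestronglyMeasurable.mul h0.1).add
        (c3.aestronglyMeasurable.mul hb.1))).add (c3.aestronglyMeasurable.mul ?_)
      exact Finset.aestronglyMeasurable_fun_sum _
        fun j _ => (hf j).1.mul (c4 j).aestronglyMeasurable
    · refine ((h0.abs.const_mul M).add (hb.abs.const_mul M)).add (Integrable.const_mul ?_ M)
      exact integrable_finsetSum _ fun j _ => (hf j).abs.mul_const Cχ
    · intro n
      filter_upwards [ae_restrict_mem hmeas] with z hz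
      obtain ⟨m1, m2⟩ := hM z.1 hz.1
      have hc := hχ01 n z.2
      rw [Real.norm_eq_abs]
      refine (abs_add_le _ _).trans (add_le_add ?_ ?_)
      · rw [abs_mul, abs_of_nonneg hc.1]
        refine (mul_le_of_le_one_left (abs_nonneg _) hc.2).trans
          ((abs_add_le _ _).trans (add_le_add ?_ ?_))
        · rw [abs_mul]; exact mul_le_mul_of_nonneg_right m2 (abs_nonneg _)
        · rw [abs_mul]; exact mul_le_mul_of_nonneg_right m1 (abs_nonneg _)
      · rw [abs_mul]
        refine mul_le_mul m1 ((Finset.abs_sum_le_sum_abs _ _).trans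
          (Finset.sum_le_sum fun j _ => ?_)) (abs_nonneg _) hM0
        rw [abs_mul]
        refine mul_le_mul_of_nonneg_left ?_ (abs_nonneg _)
        have := (fderiv ℝ (χ n) z.2).le_opNorm (unitVec j)
        rw [norm_unitVec, mul_one] at this
        exact this.trans (hCχ n z.2)
    · refine Eventually.of_forall fun z => ?_
      refine tendsto_const_nhds.congr' ?_
      obtain ⟨N, hN⟩ := exists_nat_gt ‖z.2‖
      filter_upwards [eventually_ge_atTop N] with n hn
      have hzn : ‖z.2‖ < n := hN.trans_le (by exact_mod_cast hn)
      rw [hχ1 n z.2 hzn.le, fderiv_cutoff_eq_zero hχ1 hzn]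
      simp
  have lim2 : Tendsto (fun n => ∫ x in dom.cell, fi x * (κ n (0, x) * ψ (0, x))) atTop
      (𝓝 (η 0 * ∫ x in dom.cell, fi x * ψ (0, x))) := by
    rw [← integral_const_mul]
    refine tendsto_integral_of_dominated_convergence
      (bound := fun x => |η 0| * |fi x * ψ (0, x)|) ?_ ?_ ?_ ?_
    · intro n
      have : AEStronglyMeasurable (fun x => η 0 * χ n x * (fi x * ψ (0, x)))
          (volume.restrict dom.cell) :=
        (continuous_const.mul (hχ1' n).continuous).aestronglyMeasurable.mul hi.1
      refine this.congr (Eventually.of_forall fun x => ?_)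
      simp only [κ]; ring
    · exact hi.abs.const_mul _
    · refine fun n => Eventually.of_forall fun x => ?_
      have hc := hχ01 n x
      have : fi x * (κ n (0, x) * ψ (0, x)) = χ n x * (η 0 * (fi x * ψ (0, x))) := by
        simp only [κ]; ring
      rw [this, norm_mul, ← abs_mul, Real.norm_of_nonneg hc.1]
      exact mul_le_of_le_one_left (abs_nonneg _) hc.2
    · refine Eventually.of_forall fun x => tendsto_const_nhds.congr' ?_
      obtain ⟨N, hN⟩ := exists_nat_gt ‖x‖
      filter_upwards [eventually_ge_atTop N] with n hn
      have hzn : ‖x‖ ≤ n := hN.le.trans (by exact_mod_cast hn)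
      simp only [κ, hχ1 n x hzn]
      ring
  refine tendsto_nhds_unique lim1 ?_
  simp only [hform] at key
  simp only [key]
  exact lim2.neg

/-- A weak equation, tested with a function of class `C¹` that decays suitably, holds on `(0,τ)`
for almost every `τ`. -/
theorem ae_eq (h : WeakEq dom T f0 f g fi) (hT : 0 < T) {ψ : ℝ × E → ℝ}
    (hψ : ContDiffOn ℝ 1 ψ (Icc 0 T ×ˢ univ)) (per : ∀ t ∈ Icc 0 T, dom.Per fun x => ψ (t, x))
    (h0 : IntegrableOn (fun z => f0 z * ψ z) (Ioo 0 T ×ˢ dom.cell))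
    (hf : ∀ j, IntegrableOn (fun z => f j z * ψ z) (Ioo 0 T ×ˢ dom.cell))
    (hb : IntegrableOn (wform f0 f g (fderiv ℝ ψ) ψ) (Ioo 0 T ×ˢ dom.cell))
    (hi : IntegrableOn (fun x => fi x * ψ (0, x)) dom.cell) :
    ∀ᵐ τ ∂(volume.restrict (Ioo 0 T)),
      (∫ x in dom.cell, f0 (τ, x) * ψ (τ, x)) - ∫ x in dom.cell, fi x * ψ (0, x)
        = ∫ z in Ioo 0 τ ×ˢ dom.cell, wform f0 f g (fderiv ℝ ψ) ψ z := by
  have hprod : ∀ S : Set ℝ, (volume : Measure (ℝ × E)).restrict (S ×ˢ dom.cell) =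
      (volume.restrict S).prod (volume.restrict dom.cell) := fun S => by
    rw [Measure.volume_eq_prod, Measure.prod_restrict]
  have hai : IntegrableOn (fun t => ∫ x in dom.cell, f0 (t, x) * ψ (t, x)) (Ioo 0 T) := by
    rw [IntegrableOn, hprod] at h0
    exact h0.integral_prod_left
  have hbi : IntegrableOn (fun t => ∫ x in dom.cell, wform f0 f g (fderiv ℝ ψ) ψ (t, x))
      (Ioo 0 T) := by
    have := hb
    rw [IntegrableOn, hprod] at this
    exact this.integral_prod_left
  have key := ae_eq_of_weak_deriv hT hai hbi
    (a₀ := ∫ x in dom.cell, fi x * ψ (0, x)) (fun η hη hηT => by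
      have hη1 : ContDiff ℝ 1 η := hη.of_le (by exact_mod_cast le_top)
      rw [← h.eq_time_mul hT hψ per h0 hf hb hi hη hηT]
      have hmul : ∀ {k : ℝ → ℝ} {c : ℝ × E → ℝ}, Continuous k →
          IntegrableOn c (Ioo 0 T ×ˢ dom.cell) →
          IntegrableOn (fun z => k z.1 * c z) (Ioo 0 T ×ˢ dom.cell) := by
        intro k c hk hc
        obtain ⟨M, hM⟩ := isCompact_Icc.exists_bound_of_continuousOn (s := Icc 0 T) hk.continuousOn
        refine Integrable.bdd_mul (c := M) hc (hk.comp continuous_fst).aestronglyMeasurable ?_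
        filter_upwards [ae_restrict_mem (measurableSet_Ioo.prod (cell_measurableSet dom))]
          with z hz
        exact hM z.1 (Ioo_subset_Icc_self hz.1)
      have i1 := hmul (hη1.continuous_deriv le_rfl) h0
      have i2 := hmul hη.continuous hb
      rw [integral_add i1 i2, integral_add]
      · rw [IntegrableOn, hprod] at i1 i2
        rw [hprod, integral_prod _ i1, integral_prod _ i2]
        simp only [integral_const_mul]
      · rw [IntegrableOn, hprod] at i1
        have := i1.integral_prod_left
        simpa only [integral_const_mul] using this
      · rw [IntegrableOn, hprod] at i2
        have := i2.integral_prod_left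
        simpa only [integral_const_mul] using this)
  rw [ae_restrict_iff' measurableSet_Ioo] at key ⊢
  filter_upwards [key] with τ hτ hmem
  rw [hτ hmem, hprod, integral_prod]
  rw [← hprod]
  exact hb.mono_set (prod_mono_left (Ioo_subset_Ioo_right hmem.2.le))

end WeakEq

end
end KEntropy

namespace KEntropy
noncomputable section
open scoped ContDiff ENNReal

/-! ### Convergence of mollifications in `L²` -/

section MollifyL2

variable {X : Type*} [NormedAddCommGroup X] [NormedSpace ℝ X] [FiniteDimensional ℝ X]
  [MeasureSpace X] [BorelSpace X] [(volume : Measure X).IsAddHaarMeasure]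

theorem mollify_congr_ae {n : ℕ} {g h : X → ℝ} (hgh : g =ᵐ[volume] h) :
    mollify n g = mollify n h := by
  ext x
  refine integral_congr_ae ?_
  have h1 := (quasiMeasurePreserving_sub_left (volume : Measure X) x).ae_eq_comp hgh
  filter_upwards [h1] with y hy
  simp only [Function.comp] at hy
  rw [hy]

/-- Translations preserve the measure and depend continuously on the shift in the compact-open
topology, hence they act continuously on `L²`. -/
theorem tendsto_eLpNorm_translate {H : X → ℝ} (hH : MemLp H 2 volume) :
    Tendsto (fun y => eLpNorm (fun z => H (z - y) - H z) 2 volume) (𝓝 0) (𝓝 0) := by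
  let τ : X → C(X, X) := fun y => ⟨fun z => z - y, by fun_prop⟩
  have hτ : Continuous τ := ContinuousMap.continuous_of_continuous_uncurry _ (by
    change Continuous fun p : X × X => p.2 - p.1
    fun_prop)
  have hm : ∀ y, MeasurePreserving (τ y) volume volume := fun y =>
    measurePreserving_sub_right volume y
  have hc : Continuous fun y => Lp.compMeasurePreserving (τ y) (hm y) (hH.toLp H) :=
    continuous_const.compMeasurePreservingLp hτ hm (by simp)
  have h0 : Lp.compMeasurePreserving (τ 0) (hm 0) (hH.toLp H) = hH.toLp H := by
    rw [Lp.toLp_compMeasurePreserving]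
    congr 1
    ext z; simp [τ]
  have h1 := hc.tendsto 0
  rw [h0] at h1
  have h2 : ∀ y, MemLp (H ∘ τ y) 2 volume := fun y => hH.comp_measurePreserving (hm y)
  have h3 : (fun y => Lp.compMeasurePreserving (τ y) (hm y) (hH.toLp H)) =
      fun y => (h2 y).toLp := by
    ext1 y; rw [Lp.toLp_compMeasurePreserving]
  rw [h3, Lp.tendsto_Lp_iff_tendsto_eLpNorm'' _ h2] at h1
  exact h1

/-- The difference is the mean of `H(· - y) - H` with respect to a probability measure on small `y`.
Jensen's inequality and Tonelli's theorem bound its norm by the largest `L²` distance between `H`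
and a small translate. -/
theorem mollify_tendsto_eLpNorm {H : X → ℝ} (hH : MemLp H 2 volume) :
    Tendsto (fun n => eLpNorm (fun z => mollify n H z - H z) 2 volume) atTop (𝓝 0) := by
  -- Tonelli's theorem needs `(z, y) ↦ H (z - y)` to be jointly measurable, so a measurable
  -- representative is taken; mollification does not see the change.
  wlog hm : StronglyMeasurable H generalizing H
  · have hae := hH.1.ae_eq_mk
    have h1 := this ((memLp_congr_ae hae).1 hH) hH.1.stronglyMeasurable_mk
    refine h1.congr fun n => eLpNorm_congr_ae ?_
    rw [mollify_congr_ae hae]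
    filter_upwards [hae] with z hz
    rw [hz]
  rw [ENNReal.tendsto_nhds_zero]
  intro ε hε
  have h1 := (ENNReal.tendsto_nhds_zero.1 (tendsto_eLpNorm_translate hH)) ε hε
  obtain ⟨δ, hδ, hδ'⟩ := Metric.eventually_nhds_iff.1 h1
  filter_upwards [(bump_rOut_tendsto (X := X)).eventually_lt_const hδ] with n hn
  set ν : Measure X := volume.withDensity fun y => ENNReal.ofReal (kern X n y)
  have hkm : Measurable fun y => ENNReal.ofReal (kern X n y) :=
    (kern_continuous n).measurable.ennreal_ofReal
  have hν : IsProbabilityMeasure ν := ⟨by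
    rw [withDensity_apply _ MeasurableSet.univ, setLIntegral_univ,
      ← ofReal_integral_eq_lintegral_ofReal (kern_integrable n)
        (Eventually.of_forall (kern_nonneg n)), kern_integral, ENNReal.ofReal_one]⟩
  have hloc : LocallyIntegrable H := hH.locallyIntegrable (by norm_num)
  have hint : ∀ z, Integrable fun y => kern X n y • H (z - y) := fun z =>
    ((bump X n).hasCompactSupport_normed.convolutionExists_left
      (ContinuousLinearMap.lsmul ℝ ℝ) (bump X n).continuous_normed hloc) z
  have hpt : ∀ z, ‖mollify n H z - H z‖ₑ ^ (2 : ℝ) ≤ ∫⁻ y, ‖H (z - y) - H z‖ₑ ^ (2 : ℝ) ∂ν := by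
    intro z
    have e1 : mollify n H z - H z = ∫ y, kern X n y • (H (z - y) - H z) := by
      simp only [smul_sub]
      rw [integral_sub (hint z) ((kern_integrable n).smul_const (H z)), integral_smul_const,
        kern_integral, one_smul]
      rfl
    have e2 : mollify n H z - H z = ∫ y, (H (z - y) - H z) ∂ν := by
      rw [e1, integral_withDensity_eq_integral_toReal_smul hkm
        (Eventually.of_forall fun _ => ENNReal.ofReal_lt_top)]
      congr 1; ext y
      rw [ENNReal.toReal_ofReal (kern_nonneg n y)]
    have hms : AEStronglyMeasurable (fun y => H (z - y) - H z) ν :=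
      ((hm.comp_measurable (measurable_const.sub measurable_id)).sub
        stronglyMeasurable_const).aestronglyMeasurable
    have e3 : ‖mollify n H z - H z‖ₑ ≤ eLpNorm (fun y => H (z - y) - H z) 2 ν := by
      rw [e2]
      refine (enorm_integral_le_lintegral_enorm _).trans ?_
      rw [← eLpNorm_one_eq_lintegral_enorm]
      exact eLpNorm_le_eLpNorm_of_exponent_le (by norm_num) hms
    have e4 := ENNReal.rpow_le_rpow e3 (by norm_num : (0 : ℝ) ≤ 2)
    refine e4.trans (le_of_eq ?_)
    rw [eLpNorm_eq_lintegral_rpow_enorm_toReal (by norm_num) (by norm_num)]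
    rw [← ENNReal.rpow_mul]
    simp
  have hsq : eLpNorm (fun z => mollify n H z - H z) 2 volume ^ (2 : ℝ) ≤ ε ^ (2 : ℝ) := by
    have e0 : ∀ (μ' : Measure X) (k : X → ℝ), eLpNorm k 2 μ' ^ (2 : ℝ) = ∫⁻ z, ‖k z‖ₑ ^ (2 : ℝ) ∂μ' := by
      intro μ' k
      rw [eLpNorm_eq_lintegral_rpow_enorm_toReal (by norm_num) (by norm_num), ← ENNReal.rpow_mul]
      simp
    rw [e0]
    refine (lintegral_mono hpt).trans ?_
    rw [lintegral_lintegral_swap]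
    · have hb : ∀ᵐ y ∂ν, ∫⁻ z, ‖H (z - y) - H z‖ₑ ^ (2 : ℝ) ≤ ε ^ (2 : ℝ) := by
        rw [ae_withDensity_iff hkm]
        refine Eventually.of_forall fun y hy => ?_
        rw [← e0 volume (fun z => H (z - y) - H z)]
        refine ENNReal.rpow_le_rpow (hδ' ?_) (by norm_num)
        rw [dist_zero_right]
        by_contra hcon
        exact hy (by rw [kern_eq_zero (hn.le.trans (not_lt.1 hcon))]; simp)
      refine (lintegral_mono_ae hb).trans ?_
      simp
    · have : Measurable fun p : X × X => ‖H (p.1 - p.2) - H p.1‖ₑ ^ (2 : ℝ) :=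
        (((hm.measurable.comp (measurable_fst.sub measurable_snd)).sub
          (hm.measurable.comp measurable_fst)).enorm).pow_const 2
      exact this.aemeasurable
  exact (ENNReal.rpow_le_rpow_iff (by norm_num : (0 : ℝ) < 2)).1 hsq

end MollifyL2

/-- Products of sequences converging in `L²` converge in the mean. -/
theorem tendsto_integral_mul_of_L2 {α : Type*} [MeasurableSpace α] {μ : Measure α}
    {a b : α → ℝ} {an bn : ℕ → α → ℝ} (ha : MemLp a 2 μ) (hb : MemLp b 2 μ)
    (han : ∀ n, MemLp (an n) 2 μ) (hbn : ∀ n, MemLp (bn n) 2 μ)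
    (la : Tendsto (fun n => eLpNorm (fun z => an n z - a z) 2 μ) atTop (𝓝 0))
    (lb : Tendsto (fun n => eLpNorm (fun z => bn n z - b z) 2 μ) atTop (𝓝 0)) :
    Tendsto (fun n => ∫ z, an n z * bn n z ∂μ) atTop (𝓝 (∫ z, a z * b z ∂μ)) := by
  have l1 := (Lp.tendsto_Lp_iff_tendsto_eLpNorm'' an han a ha).2 la
  have l2 := (Lp.tendsto_Lp_iff_tendsto_eLpNorm'' bn hbn b hb).2 lb
  have l3 := l2.inner (𝕜 := ℝ) l1
  have e : ∀ {f g : α → ℝ} (hf : MemLp f 2 μ) (hg : MemLp g 2 μ),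
      inner ℝ (hg.toLp g) (hf.toLp f) = ∫ z, f z * g z ∂μ := by
    intro f g hf hg
    rw [L2.inner_def]
    refine integral_congr_ae ?_
    filter_upwards [hf.coeFn_toLp, hg.coeFn_toLp] with z h1 h2
    rw [h1, h2]
    simp
  simp only [e] at l3
  exact l3

end
end KEntropy

namespace KEntropy
noncomputable section
open scoped ContDiff ENNReal

/-! ### Elementary weak equations -/

theorem dt_eq_fderiv {F : Type*} [NormedAddCommGroup F] [NormedSpace ℝ F] {φ : ℝ × E → F}
    {t : ℝ} {x : E} (h : DifferentiableAt ℝ φ (t, x)) :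
    dt (fun t x => φ (t, x)) t x = fderiv ℝ φ (t, x) (1, 0) := by
  have h1 : HasDerivAt (fun s : ℝ => (s, x)) ((1 : ℝ), (0 : E)) t :=
    (hasDerivAt_id t).prodMk (hasDerivAt_const t x)
  exact (h.hasFDerivAt.comp_hasDerivAt t h1).deriv

theorem fderiv_slice {F : Type*} [NormedAddCommGroup F] [NormedSpace ℝ F] {φ : ℝ × E → F}
    {t : ℝ} {x : E} (h : DifferentiableAt ℝ φ (t, x)) (v : E) :
    fderiv ℝ (fun x => φ (t, x)) x v = fderiv ℝ φ (t, x) (0, v) := by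
  have h1 : HasFDerivAt (fun y : E => (t, y)) (ContinuousLinearMap.inr ℝ ℝ E) x :=
    hasFDerivAt_prodMk_right t x
  change fderiv ℝ (φ ∘ Prod.mk t) x v = _
  rw [(h.hasFDerivAt.comp x h1).fderiv]
  simp

theorem pd_eq_fderiv {F : Type*} [NormedAddCommGroup F] [NormedSpace ℝ F] {φ : ℝ × E → F}
    {t : ℝ} {x : E} (h : DifferentiableAt ℝ φ (t, x)) (j : Fin 3) :
    pd j (fun x => φ (t, x)) x = fderiv ℝ φ (t, x) (0, unitVec j) :=
  fderiv_slice h _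

theorem IsTest.contDiff_one {dom : Dom} {T : ℝ} {φ : ℝ × E → ℝ}
    (h : IsTest dom T (fun t x => φ (t, x))) : ContDiff ℝ 1 φ :=
  (show ContDiff ℝ ∞ φ from h.smooth).of_le (by exact_mod_cast le_top)

theorem IsTest.exists_radius {dom : Dom} {T : ℝ} {φ : ℝ × E → ℝ}
    (h : IsTest dom T (fun t x => φ (t, x))) :
    ∃ R : ℝ, ∀ z : ℝ × E, z.2 ∈ dom.cell → R < ‖z.2‖ → φ z = 0 ∧ fderiv ℝ φ z = 0 := by
  cases dom
  · refine ⟨2, fun z hz hR => ?_⟩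
    have := cell_torus_subset hz
    rw [mem_closedBall_zero_iff] at this
    linarith
  · obtain ⟨R, hR⟩ := h.supp rfl
    refine ⟨R, fun z _ hz => ⟨hR z.1 z.2 hz.le, ?_⟩⟩
    have : φ =ᶠ[𝓝 z] fun _ => 0 := by
      filter_upwards [(isOpen_lt continuous_const continuous_snd.norm).mem_nhds hz] with y hy
      exact hR y.1 y.2 (le_of_lt hy)
    rw [this.fderiv_eq]; simp

theorem IsTest.zero_off_time {dom : Dom} {T : ℝ} {φ : ℝ × E → ℝ}
    (h : IsTest dom T (fun t x => φ (t, x))) : ∀ x, φ (T, x) = 0 := fun x => by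
  obtain ⟨T', hT', hz⟩ := h.time
  exact hz T x hT'.le

theorem measure_local_lt_top (dom : Dom) (T R : ℝ) :
    volume (Ioo 0 T ×ˢ (dom.cell ∩ Metric.closedBall 0 R) : Set (ℝ × E)) < ⊤ := by
  rw [Measure.volume_eq_prod, Measure.prod_prod]
  exact ENNReal.mul_lt_top (by simp) ((measure_mono inter_subset_right).trans_lt
    measure_closedBall_lt_top)

/-- A locally integrable function times a continuous function with bounded support. -/
theorem integrableOn_mul_of_vanish {dom : Dom} {T : ℝ} {f k : ℝ × E → ℝ}
    (hf : ∀ R, IntegrableOn f (Ioo 0 T ×ˢ (dom.cell ∩ Metric.closedBall 0 R)))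
    (hk : Continuous k) {R : ℝ} (hR : ∀ z : ℝ × E, z.2 ∈ dom.cell → R < ‖z.2‖ → k z = 0) :
    IntegrableOn (fun z => f z * k z) (Ioo 0 T ×ˢ dom.cell) := by
  have hS : MeasurableSet (Ioo 0 T ×ˢ (dom.cell ∩ Metric.closedBall 0 R)) :=
    measurableSet_Ioo.prod ((cell_measurableSet dom).inter measurableSet_closedBall)
  have h1 : IntegrableOn (fun z => f z * k z) (Ioo 0 T ×ˢ (dom.cell ∩ Metric.closedBall 0 R)) := by
    have hK : IsCompact (Icc 0 T ×ˢ Metric.closedBall (0 : E) R) :=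
      isCompact_Icc.prod (isCompact_closedBall _ _)
    obtain ⟨M, hM⟩ := hK.exists_bound_of_continuousOn hk.continuousOn
    refine Integrable.mul_bdd (c := M) (hf R) hk.aestronglyMeasurable ?_
    filter_upwards [ae_restrict_mem hS] with z hz
    exact hM z ⟨Ioo_subset_Icc_self hz.1, hz.2.2⟩
  refine IntegrableOn.of_forall_sdiff_eq_zero h1
    (measurableSet_Ioo.prod (cell_measurableSet dom)) fun z hz => ?_
  rw [hR z hz.1.2 ?_, mul_zero]
  by_contra hcon
  exact hz.2 ⟨hz.1.1, hz.1.2, by simpa using hcon⟩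

theorem integrableOn_of_vanish {dom : Dom} {T : ℝ} {k : ℝ × E → ℝ}
    (hk : Continuous k) {R : ℝ} (hR : ∀ z : ℝ × E, z.2 ∈ dom.cell → R < ‖z.2‖ → k z = 0) :
    IntegrableOn k (Ioo 0 T ×ˢ dom.cell) := by
  have := integrableOn_mul_of_vanish (f := fun _ => 1) (T := T)
    (fun R => integrableOn_const (measure_local_lt_top dom T R).ne) hk hR
  simpa using this

theorem volume_restrict_prod (S : Set ℝ) (A : Set E) :
    (volume : Measure (ℝ × E)).restrict (S ×ˢ A) =
      (volume.restrict S).prod (volume.restrict A) := by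
  rw [Measure.volume_eq_prod, Measure.prod_restrict]

/-- Integrals of derivatives over the domain vanish. -/
theorem integral_cell_fderiv {dom : Dom} {φ : E → ℝ} (hφ : ContDiff ℝ 1 φ) (per : dom.Per φ)
    (supp : dom = .space → ∃ R : ℝ, ∀ x, R ≤ ‖x‖ → φ x = 0) (e : E) :
    ∫ x in dom.cell, fderiv ℝ φ x e = 0 := by
  obtain ⟨R, hR2, hR⟩ : ∃ R : ℝ, 2 ≤ R ∧ (dom = .space → ∀ x, R ≤ ‖x‖ → φ x = 0) := by
    cases dom
    · exact ⟨2, le_rfl, nofun⟩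
    · obtain ⟨R, hR⟩ := supp rfl
      exact ⟨max 2 R, le_max_left _ _, fun _ x hx => hR x ((le_max_right _ _).trans hx)⟩
  have hφ' : Continuous (fderiv ℝ φ) := hφ.continuous_fderiv one_ne_zero
  have hR' : dom = .space → ∀ x, R < ‖x‖ → fderiv ℝ φ x = 0 := fun hd x hx => by
    have : φ =ᶠ[𝓝 x] fun _ => 0 := by
      filter_upwards [(isOpen_lt continuous_const continuous_norm).mem_nhds hx] with y hy
      exact hR hd y (le_of_lt hy)
    rw [this.fderiv_eq]; simp
  set ρ := R + ‖e‖ + 1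
  obtain ⟨M, hM⟩ := (isCompact_closedBall (0 : E) (ρ + ‖e‖ + 1)).exists_bound_of_continuousOn
    hφ'.continuousOn
  have hmeas : MeasurableSet (dom.cell ∩ Metric.closedBall (0 : E) ρ) :=
    (cell_measurableSet dom).inter measurableSet_closedBall
  have hfin : volume (dom.cell ∩ Metric.closedBall (0 : E) ρ) < ⊤ :=
    (measure_mono inter_subset_right).trans_lt measure_closedBall_lt_top
  have hoff : ∀ x ∈ dom.cell, ρ < ‖x‖ → dom = .space := by
    intro x hx h2
    cases dom
    · have := cell_torus_subset hx
      rw [mem_closedBall_zero_iff] at this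
      have := norm_nonneg e
      linarith
    · rfl
  -- The integral of `φ(x + h e)` does not depend on `h`. Differentiating it under the integral sign
  -- at `h = 0` gives the claim on both domains, without boundary terms.
  have key := hasDerivAt_integral_of_dominated_loc_of_deriv_le (μ := volume.restrict dom.cell)
    (F := fun (h : ℝ) x => φ (x + h • e)) (F' := fun (h : ℝ) x => fderiv ℝ φ (x + h • e) e)
    (x₀ := (0 : ℝ)) (s := Metric.ball 0 1)
    (bound := (dom.cell ∩ Metric.closedBall (0 : E) ρ).indicator fun _ => |M| * ‖e‖)
    (Metric.ball_mem_nhds _ one_pos) ?_ ?_ ?_ ?_ ?_ ?_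
  · have h1 := key.2
    have hconst : (fun h : ℝ => ∫ x in dom.cell, φ (x + h • e)) =
        fun _ => ∫ x in dom.cell, φ x := by
      ext h; exact integral_cell_add per _
    rw [hconst] at h1
    have := h1.unique (hasDerivAt_const 0 _)
    simpa using this
  · exact Eventually.of_forall fun h =>
      (hφ.continuous.comp (continuous_id.add continuous_const)).aestronglyMeasurable
  · have h1 : IntegrableOn φ (dom.cell ∩ Metric.closedBall (0 : E) ρ) :=
      (hφ.continuous.continuousOn.integrableOn_compact (isCompact_closedBall 0 ρ)).mono_set
        inter_subset_right
    have h2 : IntegrableOn φ dom.cell := by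
      refine IntegrableOn.of_forall_sdiff_eq_zero h1 (cell_measurableSet dom) fun x hx => ?_
      have hx2 : ρ < ‖x‖ := by
        by_contra hcon
        exact hx.2 ⟨hx.1, by simpa using hcon⟩
      exact hR (hoff x hx.1 hx2) x (by linarith [norm_nonneg e])
    simp only [zero_smul, add_zero]
    exact h2
  · exact ((hφ'.comp (continuous_id.add continuous_const)).clm_apply
      continuous_const).aestronglyMeasurable
  · filter_upwards [ae_restrict_mem (cell_measurableSet dom)] with x hx h hh
    have hh' : |h| < 1 := by simpa using hh
    have hhe : ‖h • e‖ ≤ ‖e‖ := by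
      rw [norm_smul]; exact mul_le_of_le_one_left (norm_nonneg _) hh'.le
    by_cases hxρ : ‖x‖ ≤ ρ
    · rw [indicator_of_mem (show x ∈ dom.cell ∩ Metric.closedBall (0 : E) ρ from
        ⟨hx, by simpa using hxρ⟩)]
      refine ((fderiv ℝ φ _).le_opNorm e).trans
        (mul_le_mul_of_nonneg_right ((hM _ ?_).trans (le_abs_self _)) (norm_nonneg _))
      rw [mem_closedBall_zero_iff]
      linarith [norm_add_le x (h • e)]
    · rw [indicator_of_notMem (fun hc : x ∈ dom.cell ∩ Metric.closedBall (0 : E) ρ =>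
        hxρ (by simpa using hc.2))]
      rw [not_le] at hxρ
      rw [hR' (hoff x hx hxρ) (x + h • e) ?_]
      · simp
      · have := norm_sub_le (x + h • e) (h • e)
        rw [add_sub_cancel_right] at this
        linarith
  · rw [integrable_indicator_iff hmeas]
    exact (integrableOn_const hfin.ne).mono_measure Measure.restrict_le_self
  · refine Eventually.of_forall fun x h _ => ?_
    have h1 : HasDerivAt (fun h : ℝ => x + h • e) e h := by
      simpa using ((hasDerivAt_id h).smul_const e).const_add x
    exact ((hφ.differentiable one_ne_zero _).hasFDerivAt).comp_hasDerivAt h h1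

theorem IsTest.slice_supp {dom : Dom} {T : ℝ} {φ : ℝ × E → ℝ}
    (h : IsTest dom T (fun t x => φ (t, x))) (t : ℝ) :
    dom = .space → ∃ R : ℝ, ∀ x, R ≤ ‖x‖ → φ (t, x) = 0 := fun hd => by
  obtain ⟨R, hR⟩ := h.supp hd
  exact ⟨R, fun x hx => hR t x hx⟩

theorem integral_test_fderiv {dom : Dom} {T : ℝ} {φ : ℝ × E → ℝ}
    (h : IsTest dom T (fun t x => φ (t, x))) (j : Fin 3) :
    ∫ z in Ioo 0 T ×ˢ dom.cell, fderiv ℝ φ z (0, unitVec j) = 0 := by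
  obtain ⟨R, hR⟩ := h.exists_radius
  have hφ := h.contDiff_one
  have hi : IntegrableOn (fun z => fderiv ℝ φ z (0, unitVec j)) (Ioo 0 T ×ˢ dom.cell) :=
    integrableOn_of_vanish ((hφ.continuous_fderiv one_ne_zero).clm_apply continuous_const)
      (R := R) fun z hz h2 => by simp [(hR z hz h2).2]
  rw [volume_restrict_prod, integral_prod]
  · refine integral_eq_zero_of_ae (Eventually.of_forall fun t => ?_)
    have h1 : ∀ x, fderiv ℝ φ (t, x) (0, unitVec j) = fderiv ℝ (fun x => φ (t, x)) x (unitVec j) :=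
      fun x => (fderiv_slice (hφ.differentiable one_ne_zero _) _).symm
    simp only [h1]
    exact integral_cell_fderiv (hφ.comp (contDiff_const.prodMk contDiff_id)) (h.per t)
      (h.slice_supp t) _
  · rw [← volume_restrict_prod]; exact hi

theorem integral_test_time {dom : Dom} {T : ℝ} (hT : 0 < T) {φ : ℝ × E → ℝ}
    (h : IsTest dom T (fun t x => φ (t, x))) :
    ∫ z in Ioo 0 T ×ˢ dom.cell, fderiv ℝ φ z (1, 0) = - ∫ x in dom.cell, φ (0, x) := by
  obtain ⟨R, hR⟩ := h.exists_radius
  have hφ := h.contDiff_one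
  have hc : Continuous (fun z => fderiv ℝ φ z (1, 0)) :=
    (hφ.continuous_fderiv one_ne_zero).clm_apply continuous_const
  have hi : IntegrableOn (fun z => fderiv ℝ φ z (1, 0)) (Ioo 0 T ×ˢ dom.cell) :=
    integrableOn_of_vanish hc (R := R) fun z hz h2 => by simp [(hR z hz h2).2]
  rw [volume_restrict_prod, integral_prod_symm]
  · rw [← integral_neg]
    refine integral_congr_ae (Eventually.of_forall fun x => ?_)
    change ∫ t in Ioo 0 T, fderiv ℝ φ (t, x) (1, 0) = - φ (0, x)
    rw [← integral_Ioc_eq_integral_Ioo, ← intervalIntegral.integral_of_le hT.le]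
    rw [intervalIntegral.integral_eq_sub_of_hasDerivAt (f := fun t => φ (t, x))]
    · simp [h.zero_off_time x]
    · intro t _
      exact (hφ.differentiable one_ne_zero (t, x)).hasFDerivAt.comp_hasDerivAt t
        ((hasDerivAt_id t).prodMk (hasDerivAt_const t x))
    · exact (hc.comp (by fun_prop)).intervalIntegrable _ _
  · rw [← volume_restrict_prod]; exact hi

namespace WeakEq

variable {dom : Dom} {T : ℝ}

/-- Constants are transported trivially. -/
theorem one (hT : 0 < T) : WeakEq dom T (fun _ => 1) (fun _ _ => 0) (fun _ => 0) (fun _ => 1) where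
  int_f0 := fun R => integrableOn_const (measure_local_lt_top dom T R).ne
  int_f := fun _ _ => integrableOn_zero
  int_g := fun _ => integrableOn_zero
  int_fi := fun R => integrableOn_const
    ((measure_mono inter_subset_right).trans_lt measure_closedBall_lt_top).ne
  eq := fun φ hφ => by simpa [wform] using integral_test_time hT hφ

/-- Constants have vanishing gradient. -/
theorem grad_one (i : Fin 3) : WeakEq dom T (fun _ => 0) (fun j _ => if j = i then 1 else 0)
    (fun _ => 0) (fun _ => 0) where
  int_f0 := fun _ => integrableOn_zero
  int_f := fun _ R => integrableOn_const (measure_local_lt_top dom T R).ne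
  int_g := fun _ => integrableOn_zero
  int_fi := fun _ => integrableOn_zero
  eq := fun φ hφ => by simpa [wform] using integral_test_fderiv hφ i

theorem wform_integrable {f0 : ℝ × E → ℝ} {f : Fin 3 → ℝ × E → ℝ} {g : ℝ × E → ℝ}
    (h0 : ∀ R, IntegrableOn f0 (Ioo 0 T ×ˢ (dom.cell ∩ Metric.closedBall 0 R)))
    (h1 : ∀ j R, IntegrableOn (f j) (Ioo 0 T ×ˢ (dom.cell ∩ Metric.closedBall 0 R)))
    (h2 : ∀ R, IntegrableOn g (Ioo 0 T ×ˢ (dom.cell ∩ Metric.closedBall 0 R))) {φ : ℝ × E → ℝ}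
    (hφ : IsTest dom T (fun t x => φ (t, x))) :
    IntegrableOn (wform f0 f g (fderiv ℝ φ) φ) (Ioo 0 T ×ˢ dom.cell) := by
  obtain ⟨R, hR⟩ := hφ.exists_radius
  have hc : ∀ e, Continuous (fun z => fderiv ℝ φ z e) := fun e =>
    (hφ.contDiff_one.continuous_fderiv one_ne_zero).clm_apply continuous_const
  have hv : ∀ e, ∀ z : ℝ × E, z.2 ∈ dom.cell → R < ‖z.2‖ → fderiv ℝ φ z e = 0 :=
    fun e z hz h2 => by simp [(hR z hz h2).2]
  refine ((integrableOn_mul_of_vanish h0 (hc _) (hv _)).add ?_).add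
    (integrableOn_mul_of_vanish h2 hφ.contDiff_one.continuous fun z hz h2 => (hR z hz h2).1)
  exact integrable_finsetSum _ fun j _ => integrableOn_mul_of_vanish (h1 j) (hc _) (hv _)

/-- Its use is to subtract the far-field constants by means of the trivial equations `one` and
`grad_one`. -/
theorem sub {f0 f0' : ℝ × E → ℝ} {f f' : Fin 3 → ℝ × E → ℝ} {g g' : ℝ × E → ℝ} {fi fi' : E → ℝ}
    (h : WeakEq dom T f0 f g fi) (h' : WeakEq dom T f0' f' g' fi') (c : ℝ) :
    WeakEq dom T (fun z => f0 z - c * f0' z) (fun j z => f j z - c * f' j z)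
      (fun z => g z - c * g' z) (fun x => fi x - c * fi' x) where
  int_f0 := fun R => (h.int_f0 R).sub ((h'.int_f0 R).const_mul c)
  int_f := fun j R => (h.int_f j R).sub ((h'.int_f j R).const_mul c)
  int_g := fun R => (h.int_g R).sub ((h'.int_g R).const_mul c)
  int_fi := fun R => (h.int_fi R).sub ((h'.int_fi R).const_mul c)
  eq := fun φ hφ => by
    have e1 : ∀ z, wform (fun z => f0 z - c * f0' z) (fun j z => f j z - c * f' j z)
        (fun z => g z - c * g' z) (fderiv ℝ φ) φ z =
        wform f0 f g (fderiv ℝ φ) φ z - c * wform f0' f' g' (fderiv ℝ φ) φ z := fun z => by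
      simp only [wform, Fin.sum_univ_three]; ring
    have i1 := wform_integrable h.int_f0 h.int_f h.int_g hφ
    have i2 := wform_integrable h'.int_f0 h'.int_f h'.int_g hφ
    obtain ⟨R, hR⟩ := hφ.exists_radius
    have hd : ∀ {k : E → ℝ}, (∀ R, IntegrableOn k (dom.cell ∩ Metric.closedBall 0 R)) →
        IntegrableOn (fun x => k x * φ (0, x)) dom.cell := by
      intro k hk
      have hc : Continuous fun x : E => φ (0, x) := hφ.contDiff_one.continuous.comp (by fun_prop)
      obtain ⟨M, hM⟩ := (isCompact_closedBall (0 : E) R).exists_bound_of_continuousOn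
        hc.continuousOn
      have h1 : IntegrableOn (fun x => k x * φ (0, x)) (dom.cell ∩ Metric.closedBall 0 R) := by
        refine Integrable.mul_bdd (c := M) (hk R) hc.aestronglyMeasurable ?_
        filter_upwards [ae_restrict_mem
          ((cell_measurableSet dom).inter measurableSet_closedBall)] with x hx
        exact hM x hx.2
      refine IntegrableOn.of_forall_sdiff_eq_zero h1 (cell_measurableSet dom) fun x hx => ?_
      rw [(hR (0, x) hx.1 ?_).1, mul_zero]
      by_contra hcon
      exact hx.2 ⟨hx.1, by simpa using hcon⟩
    simp only [e1]
    rw [integral_sub i1 (i2.const_mul c), integral_const_mul, h.eq φ hφ, h'.eq φ hφ]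
    have e2 : ∀ x, (fi x - c * fi' x) * φ (0, x) = fi x * φ (0, x) - c * (fi' x * φ (0, x)) :=
      fun x => by ring
    simp only [e2]
    rw [integral_sub (hd h.int_fi) ((hd h'.int_fi).const_mul c), integral_const_mul]
    ring

/-- A stationary equation that is known for test functions on `(0,T) × Ω`. -/
theorem of_interior {f : Fin 3 → ℝ × E → ℝ} {g : ℝ × E → ℝ}
    (h1 : ∀ j R, IntegrableOn (f j) (Ioo 0 T ×ˢ (dom.cell ∩ Metric.closedBall 0 R)))
    (h2 : ∀ R, IntegrableOn g (Ioo 0 T ×ˢ (dom.cell ∩ Metric.closedBall 0 R)))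
    (heq : ∀ φ : ℝ × E → ℝ, IsInteriorTest dom T (fun t x => φ (t, x)) →
      ∫ z in Ioo 0 T ×ˢ dom.cell, wform (fun _ => 0) f g (fderiv ℝ φ) φ z = 0) :
    WeakEq dom T (fun _ => 0) f g (fun _ => 0) where
  int_f0 := fun _ => integrableOn_zero
  int_f := h1
  int_g := h2
  int_fi := fun _ => integrableOn_zero
  eq := fun φ hφ => by
    simp only [zero_mul, integral_zero, neg_zero]
    -- A cut-off near the initial time: 0 for `t ≤ 1/n` and 1 for `t ≥ 2/n`, if `n > 0`. The
    -- equation contains no time derivative, so `ζ` simply factors out.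
    set ζ : ℕ → ℝ → ℝ := fun n t => Real.smoothTransition (n * t - 1)
    have hζ : ∀ n, ContDiff ℝ ∞ (ζ n) := fun n =>
      Real.smoothTransition.contDiff.comp ((contDiff_const.mul contDiff_id).sub contDiff_const)
    have hi := wform_integrable (dom := dom) (T := T) (f0 := fun _ => 0)
      (fun _ => integrableOn_zero) h1 h2 hφ
    have hfd : ∀ n (z : ℝ × E), HasFDerivAt (fun z : ℝ × E => ζ n z.1 * φ z)
        (ζ n z.1 • fderiv ℝ φ z + φ z • deriv (ζ n) z.1 • ContinuousLinearMap.fst ℝ ℝ E) z :=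
      fun n z => by
      have d1 : HasFDerivAt (fun z : ℝ × E => ζ n z.1)
          (deriv (ζ n) z.1 • ContinuousLinearMap.fst ℝ ℝ E) z :=
        (((hζ n).differentiable (by simp)) z.1).hasDerivAt.comp_hasFDerivAt z hasFDerivAt_fst
      exact d1.mul (hφ.contDiff_one.differentiable one_ne_zero z).hasFDerivAt
    have hn : ∀ n : ℕ, ∫ z in Ioo 0 T ×ˢ dom.cell,
        ζ n z.1 * wform (fun _ => 0) f g (fderiv ℝ φ) φ z = 0 := by
      intro n
      have := heq (fun z => ζ n z.1 * φ z)
        { smooth := ((hζ n).comp contDiff_fst).mul hφ.smooth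
          per := fun t => by
            cases dom
            · intro j x
              have : φ (t, x + unitVec j) = φ (t, x) := hφ.per t j x
              simp only [this]
            · trivial
          time := by
            obtain ⟨T', a, b⟩ := hφ.time
            exact ⟨T', a, fun t x ht => by simp [show φ (t, x) = 0 from b t x ht]⟩
          supp := fun hd => by
            obtain ⟨R, hR⟩ := hφ.supp hd
            exact ⟨R, fun t x hx => by simp [show φ (t, x) = 0 from hR t x hx]⟩
          init := by
            refine ⟨1 / ((n : ℝ) + 1), by positivity, fun t x ht => ?_⟩
            have : ζ n t = 0 := by
              apply Real.smoothTransition.zero_of_nonpos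
              rw [le_div_iff₀ (by positivity)] at ht
              by_cases h0 : 0 ≤ t
              · nlinarith
              · nlinarith [(n.cast_nonneg : (0 : ℝ) ≤ n)]
            simp [this] }
      refine Eq.trans (integral_congr_ae (Eventually.of_forall fun z => ?_)) this
      simp only [wform, (hfd n z).fderiv, Fin.sum_univ_three]
      simp
      ring
    have lim : Tendsto (fun n : ℕ => ∫ z in Ioo 0 T ×ˢ dom.cell,
        ζ n z.1 * wform (fun _ => 0) f g (fderiv ℝ φ) φ z) atTop
        (𝓝 (∫ z in Ioo 0 T ×ˢ dom.cell, wform (fun _ => 0) f g (fderiv ℝ φ) φ z)) := by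
      refine tendsto_integral_of_dominated_convergence
        (bound := fun z => |wform (fun _ => 0) f g (fderiv ℝ φ) φ z|) ?_ hi.abs ?_ ?_
      · exact fun n => ((hζ n).continuous.comp continuous_fst).aestronglyMeasurable.mul hi.1
      · refine fun n => Eventually.of_forall fun z => ?_
        rw [norm_mul, Real.norm_of_nonneg (Real.smoothTransition.nonneg _)]
        exact mul_le_of_le_one_left (abs_nonneg _) (Real.smoothTransition.le_one _)
      · filter_upwards [ae_restrict_mem (measurableSet_Ioo.prod (cell_measurableSet dom))]
          with z hz
        refine tendsto_const_nhds.congr' ?_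
        obtain ⟨N, hN⟩ := exists_nat_gt (2 / z.1)
        filter_upwards [eventually_ge_atTop N] with n hn
        have : ζ n z.1 = 1 := by
          apply Real.smoothTransition.one_of_one_le
          rw [div_lt_iff₀ hz.1.1] at hN
          have : (N : ℝ) ≤ n := by exact_mod_cast hn
          nlinarith [hz.1.1]
        rw [this, one_mul]
    simp only [hn] at lim
    exact tendsto_nhds_unique lim tendsto_const_nhds

end WeakEq

end
end KEntropy

namespace KEntropy
noncomputable section
open scoped ContDiff ENNReal

/-! ### Weak gradients of squares -/

/-- Mollification is symmetric with respect to the pairing on `ℝ × Ω`. -/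
theorem integral_mollify_swap {dom : Dom} {T : ℝ} {n : ℕ} {F k : ℝ × E → ℝ}
    (Fper : ∀ t, dom.Per fun x => F (t, x)) (kper : ∀ t, dom.Per fun x => k (t, x))
    (Floc : LocallyIntegrable F) (Ftime : ∀ z : ℝ × E, z.1 ∉ Ioo 0 T → F z = 0)
    (kc : Continuous k) (ktime : ∀ z : ℝ × E, z.1 ∉ Ioo 0 T → k z = 0)
    (ksupp : dom = .space → ∃ R : ℝ, ∀ z : ℝ × E, R ≤ ‖z.2‖ → k z = 0) :
    ∫ z in univ ×ˢ dom.cell, F z * mollify n k z = ∫ z in univ ×ˢ dom.cell, mollify n F z * k z := by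
  obtain ⟨R, hR2, hR⟩ : ∃ R : ℝ, 2 ≤ R ∧ (dom = .space → ∀ z : ℝ × E, R ≤ ‖z.2‖ → k z = 0) := by
    cases dom
    · exact ⟨2, le_rfl, nofun⟩
    · obtain ⟨R, hR⟩ := ksupp rfl
      exact ⟨max 2 R, le_max_left _ _, fun _ x hx => hR x ((le_max_right _ _).trans hx)⟩
  have hoff : ∀ x ∈ dom.cell, R < ‖x‖ → dom = .space := by
    intro x hx h2
    cases dom
    · have := cell_torus_subset hx
      rw [mem_closedBall_zero_iff] at this
      linarith
    · rfl
  set S : Set (ℝ × E) := univ ×ˢ dom.cell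
  have hS : MeasurableSet S := MeasurableSet.univ.prod (cell_measurableSet dom)
  set K : Set (ℝ × E) := Icc 0 T ×ˢ Metric.closedBall 0 (R + 1)
  have hKm : MeasurableSet K := measurableSet_Icc.prod measurableSet_closedBall
  have hK : IsCompact K := isCompact_Icc.prod (isCompact_closedBall _ _)
  -- `F` is only locally integrable. The part relevant for the kernel of radius at most 1 and the
  -- support of `k` lies in a compact set, and its restriction is integrable on the whole space, as
  -- Fubini's theorem requires.
  set Fb := K.indicator F
  have hFb : Integrable Fb := (integrable_indicator_iff hKm).2 (Floc.integrableOn_isCompact hK)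
  have hFbe : ∀ z : ℝ × E, ‖z.2‖ ≤ R + 1 → Fb z = F z := fun z hz => by
    by_cases hm : z ∈ K
    · exact indicator_of_mem hm _
    · rw [show Fb z = 0 from indicator_of_notMem hm _, Ftime z]
      exact fun h => hm ⟨Ioo_subset_Icc_self h, by simpa using hz⟩
  obtain ⟨M, hM⟩ := (isCompact_closedBall (0 : ℝ × E) (|T| + R + 3)).exists_bound_of_continuousOn
    kc.continuousOn
  have hkz : ∀ z : ℝ × E, ‖z.2‖ ≤ R + 2 → |k z| ≤ |M| := fun z hz => by
    by_cases ht : z.1 ∈ Ioo 0 T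
    · refine (hM z ?_).trans (le_abs_self _)
      rw [mem_closedBall_zero_iff, Prod.norm_def]
      refine max_le ?_ (by linarith [abs_nonneg T])
      rw [Real.norm_of_nonneg ht.1.le]
      linarith [ht.2, le_abs_self T]
    · simp [ktime z ht]
  have i1 : Integrable (fun p : (ℝ × E) × (ℝ × E) => F p.1 * (kern (ℝ × E) n p.2 * k (p.1 - p.2)))
      ((volume.restrict S).prod volume) := by
    have hb : Integrable (fun p : (ℝ × E) × (ℝ × E) => ‖Fb p.1‖ * (kern (ℝ × E) n p.2 * |M|))
        ((volume.restrict S).prod volume) :=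
      (hFb.restrict.norm).mul_prod ((kern_integrable n).mul_const |M|)
    refine hb.mono' ?_ ?_
    · refine Floc.aestronglyMeasurable.restrict.comp_fst.mul (Continuous.aestronglyMeasurable ?_)
      exact ((kern_continuous n).comp continuous_snd).mul
        (kc.comp (continuous_fst.sub continuous_snd))
    · have hae : ∀ᵐ p ∂((volume.restrict S).prod (volume : Measure (ℝ × E))), p.1 ∈ S :=
        Measure.quasiMeasurePreserving_fst.ae (ae_restrict_mem hS)
      filter_upwards [hae] with p hp
      rw [norm_mul, norm_mul, Real.norm_of_nonneg (kern_nonneg n p.2)]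
      by_cases hy : ‖p.2‖ < (bump (ℝ × E) n).rOut
      · have h1 := bump_rOut_le_one (X := ℝ × E) n
        have h2 := norm_snd_le p.2
        by_cases hpR : ‖p.1.2‖ ≤ R + 1
        · rw [hFbe _ hpR]
          refine mul_le_mul_of_nonneg_left (mul_le_mul_of_nonneg_left (hkz _ ?_)
            (kern_nonneg n p.2)) (norm_nonneg _)
          have := norm_sub_le p.1.2 p.2.2
          change ‖p.1.2 - p.2.2‖ ≤ _
          linarith
        · have hd := hoff _ hp.2 (by linarith)
          rw [hR hd (p.1 - p.2) ?_]
          · simp only [norm_zero, mul_zero]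
            exact mul_nonneg (norm_nonneg _) (mul_nonneg (kern_nonneg n p.2) (abs_nonneg _))
          · have := norm_sub_norm_le p.1.2 p.2.2
            change _ ≤ ‖p.1.2 - p.2.2‖
            linarith
      · simp [kern_eq_zero (not_lt.1 hy)]
  have i2 : Integrable (fun p : (ℝ × E) × (ℝ × E) => kern (ℝ × E) n p.2 * F (p.1 - p.2) * k p.1)
      ((volume.restrict S).prod volume) := by
    have h1 : Integrable (fun p : (ℝ × E) × (ℝ × E) => kern (ℝ × E) n p.2 * Fb (p.1 - p.2))
        (volume.prod volume) :=
      (kern_integrable n).convolution_integrand (ContinuousLinearMap.lsmul ℝ ℝ) hFb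
    have h2 : Integrable (fun p : (ℝ × E) × (ℝ × E) => kern (ℝ × E) n p.2 * Fb (p.1 - p.2))
        ((volume.restrict S).prod volume) := by
      have := Measure.prod_restrict (μ := (volume : Measure (ℝ × E)))
        (ν := (volume : Measure (ℝ × E))) S univ
      rw [Measure.restrict_univ] at this
      rw [this]
      exact h1.restrict
    have hae : ∀ᵐ p ∂((volume.restrict S).prod (volume : Measure (ℝ × E))), p.1 ∈ S :=
      Measure.quasiMeasurePreserving_fst.ae (ae_restrict_mem hS)
    have hbd : ∀ z ∈ S, |k z| ≤ |M| := by
      intro z hz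
      by_cases hzR : ‖z.2‖ ≤ R
      · exact hkz z (by linarith)
      · rw [hR (hoff _ hz.2 (not_le.1 hzR)) z (not_le.1 hzR).le]; simp
    have h3 : Integrable (fun p : (ℝ × E) × (ℝ × E) =>
        kern (ℝ × E) n p.2 * Fb (p.1 - p.2) * k p.1) ((volume.restrict S).prod volume) := by
      refine h2.mul_bdd (c := |M|) (kc.comp continuous_fst).aestronglyMeasurable ?_
      filter_upwards [hae] with p hp
      exact hbd _ hp
    refine h3.congr ?_
    filter_upwards [hae] with p hp
    by_cases hy : ‖p.2‖ < (bump (ℝ × E) n).rOut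
    · have h1 := bump_rOut_le_one (X := ℝ × E) n
      have h2 := norm_snd_le p.2
      by_cases hzR : ‖p.1.2‖ ≤ R
      · rw [hFbe]
        have := norm_sub_le p.1.2 p.2.2
        change ‖p.1.2 - p.2.2‖ ≤ _
        linarith
      · rw [hR (hoff _ hp.2 (not_le.1 hzR)) p.1 (not_le.1 hzR).le]; simp
    · simp [kern_eq_zero (not_lt.1 hy)]
  have e1 : ∫ z in S, F z * mollify n k z =
      ∫ y, kern (ℝ × E) n y * ∫ z in S, F (z + y) * k z := by
    have : ∀ z, F z * mollify n k z = ∫ y, F z * (kern (ℝ × E) n y * k (z - y)) := fun z => by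
      rw [integral_const_mul]; rfl
    simp only [this]
    rw [integral_integral_swap i1]
    congr 1; ext y
    have e2 := integral_strip_add (dom := dom) (f := fun z => F z * k (z - y)) (fun t => by
      cases dom
      · intro j x
        have h1 : F (t, x + unitVec j) = F (t, x) := Fper t j x
        have h2 : k (t - y.1, x - y.2 + unitVec j) = k (t - y.1, x - y.2) := kper _ j _
        have h3 : x + unitVec j - y.2 = x - y.2 + unitVec j := by abel
        change F _ * k (t - y.1, x + unitVec j - y.2) = F _ * k (t - y.1, x - y.2)
        rw [h1, h3, h2]
      · trivial) y
    simp only [add_sub_cancel_right] at e2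
    rw [e2, ← integral_const_mul]
    congr 1; ext z; ring
  have e3 : ∫ z in S, mollify n F z * k z =
      ∫ y, kern (ℝ × E) n y * ∫ z in S, F (z - y) * k z := by
    have : ∀ z, mollify n F z * k z = ∫ y, kern (ℝ × E) n y * F (z - y) * k z := fun z => by
      rw [integral_mul_const]; rfl
    simp only [this]
    rw [integral_integral_swap i2]
    congr 1; ext y
    rw [← integral_const_mul]
    congr 1; ext z; ring
  -- Both sides are now averages over shifts `y`, with opposite signs; the kernel is even.
  rw [e1, e3, ← integral_neg_eq_self]
  congr 1; ext y
  rw [kern_neg]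
  simp only [sub_eq_add_neg]

theorem setIntegral_strip_eq {dom : Dom} {T : ℝ} {h : ℝ × E → ℝ}
    (hh : ∀ z : ℝ × E, z.1 ∉ Ioo 0 T → h z = 0) :
    ∫ z in univ ×ˢ dom.cell, h z = ∫ z in Ioo 0 T ×ˢ dom.cell, h z := by
  exact setIntegral_eq_of_subset_of_forall_sdiff_eq_zero
    (MeasurableSet.univ.prod (cell_measurableSet dom)) (prod_mono_left (subset_univ _))
    fun z hz => hh z fun ht => hz.2 ⟨ht, hz.1.2⟩

theorem mollify_per {dom : Dom} {n : ℕ} {φ : ℝ × E → ℝ} (per : ∀ t, dom.Per fun x => φ (t, x))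
    (t : ℝ) : dom.Per fun x => mollify n φ (t, x) := by
  cases dom
  · intro j x
    have := mollify_add_period (n := n) (g := φ) (p := ((0 : ℝ), unitVec j))
      (fun z => by simpa [Prod.add_def] using per z.1 j z.2) (t, x)
    simpa [Prod.add_def] using this
  · trivial

/-- Mollification spreads the support by less than `δ`, so a margin of `2δ` at both ends of the time
interval leaves one of `δ`. -/
theorem IsInteriorTest.mollify {dom : Dom} {T : ℝ} {φ : ℝ × E → ℝ} {n : ℕ} {δ : ℝ}
    (h : IsInteriorTest dom T (fun t x => φ (t, x))) (hδ : (bump (ℝ × E) n).rOut < δ)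
    (hφ : ∀ z : ℝ × E, z.1 ∉ Ioo (2 * δ) (T - 2 * δ) → φ z = 0) :
    IsInteriorTest dom T (fun t x => KEntropy.mollify n φ (t, x)) := by
  have hδ0 : 0 < δ := (bump (ℝ × E) n).rOut_pos.trans hδ
  have habs : ∀ y : ℝ × E, ‖y‖ < (bump (ℝ × E) n).rOut → |y.1| < δ := fun y hy =>
    ((Real.norm_eq_abs _ ▸ norm_fst_le y : |y.1| ≤ ‖y‖).trans_lt hy).trans hδ
  exact
  { smooth := mollify_contDiff (h.contDiff_one.continuous.locallyIntegrable)
    per := mollify_per h.per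
    time := ⟨T - δ, by linarith, fun t x ht => mollify_eq_zero fun y hy => hφ _ fun hm => by
      have h1 := hm.2
      change t - y.1 < _ at h1
      linarith [habs y hy, le_abs_self y.1]⟩
    supp := fun hd => by
      obtain ⟨R, hR⟩ := h.supp hd
      refine ⟨R + 1, fun t x hx => mollify_eq_zero fun y hy => hR _ _ ?_⟩
      have h1 := bump_rOut_le_one (X := ℝ × E) n
      have h2 := norm_snd_le y
      have h3 := norm_sub_norm_le x y.2
      linarith
    init := ⟨δ, hδ0, fun t x ht => mollify_eq_zero fun y hy => hφ _ fun hm => by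
      have h1 := hm.1
      change _ < t - y.1 at h1
      linarith [habs y hy, neg_abs_le y.1]⟩ }

theorem fderiv_mollify_apply {n : ℕ} {φ : ℝ × E → ℝ} (hφ : ContDiff ℝ 1 φ) (e z : ℝ × E) :
    fderiv ℝ (mollify n φ) z e = mollify n (fun z => fderiv ℝ φ z e) z := by
  rw [(mollify_hasFDerivAt hφ z).fderiv]
  simp only [mollify]
  rw [ContinuousLinearMap.integral_apply]
  · rfl
  · refine Continuous.integrable_of_hasCompactSupport ?_ ?_
    · exact (kern_continuous n).smul
        ((hφ.continuous_fderiv one_ne_zero).comp (continuous_const.sub continuous_id))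
    · have hk : HasCompactSupport (kern (ℝ × E) n) :=
        (bump (ℝ × E) n).hasCompactSupport_normed
      exact hk.smul_right (f' := fun y => fderiv ℝ φ (z - y))

theorem memLp_ball {dom : Dom} {T : ℝ} {f : ℝ × E → ℝ} (fper : ∀ t, dom.Per fun x => f (t, x))
    (fm : AEStronglyMeasurable f (volume.restrict (Ioo 0 T ×ˢ univ)))
    (fi : ∀ R, IntegrableOn (fun z => f z ^ 2) (Ioo 0 T ×ˢ (dom.cell ∩ Metric.closedBall 0 R)))
    (R : ℝ) : MemLp ((Ioo 0 T ×ˢ Metric.closedBall (0 : E) R).indicator f) 2 volume := by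
  have hS : MeasurableSet (Ioo 0 T ×ˢ Metric.closedBall (0 : E) R) :=
    measurableSet_Ioo.prod measurableSet_closedBall
  rw [memLp_indicator_iff_restrict hS, memLp_two_iff_integrable_sq]
  · refine integrableOn_strip_ball (dom := dom) (fun t => ?_) fi R
    cases dom
    · intro j x
      have : f (t, x + unitVec j) = f (t, x) := fper t j x
      simp only [this]
    · trivial
  · exact fm.mono_set (prod_mono_right (subset_univ _))

/-- The weak gradient of `f²` is `2 f ∇f`. -/
theorem weakGrad_sq {dom : Dom} {T : ℝ} {f G : ℝ × E → ℝ} {j : Fin 3}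
    (fper : ∀ t, dom.Per fun x => f (t, x)) (Gper : ∀ t, dom.Per fun x => G (t, x))
    (fm : AEStronglyMeasurable f (volume.restrict (Ioo 0 T ×ˢ univ)))
    (Gm : AEStronglyMeasurable G (volume.restrict (Ioo 0 T ×ˢ univ)))
    (fi : ∀ R, IntegrableOn (fun z => f z ^ 2) (Ioo 0 T ×ˢ (dom.cell ∩ Metric.closedBall 0 R)))
    (Gi : ∀ R, IntegrableOn (fun z => G z ^ 2) (Ioo 0 T ×ˢ (dom.cell ∩ Metric.closedBall 0 R)))
    (h : ∀ φ : ℝ × E → ℝ, IsInteriorTest dom T (fun t x => φ (t, x)) →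
      ∫ z in Ioo 0 T ×ˢ dom.cell, f z * fderiv ℝ φ z (0, unitVec j)
        = - ∫ z in Ioo 0 T ×ˢ dom.cell, G z * φ z)
    {φ : ℝ × E → ℝ} (hφ : IsInteriorTest dom T (fun t x => φ (t, x))) :
    ∫ z in Ioo 0 T ×ˢ dom.cell, f z * (f z * fderiv ℝ φ z (0, unitVec j))
      = - (2 * ∫ z in Ioo 0 T ×ˢ dom.cell, f z * (G z * φ z)) := by
  set e : ℝ × E := (0, unitVec j)
  set Q : Set (ℝ × E) := Ioo 0 T ×ˢ dom.cell
  have hQ : MeasurableSet Q := measurableSet_Ioo.prod (cell_measurableSet dom)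
  set S : Set (ℝ × E) := Ioo 0 T ×ˢ univ
  -- extension by zero in time
  have ext_per : ∀ {k : ℝ × E → ℝ}, (∀ t, dom.Per fun x => k (t, x)) →
      ∀ t, dom.Per fun x => S.indicator k (t, x) := by
    intro k hk t
    cases dom
    · intro i x
      by_cases ht : t ∈ Ioo 0 T
      · have : k (t, x + unitVec i) = k (t, x) := hk t i x
        simp [S, indicator, this]
      · simp [S, indicator, ht]
    · trivial
  have ext_loc : ∀ {k : ℝ × E → ℝ},
      (∀ R, MemLp ((Ioo 0 T ×ˢ Metric.closedBall (0 : E) R).indicator k) 2 volume) →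
      LocallyIntegrable (S.indicator k) := by
    intro k hk
    rw [locallyIntegrable_iff]
    intro K hK
    obtain ⟨R, hR⟩ := hK.isBounded.subset_closedBall 0
    have h1 : IntegrableOn ((Ioo 0 T ×ˢ Metric.closedBall (0 : E) R).indicator k) K :=
      ((hk R).locallyIntegrable (by norm_num)).integrableOn_isCompact hK
    refine h1.congr_fun (fun z hz => ?_) hK.measurableSet
    have h2 : ‖z.2‖ ≤ R := (norm_snd_le z).trans (by simpa using hR hz)
    by_cases ht : z.1 ∈ Ioo 0 T
    · rw [indicator_of_mem (show z ∈ S from ⟨ht, mem_univ _⟩),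
        indicator_of_mem (show z ∈ Ioo 0 T ×ˢ Metric.closedBall (0 : E) R from
          ⟨ht, by simpa using h2⟩)]
    · rw [indicator_of_notMem (show z ∉ S from fun hc => ht hc.1),
        indicator_of_notMem (show z ∉ Ioo 0 T ×ˢ Metric.closedBall (0 : E) R from
          fun hc => ht hc.1)]
  have ext_off : ∀ (k : ℝ × E → ℝ) (z : ℝ × E), z.1 ∉ Ioo 0 T → S.indicator k z = 0 :=
    fun k z hz => indicator_of_notMem (fun hc => hz hc.1) _
  have ext_on : ∀ (k : ℝ × E → ℝ) (z : ℝ × E), z.1 ∈ Ioo 0 T → S.indicator k z = k z :=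
    fun k z hz => indicator_of_mem (show z ∈ S from ⟨hz, mem_univ _⟩) _
  have f2 := memLp_ball fper fm fi
  have G2 := memLp_ball Gper Gm Gi
  set F := S.indicator f
  set GG := S.indicator G
  have hF := ext_loc f2
  have hGG := ext_loc G2
  obtain ⟨T₁, hT₁, hφT⟩ := hφ.time
  obtain ⟨δ₀, hδ₀, hφδ⟩ := hφ.init
  -- Half of the smaller gap between the support of `φ` and the ends of the time interval.
  set δ := min δ₀ (T - T₁) / 2
  have hδ : 0 < δ := half_pos (lt_min hδ₀ (sub_pos.2 hT₁))
  have hφtime : ∀ z : ℝ × E, z.1 ∉ Ioo (2 * δ) (T - 2 * δ) → φ z = 0 := by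
    intro z hz
    have e2 : 2 * δ = min δ₀ (T - T₁) := by simp only [δ]; ring
    rw [e2, mem_Ioo, not_and_or, not_lt, not_lt] at hz
    rcases hz with hz | hz
    · exact hφδ z.1 z.2 (hz.trans (min_le_left _ _))
    · exact hφT z.1 z.2 (by linarith [min_le_right δ₀ (T - T₁)])
  have hsub : ∀ z : ℝ × E, z.1 ∉ Ioo 0 T → z.1 ∉ Ioo (2 * δ) (T - 2 * δ) := fun z hz hc =>
    hz ⟨by linarith [hc.1], by linarith [hc.2]⟩
  -- the mollified equation
  have stepA : ∀ n, (bump (ℝ × E) n).rOut < δ → ∀ Ψ : ℝ × E → ℝ,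
      IsInteriorTest dom T (fun t x => Ψ (t, x)) →
      (∀ z : ℝ × E, z.1 ∉ Ioo (2 * δ) (T - 2 * δ) → Ψ z = 0) →
      ∫ z in Q, mollify n F z * fderiv ℝ Ψ z e = - ∫ z in Q, mollify n GG z * Ψ z := by
    intro n hn Ψ hΨ hΨt
    have h1 := h _ (hΨ.mollify hn hΨt)
    have hΨ1 := hΨ.contDiff_one
    have hΨt' : ∀ z : ℝ × E, z.1 ∉ Ioo 0 T → fderiv ℝ Ψ z e = 0 := by
      intro z hz
      have : Ψ =ᶠ[𝓝 z] fun _ => 0 := by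
        rw [mem_Ioo, not_and_or, not_lt, not_lt] at hz
        rcases hz with hz | hz
        · have hz' : z.1 < 2 * δ := by linarith
          filter_upwards [(isOpen_lt continuous_fst continuous_const).mem_nhds hz'] with y hy
          exact hΨt y fun hc => absurd hc.1 (not_lt.2 (le_of_lt hy))
        · have hz' : T - 2 * δ < z.1 := by linarith
          filter_upwards [(isOpen_lt continuous_const continuous_fst).mem_nhds hz'] with y hy
          exact hΨt y fun hc => absurd hc.2 (not_lt.2 (le_of_lt hy))
      rw [this.fderiv_eq]; simp
    have swap : ∀ {k k' : ℝ × E → ℝ}, (∀ t, dom.Per fun x => k (t, x)) →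
        LocallyIntegrable (S.indicator k) → Continuous k' → (∀ t, dom.Per fun x => k' (t, x)) →
        (∀ z : ℝ × E, z.1 ∉ Ioo 0 T → k' z = 0) →
        (dom = .space → ∃ R : ℝ, ∀ z : ℝ × E, R ≤ ‖z.2‖ → k' z = 0) →
        ∫ z in Q, k z * mollify n k' z = ∫ z in Q, mollify n (S.indicator k) z * k' z := by
      intro k k' kp kl kc' kp' kt' ks'
      have h2 := integral_mollify_swap (n := n) (ext_per kp) kp' kl (ext_off k) kc' kt' ks'
      rw [setIntegral_strip_eq (T := T) (fun z hz => by simp [ext_off k z hz]),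
        setIntegral_strip_eq (T := T) (fun z hz => by simp [kt' z hz])] at h2
      rw [← h2]
      refine setIntegral_congr_fun hQ fun z hz => ?_
      simp only [ext_on k z hz.1]
    have hΨsupp : dom = .space → ∃ R : ℝ, ∀ z : ℝ × E, R ≤ ‖z.2‖ → Ψ z = 0 := fun hd => by
      obtain ⟨R, hR⟩ := hΨ.supp hd
      exact ⟨R, fun z hz => hR z.1 z.2 hz⟩
    rw [swap Gper hGG hΨ1.continuous hΨ.per (fun z hz => hΨt z (hsub z hz)) hΨsupp] at h1
    rw [← h1]
    simp only [fderiv_mollify_apply hΨ1]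
    refine (swap fper hF ((hΨ1.continuous_fderiv one_ne_zero).clm_apply continuous_const) ?_
      hΨt' ?_).symm
    · intro t
      cases dom
      · intro i x
        have hp : (fun z : ℝ × E => Ψ (z + (0, unitVec i))) = Ψ := by
          ext z
          have := hΨ.per z.1 i z.2
          simpa [Prod.add_def] using this
        have h3 : fderiv ℝ (fun z : ℝ × E => Ψ (z + (0, unitVec i))) (t, x) =
            fderiv ℝ Ψ ((t, x) + (0, unitVec i)) := fderiv_comp_add_right _
        rw [hp] at h3
        change fderiv ℝ Ψ (t, x + unitVec i) e = fderiv ℝ Ψ (t, x) e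
        rw [h3]; simp
      · trivial
    · intro hd
      obtain ⟨R, hR⟩ := hΨ.supp hd
      refine ⟨R + 1, fun z hz => ?_⟩
      have hz' : R < ‖z.2‖ := by linarith
      have : Ψ =ᶠ[𝓝 z] fun _ => 0 := by
        filter_upwards [(isOpen_lt continuous_const continuous_snd.norm).mem_nhds hz'] with y hy
        exact hR y.1 y.2 (le_of_lt hy)
      rw [this.fderiv_eq]; simp
  have hφ1 := hφ.contDiff_one
  obtain ⟨R, hR⟩ := hφ.exists_radius
  have stepB : ∀ n, (bump (ℝ × E) n).rOut < δ →
      ∫ z in Q, mollify n F z * (mollify n F z * fderiv ℝ φ z e)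
        = - (2 * ∫ z in Q, mollify n F z * (mollify n GG z * φ z)) := by
    intro n hn
    have hs : ContDiff ℝ ∞ (mollify n F) := mollify_contDiff hF
    have hs1 : ContDiff ℝ 1 (mollify n F) := hs.of_le (by exact_mod_cast le_top)
    have hsG : Continuous (mollify n GG) := (mollify_contDiff hGG (n := n)).continuous
    have hsp := mollify_per (n := n) (ext_per fper)
    have mulTest : ∀ k : ℝ × E → ℝ, ContDiff ℝ ∞ k → (∀ t, dom.Per fun x => k (t, x)) →
        IsInteriorTest dom T (fun t x => k (t, x) * φ (t, x)) := fun k hk kp =>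
      { smooth := hk.mul hφ.smooth
        per := fun t => by
          cases dom
          · intro i x
            have a1 : φ (t, x + unitVec i) = φ (t, x) := hφ.per t i x
            have a2 : k (t, x + unitVec i) = k (t, x) := kp t i x
            simp only [a1, a2]
          · trivial
        time := ⟨T₁, hT₁, fun t x ht => by simp [show φ (t, x) = 0 from hφT t x ht]⟩
        supp := fun hd => by
          obtain ⟨R, hR⟩ := hφ.supp hd
          exact ⟨R, fun t x hx => by simp [show φ (t, x) = 0 from hR t x hx]⟩
        init := ⟨δ₀, hδ₀, fun t x ht => by simp [show φ (t, x) = 0 from hφδ t x ht]⟩ }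
    have t1 := mulTest _ hs hsp
    have t2 := mulTest (fun z => mollify n F z * mollify n F z) (hs.mul hs) (fun t => by
      cases dom
      · intro i x
        have a2 : mollify n F (t, x + unitVec i) = mollify n F (t, x) := hsp t i x
        simp only [a2]
      · trivial)
    -- With `F`, `G` replaced by their smooth mollifications, the equation is tested with `F φ`. The
    -- integral of `∂ⱼ(F² φ)` vanishes, and the two identities eliminate `∫ F φ ∂ⱼF`.
    have A := stepA n hn (fun z => mollify n F z * φ z) t1
      (fun z hz => by simp [hφtime z hz])
    have B := integral_test_fderiv (φ := fun z => mollify n F z * mollify n F z * φ z)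
      t2.toIsTest j
    have d1 : ∀ z, HasFDerivAt (mollify n F) (fderiv ℝ (mollify n F) z) z := fun z =>
      (hs1.differentiable one_ne_zero z).hasFDerivAt
    have d2 : ∀ z, HasFDerivAt φ (fderiv ℝ φ z) z := fun z =>
      (hφ1.differentiable one_ne_zero z).hasFDerivAt
    have e1 : ∀ z, fderiv ℝ (fun z => mollify n F z * φ z) z e =
        mollify n F z * fderiv ℝ φ z e + φ z * fderiv ℝ (mollify n F) z e := fun z => by
      rw [((d1 z).fun_mul (d2 z)).fderiv]; simp
    have e2 : ∀ z, fderiv ℝ (fun z => mollify n F z * mollify n F z * φ z) z e =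
        mollify n F z * (mollify n F z * fderiv ℝ φ z e)
          + 2 * (mollify n F z * (φ z * fderiv ℝ (mollify n F) z e)) := fun z => by
      rw [(((d1 z).fun_mul (d1 z)).fun_mul (d2 z)).fderiv]; simp; ring
    have c1 : Continuous fun z => fderiv ℝ φ z e :=
      (hφ1.continuous_fderiv one_ne_zero).clm_apply continuous_const
    have c2 : Continuous fun z => fderiv ℝ (mollify n F) z e :=
      (hs1.continuous_fderiv one_ne_zero).clm_apply continuous_const
    have i1 : IntegrableOn (fun z => mollify n F z * (mollify n F z * fderiv ℝ φ z e)) Q :=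
      integrableOn_of_vanish (hs.continuous.mul (hs.continuous.mul c1)) (R := R)
        fun z hz h2 => by simp [(hR z hz h2).2]
    have i2 : IntegrableOn (fun z => mollify n F z * (φ z * fderiv ℝ (mollify n F) z e)) Q :=
      integrableOn_of_vanish (hs.continuous.mul (hφ1.continuous.mul c2)) (R := R)
        fun z hz h2 => by simp [(hR z hz h2).1]
    simp only [e1, mul_add] at A
    change ∫ z in Q, fderiv ℝ (fun z => mollify n F z * mollify n F z * φ z) z e = 0 at B
    simp only [e2] at B
    rw [integral_add i1 i2] at A
    rw [integral_add i1 (i2.const_mul 2), integral_const_mul] at B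
    have e3 : ∫ z in Q, mollify n GG z * (mollify n F z * φ z) =
        ∫ z in Q, mollify n F z * (mollify n GG z * φ z) := by
      congr 1; ext z; ring
    rw [e3] at A
    linarith
  -- passage to the limit
  set HF := (Ioo 0 T ×ˢ Metric.closedBall (0 : E) (R + 1)).indicator f
  set HG := (Ioo 0 T ×ˢ Metric.closedBall (0 : E) (R + 1)).indicator G
  have lF := mollify_tendsto_eLpNorm (f2 (R + 1))
  have lG := mollify_tendsto_eLpNorm (G2 (R + 1))
  -- On the support of `φ` the mollification sees only the ball of radius `R + 1`. There the
  -- functions are square integrable, so convergence in `L²` of the whole space applies to the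
  -- truncated ones.
  have hloc : ∀ (k : ℝ × E → ℝ) n (z : ℝ × E), ‖z.2‖ ≤ R → mollify n (S.indicator k) z =
      mollify n ((Ioo 0 T ×ˢ Metric.closedBall (0 : E) (R + 1)).indicator k) z := by
    intro k n z hz
    refine mollify_congr fun y hy => ?_
    have h1 := bump_rOut_le_one (X := ℝ × E) n
    have h2 := norm_snd_le y
    have h3 : ‖(z - y).2‖ ≤ R + 1 := (norm_sub_le z.2 y.2).trans (by linarith)
    by_cases ht : (z - y).1 ∈ Ioo 0 T
    · rw [ext_on k _ ht, indicator_of_mem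
        (show z - y ∈ Ioo 0 T ×ˢ Metric.closedBall (0 : E) (R + 1) from ⟨ht, by simpa using h3⟩)]
    · rw [ext_off k _ ht, indicator_of_notMem
        (show z - y ∉ Ioo 0 T ×ˢ Metric.closedBall (0 : E) (R + 1) from fun hc => ht hc.1)]
  have hon : ∀ (k : ℝ × E → ℝ), ∀ z ∈ Q, ‖z.2‖ ≤ R →
      (Ioo 0 T ×ˢ Metric.closedBall (0 : E) (R + 1)).indicator k z = k z := fun k z hz hzR =>
    indicator_of_mem (show z ∈ Ioo 0 T ×ˢ Metric.closedBall (0 : E) (R + 1) from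
      ⟨hz.1, by simp only [mem_closedBall_zero_iff]; linarith⟩) _
  obtain ⟨N, hN⟩ := eventually_atTop.1 ((((bump_rOut_tendsto (X := ℝ × E)).eventually_lt_const hδ).and
    ((lF.eventually_lt_const ENNReal.zero_lt_top))).and
    (lG.eventually_lt_const ENNReal.zero_lt_top))
  have mem : ∀ {H : ℝ × E → ℝ}, MemLp H 2 volume → ∀ n,
      eLpNorm (fun z => mollify n H z - H z) 2 volume < ⊤ → MemLp (mollify n H) 2 volume := by
    intro H hH n hn
    have hm : AEStronglyMeasurable (mollify n H) :=
      (mollify_contDiff (hH.locallyIntegrable (by norm_num))).continuous.aestronglyMeasurable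
    have : MemLp (fun z => (mollify n H z - H z) + H z) 2 volume :=
      MemLp.add ⟨hm.sub hH.1, hn⟩ hH
    simpa using this
  have lim : ∀ {k H : ℝ × E → ℝ}, Continuous k →
      (∀ z : ℝ × E, z.2 ∈ dom.cell → R < ‖z.2‖ → k z = 0) → MemLp H 2 volume →
      Tendsto (fun n => eLpNorm (fun z => mollify n H z - H z) 2 volume) atTop (𝓝 0) →
      (∀ n, N ≤ n → eLpNorm (fun z => mollify n H z - H z) 2 volume < ⊤) →
      Tendsto (fun n => ∫ z in Q, mollify (n + N) HF z * (mollify (n + N) H z * k z)) atTop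
        (𝓝 (∫ z in Q, HF z * (H z * k z))) := by
    intro k H kc kv hH lH hHn
    obtain ⟨M, hM⟩ : ∃ M, ∀ z ∈ Q, |k z| ≤ M := by
      obtain ⟨M, hM⟩ := (isCompact_Icc.prod (isCompact_closedBall (0 : E) R) :
        IsCompact (Icc 0 T ×ˢ Metric.closedBall (0 : E) R)).exists_bound_of_continuousOn
          kc.continuousOn
      refine ⟨|M|, fun z hz => ?_⟩
      by_cases hzR : ‖z.2‖ ≤ R
      · exact (hM z ⟨Ioo_subset_Icc_self hz.1, by simpa using hzR⟩).trans (le_abs_self _)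
      · simp [kv z hz.2 (not_le.1 hzR)]
    have hMae : ∀ᵐ z ∂(volume.restrict Q), ‖k z‖ ≤ M := by
      filter_upwards [ae_restrict_mem hQ] with z hz
      exact hM z hz
    have mulk : ∀ {u : ℝ × E → ℝ}, MemLp u 2 volume →
        MemLp (fun z => u z * k z) 2 (volume.restrict Q) := by
      intro u hu
      refine MemLp.of_le_mul (hu.restrict Q) (hu.1.restrict.mul kc.aestronglyMeasurable) (c := M) ?_
      filter_upwards [hMae] with z hz
      rw [norm_mul, mul_comm]
      exact mul_le_mul_of_nonneg_right hz (norm_nonneg _)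
    refine tendsto_integral_mul_of_L2 ((f2 (R + 1)).restrict Q) (mulk hH)
      (fun n => (mem (f2 (R + 1)) (n + N) (hN _ (Nat.le_add_left _ _)).1.2).restrict Q)
      (fun n => mulk (mem hH (n + N) (hHn _ (Nat.le_add_left _ _)))) ?_ ?_
    · refine tendsto_of_tendsto_of_tendsto_of_le_of_le tendsto_const_nhds
        (lF.comp (tendsto_add_atTop_nat N)) (fun _ => bot_le) fun n => ?_
      exact eLpNorm_mono_measure _ Measure.restrict_le_self
    · have l2 : Tendsto (fun n => ENNReal.ofReal M *
          eLpNorm (fun z => mollify (n + N) H z - H z) 2 volume) atTop (𝓝 0) := by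
        have := ENNReal.Tendsto.const_mul (a := ENNReal.ofReal M)
          (lH.comp (tendsto_add_atTop_nat N)) (Or.inr ENNReal.ofReal_ne_top)
        simpa using this
      refine tendsto_of_tendsto_of_tendsto_of_le_of_le tendsto_const_nhds l2
        (fun _ => bot_le) fun n => ?_
      refine (eLpNorm_le_mul_eLpNorm_of_ae_le_mul
        (g := fun z => mollify (n + N) H z - H z) (c := M) ?_ 2).trans
        (mul_le_mul_right (eLpNorm_mono_measure _ Measure.restrict_le_self) _)
      filter_upwards [hMae] with z hz
      rw [← sub_mul, norm_mul, mul_comm]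
      exact mul_le_mul_of_nonneg_right hz (norm_nonneg _)
  have c1 : Continuous fun z => fderiv ℝ φ z e :=
    (hφ1.continuous_fderiv one_ne_zero).clm_apply continuous_const
  have L1 := lim c1 (fun z hz h2 => by simp [(hR z hz h2).2]) (f2 (R + 1)) lF
    (fun n hn => (hN n hn).1.2)
  have L2 := lim hφ1.continuous (fun z hz h2 => (hR z hz h2).1) (G2 (R + 1)) lG
    (fun n hn => (hN n hn).2)
  have key : ∀ n, ∫ z in Q, mollify (n + N) HF z * (mollify (n + N) HF z * fderiv ℝ φ z e)
      = - (2 * ∫ z in Q, mollify (n + N) HF z * (mollify (n + N) HG z * φ z)) := by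
    intro n
    have := stepB (n + N) (hN _ (Nat.le_add_left _ _)).1.1
    rw [setIntegral_congr_fun (g := fun z =>
      mollify (n + N) HF z * (mollify (n + N) HF z * fderiv ℝ φ z e)) hQ (fun z hz => ?_)] at this
    · rw [this, setIntegral_congr_fun (g := fun z =>
        mollify (n + N) HF z * (mollify (n + N) HG z * φ z)) hQ (fun z hz => ?_)]
      by_cases hzR : ‖z.2‖ ≤ R
      · simp only [F, GG, HF, HG, hloc _ _ z hzR]
      · simp [(hR z hz.2 (not_le.1 hzR)).1]
    · by_cases hzR : ‖z.2‖ ≤ R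
      · simp only [F, HF, hloc _ _ z hzR]
      · simp [(hR z hz.2 (not_le.1 hzR)).2]
  have L3 := tendsto_nhds_unique (L1.congr key) ((L2.const_mul 2).neg)
  have r1 : ∫ z in Q, f z * (f z * fderiv ℝ φ z e) =
      ∫ z in Q, HF z * (HF z * fderiv ℝ φ z e) := by
    refine setIntegral_congr_fun hQ fun z hz => ?_
    by_cases hzR : ‖z.2‖ ≤ R
    · simp only [HF, hon _ z hz hzR]
    · simp [(hR z hz.2 (not_le.1 hzR)).2]
  have r2 : ∫ z in Q, f z * (G z * φ z) = ∫ z in Q, HF z * (HG z * φ z) := by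
    refine setIntegral_congr_fun hQ fun z hz => ?_
    by_cases hzR : ‖z.2‖ ≤ R
    · simp only [HF, HG, hon _ z hz hzR]
    · simp [(hR z hz.2 (not_le.1 hzR)).1]
  rw [r1, r2, L3]

end
end KEntropy

namespace KEntropy
noncomputable section
open scoped ContDiff ENNReal

/-! ### Elementary inequalities for the pressure law -/

/-- Quantitative convexity of `x ↦ x ^ g`. -/
theorem rpow_sub_tangent_ge {g x : ℝ} (hg : 1 < g) (hx : 0 ≤ x) :
    min 1 (g - 1) * (x ^ (g / 2) - 1) ^ 2 ≤ x ^ g - 1 - g * (x - 1) := by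
  set w := x ^ (g / 2)
  have hw : 0 ≤ w := Real.rpow_nonneg hx _
  have hg0 : 0 < g := by linarith
  have hw2 : x ^ g = w ^ 2 := by
    simp only [w]
    rw [← Real.rpow_natCast, ← Real.rpow_mul hx]
    congr 1; push_cast; ring
  have hwx : w ^ (2 / g) = x := by
    simp only [w]
    rw [← Real.rpow_mul hx, show g / 2 * (2 / g) = 1 by field_simp, Real.rpow_one]
  -- In terms of `w = x^(g/2)` the claim is an upper bound for `x = w^(2/g)`. Bernoulli's inequality
  -- for exponents in `[0,1]` gives it: with exponent `2/g - 1` if `g ≤ 2`, where the constant is `g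
  -- - 1`, and with `2/g` if `g ≥ 2`, where it is 1.
  rcases le_total g 2 with h | h
  · have h1 : w ^ (2 / g - 1) ≤ 1 + (2 / g - 1) * (w - 1) := by
      have := rpow_one_add_le_one_add_mul_self (s := w - 1) (p := 2 / g - 1) (by linarith)
        (by rw [sub_nonneg, le_div_iff₀ hg0]; linarith)
        (by rw [sub_le_iff_le_add, div_le_iff₀ hg0]; linarith)
      simpa using this
    have h2 : x ≤ w * (1 + (2 / g - 1) * (w - 1)) := by
      rcases hw.eq_or_lt with h0 | h0
      · rw [← hwx, ← h0, Real.zero_rpow (by positivity)]; simp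
      · calc x = w * w ^ (2 / g - 1) := by
              rw [← hwx, Real.rpow_sub_one h0.ne', hwx]; field_simp
          _ ≤ _ := mul_le_mul_of_nonneg_left h1 hw
    have h3 : g * x ≤ w * (g + (2 - g) * (w - 1)) := by
      have := mul_le_mul_of_nonneg_left h2 hg0.le
      calc g * x ≤ g * (w * (1 + (2 / g - 1) * (w - 1))) := this
        _ = _ := by field_simp
    rw [min_eq_right (by linarith), hw2]
    nlinarith
  · have h1 : w ^ (2 / g) ≤ 1 + (2 / g) * (w - 1) := by
      have := rpow_one_add_le_one_add_mul_self (s := w - 1) (p := 2 / g) (by linarith)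
        (by positivity) (by rw [div_le_iff₀ hg0]; linarith)
      simpa using this
    rw [hwx] at h1
    have h3 : g * x ≤ g + 2 * (w - 1) := by
      have := mul_le_mul_of_nonneg_left h1 hg0.le
      calc g * x ≤ g * (1 + (2 / g) * (w - 1)) := this
        _ = _ := by field_simp
    rw [min_eq_left (by linarith), hw2]
    nlinarith

theorem abs_sub_one_le_abs_rpow_sub_one {g x : ℝ} (hg : 1 < g) (hx : 0 ≤ x) :
    |x - 1| ≤ |x ^ g - 1| := by
  rcases le_total x 1 with h | h
  · have h1 : x ^ g ≤ x := by
      rcases hx.eq_or_lt with h0 | h0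
      · rw [← h0, Real.zero_rpow (by linarith)]
      · calc x ^ g ≤ x ^ (1 : ℝ) := Real.rpow_le_rpow_of_exponent_ge h0 h hg.le
          _ = x := Real.rpow_one x
    rw [abs_of_nonpos (by linarith), abs_of_nonpos (by linarith)]
    linarith
  · have h1 : x ≤ x ^ g := by
      calc x = x ^ (1 : ℝ) := (Real.rpow_one x).symm
        _ ≤ x ^ g := Real.rpow_le_rpow_of_exponent_le h hg.le
    rw [abs_of_nonneg (by linarith), abs_of_nonneg (by linarith)]
    linarith

namespace Params

variable (c : Params)

/-- The coercivity constant of `relP`. -/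
def coer : ℝ := c.a / (c.γ - 1) * min 1 (c.γ - 1)

theorem γ_pos : 0 < c.γ := zero_lt_one.trans c.one_lt_γ

theorem γ_sub_pos : 0 < c.γ - 1 := sub_pos.2 c.one_lt_γ

theorem coer_pos : 0 < c.coer :=
  mul_pos (div_pos c.a_pos c.γ_sub_pos) (lt_min one_pos c.γ_sub_pos)

/-- Homogeneity: apply the inequality for `x = s / r` and multiply by `r ^ γ`. Applied with `r =
ρbar`, it turns finite relative energy into square integrability of `Params.eta`. -/
theorem relP_ge {s r : ℝ} (hs : 0 ≤ s) (hr : 0 < r) :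
    c.coer * (s ^ (c.γ / 2) - r ^ (c.γ / 2)) ^ 2 ≤ c.relP s r := by
  have h := rpow_sub_tangent_ge c.one_lt_γ (div_nonneg hs hr.le)
  have hr2 : r ^ c.γ = (r ^ (c.γ / 2)) ^ 2 := by
    rw [← Real.rpow_natCast, ← Real.rpow_mul hr.le]
    congr 1; push_cast; ring
  have e1 : r ^ c.γ * ((s / r) ^ (c.γ / 2) - 1) ^ 2 = (s ^ (c.γ / 2) - r ^ (c.γ / 2)) ^ 2 := by
    have h0 : 0 < r ^ (c.γ / 2) := Real.rpow_pos_of_pos hr _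
    rw [Real.div_rpow hs hr.le, hr2]; field_simp
  have e2 : r ^ c.γ * ((s / r) ^ c.γ - 1 - c.γ * (s / r - 1)) =
      s ^ c.γ - r ^ c.γ - c.γ * r ^ (c.γ - 1) * (s - r) := by
    have h0 : 0 < r ^ c.γ := Real.rpow_pos_of_pos hr _
    rw [Real.div_rpow hs hr.le, Real.rpow_sub_one hr.ne']; field_simp
  have h2 := mul_le_mul_of_nonneg_left h
    (mul_pos (div_pos c.a_pos c.γ_sub_pos) (Real.rpow_pos_of_pos hr c.γ)).le
  calc c.coer * (s ^ (c.γ / 2) - r ^ (c.γ / 2)) ^ 2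
      = c.a / (c.γ - 1) * r ^ c.γ * (min 1 (c.γ - 1) * ((s / r) ^ (c.γ / 2) - 1) ^ 2) := by
        rw [← e1, coer]; ring
    _ ≤ c.a / (c.γ - 1) * r ^ c.γ * ((s / r) ^ c.γ - 1 - c.γ * (s / r - 1)) := h2
    _ = c.relP s r := by rw [mul_assoc, e2, relP, P, P, dP]; ring

theorem relP_nonneg {s r : ℝ} (hs : 0 ≤ s) (hr : 0 < r) : 0 ≤ c.relP s r :=
  (mul_nonneg c.coer_pos.le (sq_nonneg _)).trans (c.relP_ge hs hr)

theorem rpow_half_sq {s : ℝ} (hs : 0 ≤ s) : (s ^ (c.γ / 2)) ^ 2 = s ^ c.γ := by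
  rw [← Real.rpow_natCast, ← Real.rpow_mul hs]
  congr 1; push_cast; ring

/-- `s ^ γ - r ^ γ` is the sum of a quadratic and a linear term in `s ^ (γ/2) - r ^ (γ/2)`. -/
theorem abs_rpow_sub_le {s r : ℝ} (hs : 0 ≤ s) (hr : 0 < r) :
    |s ^ c.γ - r ^ c.γ| ≤ (1 + 2 * r ^ (c.γ / 2)) *
      ((s ^ (c.γ / 2) - r ^ (c.γ / 2)) ^ 2 + |s ^ (c.γ / 2) - r ^ (c.γ / 2)|) := by
  have h0 : 0 < r ^ (c.γ / 2) := Real.rpow_pos_of_pos hr _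
  rw [← c.rpow_half_sq hs, ← c.rpow_half_sq hr.le]
  set x := s ^ (c.γ / 2)
  set y := r ^ (c.γ / 2)
  have : x ^ 2 - y ^ 2 = (x - y) ^ 2 + 2 * y * (x - y) := by ring
  rw [this]
  refine (abs_add_le _ _).trans ?_
  rw [abs_mul, abs_of_nonneg (sq_nonneg (x - y)), abs_of_pos (by linarith : 0 < 2 * y)]
  nlinarith [sq_nonneg (x - y), abs_nonneg (x - y), mul_nonneg h0.le (sq_nonneg (x - y))]

/-- Since `γ > 1`, `|x - 1| ≤ |x^γ - 1|` for `x = s/r`. Thus the bound for `ϱ` follows from that for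
`ϱ^γ`. -/
theorem abs_sub_le {s r : ℝ} (hs : 0 ≤ s) (hr : 0 < r) :
    |s - r| ≤ r / r ^ c.γ * |s ^ c.γ - r ^ c.γ| := by
  have h := abs_sub_one_le_abs_rpow_sub_one c.one_lt_γ (div_nonneg hs hr.le)
  have h0 : 0 < r ^ c.γ := Real.rpow_pos_of_pos hr _
  have e1 : |s - r| = r * |s / r - 1| := by
    rw [← abs_of_pos hr, ← abs_mul, abs_of_pos hr]; congr 1; field_simp
  have e2 : r / r ^ c.γ * |s ^ c.γ - r ^ c.γ| = r * |(s / r) ^ c.γ - 1| := by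
    rw [Real.div_rpow hs hr.le, show s ^ c.γ / r ^ c.γ - 1 = (s ^ c.γ - r ^ c.γ) / r ^ c.γ by
      field_simp, abs_div, abs_of_pos h0]; field_simp
  rw [e1, e2]
  exact mul_le_mul_of_nonneg_left h hr.le

/-- Linear growth bound in terms of `s ^ (γ/2) - r ^ (γ/2)`. -/
theorem exists_bounds {r : ℝ} (hr : 0 < r) : ∃ C, 0 ≤ C ∧ ∀ s, 0 ≤ s →
    |s - r| ≤ C * ((s ^ (c.γ / 2) - r ^ (c.γ / 2)) ^ 2 + |s ^ (c.γ / 2) - r ^ (c.γ / 2)|) ∧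
    |c.p s - c.p r| ≤
      C * ((s ^ (c.γ / 2) - r ^ (c.γ / 2)) ^ 2 + |s ^ (c.γ / 2) - r ^ (c.γ / 2)|) := by
  have h0 : 0 < r ^ (c.γ / 2) := Real.rpow_pos_of_pos hr _
  have h1 : 0 < r ^ c.γ := Real.rpow_pos_of_pos hr _
  set A := 1 + 2 * r ^ (c.γ / 2)
  have hA : 0 ≤ A := by positivity
  have hB : 0 ≤ r / r ^ c.γ := by positivity
  refine ⟨r / r ^ c.γ * A + c.a * A, add_nonneg (mul_nonneg hB hA) (mul_nonneg c.a_pos.le hA),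
    fun s hs => ?_⟩
  have h2 := c.abs_rpow_sub_le hs hr
  have h3 := c.abs_sub_le hs hr
  set Y := (s ^ (c.γ / 2) - r ^ (c.γ / 2)) ^ 2 + |s ^ (c.γ / 2) - r ^ (c.γ / 2)|
  have hY : 0 ≤ Y := by positivity
  have ha := c.a_pos.le
  constructor
  · refine h3.trans ((mul_le_mul_of_nonneg_left h2 hB).trans ?_)
    nlinarith [mul_nonneg (mul_nonneg ha hA) hY]
  · have : c.p s - c.p r = c.a * (s ^ c.γ - r ^ c.γ) := by simp only [p]; ring
    rw [this, abs_mul, abs_of_pos c.a_pos]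
    refine (mul_le_mul_of_nonneg_left h2 ha).trans ?_
    nlinarith [mul_nonneg (mul_nonneg hB hA) hY]

theorem hasDerivAt_p {r : ℝ} (hr : 0 < r) : HasDerivAt c.p (c.dp r) r := by
  have := (Real.hasDerivAt_rpow_const (x := r) (p := c.γ) (Or.inl hr.ne')).const_mul c.a
  rw [← mul_assoc] at this
  exact this

theorem hasDerivAt_P {r : ℝ} (hr : 0 < r) : HasDerivAt c.P (c.dP r) r := by
  have := (Real.hasDerivAt_rpow_const (x := r) (p := c.γ) (Or.inl hr.ne')).const_mul
    (c.a / (c.γ - 1))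
  rw [← mul_assoc] at this
  exact this

theorem hasDerivAt_dp {r : ℝ} (hr : 0 < r) : HasDerivAt c.dp (c.ddp r) r := by
  have := (Real.hasDerivAt_rpow_const (x := r) (p := c.γ - 1) (Or.inl hr.ne')).const_mul
    (c.a * c.γ)
  rw [← mul_assoc, show c.γ - 1 - 1 = c.γ - 2 by ring] at this
  exact this

/-- `r P''(r) = p'(r)`. -/
theorem hasDerivAt_dP {r : ℝ} (hr : 0 < r) : HasDerivAt c.dP (c.dp r / r) r := by
  have h := (Real.hasDerivAt_rpow_const (x := r) (p := c.γ - 1) (Or.inl hr.ne')).const_mul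
    (c.a / (c.γ - 1) * c.γ)
  refine h.congr_deriv ?_
  have := c.γ_sub_pos.ne'
  simp only [Params.dp]
  rw [Real.rpow_sub_one hr.ne' (c.γ - 1)]
  field_simp

end Params

end
end KEntropy

namespace KEntropy
noncomputable section
open scoped ContDiff ENNReal

/-! ### Bounded square integrable functions and their multipliers -/

section Good

variable {α : Type*} {mα : MeasurableSpace α} {μ : Measure α}

/-- Bounded and square integrable functions. -/
def Good (μ : Measure α) (X : α → ℝ) : Prop := MemLp X 2 μ ∧ MemLp X ⊤ μ

/-- Functions whose product with every bounded square integrable function is integrable. -/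
def Tame (μ : Measure α) (Y : α → ℝ) : Prop :=
  ∀ X, Good μ X → Integrable (fun z => Y z * X z) μ

theorem memLp_mul_bdd {p : ℝ≥0∞} {X Y : α → ℝ} (hX : MemLp X p μ) (hY : MemLp Y ⊤ μ) :
    MemLp (fun z => Y z * X z) p μ := by
  exact MemLp.mul' hX hY

theorem integrable_mul_bdd {X Y : α → ℝ} (hX : Integrable X μ) (hY : MemLp Y ⊤ μ) :
    Integrable (fun z => Y z * X z) μ :=
  memLp_one_iff_integrable.1 (memLp_mul_bdd (memLp_one_iff_integrable.2 hX) hY)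

theorem integrable_mul_L2 {X Y : α → ℝ} (hX : MemLp X 2 μ) (hY : MemLp Y 2 μ) :
    Integrable (fun z => X z * Y z) μ := hX.integrable_mul hY

namespace Good

variable {X Y : α → ℝ}

theorem add (hX : Good μ X) (hY : Good μ Y) : Good μ (fun z => X z + Y z) :=
  ⟨hX.1.add hY.1, hX.2.add hY.2⟩

theorem sub (hX : Good μ X) (hY : Good μ Y) : Good μ (fun z => X z - Y z) :=
  ⟨hX.1.sub hY.1, hX.2.sub hY.2⟩

theorem const_mul (hX : Good μ X) (k : ℝ) : Good μ (fun z => k * X z) :=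
  ⟨hX.1.const_mul k, hX.2.const_mul k⟩

theorem bdd_mul (hX : Good μ X) (hY : MemLp Y ⊤ μ) : Good μ (fun z => Y z * X z) :=
  ⟨memLp_mul_bdd hX.1 hY, memLp_mul_bdd hX.2 hY⟩

theorem mul (hX : Good μ X) (hY : Good μ Y) : Good μ (fun z => X z * Y z) := hY.bdd_mul hX.2

theorem sum {ι : Type*} {s : Finset ι} {X : ι → α → ℝ} (h : ∀ i ∈ s, Good μ (X i)) :
    Good μ (fun z => ∑ i ∈ s, X i z) :=
  ⟨memLp_finsetSum s fun i hi => (h i hi).1, memLp_finsetSum s fun i hi => (h i hi).2⟩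

theorem congr (hX : Good μ X) (h : X =ᵐ[μ] Y) : Good μ Y :=
  ⟨(memLp_congr_ae h).1 hX.1, (memLp_congr_ae h).1 hX.2⟩

theorem of_bounded {C : ℝ} (hm : AEStronglyMeasurable X μ) (hC : ∀ᵐ z ∂μ, ‖X z‖ ≤ C)
    (hi : Integrable (fun z => X z ^ 2) μ) : Good μ X :=
  ⟨(memLp_two_iff_integrable_sq hm).2 hi, memLp_top_of_bound hm C hC⟩

theorem mono' (hX : Good μ X) {C : ℝ} (hm : AEStronglyMeasurable Y μ)
    (h : ∀ᵐ z ∂μ, ‖Y z‖ ≤ C * ‖X z‖) : Good μ Y :=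
  ⟨hX.1.of_le_mul hm h, hX.2.of_le_mul hm h⟩

end Good

namespace Tame

variable {X Y : α → ℝ}

theorem of_L2 (hY : MemLp Y 2 μ) : Tame μ Y := fun _ hX => integrable_mul_L2 hY hX.1

theorem of_L1 (hY : Integrable Y μ) : Tame μ Y := fun X hX => by
  simpa [mul_comm] using integrable_mul_bdd hY hX.2

theorem add (hX : Tame μ X) (hY : Tame μ Y) : Tame μ (fun z => X z + Y z) := fun Z hZ => by
  simp only [add_mul]
  exact (hX Z hZ).add (hY Z hZ)

theorem sub (hX : Tame μ X) (hY : Tame μ Y) : Tame μ (fun z => X z - Y z) := fun Z hZ => by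
  simp only [sub_mul]
  exact (hX Z hZ).sub (hY Z hZ)

theorem const_mul (hX : Tame μ X) (k : ℝ) : Tame μ (fun z => k * X z) := fun Z hZ => by
  simpa only [mul_assoc] using (hX Z hZ).const_mul k

theorem zero : Tame μ (fun _ => 0) := fun Z _ => by simp

theorem congr (hX : Tame μ X) (h : X =ᵐ[μ] Y) : Tame μ Y := fun Z hZ =>
  (hX Z hZ).congr (h.mono fun z hz => by simp only [hz])

/-- The quadratic part is integrable and pairs with bounded functions; the linear part is in `L²`
and pairs with square integrable ones. Members of `Good` are both. -/
theorem of_le {η : α → ℝ} {C : ℝ} (hm : AEStronglyMeasurable Y μ) (hη : MemLp η 2 μ)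
    (h : ∀ᵐ z ∂μ, |Y z| ≤ C * (η z ^ 2 + |η z|)) : Tame μ Y := fun X hX => by
  have h1 : Tame μ (fun z => C * (η z ^ 2 + |η z|)) :=
    ((of_L1 hη.integrable_sq).add (of_L2 hη.abs)).const_mul C
  have hX' : Good μ (fun z => |X z|) := ⟨hX.1.abs, hX.2.abs⟩
  refine (h1 _ hX').mono' (hm.mul hX.1.1) ?_
  filter_upwards [h] with z hz
  rw [norm_mul]
  exact mul_le_mul_of_nonneg_right hz (abs_nonneg _)

end Tame

/-- If `ρ` differs from a constant by a multiplier, then `√ρ X` is square integrable. -/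
theorem Good.sqrt_mul {ρ X : α → ℝ} {k : ℝ} (hX : Good μ X) (hm : AEStronglyMeasurable ρ μ)
    (h0 : ∀ z, 0 ≤ ρ z) (ht : Tame μ (fun z => ρ z - k)) :
    MemLp (fun z => √(ρ z) * X z) 2 μ := by
  have hs : AEStronglyMeasurable (fun z => √(ρ z)) μ :=
    Real.continuous_sqrt.comp_aestronglyMeasurable hm
  refine (memLp_two_iff_integrable_sq (hs.mul hX.1.1)).2 (((ht _ (hX.mul hX)).add (hX.1.integrable_sq.const_mul k)).congr
    (Eventually.of_forall fun z => ?_))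
  simp only [mul_pow, Real.sq_sqrt (h0 z), Pi.add_apply, Pi.mul_apply]
  ring

end Good

/-! ### Test functions of class `C¹` with decay -/

/-- Functions of class `C¹` on `[0,T] × Ω` that are bounded and square integrable together with
their first derivatives. -/
structure Nice (dom : Dom) (T : ℝ) (ψ : ℝ × E → ℝ) : Prop where
  smooth : ContDiffOn ℝ 1 ψ (Icc 0 T ×ˢ univ)
  per : ∀ t ∈ Icc 0 T, dom.Per fun x => ψ (t, x)
  bdd : ∃ C, ∀ z ∈ Ioo 0 T ×ˢ dom.cell, ‖ψ z‖ ≤ C ∧ ‖fderiv ℝ ψ z‖ ≤ C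
  sq : IntegrableOn (fun z => ψ z ^ 2) (Ioo 0 T ×ˢ dom.cell)
  sq_fderiv : IntegrableOn (fun z => ‖fderiv ℝ ψ z‖ ^ 2) (Ioo 0 T ×ˢ dom.cell)

theorem measurableSet_strip (dom : Dom) (T : ℝ) : MeasurableSet (Ioo 0 T ×ˢ dom.cell) :=
  measurableSet_Ioo.prod (cell_measurableSet dom)

theorem aesm_of_continuousOn_strip {F : Type*} [NormedAddCommGroup F] [SecondCountableTopology F]
    {dom : Dom} {T : ℝ} {f : ℝ × E → F} (hf : ContinuousOn f (Ioo 0 T ×ˢ univ)) :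
    AEStronglyMeasurable f (volume.restrict (Ioo 0 T ×ˢ dom.cell)) :=
  (hf.aestronglyMeasurable (measurableSet_Ioo.prod MeasurableSet.univ)).mono_set
    (prod_mono_right (subset_univ _))

theorem volume_torus_strip_lt_top (T : ℝ) :
    volume (Ioo 0 T ×ˢ Dom.torus.cell : Set (ℝ × E)) < ⊤ := by
  have := measure_local_lt_top .torus T 2
  rwa [inter_eq_left.2 cell_torus_subset] at this

namespace Nice

variable {dom : Dom} {T : ℝ} {ψ φ : ℝ × E → ℝ}

theorem aesm_fderiv (hψ : ContDiffOn ℝ 1 ψ (Icc 0 T ×ˢ univ)) :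
    AEStronglyMeasurable (fderiv ℝ ψ) (volume.restrict (Ioo 0 T ×ˢ dom.cell)) :=
  aesm_of_continuousOn_strip (continuousOn_fderiv_strip hψ)

theorem aesm (hψ : ContDiffOn ℝ 1 ψ (Icc 0 T ×ˢ univ)) :
    AEStronglyMeasurable ψ (volume.restrict (Ioo 0 T ×ˢ dom.cell)) :=
  aesm_of_continuousOn_strip (hψ.continuousOn.mono (prod_mono_left Ioo_subset_Icc_self))

theorem of_torus (hT : 0 < T) (hψ : ContDiffOn ℝ 1 ψ (Icc 0 T ×ˢ univ))
    (per : ∀ t ∈ Icc 0 T, Dom.torus.Per fun x => ψ (t, x)) : Nice .torus T ψ := by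
  obtain ⟨C, hC, hC'⟩ := exists_bound_strip hT hψ 2
  have hb : ∀ z ∈ Ioo 0 T ×ˢ Dom.torus.cell, ‖ψ z‖ ≤ C ∧ ‖fderiv ℝ ψ z‖ ≤ C := fun z hz => by
    have h2 : ‖z.2‖ ≤ 2 := by simpa using cell_torus_subset hz.2
    exact ⟨hC z.1 (Ioo_subset_Icc_self hz.1) z.2 h2, hC' z.1 hz.1 z.2 h2⟩
  have hfin : IntegrableOn (fun _ => C ^ 2) (Ioo 0 T ×ˢ Dom.torus.cell : Set (ℝ × E)) :=
    integrableOn_const (volume_torus_strip_lt_top T).ne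
  refine ⟨hψ, per, ⟨C, hb⟩, hfin.mono' ((aesm hψ).pow 2) ?_,
    hfin.mono' ((aesm_fderiv hψ).norm.pow 2) ?_⟩
  · filter_upwards [ae_restrict_mem (measurableSet_strip _ T)] with z hz
    rw [norm_pow]
    exact pow_le_pow_left₀ (norm_nonneg _) (hb z hz).1 2
  · filter_upwards [ae_restrict_mem (measurableSet_strip _ T)] with z hz
    rw [norm_pow, norm_norm]
    exact pow_le_pow_left₀ (norm_nonneg _) (hb z hz).2 2

theorem good (h : Nice dom T ψ) : Good (volume.restrict (Ioo 0 T ×ˢ dom.cell)) ψ := by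
  obtain ⟨C, hC⟩ := h.bdd
  refine Good.of_bounded (aesm h.smooth) (C := C) ?_ h.sq
  filter_upwards [ae_restrict_mem (measurableSet_strip _ T)] with z hz
  exact (hC z hz).1

theorem good_norm_fderiv (h : Nice dom T ψ) :
    Good (volume.restrict (Ioo 0 T ×ˢ dom.cell)) (fun z => ‖fderiv ℝ ψ z‖) := by
  obtain ⟨C, hC⟩ := h.bdd
  refine Good.of_bounded (aesm_fderiv h.smooth).norm (C := C) ?_ h.sq_fderiv
  filter_upwards [ae_restrict_mem (measurableSet_strip _ T)] with z hz
  rw [norm_norm]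
  exact (hC z hz).2

theorem aesm_fderiv_apply (hψ : ContDiffOn ℝ 1 ψ (Icc 0 T ×ˢ univ)) (e : ℝ × E) :
    AEStronglyMeasurable (fun z => fderiv ℝ ψ z e) (volume.restrict (Ioo 0 T ×ˢ dom.cell)) :=
  (ContinuousLinearMap.apply ℝ ℝ e).continuous.comp_aestronglyMeasurable (aesm_fderiv hψ)

theorem good_fderiv (h : Nice dom T ψ) (e : ℝ × E) :
    Good (volume.restrict (Ioo 0 T ×ˢ dom.cell)) (fun z => fderiv ℝ ψ z e) := by
  refine h.good_norm_fderiv.mono' (C := ‖e‖) (aesm_fderiv_apply h.smooth e)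
    (Eventually.of_forall fun z => ?_)
  rw [norm_norm, mul_comm]
  exact (fderiv ℝ ψ z).le_opNorm e

theorem differentiableAt (hψ : ContDiffOn ℝ 1 ψ (Icc 0 T ×ˢ univ)) {z : ℝ × E}
    (hz : z.1 ∈ Ioo 0 T) : DifferentiableAt ℝ ψ z :=
  (contDiffAt_of_strip hψ hz).differentiableAt one_ne_zero

/-- A criterion for `Nice`, by comparison with bounded square integrable functions. -/
theorem of_good {X : ℝ × E → ℝ} (hψ : ContDiffOn ℝ 1 ψ (Icc 0 T ×ˢ univ))
    (per : ∀ t ∈ Icc 0 T, dom.Per fun x => ψ (t, x))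
    (hg : Good (volume.restrict (Ioo 0 T ×ˢ dom.cell)) X) (hX : ∃ C, ∀ z ∈ Ioo 0 T ×ˢ dom.cell, X z ≤ C)
    (h1 : ∀ z ∈ Ioo 0 T ×ˢ dom.cell, ‖ψ z‖ ≤ X z)
    (h2 : ∀ z ∈ Ioo 0 T ×ˢ dom.cell, ‖fderiv ℝ ψ z‖ ≤ X z) : Nice dom T ψ := by
  obtain ⟨C, hC⟩ := hX
  refine ⟨hψ, per, ⟨C, fun z hz => ⟨(h1 z hz).trans (hC z hz), (h2 z hz).trans (hC z hz)⟩⟩,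
    hg.1.integrable_sq.mono' ((aesm hψ).pow 2) ?_,
    hg.1.integrable_sq.mono' ((aesm_fderiv hψ).norm.pow 2) ?_⟩
  · filter_upwards [ae_restrict_mem (measurableSet_strip _ T)] with z hz
    rw [norm_pow]
    exact pow_le_pow_left₀ (norm_nonneg _) (h1 z hz) 2
  · filter_upwards [ae_restrict_mem (measurableSet_strip _ T)] with z hz
    rw [norm_pow, norm_norm]
    exact pow_le_pow_left₀ (norm_nonneg _) (h2 z hz) 2

theorem good_norm (h : Nice dom T ψ) :
    Good (volume.restrict (Ioo 0 T ×ˢ dom.cell)) (fun z => ‖ψ z‖) :=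
  ⟨h.good.1.norm, h.good.2.norm⟩

theorem per_map₂ {F : ℝ → ℝ → ℝ} {f g : E → ℝ} (hf : dom.Per f) (hg : dom.Per g) :
    dom.Per (fun x => F (f x) (g x)) := by
  cases dom
  · intro j x
    have a1 : f (x + unitVec j) = f x := hf j x
    have a2 : g (x + unitVec j) = g x := hg j x
    simp only [a1, a2]
  · trivial

theorem add (h : Nice dom T ψ) (h' : Nice dom T φ) : Nice dom T (fun z => ψ z + φ z) := by
  obtain ⟨C, hC⟩ := h.bdd
  obtain ⟨C', hC'⟩ := h'.bdd
  refine of_good (X := fun z => (‖ψ z‖ + ‖φ z‖) + (‖fderiv ℝ ψ z‖ + ‖fderiv ℝ φ z‖))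
    (h.smooth.add h'.smooth) (fun t ht => per_map₂ (F := fun a b => a + b) (h.per t ht) (h'.per t ht))
    ((h.good_norm.add h'.good_norm).add (h.good_norm_fderiv.add h'.good_norm_fderiv))
    ⟨(C + C') + (C + C'), fun z hz => add_le_add (add_le_add (hC z hz).1 (hC' z hz).1)
      (add_le_add (hC z hz).2 (hC' z hz).2)⟩ ?_ ?_
  · exact fun z _ => (norm_add_le _ _).trans (le_add_of_nonneg_right (by positivity))
  · intro z hz
    rw [((differentiableAt h.smooth hz.1).hasFDerivAt.fun_add
      (differentiableAt h'.smooth hz.1).hasFDerivAt).fderiv]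
    exact (norm_add_le _ _).trans (le_add_of_nonneg_left (by positivity))

theorem const_mul (h : Nice dom T ψ) (k : ℝ) : Nice dom T (fun z => k * ψ z) := by
  obtain ⟨C, hC⟩ := h.bdd
  refine of_good (X := fun z => |k| * (‖ψ z‖ + ‖fderiv ℝ ψ z‖)) (contDiffOn_const.mul h.smooth)
    (fun t ht => per_map₂ (F := fun a _ => k * a) (h.per t ht) (h.per t ht))
    ((h.good_norm.add h.good_norm_fderiv).const_mul _)
    ⟨|k| * (C + C), fun z hz => mul_le_mul_of_nonneg_left
      (add_le_add (hC z hz).1 (hC z hz).2) (abs_nonneg _)⟩ ?_ ?_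
  · intro z _
    rw [norm_mul, Real.norm_eq_abs]
    exact mul_le_mul_of_nonneg_left (le_add_of_nonneg_right (norm_nonneg _)) (abs_nonneg _)
  · intro z hz
    rw [((differentiableAt h.smooth hz.1).hasFDerivAt.const_mul k).fderiv, norm_smul,
      Real.norm_eq_abs]
    exact mul_le_mul_of_nonneg_left (le_add_of_nonneg_left (norm_nonneg _)) (abs_nonneg _)

theorem sub (h : Nice dom T ψ) (h' : Nice dom T φ) : Nice dom T (fun z => ψ z - φ z) := by
  simpa [sub_eq_add_neg] using h.add (h'.const_mul (-1))

theorem mul (h : Nice dom T ψ) (h' : Nice dom T φ) : Nice dom T (fun z => ψ z * φ z) := by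
  obtain ⟨C, hC⟩ := h.bdd
  obtain ⟨C', hC'⟩ := h'.bdd
  have hle : ∀ {a b A B : ℝ}, 0 ≤ a → 0 ≤ b → a ≤ A → b ≤ B → a * b ≤ A * B :=
    fun ha hb h1 h2 => mul_le_mul h1 h2 hb (ha.trans h1)
  refine of_good (X := fun z => ‖ψ z‖ * ‖φ z‖ +
      (‖ψ z‖ * ‖fderiv ℝ φ z‖ + ‖φ z‖ * ‖fderiv ℝ ψ z‖))
    (h.smooth.mul h'.smooth) (fun t ht => per_map₂ (F := fun a b => a * b) (h.per t ht) (h'.per t ht))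
    ((h.good_norm.mul h'.good_norm).add ((h.good_norm.mul h'.good_norm_fderiv).add
      (h'.good_norm.mul h.good_norm_fderiv)))
    ⟨C * C' + (C * C' + C' * C), fun z hz => add_le_add
      (hle (norm_nonneg _) (norm_nonneg _) (hC z hz).1 (hC' z hz).1)
      (add_le_add (hle (norm_nonneg _) (norm_nonneg _) (hC z hz).1 (hC' z hz).2)
      (hle (norm_nonneg _) (norm_nonneg _) (hC' z hz).1 (hC z hz).2))⟩ ?_ ?_
  · intro z _
    rw [norm_mul]
    exact le_add_of_nonneg_right (by positivity)
  · intro z hz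
    rw [((differentiableAt h.smooth hz.1).hasFDerivAt.fun_mul
      (differentiableAt h'.smooth hz.1).hasFDerivAt).fderiv]
    refine (norm_add_le _ _).trans ?_
    rw [norm_smul, norm_smul]
    exact le_add_of_nonneg_left (by positivity)

/-- Bounds are assumed on the open time interval only; continuity carries them to the endpoints. -/
theorem bound_Icc (hT : 0 < T) (hψ : ContDiffOn ℝ 1 ψ (Icc 0 T ×ˢ univ)) {C : ℝ} {x : E}
    (h : ∀ t ∈ Ioo 0 T, ‖ψ (t, x)‖ ≤ C) {t : ℝ} (ht : t ∈ Icc 0 T) : ‖ψ (t, x)‖ ≤ C := by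
  have hc : ContinuousOn (fun s => ψ (s, x)) (Icc 0 T) :=
    hψ.continuousOn.comp (by fun_prop) fun s hs => ⟨hs, mem_univ _⟩
  have hcl : closure (Ioo 0 T) = Icc 0 T := closure_Ioo hT.ne
  have ht' : t ∈ closure (Ioo 0 T) := hcl ▸ ht
  have := mem_closure_iff_nhdsWithin_neBot.1 ht'
  exact le_of_tendsto ((hc t ht).mono_left (nhdsWithin_mono _ Ioo_subset_Icc_self)).norm
    (eventually_mem_nhdsWithin.mono h)

/-- The initial values are bounded and square integrable. -/
theorem init (hT : 0 < T) (h : Nice dom T ψ) :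
    Good (volume.restrict dom.cell) (fun x => ψ (0, x)) := by
  obtain ⟨C, hC⟩ := h.bdd
  have hm : AEStronglyMeasurable (fun x => ψ (0, x)) (volume.restrict dom.cell) := by
    refine Continuous.aestronglyMeasurable ?_
    exact h.smooth.continuousOn.comp_continuous (by fun_prop) fun x => ⟨⟨le_rfl, hT.le⟩, mem_univ _⟩
  -- A trace estimate: `k` dominates `|∂ₜ(ψ²)|`, so `ψ(0,x)² ≤ ψ(t,x)² + ∫ k(s,x) ds`. Averaging
  -- over `t` gives the constant `1/T + 1`.
  set k : ℝ × E → ℝ := fun z => ψ z ^ 2 + fderiv ℝ ψ z (1, 0) ^ 2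
  have hk : Integrable k ((volume.restrict (Ioo 0 T)).prod (volume.restrict dom.cell)) := by
    rw [← volume_restrict_prod]
    exact h.good.1.integrable_sq.add (h.good_fderiv _).1.integrable_sq
  have hk2 := hk.integral_prod_right
  refine Good.of_bounded hm (C := C) ?_ ((hk2.const_mul (1 / T + 1)).mono' (hm.pow 2) ?_)
  · filter_upwards [ae_restrict_mem (cell_measurableSet dom)] with x hx
    exact bound_Icc hT h.smooth (fun t ht => (hC (t, x) ⟨ht, hx⟩).1) ⟨le_rfl, hT.le⟩
  · filter_upwards [ae_restrict_mem (cell_measurableSet dom), hk.prod_left_ae] with x hx hkx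
    rw [Real.norm_of_nonneg (sq_nonneg _)]
    change ψ (0, x) ^ 2 ≤ (1 / T + 1) * ∫ t in Ioo 0 T, k (t, x)
    set g := ∫ t in Ioo 0 T, k (t, x)
    have hc : ContinuousOn (fun s => ψ (s, x)) (Icc 0 T) :=
      h.smooth.continuousOn.comp (by fun_prop) fun s hs => ⟨hs, mem_univ _⟩
    have hd : ∀ t ∈ Ioo 0 T, HasDerivAt (fun s => ψ (s, x) ^ 2)
        (2 * ψ (t, x) * fderiv ℝ ψ (t, x) (1, 0)) t := fun t ht => by
      have h1 : HasDerivAt (fun s : ℝ => (s, x)) ((1 : ℝ), (0 : E)) t :=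
        (hasDerivAt_id t).prodMk (hasDerivAt_const t x)
      have h2 := ((differentiableAt h.smooth (z := (t, x)) ht).hasFDerivAt.comp_hasDerivAt t h1).fun_pow 2
      simpa using h2
    have hdc : ContinuousOn (fun t => 2 * ψ (t, x) * fderiv ℝ ψ (t, x) (1, 0)) (Ioo 0 T) := by
      refine ((continuousOn_const.mul (hc.mono Ioo_subset_Icc_self))).mul ?_
      exact ((continuousOn_fderiv_strip h.smooth).comp (by fun_prop)
        fun s hs => ⟨hs, mem_univ _⟩).clm_apply continuousOn_const
    have hle : ∀ t, ‖2 * ψ (t, x) * fderiv ℝ ψ (t, x) (1, 0)‖ ≤ k (t, x) := fun t => by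
      rw [Real.norm_eq_abs, abs_le]
      constructor <;> simp only [k] <;>
        nlinarith [sq_nonneg (ψ (t, x) + fderiv ℝ ψ (t, x) (1, 0)),
          sq_nonneg (ψ (t, x) - fderiv ℝ ψ (t, x) (1, 0))]
    have hint : IntegrableOn (fun t => 2 * ψ (t, x) * fderiv ℝ ψ (t, x) (1, 0)) (Ioo 0 T) :=
      hkx.mono' (hdc.aestronglyMeasurable measurableSet_Ioo) (Eventually.of_forall hle)
    have hmain : ∀ t ∈ Ioo 0 T, ψ (0, x) ^ 2 ≤ ψ (t, x) ^ 2 + g := by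
      intro t ht
      have hsub : Ioo 0 t ⊆ Ioo 0 T := Ioo_subset_Ioo_right ht.2.le
      have e := intervalIntegral.integral_eq_sub_of_hasDerivAt_of_le ht.1.le
        (f := fun s => ψ (s, x) ^ 2) ((hc.mono (Icc_subset_Icc_right ht.2.le)).pow 2)
        (fun s hs => hd s (hsub hs))
        (by rw [intervalIntegrable_iff_integrableOn_Ioo_of_le ht.1.le]; exact hint.mono_set hsub)
      rw [intervalIntegral.integral_of_le ht.1.le, integral_Ioc_eq_integral_Ioo] at e
      have h3 : |∫ s in Ioo 0 t, 2 * ψ (s, x) * fderiv ℝ ψ (s, x) (1, 0)| ≤ g := by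
        calc _ ≤ ∫ s in Ioo 0 t, k (s, x) :=
              norm_integral_le_of_norm_le (IntegrableOn.mono_set hkx hsub) (Eventually.of_forall hle)
          _ ≤ g := setIntegral_mono_set hkx (Eventually.of_forall fun s => by
                change 0 ≤ k _; simp only [k]; positivity) hsub.eventuallyLE
      have := (abs_le.1 h3).1
      linarith
    have hψ2 : IntegrableOn (fun t => ψ (t, x) ^ 2) (Ioo 0 T) :=
      ((hc.pow 2).integrableOn_compact isCompact_Icc).mono_set Ioo_subset_Icc_self
    have h4 : ∫ t in Ioo 0 T, ψ (0, x) ^ 2 ≤ ∫ t in Ioo 0 T, (ψ (t, x) ^ 2 + g) :=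
      setIntegral_mono_on (integrableOn_const (by simp)) (hψ2.add (integrableOn_const (by simp)))
        measurableSet_Ioo hmain
    have h5 : ∫ t in Ioo 0 T, ψ (t, x) ^ 2 ≤ g :=
      setIntegral_mono_on hψ2 hkx measurableSet_Ioo fun t _ => by
        simp only [k]; exact le_add_of_nonneg_right (sq_nonneg _)
    have hv : (volume : Measure ℝ).real (Ioo 0 T) = T := by simp [hT.le]
    rw [integral_add hψ2 (integrableOn_const (by simp))] at h4
    simp only [setIntegral_const, smul_eq_mul, hv] at h4
    have h6 : T * ψ (0, x) ^ 2 ≤ (1 + T) * g := by linarith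
    have h7 : ψ (0, x) ^ 2 ≤ (1 + T) * g / T := by rw [le_div_iff₀ hT]; linarith
    calc _ ≤ _ := h7
      _ = _ := by field_simp

end Nice

end
end KEntropy

namespace KEntropy
noncomputable section
open scoped ContDiff ENNReal

/-! ### Test triples -/

section Slices

variable {F : Type*} [NormedAddCommGroup F] [NormedSpace ℝ F] {T : ℝ} {f : ℝ → E → F}

theorem differentiableAt_strip (hf : ContDiffOn ℝ 1 (fun z : ℝ × E => f z.1 z.2) (Icc 0 T ×ˢ univ))
    {z : ℝ × E} (hz : z.1 ∈ Ioo 0 T) : DifferentiableAt ℝ (fun z : ℝ × E => f z.1 z.2) z :=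
  (hf.contDiffAt (mem_nhds_strip hz)).differentiableAt one_ne_zero

theorem dt_apply_eq (L : F →L[ℝ] ℝ)
    (hf : ContDiffOn ℝ 1 (fun z : ℝ × E => f z.1 z.2) (Icc 0 T ×ˢ univ)) {z : ℝ × E}
    (hz : z.1 ∈ Ioo 0 T) :
    L (dt f z.1 z.2) = fderiv ℝ (fun z : ℝ × E => L (f z.1 z.2)) z (1, 0) := by
  have h := differentiableAt_strip hf hz
  rw [show dt f z.1 z.2 = _ from dt_eq_fderiv (φ := fun z : ℝ × E => f z.1 z.2) h]
  have := (L.hasFDerivAt.comp z h.hasFDerivAt).fderiv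
  change _ = fderiv ℝ (L ∘ fun z : ℝ × E => f z.1 z.2) z (1, 0)
  rw [this]; rfl

theorem pd_apply_eq (L : F →L[ℝ] ℝ)
    (hf : ContDiffOn ℝ 1 (fun z : ℝ × E => f z.1 z.2) (Icc 0 T ×ˢ univ)) {z : ℝ × E}
    (hz : z.1 ∈ Ioo 0 T) (j : Fin 3) :
    L (pd j (f z.1) z.2) = fderiv ℝ (fun z : ℝ × E => L (f z.1 z.2)) z (0, unitVec j) := by
  have h := differentiableAt_strip hf hz
  rw [show pd j (f z.1) z.2 = _ from pd_eq_fderiv (φ := fun z : ℝ × E => f z.1 z.2) h j]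
  have := (L.hasFDerivAt.comp z h.hasFDerivAt).fderiv
  change _ = fderiv ℝ (L ∘ fun z : ℝ × E => f z.1 z.2) z (0, unitVec j)
  rw [this]; rfl

/-- `IsDecaying` controls the time derivative and the spatial derivative separately, while the weak
equations are tested with the space-time derivative. -/
theorem norm_fderiv_strip_le
    (hf : ContDiffOn ℝ 1 (fun z : ℝ × E => f z.1 z.2) (Icc 0 T ×ˢ univ)) {z : ℝ × E}
    (hz : z.1 ∈ Ioo 0 T) :
    ‖fderiv ℝ (fun z : ℝ × E => f z.1 z.2) z‖ ≤ ‖dt f z.1 z.2‖ + ‖fderiv ℝ (f z.1) z.2‖ := by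
  have h := differentiableAt_strip hf hz
  refine ContinuousLinearMap.opNorm_le_bound _ (by positivity) fun e => ?_
  have e1 : e = e.1 • ((1 : ℝ), (0 : E)) + (0, e.2) := by ext <;> simp
  have e2 : fderiv ℝ (fun z : ℝ × E => f z.1 z.2) z e =
      e.1 • dt f z.1 z.2 + fderiv ℝ (f z.1) z.2 e.2 := by
    conv_lhs => rw [e1]
    rw [map_add, map_smul]
    rw [show dt f z.1 z.2 = _ from dt_eq_fderiv (φ := fun z : ℝ × E => f z.1 z.2) h,
      show fderiv ℝ (f z.1) z.2 e.2 = _ from fderiv_slice (φ := fun z : ℝ × E => f z.1 z.2) h e.2]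
  rw [e2, add_mul]
  refine (norm_add_le _ _).trans (add_le_add ?_ ?_)
  · rw [norm_smul, mul_comm]
    exact mul_le_mul_of_nonneg_left (norm_fst_le e) (norm_nonneg _)
  · exact ((fderiv ℝ (f z.1) z.2).le_opNorm _).trans
      (mul_le_mul_of_nonneg_left (norm_snd_le e) (norm_nonneg _))

end Slices

theorem Nice.of_decaying {F : Type*} [NormedAddCommGroup F] [NormedSpace ℝ F] {T : ℝ}
    {f : ℝ → E → F} (L : F →L[ℝ] ℝ) [SecondCountableTopology F]
    (hf : ContDiffOn ℝ 1 (fun z : ℝ × E => f z.1 z.2) (Icc 0 T ×ˢ univ)) (hd : IsDecaying T f) :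
    Nice .space T (fun z => L (f z.1 z.2)) := by
  obtain ⟨C, hC⟩ := hd.bdd
  have hL : ContDiffOn ℝ 1 (fun z : ℝ × E => L (f z.1 z.2)) (Icc 0 T ×ˢ univ) :=
    L.contDiff.comp_contDiffOn hf
  set X : ℝ × E → ℝ := fun z => ‖f z.1 z.2‖ + ‖dt f z.1 z.2‖ + ‖fderiv ℝ (f z.1) z.2‖
  have hXC : ∀ z ∈ Ioo 0 T ×ˢ Dom.space.cell, X z ≤ C + C + C := fun z hz =>
    add_le_add (add_le_add (hC z.1 hz.1 z.2).1 (hC z.1 hz.1 z.2).2.1) (hC z.1 hz.1 z.2).2.2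
  have b1 : ∀ z, ‖L (f z.1 z.2)‖ ≤ ‖L‖ * X z := fun z =>
    (L.le_opNorm _).trans (mul_le_mul_of_nonneg_left (by
      simp only [X]; rw [add_assoc]; exact le_add_of_nonneg_right (by positivity)) (norm_nonneg _))
  have b2 : ∀ z ∈ Ioo 0 T ×ˢ Dom.space.cell,
      ‖fderiv ℝ (fun z : ℝ × E => L (f z.1 z.2)) z‖ ≤ ‖L‖ * X z := fun z hz => by
    have e := (L.hasFDerivAt.comp z (differentiableAt_strip hf hz.1).hasFDerivAt).fderiv
    change ‖fderiv ℝ (L ∘ fun z : ℝ × E => f z.1 z.2) z‖ ≤ _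
    rw [e]
    refine (ContinuousLinearMap.opNorm_comp_le _ _).trans
      (mul_le_mul_of_nonneg_left ?_ (norm_nonneg _))
    refine (norm_fderiv_strip_le hf hz.1).trans ?_
    simp only [X]; rw [add_assoc]; exact le_add_of_nonneg_left (norm_nonneg _)
  have hsq : IntegrableOn (fun z : ℝ × E => ‖L‖ ^ 2 * (3 * (‖f z.1 z.2‖ ^ 2 + ‖dt f z.1 z.2‖ ^ 2
      + ‖fderiv ℝ (f z.1) z.2‖ ^ 2))) (Ioo 0 T ×ˢ Dom.space.cell) :=
    (Integrable.const_mul (Integrable.const_mul hd.sq 3) _)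
  have hX2 : ∀ z, (‖L‖ * X z) ^ 2 ≤ ‖L‖ ^ 2 * (3 * (‖f z.1 z.2‖ ^ 2 + ‖dt f z.1 z.2‖ ^ 2
      + ‖fderiv ℝ (f z.1) z.2‖ ^ 2)) := fun z => by
    rw [mul_pow]
    refine mul_le_mul_of_nonneg_left ?_ (sq_nonneg _)
    simp only [X]
    nlinarith [sq_nonneg (‖f z.1 z.2‖ - ‖dt f z.1 z.2‖),
      sq_nonneg (‖f z.1 z.2‖ - ‖fderiv ℝ (f z.1) z.2‖),
      sq_nonneg (‖dt f z.1 z.2‖ - ‖fderiv ℝ (f z.1) z.2‖)]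
  refine ⟨hL, fun _ _ => trivial, ⟨‖L‖ * (C + C + C), fun z hz => ⟨(b1 z).trans
    (mul_le_mul_of_nonneg_left (hXC z hz) (norm_nonneg _)), (b2 z hz).trans
    (mul_le_mul_of_nonneg_left (hXC z hz) (norm_nonneg _))⟩⟩,
    hsq.mono' ((Nice.aesm hL).pow 2) (Eventually.of_forall fun z => ?_),
    hsq.mono' ((Nice.aesm_fderiv hL).norm.pow 2) ?_⟩
  · rw [norm_pow]
    exact (pow_le_pow_left₀ (norm_nonneg _) (b1 z) 2).trans (hX2 z)
  · filter_upwards [ae_restrict_mem (measurableSet_strip .space T)] with z hz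
    rw [norm_pow, norm_norm]
    exact (pow_le_pow_left₀ (norm_nonneg _) (b2 z hz) 2).trans (hX2 z)

namespace IsTestTriple

variable {dom : Dom} {c : Params} {q : Triple}

theorem per_proj {f : E → E} (hf : dom.Per f) (i : Fin 3) : dom.Per (fun x => f x i) := by
  cases dom
  · intro j x
    have a1 : f (x + unitVec j) = f x := hf j x
    simp only [a1]
  · trivial

theorem nice_proj {f : ℝ → E → E}
    (hf : ContDiffOn ℝ 1 (fun z : ℝ × E => f z.1 z.2) (Icc 0 c.T ×ˢ univ))
    (per : ∀ t ∈ Icc 0 c.T, dom.Per (f t)) (hd : dom = .space → IsDecaying c.T f) (i : Fin 3) :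
    Nice dom c.T (fun z => f z.1 z.2 i) := by
  cases dom
  · refine Nice.of_torus c.T_pos ?_ fun t ht => per_proj (per t ht) i
    exact (EuclideanSpace.proj (𝕜 := ℝ) i).contDiff.comp_contDiffOn hf
  · exact Nice.of_decaying (EuclideanSpace.proj (𝕜 := ℝ) i) hf (hd rfl)

theorem nice_V (h : IsTestTriple dom c q) (i : Fin 3) : Nice dom c.T (fun z => q.V z.1 z.2 i) :=
  nice_proj h.smooth_V (fun t ht => (h.per t ht).2.1) (fun hd => (h.decay hd).2.1) i

theorem nice_W (h : IsTestTriple dom c q) (i : Fin 3) : Nice dom c.T (fun z => q.W z.1 z.2 i) :=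
  nice_proj h.smooth_W (fun t ht => (h.per t ht).2.2) (fun hd => (h.decay hd).2.2) i

theorem nice_U (h : IsTestTriple dom c q) (i : Fin 3) : Nice dom c.T (fun z => q.U c z.1 z.2 i) := by
  simpa [Triple.U] using (h.nice_V i).sub ((h.nice_W i).const_mul c.β)

theorem smooth_U (h : IsTestTriple dom c q) :
    ContDiffOn ℝ 1 (fun z : ℝ × E => q.U c z.1 z.2) (Icc 0 c.T ×ˢ univ) :=
  h.smooth_V.sub (h.smooth_W.const_smul c.β)

theorem smooth_sub_r (h : IsTestTriple dom c q) :
    ContDiffOn ℝ 1 (fun z : ℝ × E => q.r z.1 z.2 - c.ρbar) (Icc 0 c.T ×ˢ univ) :=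
  h.smooth_r.sub contDiffOn_const

theorem nice_sub_r (h : IsTestTriple dom c q) :
    Nice dom c.T (fun z => q.r z.1 z.2 - c.ρbar) := by
  cases dom
  · exact Nice.of_torus c.T_pos h.smooth_sub_r fun t ht =>
      Nice.per_map₂ (F := fun a _ => a - c.ρbar) (h.per t ht).1 (h.per t ht).1
  · exact Nice.of_decaying (f := fun t x => q.r t x - c.ρbar) (ContinuousLinearMap.id ℝ ℝ)
      h.smooth_sub_r (h.decay rfl).1

/-- Positive upper and lower bounds for `r`. -/
theorem exists_bounds (h : IsTestTriple dom c q) : ∃ r₀ r₁ : ℝ, 0 < r₀ ∧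
    c.ρbar ∈ Icc r₀ r₁ ∧ ∀ t ∈ Icc 0 c.T, ∀ x ∈ dom.cell, q.r t x ∈ Icc r₀ r₁ := by
  have hcont := h.smooth_r.continuousOn
  -- bounds on compact sets
  have hcomp : ∀ R : ℝ, ∃ r₀ > 0, ∀ t ∈ Icc 0 c.T, ∀ x : E, ‖x‖ ≤ R → r₀ ≤ q.r t x := by
    intro R
    have hK : IsCompact (Icc 0 c.T ×ˢ Metric.closedBall (0 : E) R) :=
      isCompact_Icc.prod (isCompact_closedBall _ _)
    rcases (Icc 0 c.T ×ˢ Metric.closedBall (0 : E) R).eq_empty_or_nonempty with h0 | h0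
    · refine ⟨1, one_pos, fun t ht x hx => ?_⟩
      have : (t, x) ∈ Icc 0 c.T ×ˢ Metric.closedBall (0 : E) R := ⟨ht, by simpa using hx⟩
      rw [h0] at this
      exact this.elim
    · obtain ⟨z, hz, hmin⟩ := hK.exists_isMinOn h0
        (hcont.mono (prod_mono_right (subset_univ _)))
      exact ⟨q.r z.1 z.2, h.pos z.1 hz.1 z.2, fun t ht x hx =>
        hmin (show (t, x) ∈ Icc 0 c.T ×ˢ Metric.closedBall (0 : E) R from ⟨ht, by simpa using hx⟩)⟩
  have hlow : ∃ r₀ > 0, ∀ t ∈ Icc 0 c.T, ∀ x ∈ dom.cell, r₀ ≤ q.r t x := by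
    cases dom
    · obtain ⟨r₀, h0, h1⟩ := hcomp 2
      exact ⟨r₀, h0, fun t ht x hx => h1 t ht x (by simpa using cell_torus_subset hx)⟩
    · obtain ⟨C, hC⟩ := (h.decay rfl).1.bdd
      have hC0 : ∀ t ∈ Ioo 0 c.T, ∀ x, ‖dt q.r t x‖ ≤ |C| := fun t ht x => by
        have := (hC t ht x).2.1
        rw [show dt (fun t x => q.r t x - c.ρbar) t x = dt q.r t x from deriv_sub_const _] at this
        exact this.trans (le_abs_self _)
      -- The limit at infinity is assumed for each time separately. The bounded time derivative
      -- makes `r` Lipschitz in time uniformly in `x`, which yields uniformity.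
      have hlip : ∀ x, ∀ s ∈ Icc 0 c.T, ∀ t ∈ Icc 0 c.T, |q.r t x - q.r s x| ≤ |C| * |t - s| := by
        intro x
        have key : ∀ s ∈ Icc 0 c.T, ∀ t ∈ Icc 0 c.T, s < t →
            |q.r t x - q.r s x| ≤ |C| * |t - s| := by
          intro s hs t ht hst
          have hsub : Ioo s t ⊆ Ioo 0 c.T := fun y hy => ⟨hs.1.trans_lt hy.1, hy.2.trans_le ht.2⟩
          have hc : ContinuousOn (fun t => q.r t x) (Icc s t) :=
            hcont.comp (f := fun t => (t, x)) (by fun_prop)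
              fun y hy => ⟨⟨hs.1.trans hy.1, hy.2.trans ht.2⟩, mem_univ _⟩
          have hdif : ∀ y ∈ Ioo s t, HasDerivAt (fun t => q.r t x) (dt q.r y x) y := fun y hy => by
            have h1 : HasDerivAt (fun s : ℝ => (s, x)) ((1 : ℝ), (0 : E)) y :=
              (hasDerivAt_id y).prodMk (hasDerivAt_const y x)
            exact ((differentiableAt_strip h.smooth_r (z := (y, x)) (hsub hy)).hasFDerivAt.comp_hasDerivAt
              y h1).differentiableAt.hasDerivAt
          obtain ⟨y, hy, e⟩ := exists_hasDerivAt_eq_slope _ _ hst hc hdif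
          have e' : q.r t x - q.r s x = dt q.r y x * (t - s) := by
            rw [e]; have : t - s ≠ 0 := by linarith
            field_simp
          rw [e', abs_mul]
          exact mul_le_mul_of_nonneg_right (hC0 y (hsub hy) x) (abs_nonneg _)
        intro s hs t ht
        rcases lt_trichotomy s t with h1 | h1 | h1
        · exact key s hs t ht h1
        · simp [h1]
        · rw [abs_sub_comm, abs_sub_comm t s]; exact key t ht s hs h1
      -- Compactness of `[0,T]`: near infinity `r > ¾ρbar` at one time, and at neighbouring times it
      -- changes by less than `¼ρbar`.
      have hfar : ∃ R : ℝ, ∀ t ∈ Icc 0 c.T, ∀ x : E, R ≤ ‖x‖ → c.ρbar / 2 ≤ q.r t x := by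
        refine (isCompact_Icc (a := (0 : ℝ)) (b := c.T)).induction_on
          (p := fun S => ∃ R : ℝ, ∀ t ∈ S, ∀ x : E, R ≤ ‖x‖ → c.ρbar / 2 ≤ q.r t x) ?_ ?_ ?_ ?_
        · exact ⟨0, fun t ht => ht.elim⟩
        · exact fun S S' hS ⟨R, hR⟩ => ⟨R, fun t ht => hR t (hS ht)⟩
        · rintro S S' ⟨R, hR⟩ ⟨R', hR'⟩
          refine ⟨max R R', fun t ht x hx => ?_⟩
          rcases ht with ht | ht
          · exact hR t ht x ((le_max_left _ _).trans hx)
          · exact hR' t ht x ((le_max_right _ _).trans hx)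
        · intro t ht
          have h1 := h.far rfl t ht
          have h2 : ∀ᶠ x in cocompact E, c.ρbar * (3 / 4) < q.r t x :=
            h1.eventually_const_lt (by linarith [c.ρbar_pos])
          rw [← Metric.cobounded_eq_cocompact, ← comap_norm_atTop, eventually_comap] at h2
          obtain ⟨R, hR⟩ := eventually_atTop.1 h2
          refine ⟨Icc 0 c.T ∩ {s | |C| * |s - t| < c.ρbar / 4}, ?_, R, fun s hs x hx => ?_⟩
          · refine inter_mem self_mem_nhdsWithin (mem_nhdsWithin_of_mem_nhds ?_)
            refine (isOpen_lt (by fun_prop) continuous_const).mem_nhds ?_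
            simp [c.ρbar_pos]
          · have h3 := hR ‖x‖ hx x rfl
            have h4 := hlip x t ht s hs.1
            have h5 : |C| * |s - t| < c.ρbar / 4 := hs.2
            have := (abs_le.1 h4).1
            linarith
      obtain ⟨R, hR⟩ := hfar
      obtain ⟨r₀, h0, h1⟩ := hcomp R
      refine ⟨min r₀ (c.ρbar / 2), lt_min h0 (by linarith [c.ρbar_pos]), fun t ht x _ => ?_⟩
      rcases le_total ‖x‖ R with h2 | h2
      · exact (min_le_left _ _).trans (h1 t ht x h2)
      · exact (min_le_right _ _).trans (hR t ht x h2)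
  obtain ⟨r₀, h0, h1⟩ := hlow
  obtain ⟨C, hC⟩ := h.nice_sub_r.bdd
  refine ⟨min r₀ c.ρbar, max (c.ρbar + C) c.ρbar, lt_min h0 c.ρbar_pos,
    ⟨min_le_right _ _, le_max_right _ _⟩, fun t ht x hx =>
      ⟨(min_le_left _ _).trans (h1 t ht x hx), le_max_of_le_left ?_⟩⟩
  have := Nice.bound_Icc c.T_pos h.smooth_sub_r (x := x) (fun t ht => (hC (t, x) ⟨ht, hx⟩).1) ht
  have := (abs_le.1 (Real.norm_eq_abs _ ▸ this)).2
  simp only at this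
  linarith

theorem smooth_comp_r (h : IsTestTriple dom c q) {F : ℝ → ℝ} (hF : ContDiffOn ℝ 1 F (Ioi 0)) :
    ContDiffOn ℝ 1 (fun z : ℝ × E => F (q.r z.1 z.2)) (Icc 0 c.T ×ˢ univ) :=
  hF.comp h.smooth_r fun z hz => h.pos z.1 hz.1 z.2

theorem fderiv_comp_r (h : IsTestTriple dom c q) {F : ℝ → ℝ} {F' : ℝ} {z : ℝ × E}
    (hz : z.1 ∈ Ioo 0 c.T) (hF : HasDerivAt F F' (q.r z.1 z.2)) :
    fderiv ℝ (fun z : ℝ × E => F (q.r z.1 z.2)) z =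
      F' • fderiv ℝ (fun z : ℝ × E => q.r z.1 z.2) z := by
  have h1 := (differentiableAt_strip h.smooth_r hz).hasFDerivAt
  exact (hF.comp_hasFDerivAt z h1).fderiv

/-- The values of `r` and `ρbar` lie in a common compact interval of positive numbers, on which `F'`
is bounded. By the mean value theorem and the chain rule the difference is controlled by `r - ρbar`
and its derivative. -/
theorem nice_comp_r (h : IsTestTriple dom c q) {F F' : ℝ → ℝ}
    (hd : ∀ r, 0 < r → HasDerivAt F (F' r) r) (hc : ContinuousOn F' (Ioi 0)) :
    Nice dom c.T (fun z => F (q.r z.1 z.2) - F c.ρbar) := by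
  have hF : ContDiffOn ℝ 1 F (Ioi 0) := by
    refine (contDiffOn_one_iff_derivWithin (uniqueDiffOn_Ioi 0)).2
      ⟨fun r hr => (hd r hr).differentiableAt.differentiableWithinAt, hc.congr fun r hr => ?_⟩
    exact (hd r hr).hasDerivWithinAt.derivWithin (uniqueDiffOn_Ioi 0 r hr)
  have hs := (h.smooth_comp_r hF).sub (contDiffOn_const (c := F c.ρbar))
  have hp : ∀ t ∈ Icc 0 c.T, dom.Per fun x => F (q.r t x) - F c.ρbar := fun t ht =>
    Nice.per_map₂ (F := fun a _ => F a - F c.ρbar) (h.per t ht).1 (h.per t ht).1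
  obtain ⟨r₀, r₁, h0, hb, hr⟩ := h.exists_bounds
  have hsub : Icc r₀ r₁ ⊆ Ioi 0 := fun y hy => h0.trans_le hy.1
  obtain ⟨M, hM⟩ := (isCompact_Icc (a := r₀) (b := r₁)).exists_bound_of_continuousOn (hc.mono hsub)
  have hM0 : 0 ≤ M := (norm_nonneg _).trans (hM _ hb)
  have hn := h.nice_sub_r
  obtain ⟨C, hC⟩ := hn.bdd
  refine Nice.of_good (X := fun z => M * (‖q.r z.1 z.2 - c.ρbar‖ +
      ‖fderiv ℝ (fun z : ℝ × E => q.r z.1 z.2 - c.ρbar) z‖)) hs hp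
    ((hn.good_norm.add hn.good_norm_fderiv).const_mul M) ⟨M * (C + C), fun z hz =>
      mul_le_mul_of_nonneg_left (add_le_add (hC z hz).1 (hC z hz).2) hM0⟩ ?_ ?_
  · intro z hz
    have := (convex_Icc r₀ r₁).norm_image_sub_le_of_norm_hasDerivWithin_le
      (fun y hy => (hd y (hsub hy)).hasDerivWithinAt) hM hb (hr z.1 (Ioo_subset_Icc_self hz.1) z.2 hz.2)
    exact this.trans (mul_le_mul_of_nonneg_left (le_add_of_nonneg_right (norm_nonneg _)) hM0)
  · intro z hz
    have hrz := hr z.1 (Ioo_subset_Icc_self hz.1) z.2 hz.2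
    rw [fderiv_sub_const, fderiv_sub_const, h.fderiv_comp_r hz.1 (hd _ (hsub hrz)), norm_smul]
    exact mul_le_mul (hM _ hrz) (le_add_of_nonneg_left (norm_nonneg _)) (norm_nonneg _) hM0

end IsTestTriple

end
end KEntropy

namespace KEntropy
noncomputable section
open scoped ContDiff ENNReal

/-! ### Integrability of the fields of a solution -/

/-- Lebesgue measure on `(0,T) × Ω`. -/
abbrev strip (dom : Dom) (T : ℝ) : Measure (ℝ × E) := volume.restrict (Ioo 0 T ×ˢ dom.cell)

section Abstract

variable {α : Type*} {mα : MeasurableSpace α} {μ : Measure α}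

/-- The distance of the density from its far-field value, in the variable `ϱ ^ (γ/2)`. -/
def Params.eta (c : Params) (s : ℝ) : ℝ := s ^ (c.γ / 2) - c.ρbar ^ (c.γ / 2)

theorem aesm_rpow {ρ : α → ℝ} (hm : AEStronglyMeasurable ρ μ) {g : ℝ} (hg : 0 ≤ g) :
    AEStronglyMeasurable (fun z => ρ z ^ g) μ :=
  (Real.continuous_rpow_const hg).comp_aestronglyMeasurable hm

/-- On the torus the measure is finite and the crude estimate `(x - y)² ≤ 2x² + 2y²` suffices; on
the whole space the coercivity `relP_ge` is needed. After this lemma, the integrability estimates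
based on `Params.eta` no longer need to distinguish the domains. -/
theorem memLp_eta {dom : Dom} {c : Params} {ρ : α → ℝ} (hfin : dom = .torus → IsFiniteMeasure μ)
    (hm : AEStronglyMeasurable ρ μ) (h0 : ∀ z, 0 ≤ ρ z)
    (hi : Integrable (fun z => c.pot dom (ρ z)) μ) : MemLp (fun z => c.eta (ρ z)) 2 μ := by
  have hηm : AEStronglyMeasurable (fun z => c.eta (ρ z)) μ :=
    (aesm_rpow hm (by linarith [c.γ_pos])).sub aestronglyMeasurable_const
  rw [memLp_two_iff_integrable_sq hηm]
  cases dom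
  · have := hfin rfl
    have hi2 : Integrable (fun z => 2 * ((c.γ - 1) / c.a * c.P (ρ z)) +
        2 * c.ρbar ^ c.γ) μ := ((hi.const_mul _).const_mul _).add (integrable_const _)
    refine hi2.mono' (hηm.pow 2) (Eventually.of_forall fun z => ?_)
    have e : (c.γ - 1) / c.a * c.P (ρ z) = ρ z ^ c.γ := by
      have := c.γ_sub_pos.ne'
      have := c.a_pos.ne'
      simp only [Params.P]; field_simp
    rw [e, ← c.rpow_half_sq (h0 z), ← c.rpow_half_sq c.ρbar_pos.le, Real.norm_of_nonneg (sq_nonneg _)]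
    simp only [Params.eta]
    nlinarith [sq_nonneg (ρ z ^ (c.γ / 2) + c.ρbar ^ (c.γ / 2))]
  · refine (hi.const_mul (1 / c.coer)).mono' (hηm.pow 2) (Eventually.of_forall fun z => ?_)
    rw [Real.norm_of_nonneg (sq_nonneg _), one_div, inv_mul_eq_div, le_div_iff₀ c.coer_pos,
      mul_comm]
    exact c.relP_ge (h0 z) c.ρbar_pos

theorem tame_sub_rho {c : Params} {ρ : α → ℝ} (hm : AEStronglyMeasurable ρ μ) (h0 : ∀ z, 0 ≤ ρ z)
    (hη : MemLp (fun z => c.eta (ρ z)) 2 μ) : Tame μ (fun z => ρ z - c.ρbar) := by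
  obtain ⟨C, -, hC⟩ := c.exists_bounds c.ρbar_pos
  exact Tame.of_le (hm.sub aestronglyMeasurable_const) hη
    (Eventually.of_forall fun z => (hC _ (h0 z)).1)

theorem tame_sub_p {c : Params} {ρ : α → ℝ} (hm : AEStronglyMeasurable ρ μ) (h0 : ∀ z, 0 ≤ ρ z)
    (hη : MemLp (fun z => c.eta (ρ z)) 2 μ) : Tame μ (fun z => c.p (ρ z) - c.p c.ρbar) := by
  obtain ⟨C, -, hC⟩ := c.exists_bounds c.ρbar_pos
  exact Tame.of_le (((aesm_rpow hm c.γ_pos.le).const_mul _).sub aestronglyMeasurable_const) hη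
    (Eventually.of_forall fun z => (hC _ (h0 z)).2)

theorem memLp_sqrt_comp {ρ : α → ℝ} {v : α → E} (hm : AEStronglyMeasurable ρ μ)
    (hv : AEStronglyMeasurable v μ) (h0 : ∀ z, 0 ≤ ρ z)
    (hi : Integrable (fun z => ρ z * ‖v z‖ ^ 2) μ) (i : Fin 3) :
    MemLp (fun z => √(ρ z) * v z i) 2 μ := by
  have hvi : AEStronglyMeasurable (fun z => v z i) μ :=
    (EuclideanSpace.proj (𝕜 := ℝ) i).continuous.comp_aestronglyMeasurable hv
  have hm2 := (Real.continuous_sqrt.comp_aestronglyMeasurable hm).mul hvi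
  refine (memLp_two_iff_integrable_sq hm2).2 (hi.mono' (hm2.pow 2) (Eventually.of_forall fun z => ?_))
  simp only [Pi.mul_apply]
  rw [mul_pow, Real.sq_sqrt (h0 z), Real.norm_of_nonneg (mul_nonneg (h0 z) (sq_nonneg _))]
  refine mul_le_mul_of_nonneg_left ?_ (h0 z)
  have h1 : |v z i| ≤ ‖v z‖ := by simpa using PiLp.norm_apply_le (v z) i
  rw [← sq_abs]
  exact pow_le_pow_left₀ (abs_nonneg _) h1 2

theorem memLp_entry {S : α → Mat} (hS : AEStronglyMeasurable S μ)
    (hi : Integrable (fun z => ddot (S z) (S z)) μ) (i j : Fin 3) :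
    MemLp (fun z => S z i j) 2 μ := by
  have hm : AEStronglyMeasurable (fun z => S z i j) μ :=
    ((continuous_apply_apply i j : Continuous fun A : Mat => A i j)).comp_aestronglyMeasurable hS
  refine (memLp_two_iff_integrable_sq hm).2 (hi.mono' (hm.pow 2) (Eventually.of_forall fun z => ?_))
  rw [Real.norm_of_nonneg (sq_nonneg _), ddot]
  have h1 : S z i j ^ 2 ≤ ∑ j, S z i j * S z i j := by
    rw [sq]
    exact Finset.single_le_sum (f := fun j => S z i j * S z i j)
      (fun j _ => mul_self_nonneg _) (Finset.mem_univ j)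
  exact h1.trans (Finset.single_le_sum (f := fun i => ∑ j, S z i j * S z i j)
    (fun i _ => Finset.sum_nonneg fun j _ => mul_self_nonneg _) (Finset.mem_univ i))

end Abstract

theorem LInfL1.integrable {dom : Dom} {T : ℝ} {f : ℝ → E → ℝ} (h : LInfL1 dom T f)
    (hm : AEStronglyMeasurable (fun z : ℝ × E => f z.1 z.2) (strip dom T)) :
    Integrable (fun z : ℝ × E => f z.1 z.2) (strip dom T) := by
  obtain ⟨C, hC⟩ := h
  rw [strip, volume_restrict_prod] at hm ⊢
  rw [integrable_prod_iff hm]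
  refine ⟨hC.mono fun t ht => ht.1, ?_⟩
  have hfin : IsFiniteMeasure (volume.restrict (Ioo 0 T)) := ⟨by simp⟩
  refine (integrable_const C).mono' hm.norm.integral_prod_right' (hC.mono fun t ht => ?_)
  rw [Real.norm_of_nonneg (integral_nonneg fun _ => norm_nonneg _)]
  exact ht.2

theorem isFiniteMeasure_torus_strip {dom : Dom} (T : ℝ) (h : dom = .torus) :
    IsFiniteMeasure (strip dom T) := by
  subst h
  exact ⟨by rw [strip, Measure.restrict_apply_univ]; exact volume_torus_strip_lt_top T⟩

theorem isFiniteMeasure_torus_cell {dom : Dom} (h : dom = .torus) :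
    IsFiniteMeasure ((volume : Measure E).restrict dom.cell) := by
  subst h
  exact ⟨by
    rw [Measure.restrict_apply_univ]
    exact (measure_mono cell_torus_subset).trans_lt measure_closedBall_lt_top⟩

theorem StMeas.strip {F : Type*} [TopologicalSpace F] {dom : Dom} {T : ℝ} {f : ℝ → E → F}
    (h : StMeas T f) : AEStronglyMeasurable (fun z : ℝ × E => f z.1 z.2) (strip dom T) :=
  AEStronglyMeasurable.mono_set (prod_mono_right (subset_univ _)) h

/-- Multipliers are locally integrable. -/
theorem Tame.integrableOn_ball {dom : Dom} {T : ℝ} {Y : ℝ × E → ℝ} (h : Tame (strip dom T) Y)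
    (R : ℝ) : IntegrableOn Y (Ioo 0 T ×ˢ (dom.cell ∩ Metric.closedBall 0 R)) := by
  set B : Set (ℝ × E) := univ ×ˢ Metric.closedBall 0 R
  have hB : MeasurableSet B := MeasurableSet.univ.prod measurableSet_closedBall
  have e : Ioo 0 T ×ˢ (dom.cell ∩ Metric.closedBall (0 : E) R) = (Ioo 0 T ×ˢ dom.cell) ∩ B := by
    ext z; simp only [B, mem_prod, mem_inter_iff, mem_univ, true_and, and_assoc]
  have hfin : strip dom T B < ⊤ := by
    rw [Measure.restrict_apply hB, inter_comm, ← e]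
    exact measure_local_lt_top dom T R
  have hg : Good (strip dom T) (B.indicator fun _ => (1 : ℝ)) :=
    ⟨memLp_indicator_const _ hB _ (Or.inr hfin.ne), memLp_indicator_const _ hB _ (Or.inr hfin.ne)⟩
  have h1 := h _ hg
  have e2 : (fun z => Y z * B.indicator (fun _ => (1 : ℝ)) z) = B.indicator Y := by
    ext z; by_cases hz : z ∈ B <;> simp [hz]
  rw [e2, integrable_indicator_iff hB, IntegrableOn, Measure.restrict_restrict hB, inter_comm,
    ← e] at h1
  exact h1

theorem Tame.integrableOn_cell_ball {dom : Dom} {Y : E → ℝ}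
    (h : Tame (volume.restrict dom.cell) Y) (R : ℝ) :
    IntegrableOn Y (dom.cell ∩ Metric.closedBall 0 R) := by
  set B : Set E := Metric.closedBall 0 R
  have hB : MeasurableSet B := measurableSet_closedBall
  have hfin : volume.restrict dom.cell B < ⊤ :=
    (Measure.restrict_apply_le _ _).trans_lt measure_closedBall_lt_top
  have hg : Good (volume.restrict dom.cell) (B.indicator fun _ => (1 : ℝ)) :=
    ⟨memLp_indicator_const _ hB _ (Or.inr hfin.ne), memLp_indicator_const _ hB _ (Or.inr hfin.ne)⟩
  have h1 := h _ hg
  have e2 : (fun z => Y z * B.indicator (fun _ => (1 : ℝ)) z) = B.indicator Y := by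
    ext z; by_cases hz : z ∈ B <;> simp [hz]
  rw [e2, integrable_indicator_iff hB, IntegrableOn, Measure.restrict_restrict hB, inter_comm] at h1
  exact h1

theorem nice_good_gradient {dom : Dom} {G : E → ℝ} (hG : IsPotential dom G) (T : ℝ) (i : Fin 3) :
    Good (strip dom T) (fun z => gradient G z.2 i) := by
  have hc : Continuous (gradient G) :=
    (InnerProductSpace.toDual ℝ E).symm.continuous.comp (hG.smooth.continuous_fderiv one_ne_zero)
  have hci : Continuous (fun z : ℝ × E => gradient G z.2 i) :=
    (EuclideanSpace.proj (𝕜 := ℝ) i).continuous.comp (hc.comp continuous_snd)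
  have hle : ∀ x, ‖gradient G x i‖ ≤ ‖gradient G x‖ := fun x => PiLp.norm_apply_le (gradient G x) i
  cases dom
  · obtain ⟨M, hM⟩ := (isCompact_closedBall (0 : E) 2).exists_bound_of_continuousOn hc.continuousOn
    have := isFiniteMeasure_torus_strip (dom := .torus) T rfl
    have hb : ∀ᵐ z ∂(strip .torus T), ‖gradient G z.2 i‖ ≤ M := by
      filter_upwards [ae_restrict_mem (measurableSet_strip .torus T)] with z hz
      exact (hle _).trans (hM _ (cell_torus_subset hz.2))
    exact ⟨MemLp.of_bound hci.aestronglyMeasurable M hb, MemLp.of_bound hci.aestronglyMeasurable M hb⟩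
  · obtain ⟨⟨M, hM⟩, hsq⟩ := hG.decay rfl
    refine Good.of_bounded hci.aestronglyMeasurable (C := M)
      (Eventually.of_forall fun z => (hle _).trans (hM _)) ?_
    have hfin : IsFiniteMeasure (volume.restrict (Ioo 0 T)) := ⟨by simp⟩
    have h1 : Integrable (fun z : ℝ × E => ‖gradient G z.2‖ ^ 2) (strip .space T) := by
      rw [strip, volume_restrict_prod]
      simp only [Dom.cell, Measure.restrict_univ]
      exact hsq.comp_snd _
    refine h1.mono' (hci.pow 2).aestronglyMeasurable (Eventually.of_forall fun z => ?_)
    rw [norm_pow]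
    exact pow_le_pow_left₀ (norm_nonneg _) (hle _) 2

namespace IsSolution

variable {dom : Dom} {c : Params} {G : E → ℝ} {d : Data} {s : Fields}

theorem aesm_ρ (h : IsSolution dom c G d s) :
    AEStronglyMeasurable (fun z : ℝ × E => s.ρ z.1 z.2) (strip dom c.T) := h.meas.1.strip

theorem integrable_pot (h : IsSolution dom c G d s) :
    Integrable (fun z : ℝ × E => c.pot dom (s.ρ z.1 z.2)) (strip dom c.T) := by
  refine h.reg_pot.integrable ?_
  have := aesm_rpow h.aesm_ρ c.γ_pos.le
  cases dom
  · exact this.const_mul _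
  · exact ((this.const_mul _).sub aestronglyMeasurable_const).sub
      ((h.aesm_ρ.sub aestronglyMeasurable_const).const_mul _)

theorem memLp_eta (h : IsSolution dom c G d s) :
    MemLp (fun z : ℝ × E => c.eta (s.ρ z.1 z.2)) 2 (strip dom c.T) :=
  KEntropy.memLp_eta (isFiniteMeasure_torus_strip c.T) h.aesm_ρ (fun _ => h.nonneg _ _)
    h.integrable_pot

theorem tame_ρ (h : IsSolution dom c G d s) :
    Tame (strip dom c.T) (fun z => s.ρ z.1 z.2 - c.ρbar) :=
  tame_sub_rho h.aesm_ρ (fun _ => h.nonneg _ _) h.memLp_eta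

theorem tame_p (h : IsSolution dom c G d s) :
    Tame (strip dom c.T) (fun z => c.p (s.ρ z.1 z.2) - c.p c.ρbar) :=
  tame_sub_p h.aesm_ρ (fun _ => h.nonneg _ _) h.memLp_eta

theorem memLp_sqrt_good (h : IsSolution dom c G d s) {X : ℝ × E → ℝ} (hX : Good (strip dom c.T) X) :
    MemLp (fun z => √(s.ρ z.1 z.2) * X z) 2 (strip dom c.T) :=
  hX.sqrt_mul h.aesm_ρ (fun _ => h.nonneg _ _) h.tame_ρ

theorem integrable_kin {v : ℝ → E → E} (h : IsSolution dom c G d s) (hv : StMeas c.T v)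
    (hi : LInfL1 dom c.T (fun t x => s.ρ t x * ‖v t x‖ ^ 2)) :
    Integrable (fun z : ℝ × E => s.ρ z.1 z.2 * ‖v z.1 z.2‖ ^ 2) (strip dom c.T) :=
  hi.integrable (h.aesm_ρ.mul (hv.strip.norm.pow 2))

theorem memLp_v (h : IsSolution dom c G d s) (i : Fin 3) :
    MemLp (fun z => √(s.ρ z.1 z.2) * s.v z.1 z.2 i) 2 (strip dom c.T) :=
  memLp_sqrt_comp h.aesm_ρ h.meas.2.1.strip (fun _ => h.nonneg _ _)
    (h.integrable_kin h.meas.2.1 h.reg_v) i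

theorem memLp_w (h : IsSolution dom c G d s) (i : Fin 3) :
    MemLp (fun z => √(s.ρ z.1 z.2) * s.w z.1 z.2 i) 2 (strip dom c.T) :=
  memLp_sqrt_comp h.aesm_ρ h.meas.2.2.1.strip (fun _ => h.nonneg _ _)
    (h.integrable_kin h.meas.2.2.1 h.reg_w) i

theorem memLp_l (h : IsSolution dom c G d s) (i : Fin 3) :
    MemLp (fun z => √(s.ρ z.1 z.2) * s.l z.1 z.2 i) 2 (strip dom c.T) :=
  memLp_sqrt_comp h.aesm_ρ h.meas.2.2.2.1.strip (fun _ => h.nonneg _ _)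
    (h.integrable_kin h.meas.2.2.2.1 h.reg_l) i

theorem memLp_u (h : IsSolution dom c G d s) (i : Fin 3) :
    MemLp (fun z => √(s.ρ z.1 z.2) * s.u c z.1 z.2 i) 2 (strip dom c.T) := by
  have := (h.memLp_v i).sub ((h.memLp_w i).const_mul c.β)
  refine this.congr_norm ?_ (Eventually.of_forall fun z => ?_)
  · refine this.1.congr (Eventually.of_forall fun z => ?_)
    simp [Fields.u]; ring
  · simp only [Pi.sub_apply]; congr 1; simp [Fields.u]; ring

theorem memLp_S (h : IsSolution dom c G d s) (i j : Fin 3) :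
    MemLp (fun z => s.S z.1 z.2 i j) 2 (strip dom c.T) :=
  memLp_entry h.meas.2.2.2.2.1.strip h.reg_S i j

theorem memLp_A (h : IsSolution dom c G d s) (i j : Fin 3) :
    MemLp (fun z => s.A z.1 z.2 i j) 2 (strip dom c.T) :=
  memLp_entry h.meas.2.2.2.2.2.strip h.reg_A i j

theorem memLp_pow_l (h : IsSolution dom c G d s) (i : Fin 3) :
    MemLp (fun z => s.ρ z.1 z.2 ^ (c.γ / 2) * s.l z.1 z.2 i) 2 (strip dom c.T) := by
  have hli : AEStronglyMeasurable (fun z : ℝ × E => s.l z.1 z.2 i) (strip dom c.T) :=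
    (EuclideanSpace.proj (𝕜 := ℝ) i).continuous.comp_aestronglyMeasurable h.meas.2.2.2.1.strip
  have hm : AEStronglyMeasurable (fun z => s.ρ z.1 z.2 ^ (c.γ / 2) * s.l z.1 z.2 i) (strip dom c.T) :=
    (aesm_rpow h.aesm_ρ (by linarith [c.γ_pos])).mul hli
  have hg := c.γ_pos
  refine (memLp_two_iff_integrable_sq hm).2
    ((Integrable.const_mul h.reg_grad_pow ((2 / c.γ) ^ 2)).mono' (hm.pow 2)
      (Eventually.of_forall fun z => ?_))
  have h1 : |s.l z.1 z.2 i| ≤ ‖s.l z.1 z.2‖ := by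
    simpa using PiLp.norm_apply_le (s.l z.1 z.2) i
  have h2 : (0 : ℝ) ≤ s.ρ z.1 z.2 ^ (c.γ / 2) := Real.rpow_nonneg (h.nonneg _ _) _
  beta_reduce
  rw [Real.norm_of_nonneg (sq_nonneg _), norm_smul, Real.norm_of_nonneg (by positivity),
    ← mul_pow, ← sq_abs, abs_mul, abs_of_nonneg h2]
  refine pow_le_pow_left₀ (by positivity) ?_ 2
  calc s.ρ z.1 z.2 ^ (c.γ / 2) * |s.l z.1 z.2 i| ≤ s.ρ z.1 z.2 ^ (c.γ / 2) * ‖s.l z.1 z.2‖ :=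
        mul_le_mul_of_nonneg_left h1 h2
    _ = _ := by field_simp

/-- The square is `ϱ^γ X²`: the deviation of `ϱ^γ` from its far-field value is a multiplier, and
`X²` is both integrable and in `Good`. -/
theorem memLp_pow_good (h : IsSolution dom c G d s) {X : ℝ × E → ℝ} (hX : Good (strip dom c.T) X) :
    MemLp (fun z => s.ρ z.1 z.2 ^ (c.γ / 2) * X z) 2 (strip dom c.T) := by
  have hm : AEStronglyMeasurable (fun z => s.ρ z.1 z.2 ^ (c.γ / 2) * X z) (strip dom c.T) :=
    (aesm_rpow h.aesm_ρ (by linarith [c.γ_pos])).mul hX.1.1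
  refine (memLp_two_iff_integrable_sq hm).2
    (((h.tame_p _ ((hX.mul hX).const_mul (1 / c.a))).add
      (hX.1.integrable_sq.const_mul (c.ρbar ^ c.γ))).congr (Eventually.of_forall fun z => ?_))
  have := c.a_pos.ne'
  simp only [mul_pow, c.rpow_half_sq (h.nonneg z.1 z.2), Pi.add_apply, Params.p]
  field_simp
  ring

/-- `√ϱ a` is a multiplier if `a` is square integrable. -/
theorem tame_sqrt_mul (h : IsSolution dom c G d s) {a : ℝ × E → ℝ} (ha : MemLp a 2 (strip dom c.T)) :
    Tame (strip dom c.T) (fun z => √(s.ρ z.1 z.2) * a z) := fun X hX => by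
  refine (integrable_mul_L2 ha (h.memLp_sqrt_good hX)).congr (Eventually.of_forall fun z => ?_)
  simp only; ring

/-- Since `ϱ p'(ϱ) = aγ ϱ^(γ/2) ϱ^(γ/2)`, one factor joins `∇log ϱ` and the other the test function,
and both products are square integrable. -/
theorem tame_dp (h : IsSolution dom c G d s) (i : Fin 3) :
    Tame (strip dom c.T) (fun z => c.dp (s.ρ z.1 z.2) * s.ρ z.1 z.2 * s.l z.1 z.2 i) := fun X hX => by
  refine ((integrable_mul_L2 (h.memLp_pow_l i) (h.memLp_pow_good hX)).const_mul (c.a * c.γ)).congr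
    (Eventually.of_forall fun z => ?_)
  have h0 := h.nonneg z.1 z.2
  have e : s.ρ z.1 z.2 ^ (c.γ - 1) * s.ρ z.1 z.2 = s.ρ z.1 z.2 ^ (c.γ / 2) * s.ρ z.1 z.2 ^ (c.γ / 2) := by
    rw [← sq, c.rpow_half_sq h0]
    -- In the vacuum the law of exponents is not available; there both sides are zero.
    rcases h0.eq_or_lt with h1 | h1
    · rw [← h1, Real.zero_rpow c.γ_pos.ne']; simp
    · rw [Real.rpow_sub_one h1.ne']; field_simp
  simp only [Params.dp]
  linear_combination (-(c.a * c.γ) * s.l z.1 z.2 i * X z) * e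

end IsSolution

end
end KEntropy

namespace KEntropy
noncomputable section
open scoped ContDiff ENNReal

/-! ### Scalar weak equations satisfied by a solution -/

theorem sum_smul_unitVec (u : E) : ∑ j, u j • unitVec j = u := by
  ext i
  simp [unitVec, Fin.sum_univ_three]
  fin_cases i <;> simp

theorem fderiv_eq_sum {F : Type*} [NormedAddCommGroup F] [NormedSpace ℝ F] (L : E →L[ℝ] F) (u : E) :
    L u = ∑ j, u j • L (unitVec j) := by
  conv_lhs => rw [← sum_smul_unitVec u]
  simp [map_sum, map_smul]

theorem inner_gradient_eq (f : E → ℝ) (x u : E) :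
    inner ℝ u (gradient f x) = ∑ j, u j * pd j f x := by
  rw [real_inner_comm, gradient, InnerProductSpace.toDual_symm_apply, fderiv_eq_sum]
  rfl

theorem gradient_apply (f : E → ℝ) (x : E) (i : Fin 3) : gradient f x i = pd i f x := by
  have h := inner_gradient_eq f x (unitVec i)
  have h2 : inner ℝ (unitVec i) (gradient f x) = gradient f x i := by
    rw [unitVec, EuclideanSpace.inner_single_left]; simp
  rw [← h2, h]
  simp [unitVec]

theorem inner_eq_sum (u v : E) : inner ℝ u v = ∑ i, u i * v i := by
  simp [PiLp.inner_apply, mul_comm]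

theorem norm_sq_eq_sum (u : E) : ‖u‖ ^ 2 = ∑ i, u i * u i := by
  rw [← real_inner_self_eq_norm_sq, inner_eq_sum]

theorem pd_smul_unitVec {f : E → ℝ} {x : E} (hf : DifferentiableAt ℝ f x) (i j k : Fin 3) :
    pd j (fun y => f y • unitVec i) x k = if k = i then pd j f x else 0 := by
  have := (hf.hasFDerivAt.smul_const (unitVec i)).fderiv
  simp only [pd, this]
  simp [unitVec]

theorem dt_smul_unitVec {φ : ℝ → E → ℝ} {t : ℝ} {x : E}
    (hf : DifferentiableAt ℝ (fun s => φ s x) t) (i k : Fin 3) :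
    dt (fun t y => φ t y • unitVec i) t x k = if k = i then dt φ t x else 0 := by
  have := (hf.hasDerivAt.smul_const (unitVec i)).deriv
  simp only [dt, this]
  simp [unitVec]

theorem IsTest.smul_unitVec {dom : Dom} {T : ℝ} {φ : ℝ → E → ℝ} (h : IsTest dom T φ) (i : Fin 3) :
    IsTest dom T (fun t x => φ t x • unitVec i) where
  smooth := h.smooth.smul contDiff_const
  per := fun t => by
    have := h.per t
    cases dom
    · intro j x
      have a1 : φ t (x + unitVec j) = φ t x := this j x
      simp only [a1]
    · trivial
  time := by
    obtain ⟨T', h1, h2⟩ := h.time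
    exact ⟨T', h1, fun t x ht => by simp [h2 t x ht]⟩
  supp := fun hd => by
    obtain ⟨R, hR⟩ := h.supp hd
    exact ⟨R, fun t x hx => by simp [hR t x hx]⟩

namespace IsSolution

variable {dom : Dom} {c : Params} {G : E → ℝ} {d : Data} {s : Fields}

theorem tame_const_local {dom : Dom} {T : ℝ} (k : ℝ) (R : ℝ) :
    IntegrableOn (fun _ : ℝ × E => k) (Ioo 0 T ×ˢ (dom.cell ∩ Metric.closedBall 0 R)) :=
  integrableOn_const (measure_local_lt_top dom T R).ne

theorem local_ρ (h : IsSolution dom c G d s) (R : ℝ) :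
    IntegrableOn (fun z : ℝ × E => s.ρ z.1 z.2) (Ioo 0 c.T ×ˢ (dom.cell ∩ Metric.closedBall 0 R)) := by
  have := (h.tame_ρ.integrableOn_ball R).add (tame_const_local c.ρbar R)
  refine this.congr (Eventually.of_forall fun z => ?_)
  simp

theorem local_p (h : IsSolution dom c G d s) (R : ℝ) :
    IntegrableOn (fun z : ℝ × E => c.p (s.ρ z.1 z.2))
      (Ioo 0 c.T ×ˢ (dom.cell ∩ Metric.closedBall 0 R)) := by
  have := (h.tame_p.integrableOn_ball R).add (tame_const_local (c.p c.ρbar) R)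
  refine this.congr (Eventually.of_forall fun z => ?_)
  simp

theorem tame_ρ_mul (h : IsSolution dom c G d s) {a : ℝ × E → ℝ}
    (ha : MemLp (fun z => √(s.ρ z.1 z.2) * a z) 2 (strip dom c.T)) :
    Tame (strip dom c.T) (fun z => s.ρ z.1 z.2 * a z) :=
  (h.tame_sqrt_mul ha).congr (Eventually.of_forall fun z => by
    simp only [← mul_assoc, Real.mul_self_sqrt (h.nonneg z.1 z.2)])

theorem integrable_ρ_mul_mul (h : IsSolution dom c G d s) {a b : ℝ × E → ℝ}
    (ha : MemLp (fun z => √(s.ρ z.1 z.2) * a z) 2 (strip dom c.T))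
    (hb : MemLp (fun z => √(s.ρ z.1 z.2) * b z) 2 (strip dom c.T)) :
    Integrable (fun z => s.ρ z.1 z.2 * a z * b z) (strip dom c.T) :=
  (integrable_mul_L2 ha hb).congr (Eventually.of_forall fun z => by
    have := Real.mul_self_sqrt (h.nonneg z.1 z.2)
    simp only
    linear_combination (a z * b z) * this)

/-! Initial data. -/

theorem aesm_data_ρ (h : IsSolution dom c G d s) :
    AEStronglyMeasurable d.ρ (volume.restrict dom.cell) := h.data_meas.1.restrict

theorem memLp_eta_data (h : IsSolution dom c G d s) :
    MemLp (fun x => c.eta (d.ρ x)) 2 (volume.restrict dom.cell) :=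
  KEntropy.memLp_eta isFiniteMeasure_torus_cell h.aesm_data_ρ h.data_nonneg h.data_pot

theorem tame_data (h : IsSolution dom c G d s) :
    Tame (volume.restrict dom.cell) (fun x => d.ρ x - c.ρbar) :=
  tame_sub_rho h.aesm_data_ρ h.data_nonneg h.memLp_eta_data

theorem memLp_sqrt_data_good (h : IsSolution dom c G d s) {X : E → ℝ}
    (hX : Good (volume.restrict dom.cell) X) :
    MemLp (fun x => √(d.ρ x) * X x) 2 (volume.restrict dom.cell) :=
  hX.sqrt_mul h.aesm_data_ρ h.data_nonneg h.tame_data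

theorem memLp_data_v (h : IsSolution dom c G d s) (i : Fin 3) :
    MemLp (fun x => √(d.ρ x) * d.v x i) 2 (volume.restrict dom.cell) := by
  refine memLp_sqrt_comp h.aesm_data_ρ h.data_meas.2.1.restrict h.data_nonneg ?_ i
  refine (Integrable.const_mul h.data_kin 2).mono'
    (h.aesm_data_ρ.mul (h.data_meas.2.1.restrict.norm.pow 2)) (Eventually.of_forall fun x => ?_)
  have h0 := h.data_nonneg x
  rw [Real.norm_of_nonneg (by positivity)]
  nlinarith [mul_nonneg h0 (sq_nonneg ‖d.w x‖)]

theorem memLp_data_w (h : IsSolution dom c G d s) (i : Fin 3) :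
    MemLp (fun x => √(d.ρ x) * d.w x i) 2 (volume.restrict dom.cell) := by
  refine memLp_sqrt_comp h.aesm_data_ρ h.data_meas.2.2.restrict h.data_nonneg ?_ i
  refine (Integrable.const_mul h.data_kin 2).mono'
    (h.aesm_data_ρ.mul (h.data_meas.2.2.restrict.norm.pow 2)) (Eventually.of_forall fun x => ?_)
  have h0 := h.data_nonneg x
  rw [Real.norm_of_nonneg (by positivity)]
  nlinarith [mul_nonneg h0 (sq_nonneg ‖d.v x‖)]

theorem tame_data_mul (h : IsSolution dom c G d s) {a : E → ℝ}
    (ha : MemLp (fun x => √(d.ρ x) * a x) 2 (volume.restrict dom.cell)) :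
    Tame (volume.restrict dom.cell) (fun x => d.ρ x * a x) := fun X hX => by
  refine (integrable_mul_L2 ha (h.memLp_sqrt_data_good hX)).congr (Eventually.of_forall fun z => ?_)
  have := Real.mul_self_sqrt (h.data_nonneg z)
  simp only
  linear_combination (a z * X z) * this

theorem local_data (h : IsSolution dom c G d s) (R : ℝ) :
    IntegrableOn d.ρ (dom.cell ∩ Metric.closedBall 0 R) := by
  have := (h.tame_data.integrableOn_cell_ball R).add
    (integrableOn_const (C := c.ρbar) ((measure_mono inter_subset_right).trans_lt
      measure_closedBall_lt_top).ne)
  refine this.congr (Eventually.of_forall fun z => ?_)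
  simp

/-! The equations. -/

theorem weakEq_continuity (h : IsSolution dom c G d s) :
    WeakEq dom c.T (fun z => s.ρ z.1 z.2) (fun j z => s.ρ z.1 z.2 * s.u c z.1 z.2 j)
      (fun _ => 0) d.ρ where
  int_f0 := h.local_ρ
  int_f := fun j R => (h.tame_ρ_mul (h.memLp_u j)).integrableOn_ball R
  int_g := fun _ => integrableOn_zero
  int_fi := h.local_data
  eq := fun φ hφ => by
    have := h.continuity _ hφ
    rw [← this, stInt]
    congr 1; ext z
    have hd := hφ.contDiff_one.differentiable one_ne_zero z
    rw [wform, inner_gradient_eq, dt_eq_fderiv hd]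
    simp only [pd_eq_fderiv (φ := φ) hd, Finset.mul_sum, zero_mul, add_zero, mul_assoc]

/-- Symmetric part of a matrix. -/
def symPart (A : Mat) (i j : Fin 3) : ℝ := 1 / 2 * (A i j + A j i)

/-- Antisymmetric part of a matrix. -/
def skewPart (A : Mat) (i j : Fin 3) : ℝ := 1 / 2 * (A i j - A j i)

/-- Test fields `φ eᵢ` extract one component of the vector equation. No symmetry of the stress field
is used, so its symmetric part appears as the flux. -/
theorem ddot_symGrad_smul {f : E → ℝ} {x : E} (hf : DifferentiableAt ℝ f x) (A : Mat) (i : Fin 3) :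
    ddot A (symGrad (fun y => f y • unitVec i) x) = ∑ j, symPart A i j * pd j f x := by
  simp only [ddot, symGrad, jac, Matrix.smul_apply, Matrix.add_apply, Matrix.transpose_apply,
    Matrix.of_apply, pd_smul_unitVec hf, smul_eq_mul, symPart]
  fin_cases i <;> simp [Fin.sum_univ_three] <;> ring

theorem ddot_skewGrad_smul {f : E → ℝ} {x : E} (hf : DifferentiableAt ℝ f x) (A : Mat) (i : Fin 3) :
    ddot A (skewGrad (fun y => f y • unitVec i) x) = ∑ j, skewPart A i j * pd j f x := by
  simp only [ddot, skewGrad, jac, Matrix.smul_apply, Matrix.sub_apply, Matrix.transpose_apply,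
    Matrix.of_apply, pd_smul_unitVec hf, smul_eq_mul, skewPart]
  fin_cases i <;> simp [Fin.sum_univ_three] <;> ring

theorem divg_smul {f : E → ℝ} {x : E} (hf : DifferentiableAt ℝ f x) (i : Fin 3) :
    divg (fun y => f y • unitVec i) x = pd i f x := by
  simp only [divg, Matrix.trace, jac, Matrix.diag, Matrix.of_apply, pd_smul_unitVec hf]
  simp

theorem inner_convect_smul {f : E → ℝ} {x : E} (hf : DifferentiableAt ℝ f x) (u v : E) (i : Fin 3) :
    inner ℝ v (convect u (fun y => f y • unitVec i) x) = v i * ∑ j, u j * pd j f x := by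
  rw [inner_eq_sum]
  have : ∀ k, convect u (fun y => f y • unitVec i) x k =
      if k = i then ∑ j, u j * pd j f x else 0 := fun k => by
    simp only [convect, Fin.sum_univ_three, PiLp.add_apply, PiLp.smul_apply, pd_smul_unitVec hf,
      smul_eq_mul]
    split_ifs <;> simp
  simp [this]

theorem inner_dt_smul {φ : ℝ → E → ℝ} {t : ℝ} {x : E}
    (hf : DifferentiableAt ℝ (fun s => φ s x) t) (v : E) (i : Fin 3) :
    inner ℝ v (dt (fun t y => φ t y • unitVec i) t x) = v i * dt φ t x := by
  rw [inner_eq_sum]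
  simp [dt_smul_unitVec hf]

theorem memLp_symPart {μ : Measure (ℝ × E)} {A : ℝ × E → Mat} (h : ∀ i j, MemLp (fun z => A z i j) 2 μ)
    (i j : Fin 3) : MemLp (fun z => symPart (A z) i j) 2 μ := ((h i j).add (h j i)).const_mul _

theorem memLp_skewPart {μ : Measure (ℝ × E)} {A : ℝ × E → Mat} (h : ∀ i j, MemLp (fun z => A z i j) 2 μ)
    (i j : Fin 3) : MemLp (fun z => skewPart (A z) i j) 2 μ := ((h i j).sub (h j i)).const_mul _

theorem weakEq_v (h : IsSolution dom c G d s) (hG : IsPotential dom G) (i : Fin 3) :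
    WeakEq dom c.T (fun z => s.ρ z.1 z.2 * s.v z.1 z.2 i)
      (fun j z => s.ρ z.1 z.2 * s.v z.1 z.2 i * s.u c z.1 z.2 j
        + (if j = i then 1 else 0) * (1 / c.ε ^ 2 * c.p (s.ρ z.1 z.2))
        - 2 * c.μ * (√(1 - c.κ) * (√(s.ρ z.1 z.2) * symPart (s.S z.1 z.2) i j)
            + c.κ * (√(s.ρ z.1 z.2) * skewPart (s.A z.1 z.2) i j)))
      (fun z => 1 / c.ε ^ 2 * (s.ρ z.1 z.2 * gradient G z.2 i))
      (fun x => d.ρ x * d.v x i) := by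
  have i0 := fun R => (h.tame_ρ_mul (h.memLp_v i)).integrableOn_ball R
  have iS := fun j R => (h.tame_sqrt_mul (memLp_symPart h.memLp_S i j)).integrableOn_ball R
  have iA := fun j R => (h.tame_sqrt_mul (memLp_skewPart h.memLp_A i j)).integrableOn_ball R
  have iu := fun j R => (Tame.of_L1 (h.integrable_ρ_mul_mul (h.memLp_v i) (h.memLp_u j))).integrableOn_ball R
  have iG := fun R => (h.tame_ρ_mul (h.memLp_sqrt_good (nice_good_gradient hG c.T i))).integrableOn_ball R
  refine ⟨i0, fun j R => ?_, fun R => Integrable.const_mul (iG R) _, fun R =>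
    (h.tame_data_mul (h.memLp_data_v i)).integrableOn_cell_ball R, fun φ hφ => ?_⟩
  · exact ((iu j R).add (((h.local_p R).const_mul _).const_mul _)).sub
      ((((iS j R).const_mul _).add ((iA j R).const_mul _)).const_mul _)
  · have e := h.momentum_v _ (hφ.smul_unitVec i)
    obtain ⟨R, hR⟩ := hφ.exists_radius
    have hφ1 := hφ.contDiff_one
    have hd := fun z => hφ1.differentiable one_ne_zero z
    have hd1 : ∀ z : ℝ × E, DifferentiableAt ℝ (fun x => φ (z.1, x)) z.2 := fun z =>
      (hd z).comp z.2 (differentiableAt_const _ |>.prodMk differentiableAt_id)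
    have hd2 : ∀ z : ℝ × E, DifferentiableAt ℝ (fun t => φ (t, z.2)) z.1 := fun z =>
      (hd z).comp z.1 (differentiableAt_id.prodMk (differentiableAt_const _))
    have hc : ∀ e, Continuous (fun z => fderiv ℝ φ z e) := fun e =>
      (hφ1.continuous_fderiv one_ne_zero).clm_apply continuous_const
    have hv : ∀ e, ∀ z : ℝ × E, z.2 ∈ dom.cell → R < ‖z.2‖ → fderiv ℝ φ z e = 0 :=
      fun e z hz h2 => by simp [(hR z hz h2).2]
    simp only [stInt, inner_convect_smul (hd1 (_, _)),
      divg_smul (hd1 (_, _)), ddot_symGrad_smul (hd1 (_, _)), ddot_skewGrad_smul (hd1 (_, _)),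
      pd_eq_fderiv (hd (_, _))] at e
    have eG : ∀ z : ℝ × E, inner ℝ (gradient G z.2) (φ (z.1, z.2) • unitVec i) =
        gradient G z.2 i * φ z := fun z => by
      rw [inner_smul_right, unitVec, EuclideanSpace.inner_single_right]; simp [mul_comm]
    have eD : ∀ x : E, inner ℝ (d.v x) (φ (0, x) • unitVec i) = d.v x i * φ (0, x) := fun x => by
      rw [inner_smul_right, unitVec, EuclideanSpace.inner_single_right]; simp [mul_comm]
    have eT : ∀ z : ℝ × E, inner ℝ (s.v z.1 z.2) (dt (fun t x => φ (t, x) • unitVec i) z.1 z.2) =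
        s.v z.1 z.2 i * fderiv ℝ φ z (1, 0) := fun z => by
      rw [inner_dt_smul (φ := fun t x => φ (t, x)) (hd2 z), dt_eq_fderiv (hd (z.1, z.2))]
    simp only [eG, eD, eT] at e
    have j1 : IntegrableOn (fun z : ℝ × E => s.ρ z.1 z.2 * (s.v z.1 z.2 i * fderiv ℝ φ z (1, 0))
        + s.ρ z.1 z.2 * (s.v z.1 z.2 i * ∑ j, s.u c z.1 z.2 j * fderiv ℝ φ z (0, unitVec j))
        + 1 / c.ε ^ 2 * c.p (s.ρ z.1 z.2) * fderiv ℝ φ z (0, unitVec i)) (Ioo 0 c.T ×ˢ dom.cell) := by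
      refine (Integrable.add (Integrable.add ?_ ?_) ?_)
      · have := integrableOn_mul_of_vanish i0 (hc (1, 0)) (hv (1, 0))
        simp only [mul_assoc] at this
        exact this
      · have := integrable_finsetSum (μ := strip dom c.T) Finset.univ fun j _ =>
          integrableOn_mul_of_vanish (iu j) (hc (0, unitVec j)) (hv _)
        refine this.congr (Eventually.of_forall fun z => ?_)
        simp only [Finset.mul_sum, mul_assoc]
      · exact integrableOn_mul_of_vanish (fun R => (h.local_p R).const_mul _) (hc _) (hv _)
    have j2 : IntegrableOn (fun z : ℝ × E => √(1 - c.κ) * √(s.ρ z.1 z.2) *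
          ∑ j, symPart (s.S z.1 z.2) i j * fderiv ℝ φ z (0, unitVec j)
        + c.κ * √(s.ρ z.1 z.2) *
          ∑ j, skewPart (s.A z.1 z.2) i j * fderiv ℝ φ z (0, unitVec j)) (Ioo 0 c.T ×ˢ dom.cell) := by
      refine Integrable.add ?_ ?_
      · have := integrable_finsetSum (μ := strip dom c.T) Finset.univ fun j _ =>
          (integrableOn_mul_of_vanish (iS j) (hc (0, unitVec j)) (hv _)).const_mul √(1 - c.κ)
        refine this.congr (Eventually.of_forall fun z => ?_)
        simp only [Finset.mul_sum, mul_assoc]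
      · have := integrable_finsetSum (μ := strip dom c.T) Finset.univ fun j _ =>
          (integrableOn_mul_of_vanish (iA j) (hc (0, unitVec j)) (hv _)).const_mul c.κ
        refine this.congr (Eventually.of_forall fun z => ?_)
        simp only [Finset.mul_sum, mul_assoc]
    have j3 : IntegrableOn (fun z : ℝ × E => s.ρ z.1 z.2 * (gradient G z.2 i * φ z))
        (Ioo 0 c.T ×ˢ dom.cell) := by
      simpa only [mul_assoc] using integrableOn_mul_of_vanish iG hφ1.continuous
        fun z hz h2 => (hR z hz h2).1
    have e2 : ∫ x in dom.cell, d.ρ x * d.v x i * φ (0, x) =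
        ∫ x in dom.cell, d.ρ x * (d.v x i * φ (0, x)) := by simp only [mul_assoc]
    rw [e2]
    have e3 : ∫ z in Ioo 0 c.T ×ˢ dom.cell, wform (fun z => s.ρ z.1 z.2 * s.v z.1 z.2 i)
        (fun j z => s.ρ z.1 z.2 * s.v z.1 z.2 i * s.u c z.1 z.2 j
          + (if j = i then 1 else 0) * (1 / c.ε ^ 2 * c.p (s.ρ z.1 z.2))
          - 2 * c.μ * (√(1 - c.κ) * (√(s.ρ z.1 z.2) * symPart (s.S z.1 z.2) i j)
              + c.κ * (√(s.ρ z.1 z.2) * skewPart (s.A z.1 z.2) i j)))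
        (fun z => 1 / c.ε ^ 2 * (s.ρ z.1 z.2 * gradient G z.2 i)) (fderiv ℝ φ) φ z
        = _ := integral_congr_ae (Eventually.of_forall fun z => by
      change _ = ((s.ρ z.1 z.2 * (s.v z.1 z.2 i * fderiv ℝ φ z (1, 0))
        + s.ρ z.1 z.2 * (s.v z.1 z.2 i * ∑ j, s.u c z.1 z.2 j * fderiv ℝ φ z (0, unitVec j))
        + 1 / c.ε ^ 2 * c.p (s.ρ z.1 z.2) * fderiv ℝ φ z (0, unitVec i))
        - 2 * c.μ * (√(1 - c.κ) * √(s.ρ z.1 z.2) *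
          ∑ j, symPart (s.S z.1 z.2) i j * fderiv ℝ φ z (0, unitVec j)
        + c.κ * √(s.ρ z.1 z.2) *
          ∑ j, skewPart (s.A z.1 z.2) i j * fderiv ℝ φ z (0, unitVec j)))
        + 1 / c.ε ^ 2 * (s.ρ z.1 z.2 * (gradient G z.2 i * φ z))
      have e4 : ∑ j, (if j = i then (1 : ℝ) else 0) * fderiv ℝ φ z (0, unitVec j) =
          fderiv ℝ φ z (0, unitVec i) := by simp
      rw [wform, ← e4]
      simp only [Fin.sum_univ_three]
      ring)
    rw [e3, integral_add, integral_sub, integral_const_mul, integral_const_mul]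
    · linear_combination e
    · exact j1
    · exact j2.const_mul _
    · exact j1.sub (j2.const_mul _)
    · exact j3.const_mul _

theorem weakEq_w (h : IsSolution dom c G d s) (i : Fin 3) :
    WeakEq dom c.T (fun z => s.ρ z.1 z.2 * s.w z.1 z.2 i)
      (fun j z => s.ρ z.1 z.2 * s.w z.1 z.2 i * s.u c z.1 z.2 j
        + 2 * c.μ * (√c.κ * (√(s.ρ z.1 z.2) * symPart (s.S z.1 z.2) i j)
            - c.θ * (√(s.ρ z.1 z.2) * skewPart (s.A z.1 z.2) i j)))
      (fun _ => 0)
      (fun x => d.ρ x * d.w x i) := by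
  have i0 := fun R => (h.tame_ρ_mul (h.memLp_w i)).integrableOn_ball R
  have iS := fun j R => (h.tame_sqrt_mul (memLp_symPart h.memLp_S i j)).integrableOn_ball R
  have iA := fun j R => (h.tame_sqrt_mul (memLp_skewPart h.memLp_A i j)).integrableOn_ball R
  have iu := fun j R => (Tame.of_L1 (h.integrable_ρ_mul_mul (h.memLp_w i) (h.memLp_u j))).integrableOn_ball R
  refine ⟨i0, fun j R => ?_, fun R => integrableOn_zero, fun R =>
    (h.tame_data_mul (h.memLp_data_w i)).integrableOn_cell_ball R, fun φ hφ => ?_⟩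
  · exact (iu j R).add ((((iS j R).const_mul _).sub ((iA j R).const_mul _)).const_mul _)
  · have e := h.momentum_w _ (hφ.smul_unitVec i)
    obtain ⟨R, hR⟩ := hφ.exists_radius
    have hφ1 := hφ.contDiff_one
    have hd := fun z => hφ1.differentiable one_ne_zero z
    have hd1 : ∀ z : ℝ × E, DifferentiableAt ℝ (fun x => φ (z.1, x)) z.2 := fun z =>
      (hd z).comp z.2 (differentiableAt_const _ |>.prodMk differentiableAt_id)
    have hd2 : ∀ z : ℝ × E, DifferentiableAt ℝ (fun t => φ (t, z.2)) z.1 := fun z =>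
      (hd z).comp z.1 (differentiableAt_id.prodMk (differentiableAt_const _))
    have hc : ∀ e, Continuous (fun z => fderiv ℝ φ z e) := fun e =>
      (hφ1.continuous_fderiv one_ne_zero).clm_apply continuous_const
    have hv : ∀ e, ∀ z : ℝ × E, z.2 ∈ dom.cell → R < ‖z.2‖ → fderiv ℝ φ z e = 0 :=
      fun e z hz h2 => by simp [(hR z hz h2).2]
    simp only [stInt, inner_convect_smul (hd1 (_, _)),
      ddot_symGrad_smul (hd1 (_, _)), ddot_skewGrad_smul (hd1 (_, _)),
      pd_eq_fderiv (hd (_, _))] at e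
    have eD : ∀ x : E, inner ℝ (d.w x) (φ (0, x) • unitVec i) = d.w x i * φ (0, x) := fun x => by
      rw [inner_smul_right, unitVec, EuclideanSpace.inner_single_right]; simp [mul_comm]
    have eT : ∀ z : ℝ × E, inner ℝ (s.w z.1 z.2) (dt (fun t x => φ (t, x) • unitVec i) z.1 z.2) =
        s.w z.1 z.2 i * fderiv ℝ φ z (1, 0) := fun z => by
      rw [inner_dt_smul (φ := fun t x => φ (t, x)) (hd2 z), dt_eq_fderiv (hd (z.1, z.2))]
    simp only [eD, eT] at e
    have j1 : IntegrableOn (fun z : ℝ × E => s.ρ z.1 z.2 * (s.w z.1 z.2 i * fderiv ℝ φ z (1, 0))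
        + s.ρ z.1 z.2 * (s.w z.1 z.2 i * ∑ j, s.u c z.1 z.2 j * fderiv ℝ φ z (0, unitVec j)))
        (Ioo 0 c.T ×ˢ dom.cell) := by
      refine (Integrable.add ?_ ?_)
      · have := integrableOn_mul_of_vanish i0 (hc (1, 0)) (hv (1, 0))
        simp only [mul_assoc] at this
        exact this
      · have := integrable_finsetSum (μ := strip dom c.T) Finset.univ fun j _ =>
          integrableOn_mul_of_vanish (iu j) (hc (0, unitVec j)) (hv _)
        refine this.congr (Eventually.of_forall fun z => ?_)
        simp only [Finset.mul_sum, mul_assoc]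
    have j2 : IntegrableOn (fun z : ℝ × E => √c.κ * √(s.ρ z.1 z.2) *
          ∑ j, symPart (s.S z.1 z.2) i j * fderiv ℝ φ z (0, unitVec j)
        - c.θ * √(s.ρ z.1 z.2) *
          ∑ j, skewPart (s.A z.1 z.2) i j * fderiv ℝ φ z (0, unitVec j)) (Ioo 0 c.T ×ˢ dom.cell) := by
      refine Integrable.sub ?_ ?_
      · have := integrable_finsetSum (μ := strip dom c.T) Finset.univ fun j _ =>
          (integrableOn_mul_of_vanish (iS j) (hc (0, unitVec j)) (hv _)).const_mul √c.κ
        refine this.congr (Eventually.of_forall fun z => ?_)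
        simp only [Finset.mul_sum, mul_assoc]
      · have := integrable_finsetSum (μ := strip dom c.T) Finset.univ fun j _ =>
          (integrableOn_mul_of_vanish (iA j) (hc (0, unitVec j)) (hv _)).const_mul c.θ
        refine this.congr (Eventually.of_forall fun z => ?_)
        simp only [Finset.mul_sum, mul_assoc]
    have e2 : ∫ x in dom.cell, d.ρ x * d.w x i * φ (0, x) =
        ∫ x in dom.cell, d.ρ x * (d.w x i * φ (0, x)) := by simp only [mul_assoc]
    rw [e2, ← e, ← integral_const_mul]
    refine Eq.trans ?_ (integral_add j1 (j2.const_mul _))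
    refine integral_congr_ae (Eventually.of_forall fun z => ?_)
    simp only [wform, Fin.sum_univ_three]
    ring

theorem per_map {F F' : Type*} {k : F → F'} {f : E → F} (hf : dom.Per f) :
    dom.Per (fun x => k (f x)) := by
  cases dom
  · intro j x
    have a1 : f (x + unitVec j) = f x := hf j x
    simp only [a1]
  · trivial

theorem per_map₂' {F F' F'' : Type*} {k : F → F' → F''} {f : E → F} {g : E → F'} (hf : dom.Per f)
    (hg : dom.Per g) : dom.Per (fun x => k (f x) (g x)) := by
  cases dom
  · intro j x
    have a1 : f (x + unitVec j) = f x := hf j x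
    have a2 : g (x + unitVec j) = g x := hg j x
    simp only [a1, a2]
  · trivial

theorem aesm_full (h : IsSolution dom c G d s) :
    AEStronglyMeasurable (fun z : ℝ × E => s.ρ z.1 z.2) (volume.restrict (Ioo 0 c.T ×ˢ univ)) :=
  h.meas.1

theorem aesm_full_l (h : IsSolution dom c G d s) (i : Fin 3) :
    AEStronglyMeasurable (fun z : ℝ × E => s.l z.1 z.2 i) (volume.restrict (Ioo 0 c.T ×ˢ univ)) :=
  (EuclideanSpace.proj (𝕜 := ℝ) i).continuous.comp_aestronglyMeasurable h.meas.2.2.2.1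

theorem HasWeakGrad.fderiv_form {T : ℝ} {f : ℝ → E → ℝ} {g : ℝ → E → E} (h : HasWeakGrad dom T f g)
    (j : Fin 3) (φ : ℝ × E → ℝ) (hφ : IsInteriorTest dom T (fun t x => φ (t, x))) :
    ∫ z in Ioo 0 T ×ˢ dom.cell, f z.1 z.2 * fderiv ℝ φ z (0, unitVec j)
      = - ∫ z in Ioo 0 T ×ˢ dom.cell, g z.1 z.2 j * φ z := by
  have e := h _ hφ j
  have hd := fun z => hφ.contDiff_one.differentiable one_ne_zero z
  simp only [stInt, pd_eq_fderiv (hd (_, _))] at e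
  exact e

/-- Regularity is given for `√ϱ`, and `ϱ = (√ϱ)²`; the rule for squares gives `∇ϱ = ϱ ∇log ϱ`. -/
theorem weakEq_grad_ρ (h : IsSolution dom c G d s) (i : Fin 3) :
    WeakEq dom c.T (fun _ => 0) (fun j z => (if j = i then 1 else 0) * s.ρ z.1 z.2)
      (fun z => s.ρ z.1 z.2 * s.l z.1 z.2 i) (fun _ => 0) := by
  have il := fun R => (h.tame_ρ_mul (h.memLp_l i)).integrableOn_ball R
  refine WeakEq.of_interior (fun j R => (h.local_ρ R).const_mul _) il fun φ hφ => ?_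
  have key := weakGrad_sq (dom := dom) (T := c.T) (f := fun z => √(s.ρ z.1 z.2))
    (G := fun z => 1 / 2 * √(s.ρ z.1 z.2) * s.l z.1 z.2 i) (j := i)
    (fun t => per_map (k := fun a => √a) (h.per t).1)
    (fun t => per_map₂' (k := fun (a : ℝ) (b : E) => 1 / 2 * √a * b i) (h.per t).1 (h.per t).2.2.2.1)
    (Real.continuous_sqrt.comp_aestronglyMeasurable h.aesm_full)
    (((Real.continuous_sqrt.comp_aestronglyMeasurable h.aesm_full).const_mul _).mul (h.aesm_full_l i))
    (fun R => by simpa only [Real.sq_sqrt (h.nonneg _ _)] using h.local_ρ R)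
    (fun R => by
      have h1 : IntegrableOn (fun z : ℝ × E => (√(s.ρ z.1 z.2) * s.l z.1 z.2 i) ^ 2)
        (Ioo 0 c.T ×ˢ (dom.cell ∩ Metric.closedBall 0 R)) :=
        IntegrableOn.mono_set (h.memLp_l i).integrable_sq (prod_mono_right inter_subset_left)
      refine (h1.const_mul (1 / 4)).congr (Eventually.of_forall fun z => ?_)
      simp only; ring)
    (fun φ hφ => by
      have := HasWeakGrad.fderiv_form h.grad_sqrt i φ hφ
      simpa using this) hφ
  obtain ⟨R, hR⟩ := hφ.exists_radius
  have hφ1 := hφ.contDiff_one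
  have i1 : IntegrableOn (fun z : ℝ × E => s.ρ z.1 z.2 * fderiv ℝ φ z (0, unitVec i))
      (Ioo 0 c.T ×ˢ dom.cell) := integrableOn_mul_of_vanish h.local_ρ
    ((hφ1.continuous_fderiv one_ne_zero).clm_apply continuous_const) (R := R)
    fun z hz h2 => by simp [(hR z hz h2).2]
  have i2 : IntegrableOn (fun z : ℝ × E => s.ρ z.1 z.2 * s.l z.1 z.2 i * φ z)
      (Ioo 0 c.T ×ˢ dom.cell) := integrableOn_mul_of_vanish il hφ1.continuous (R := R)
    fun z hz h2 => (hR z hz h2).1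
  have e1 : ∀ z, wform (fun _ => 0) (fun j z => (if j = i then 1 else 0) * s.ρ z.1 z.2)
      (fun z => s.ρ z.1 z.2 * s.l z.1 z.2 i) (fderiv ℝ φ) φ z =
      s.ρ z.1 z.2 * fderiv ℝ φ z (0, unitVec i) + s.ρ z.1 z.2 * s.l z.1 z.2 i * φ z := fun z => by
    simp [wform]
  simp only [e1]
  rw [integral_add i1 i2]
  have e2 : ∫ z in Ioo 0 c.T ×ˢ dom.cell, √(s.ρ z.1 z.2) * (√(s.ρ z.1 z.2) * fderiv ℝ φ z (0, unitVec i))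
      = ∫ z in Ioo 0 c.T ×ˢ dom.cell, s.ρ z.1 z.2 * fderiv ℝ φ z (0, unitVec i) := by
    simp only [← mul_assoc, Real.mul_self_sqrt (h.nonneg _ _)]
  have e3 : 2 * ∫ z in Ioo 0 c.T ×ˢ dom.cell,
      √(s.ρ z.1 z.2) * (1 / 2 * √(s.ρ z.1 z.2) * s.l z.1 z.2 i * φ z)
      = ∫ z in Ioo 0 c.T ×ˢ dom.cell, s.ρ z.1 z.2 * s.l z.1 z.2 i * φ z := by
    rw [← integral_const_mul]
    refine integral_congr_ae (Eventually.of_forall fun z => ?_)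
    have := Real.mul_self_sqrt (h.nonneg z.1 z.2)
    simp only
    linear_combination (s.l z.1 z.2 i * φ z) * this
  rw [← e2, ← e3, key]
  ring

theorem dp_mul_self {ρ : ℝ} (c : Params) (h0 : 0 ≤ ρ) :
    c.dp ρ * ρ = c.a * c.γ * (ρ ^ (c.γ / 2) * ρ ^ (c.γ / 2)) := by
  have e : ρ ^ (c.γ - 1) * ρ = ρ ^ (c.γ / 2) * ρ ^ (c.γ / 2) := by
    rw [← sq, c.rpow_half_sq h0]
    rcases h0.eq_or_lt with h1 | h1
    · rw [← h1, Real.zero_rpow c.γ_pos.ne']; simp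
    · rw [Real.rpow_sub_one h1.ne']; field_simp
  simp only [Params.dp]
  linear_combination (c.a * c.γ) * e

/-- Here `p(ϱ) = a (ϱ^(γ/2))²`, so the rule for squares applies to the second assumed gradient and
gives `∇p(ϱ) = p'(ϱ) ϱ ∇log ϱ`. -/
theorem weakEq_grad_p (h : IsSolution dom c G d s) (i : Fin 3) :
    WeakEq dom c.T (fun _ => 0) (fun j z => (if j = i then 1 else 0) * c.p (s.ρ z.1 z.2))
      (fun z => c.dp (s.ρ z.1 z.2) * s.ρ z.1 z.2 * s.l z.1 z.2 i) (fun _ => 0) := by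
  have il := fun R => (h.tame_dp i).integrableOn_ball R
  have hg := c.γ_pos
  have ep : ∀ z : ℝ × E, c.p (s.ρ z.1 z.2) =
      c.a * (s.ρ z.1 z.2 ^ (c.γ / 2) * s.ρ z.1 z.2 ^ (c.γ / 2)) := fun z => by
    rw [← sq, c.rpow_half_sq (h.nonneg _ _), Params.p]
  refine WeakEq.of_interior (fun j R => (h.local_p R).const_mul _) il fun φ hφ => ?_
  have key := weakGrad_sq (dom := dom) (T := c.T) (f := fun z => s.ρ z.1 z.2 ^ (c.γ / 2))
    (G := fun z => c.γ / 2 * s.ρ z.1 z.2 ^ (c.γ / 2) * s.l z.1 z.2 i) (j := i)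
    (fun t => per_map (k := fun a => a ^ (c.γ / 2)) (h.per t).1)
    (fun t => per_map₂' (k := fun (a : ℝ) (b : E) => c.γ / 2 * a ^ (c.γ / 2) * b i) (h.per t).1
      (h.per t).2.2.2.1)
    (aesm_rpow h.aesm_full (by positivity))
    (((aesm_rpow h.aesm_full (by positivity)).const_mul _).mul (h.aesm_full_l i))
    (fun R => by
      refine ((h.local_p R).const_mul (1 / c.a)).congr (Eventually.of_forall fun z => ?_)
      have := c.a_pos.ne'
      simp only [ep]; field_simp)
    (fun R => by
      have h1 : IntegrableOn (fun z : ℝ × E => (s.ρ z.1 z.2 ^ (c.γ / 2) * s.l z.1 z.2 i) ^ 2)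
        (Ioo 0 c.T ×ˢ (dom.cell ∩ Metric.closedBall 0 R)) :=
        IntegrableOn.mono_set (h.memLp_pow_l i).integrable_sq (prod_mono_right inter_subset_left)
      refine (h1.const_mul (c.γ ^ 2 / 4)).congr (Eventually.of_forall fun z => ?_)
      simp only; ring)
    (fun φ hφ => by
      have := HasWeakGrad.fderiv_form h.grad_pow i φ hφ
      simpa using this) hφ
  obtain ⟨R, hR⟩ := hφ.exists_radius
  have hφ1 := hφ.contDiff_one
  have i1 : IntegrableOn (fun z : ℝ × E => c.p (s.ρ z.1 z.2) * fderiv ℝ φ z (0, unitVec i))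
      (Ioo 0 c.T ×ˢ dom.cell) := integrableOn_mul_of_vanish h.local_p
    ((hφ1.continuous_fderiv one_ne_zero).clm_apply continuous_const) (R := R)
    fun z hz h2 => by simp [(hR z hz h2).2]
  have i2 : IntegrableOn (fun z : ℝ × E => c.dp (s.ρ z.1 z.2) * s.ρ z.1 z.2 * s.l z.1 z.2 i * φ z)
      (Ioo 0 c.T ×ˢ dom.cell) := integrableOn_mul_of_vanish il hφ1.continuous (R := R)
    fun z hz h2 => (hR z hz h2).1
  have e1 : ∀ z, wform (fun _ => 0) (fun j z => (if j = i then 1 else 0) * c.p (s.ρ z.1 z.2))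
      (fun z => c.dp (s.ρ z.1 z.2) * s.ρ z.1 z.2 * s.l z.1 z.2 i) (fderiv ℝ φ) φ z =
      c.p (s.ρ z.1 z.2) * fderiv ℝ φ z (0, unitVec i)
        + c.dp (s.ρ z.1 z.2) * s.ρ z.1 z.2 * s.l z.1 z.2 i * φ z := fun z => by
    simp [wform]
  simp only [e1]
  rw [integral_add i1 i2]
  have e2 : c.a * ∫ z in Ioo 0 c.T ×ˢ dom.cell, s.ρ z.1 z.2 ^ (c.γ / 2) *
      (s.ρ z.1 z.2 ^ (c.γ / 2) * fderiv ℝ φ z (0, unitVec i))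
      = ∫ z in Ioo 0 c.T ×ˢ dom.cell, c.p (s.ρ z.1 z.2) * fderiv ℝ φ z (0, unitVec i) := by
    rw [← integral_const_mul]
    simp only [ep, mul_assoc]
  have e3 : c.a * (2 * ∫ z in Ioo 0 c.T ×ˢ dom.cell, s.ρ z.1 z.2 ^ (c.γ / 2) *
      (c.γ / 2 * s.ρ z.1 z.2 ^ (c.γ / 2) * s.l z.1 z.2 i * φ z))
      = ∫ z in Ioo 0 c.T ×ˢ dom.cell, c.dp (s.ρ z.1 z.2) * s.ρ z.1 z.2 * s.l z.1 z.2 i * φ z := by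
    rw [← integral_const_mul, ← integral_const_mul]
    refine integral_congr_ae (Eventually.of_forall fun z => ?_)
    simp only [dp_mul_self c (h.nonneg z.1 z.2)]
    ring
  rw [← e2, ← e3, key]
  ring

end IsSolution

end
end KEntropy

namespace KEntropy
noncomputable section
open scoped ContDiff ENNReal

/-! ### Balance laws -/

/-- `∫ F(τ) - ∫ a = ∫₀^τ∫ b` for almost every `τ`. -/
structure Bal (dom : Dom) (T : ℝ) (F : ℝ × E → ℝ) (a : E → ℝ) (b : ℝ × E → ℝ) : Prop where
  int_F : Integrable F (strip dom T)
  int_a : Integrable a (volume.restrict dom.cell)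
  int_b : Integrable b (strip dom T)
  eq : ∀ᵐ τ ∂(volume.restrict (Ioo 0 T)),
    (∫ x in dom.cell, F (τ, x)) - (∫ x in dom.cell, a x) = ∫ z, b z ∂(strip dom τ)

/-- `∫ F(τ) - ∫ a ≤ ∫₀^τ∫ b` for almost every `τ`. -/
structure BalLE (dom : Dom) (T : ℝ) (F : ℝ × E → ℝ) (a : E → ℝ) (b : ℝ × E → ℝ) : Prop where
  int_F : Integrable F (strip dom T)
  int_a : Integrable a (volume.restrict dom.cell)
  int_b : Integrable b (strip dom T)
  le : ∀ᵐ τ ∂(volume.restrict (Ioo 0 T)),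
    (∫ x in dom.cell, F (τ, x)) - (∫ x in dom.cell, a x) ≤ ∫ z, b z ∂(strip dom τ)

theorem strip_mono (dom : Dom) {τ T : ℝ} (h : τ ≤ T) : strip dom τ ≤ strip dom T :=
  Measure.restrict_mono (prod_mono_left (Ioo_subset_Ioo_right h)) le_rfl

theorem integrable_slice {dom : Dom} {T : ℝ} {F : ℝ × E → ℝ} (h : Integrable F (strip dom T)) :
    ∀ᵐ τ ∂(volume.restrict (Ioo 0 T)), Integrable (fun x => F (τ, x)) (volume.restrict dom.cell) := by
  rw [strip, volume_restrict_prod] at h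
  exact h.prod_right_ae

theorem ae_slice {dom : Dom} {T : ℝ} {p : ℝ × E → Prop} (h : ∀ᵐ z ∂(strip dom T), p z) :
    ∀ᵐ τ ∂(volume.restrict (Ioo 0 T)), ∀ᵐ x ∂(volume.restrict dom.cell), p (τ, x) := by
  rw [strip, volume_restrict_prod] at h
  exact Measure.ae_ae_of_ae_prod h

namespace Bal

variable {dom : Dom} {T : ℝ} {F F' : ℝ × E → ℝ} {a a' : E → ℝ} {b b' : ℝ × E → ℝ}

theorem add (h : Bal dom T F a b) (h' : Bal dom T F' a' b') :
    Bal dom T (fun z => F z + F' z) (fun x => a x + a' x) (fun z => b z + b' z) where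
  int_F := h.int_F.add h'.int_F
  int_a := h.int_a.add h'.int_a
  int_b := h.int_b.add h'.int_b
  eq := by
    filter_upwards [h.eq, h'.eq, integrable_slice h.int_F, integrable_slice h'.int_F,
      ae_restrict_mem measurableSet_Ioo] with τ e e' i i' hτ
    rw [integral_add i i', integral_add h.int_a h'.int_a,
      integral_add (h.int_b.mono_measure (strip_mono dom hτ.2.le))
        (h'.int_b.mono_measure (strip_mono dom hτ.2.le)), ← e, ← e']
    ring

theorem const_mul (h : Bal dom T F a b) (k : ℝ) :
    Bal dom T (fun z => k * F z) (fun x => k * a x) (fun z => k * b z) where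
  int_F := h.int_F.const_mul k
  int_a := h.int_a.const_mul k
  int_b := h.int_b.const_mul k
  eq := by
    filter_upwards [h.eq] with τ e
    rw [integral_const_mul, integral_const_mul, integral_const_mul, ← e]
    ring

theorem sum {F : Fin 3 → ℝ × E → ℝ} {a : Fin 3 → E → ℝ} {b : Fin 3 → ℝ × E → ℝ}
    (h : ∀ i, Bal dom T (F i) (a i) (b i)) :
    Bal dom T (fun z => ∑ i, F i z) (fun x => ∑ i, a i x) (fun z => ∑ i, b i z) := by
  simp only [Fin.sum_univ_three]
  exact ((h 0).add (h 1)).add (h 2)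

theorem toLE (h : Bal dom T F a b) : BalLE dom T F a b where
  int_F := h.int_F
  int_a := h.int_a
  int_b := h.int_b
  le := h.eq.mono fun _ h => h.le

end Bal

namespace BalLE

variable {dom : Dom} {T : ℝ} {F F' : ℝ × E → ℝ} {a a' : E → ℝ} {b b' : ℝ × E → ℝ}

theorem add (h : BalLE dom T F a b) (h' : BalLE dom T F' a' b') :
    BalLE dom T (fun z => F z + F' z) (fun x => a x + a' x) (fun z => b z + b' z) where
  int_F := h.int_F.add h'.int_F
  int_a := h.int_a.add h'.int_a
  int_b := h.int_b.add h'.int_b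
  le := by
    filter_upwards [h.le, h'.le, integrable_slice h.int_F, integrable_slice h'.int_F,
      ae_restrict_mem measurableSet_Ioo] with τ e e' i i' hτ
    rw [integral_add i i', integral_add h.int_a h'.int_a,
      integral_add (h.int_b.mono_measure (strip_mono dom hτ.2.le))
        (h'.int_b.mono_measure (strip_mono dom hτ.2.le))]
    linarith

theorem congr (h : BalLE dom T F a b) (hF : F =ᵐ[strip dom T] F') (ha : a =ᵐ[volume.restrict dom.cell] a')
    (hb : b =ᵐ[strip dom T] b') : BalLE dom T F' a' b' where
  int_F := h.int_F.congr hF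
  int_a := h.int_a.congr ha
  int_b := h.int_b.congr hb
  le := by
    filter_upwards [h.le, ae_slice hF, ae_restrict_mem measurableSet_Ioo] with τ e e1 hτ
    rw [← integral_congr_ae e1, ← integral_congr_ae ha,
      ← integral_congr_ae (ae_mono (strip_mono dom hτ.2.le) hb)]
    exact e

end BalLE

namespace WeakEq

variable {dom : Dom} {T : ℝ} {f0 : ℝ × E → ℝ} {f : Fin 3 → ℝ × E → ℝ} {g : ℝ × E → ℝ} {fi : E → ℝ}
  {ψ : ℝ × E → ℝ}

/-- The pairing of `Tame` coefficients with `Good` functions provides all integrability that a test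
function without compact support requires. -/
theorem bal (h : WeakEq dom T f0 f g fi) (hT : 0 < T) (hψ : Nice dom T ψ)
    (h0 : Tame (strip dom T) f0) (hf : ∀ j, Tame (strip dom T) (f j)) (hg : Tame (strip dom T) g)
    (hi : Tame (volume.restrict dom.cell) fi) :
    Bal dom T (fun z => f0 z * ψ z) (fun x => fi x * ψ (0, x)) (wform f0 f g (fderiv ℝ ψ) ψ) := by
  have i0 := h0 _ hψ.good
  have ii := hi _ (hψ.init hT)
  have ib : Integrable (wform f0 f g (fderiv ℝ ψ) ψ) (strip dom T) := by
    refine ((h0 _ (hψ.good_fderiv _)).add ?_).add (hg _ hψ.good)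
    exact integrable_finsetSum _ fun j _ => hf j _ (hψ.good_fderiv _)
  exact ⟨i0, ii, ib, h.ae_eq hT hψ.smooth hψ.per i0 (fun j => hf j _ hψ.good) ib ii⟩

/-- The fundamental theorem of calculus as a balance law. -/
theorem bal_one (hT : 0 < T) (hψ : ContDiffOn ℝ 1 ψ (Icc 0 T ×ˢ univ))
    (per : ∀ t ∈ Icc 0 T, dom.Per fun x => ψ (t, x)) (i0 : Integrable ψ (strip dom T))
    (ib : Integrable (fun z => fderiv ℝ ψ z (1, 0)) (strip dom T))
    (ii : Integrable (fun x => ψ (0, x)) (volume.restrict dom.cell)) :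
    Bal dom T ψ (fun x => ψ (0, x)) (fun z => fderiv ℝ ψ z (1, 0)) := by
  refine ⟨i0, ii, ib, ?_⟩
  have e : wform (fun _ => 1) (fun _ _ => 0) (fun _ => 0) (fderiv ℝ ψ) ψ =
      fun z => fderiv ℝ ψ z (1, 0) := by
    ext z; simp [wform]
  have e0 : (fun z => 1 * ψ z) = ψ := by ext z; simp
  have e1 : (fun x => 1 * ψ (0, x)) = fun x => ψ (0, x) := by ext z; simp
  have := (WeakEq.one (dom := dom) hT).ae_eq hT hψ per (by rw [e0]; exact i0) (by simp)
    (by rw [e]; exact ib) (by rw [e1]; exact ii)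
  simpa only [e, one_mul] using this

end WeakEq

/-! ### Bounded square integrable quantities of a test triple -/

theorem ae_strip_of_forall {dom : Dom} {T : ℝ} {p : ℝ × E → Prop}
    (h : ∀ z : ℝ × E, z.1 ∈ Ioo 0 T → z.2 ∈ dom.cell → p z) : ∀ᵐ z ∂(strip dom T), p z := by
  filter_upwards [ae_restrict_mem (measurableSet_strip dom T)] with z hz
  exact h z hz.1 hz.2

namespace IsTestTriple

variable {dom : Dom} {c : Params} {q : Triple}

theorem fderiv_proj_time {f : ℝ → E → E}
    (hf : ContDiffOn ℝ 1 (fun z : ℝ × E => f z.1 z.2) (Icc 0 c.T ×ˢ univ)) (i : Fin 3) {z : ℝ × E}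
    (hz : z.1 ∈ Ioo 0 c.T) : fderiv ℝ (fun z : ℝ × E => f z.1 z.2 i) z (1, 0) = dt f z.1 z.2 i :=
  (dt_apply_eq (EuclideanSpace.proj (𝕜 := ℝ) i) hf hz).symm

theorem fderiv_proj_space {f : ℝ → E → E}
    (hf : ContDiffOn ℝ 1 (fun z : ℝ × E => f z.1 z.2) (Icc 0 c.T ×ˢ univ)) (i j : Fin 3) {z : ℝ × E}
    (hz : z.1 ∈ Ioo 0 c.T) :
    fderiv ℝ (fun z : ℝ × E => f z.1 z.2 i) z (0, unitVec j) = pd j (f z.1) z.2 i :=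
  (pd_apply_eq (EuclideanSpace.proj (𝕜 := ℝ) i) hf hz j).symm

theorem fderiv_scalar_time {f : ℝ → E → ℝ}
    (hf : ContDiffOn ℝ 1 (fun z : ℝ × E => f z.1 z.2) (Icc 0 c.T ×ˢ univ)) {z : ℝ × E}
    (hz : z.1 ∈ Ioo 0 c.T) : fderiv ℝ (fun z : ℝ × E => f z.1 z.2) z (1, 0) = dt f z.1 z.2 :=
  (dt_apply_eq (ContinuousLinearMap.id ℝ ℝ) hf hz).symm

theorem fderiv_scalar_space {f : ℝ → E → ℝ}
    (hf : ContDiffOn ℝ 1 (fun z : ℝ × E => f z.1 z.2) (Icc 0 c.T ×ˢ univ)) (j : Fin 3) {z : ℝ × E}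
    (hz : z.1 ∈ Ioo 0 c.T) :
    fderiv ℝ (fun z : ℝ × E => f z.1 z.2) z (0, unitVec j) = pd j (f z.1) z.2 :=
  (pd_apply_eq (ContinuousLinearMap.id ℝ ℝ) hf hz j).symm

theorem good_dt {f : ℝ → E → E}
    (hf : ContDiffOn ℝ 1 (fun z : ℝ × E => f z.1 z.2) (Icc 0 c.T ×ˢ univ)) {i : Fin 3}
    (h : Nice dom c.T (fun z => f z.1 z.2 i)) :
    Good (strip dom c.T) (fun z => dt f z.1 z.2 i) :=
  (h.good_fderiv (1, 0)).congr (ae_strip_of_forall fun _ hz _ => fderiv_proj_time hf i hz)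

theorem good_pd {f : ℝ → E → E}
    (hf : ContDiffOn ℝ 1 (fun z : ℝ × E => f z.1 z.2) (Icc 0 c.T ×ˢ univ)) {i : Fin 3}
    (h : Nice dom c.T (fun z => f z.1 z.2 i)) (j : Fin 3) :
    Good (strip dom c.T) (fun z => pd j (f z.1) z.2 i) :=
  (h.good_fderiv (0, unitVec j)).congr (ae_strip_of_forall fun _ hz _ => fderiv_proj_space hf i j hz)

theorem dt_comp_r (h : IsTestTriple dom c q) {F : ℝ → ℝ} {F' : ℝ} {z : ℝ × E}
    (hz : z.1 ∈ Ioo 0 c.T) (hF : HasDerivAt F F' (q.r z.1 z.2)) :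
    dt (fun t x => F (q.r t x)) z.1 z.2 = F' * dt q.r z.1 z.2 := by
  have h1 := differentiableAt_strip h.smooth_r hz
  have h2 : DifferentiableAt ℝ (fun s => q.r s z.2) z.1 :=
    h1.comp (f := fun s => (s, z.2)) z.1 (differentiableAt_id.prodMk (differentiableAt_const _))
  exact (hF.comp z.1 h2.hasDerivAt).deriv

theorem differentiableAt_slice {f : ℝ → E → ℝ}
    (hf : ContDiffOn ℝ 1 (fun z : ℝ × E => f z.1 z.2) (Icc 0 c.T ×ˢ univ)) {t : ℝ}
    (ht : t ∈ Icc 0 c.T) (x : E) : DifferentiableAt ℝ (f t) x := by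
  have h1 : ContDiffOn ℝ 1 (f t) univ :=
    hf.comp (f := fun y : E => (t, y)) (contDiffOn_const.prodMk contDiffOn_id) fun y _ => ⟨ht, mem_univ _⟩
  exact (contDiffOn_univ.1 h1).differentiable one_ne_zero x

theorem pd_comp_r (h : IsTestTriple dom c q) {F : ℝ → ℝ} {F' : ℝ} {t : ℝ} {x : E}
    (ht : t ∈ Icc 0 c.T) (hF : HasDerivAt F F' (q.r t x)) (j : Fin 3) :
    pd j (fun x => F (q.r t x)) x = F' * pd j (q.r t) x := by
  have h2 := differentiableAt_slice h.smooth_r ht x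
  have := (hF.comp_hasFDerivAt x h2.hasFDerivAt).fderiv
  change fderiv ℝ (F ∘ q.r t) x _ = _
  rw [this]; rfl

theorem contDiffOn_of_hasDerivAt {F F' : ℝ → ℝ} (hd : ∀ r, 0 < r → HasDerivAt F (F' r) r)
    (hc : ContinuousOn F' (Ioi 0)) : ContDiffOn ℝ 1 F (Ioi 0) := by
  refine (contDiffOn_one_iff_derivWithin (uniqueDiffOn_Ioi 0)).2
    ⟨fun r hr => (hd r hr).differentiableAt.differentiableWithinAt, hc.congr fun r hr => ?_⟩
  exact (hd r hr).hasDerivWithinAt.derivWithin (uniqueDiffOn_Ioi 0 r hr)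

theorem good_dt_comp_r (h : IsTestTriple dom c q) {F F' : ℝ → ℝ}
    (hd : ∀ r, 0 < r → HasDerivAt F (F' r) r) (hc : ContinuousOn F' (Ioi 0)) :
    Good (strip dom c.T) (fun z => dt (fun t x => F (q.r t x)) z.1 z.2) :=
  ((h.nice_comp_r hd hc).good_fderiv (1, 0)).congr (ae_strip_of_forall fun z hz _ => by
    beta_reduce
    rw [fderiv_sub_const]
    exact fderiv_scalar_time (f := fun t x => F (q.r t x))
      (h.smooth_comp_r (contDiffOn_of_hasDerivAt hd hc)) hz)

theorem good_pd_comp_r (h : IsTestTriple dom c q) {F F' : ℝ → ℝ}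
    (hd : ∀ r, 0 < r → HasDerivAt F (F' r) r) (hc : ContinuousOn F' (Ioi 0)) (j : Fin 3) :
    Good (strip dom c.T) (fun z => pd j (fun x => F (q.r z.1 x)) z.2) :=
  ((h.nice_comp_r hd hc).good_fderiv (0, unitVec j)).congr (ae_strip_of_forall fun z hz _ => by
    beta_reduce
    rw [fderiv_sub_const]
    exact fderiv_scalar_space (f := fun t x => F (q.r t x))
      (h.smooth_comp_r (contDiffOn_of_hasDerivAt hd hc)) j hz)

theorem continuousOn_rpow (g : ℝ) : ContinuousOn (fun r : ℝ => r ^ g) (Ioi 0) := fun r hr =>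
  (Real.continuousAt_rpow_const r g (Or.inl (ne_of_gt hr))).continuousWithinAt

theorem continuousOn_dp (c : Params) : ContinuousOn c.dp (Ioi 0) :=
  continuousOn_const.mul (continuousOn_rpow _)

theorem continuousOn_ddp (c : Params) : ContinuousOn c.ddp (Ioi 0) :=
  continuousOn_const.mul (continuousOn_rpow _)

theorem continuousOn_ddP (c : Params) : ContinuousOn (fun r => c.dp r / r) (Ioi 0) :=
  (continuousOn_dp c).div continuousOn_id fun _ hr => ne_of_gt hr

theorem nice_dP (h : IsTestTriple dom c q) : Nice dom c.T (fun z => c.dP (q.r z.1 z.2) - c.dP c.ρbar) :=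
  h.nice_comp_r (fun _ hr => c.hasDerivAt_dP hr) (continuousOn_ddP c)

theorem nice_p (h : IsTestTriple dom c q) : Nice dom c.T (fun z => c.p (q.r z.1 z.2) - c.p c.ρbar) :=
  h.nice_comp_r (fun _ hr => c.hasDerivAt_p hr) (continuousOn_dp c)

theorem nice_dp (h : IsTestTriple dom c q) :
    Nice dom c.T (fun z => c.dp (q.r z.1 z.2) - c.dp c.ρbar) :=
  h.nice_comp_r (fun _ hr => c.hasDerivAt_dp hr) (continuousOn_ddp c)

theorem good_gradPR (h : IsTestTriple dom c q) (i : Fin 3) :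
    Good (strip dom c.T) (fun z => gradPR c q z.1 z.2 i) := by
  simp only [gradPR, gradient_apply]
  exact h.good_pd_comp_r (fun _ hr => c.hasDerivAt_dP hr) (continuousOn_ddP c) i

theorem good_gradLogR (h : IsTestTriple dom c q) (i : Fin 3) :
    Good (strip dom c.T) (fun z => gradLogR q z.1 z.2 i) := by
  simp only [gradLogR, gradient_apply]
  exact h.good_pd_comp_r (fun r hr => Real.hasDerivAt_log hr.ne')
    (continuousOn_id.inv₀ fun _ hr => ne_of_gt hr) i

theorem good_dt_dP (h : IsTestTriple dom c q) :
    Good (strip dom c.T) (fun z => dt (fun t x => c.dP (q.r t x)) z.1 z.2) :=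
  h.good_dt_comp_r (fun _ hr => c.hasDerivAt_dP hr) (continuousOn_ddP c)

theorem gradLogR_apply (h : IsTestTriple dom c q) {t : ℝ} (ht : t ∈ Icc 0 c.T) (x : E) (i : Fin 3) :
    gradLogR q t x i = pd i (q.r t) x / q.r t x := by
  rw [gradLogR, gradient_apply, h.pd_comp_r ht (Real.hasDerivAt_log (h.pos t ht x).ne'),
    inv_mul_eq_div]

theorem gradPR_apply (h : IsTestTriple dom c q) {t : ℝ} (ht : t ∈ Icc 0 c.T) (x : E) (i : Fin 3) :
    gradPR c q t x i = c.dp (q.r t x) * gradLogR q t x i := by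
  rw [gradPR, gradient_apply, h.pd_comp_r ht (c.hasDerivAt_dP (h.pos t ht x)),
    h.gradLogR_apply ht]
  ring

end IsTestTriple

end
end KEntropy

namespace KEntropy
noncomputable section
open scoped ContDiff ENNReal

/-! ### Absolute convergence of the integrals -/

theorem convect_apply (u : E) (V : E → E) (x : E) (i : Fin 3) :
    convect u V x i = ∑ j, u j * pd j V x i := by
  simp [convect]

theorem symGrad_apply (V : E → E) (x : E) (i j : Fin 3) :
    symGrad V x i j = 1 / 2 * (pd j V x i + pd i V x j) := by
  simp [symGrad, jac]

theorem skewGrad_apply (V : E → E) (x : E) (i j : Fin 3) :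
    skewGrad V x i j = 1 / 2 * (pd j V x i - pd i V x j) := by
  simp [skewGrad, jac]

theorem divg_eq_sum (V : E → E) (x : E) : divg V x = ∑ i, pd i V x i := by
  simp [divg, Matrix.trace, jac]

theorem integrable_sum₁ {α : Type*} {mα : MeasurableSpace α} {μ : Measure α} {f : Fin 3 → α → ℝ}
    (h : ∀ i, Integrable (f i) μ) : Integrable (fun z => ∑ i, f i z) μ :=
  integrable_finsetSum _ fun i _ => h i

theorem integrable_sum₂ {α : Type*} {mα : MeasurableSpace α} {μ : Measure α}
    {f : Fin 3 → Fin 3 → α → ℝ} (h : ∀ i j, Integrable (f i j) μ) :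
    Integrable (fun z => ∑ i, ∑ j, f i j z) μ :=
  integrable_sum₁ fun i => integrable_sum₁ (h i)

/-- `√ϱ a` is square integrable on `(0,T) × Ω`. -/
def SqDens (dom : Dom) (c : Params) (s : Fields) (a : ℝ × E → ℝ) : Prop :=
  MemLp (fun z => √(s.ρ z.1 z.2) * a z) 2 (strip dom c.T)

theorem SqDens.sub {dom : Dom} {c : Params} {s : Fields} {a b : ℝ × E → ℝ}
    (ha : SqDens dom c s a) (hb : SqDens dom c s b) : SqDens dom c s (fun z => a z - b z) := by
  have := MemLp.sub ha hb
  unfold SqDens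
  simp only [mul_sub]
  exact this

section Terms

variable {dom : Dom} {c : Params} {G : E → ℝ} {d : Data} {s : Fields} {q : Triple}

theorem integrable_quadratic (h : IsSolution dom c G d s) {a b : Fin 3 → ℝ × E → ℝ}
    (ha : ∀ i, SqDens dom c s (a i)) (hb : ∀ i, SqDens dom c s (b i)) :
    Integrable (fun z => s.ρ z.1 z.2 * ∑ i, a i z * b i z) (strip dom c.T) := by
  refine (integrable_sum₁ fun i => h.integrable_ρ_mul_mul (ha i) (hb i)).congr
    (Eventually.of_forall fun z => ?_)
  simp only [Finset.mul_sum, mul_assoc]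

theorem integrable_convect (h : IsSolution dom c G d s) {a b : Fin 3 → ℝ × E → ℝ}
    {D : Fin 3 → Fin 3 → ℝ × E → ℝ} (ha : ∀ i, SqDens dom c s (a i)) (hb : ∀ i, SqDens dom c s (b i))
    (hD : ∀ i j, Good (strip dom c.T) (D i j)) :
    Integrable (fun z => s.ρ z.1 z.2 * ∑ i, (∑ j, a j z * D i j z) * b i z) (strip dom c.T) := by
  refine (integrable_sum₂ fun i j =>
    integrable_mul_bdd (h.integrable_ρ_mul_mul (ha j) (hb i)) (hD i j).2).congr
    (Eventually.of_forall fun z => ?_)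
  simp only [Fin.sum_univ_three]
  ring

/-- Again `ϱ p'(ϱ)` is split evenly, one factor `ϱ^(γ/2)` for each vector. -/
theorem IsSolution.integrable_dissipation (h : IsSolution dom c G d s) {a b : Fin 3 → ℝ × E → ℝ}
    (ha : ∀ i, MemLp (fun z => s.ρ z.1 z.2 ^ (c.γ / 2) * a i z) 2 (strip dom c.T))
    (hb : ∀ i, MemLp (fun z => s.ρ z.1 z.2 ^ (c.γ / 2) * b i z) 2 (strip dom c.T)) :
    Integrable (fun z => s.ρ z.1 z.2 * c.dp (s.ρ z.1 z.2) * ∑ i, a i z * b i z) (strip dom c.T) := by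
  refine ((integrable_sum₁ fun i => integrable_mul_L2 (ha i) (hb i)).const_mul (c.a * c.γ)).congr
    (Eventually.of_forall fun z => ?_)
  have := IsSolution.dp_mul_self c (h.nonneg z.1 z.2)
  simp only [Fin.sum_univ_three]
  linear_combination (-(a 0 z * b 0 z + a 1 z * b 1 z + a 2 z * b 2 z)) * this

theorem memLp_matrix_sub (h : IsSolution dom c G d s) {B D : Fin 3 → Fin 3 → ℝ × E → ℝ}
    (hB : ∀ i j, MemLp (B i j) 2 (strip dom c.T)) (hD : ∀ i j, Good (strip dom c.T) (D i j))
    (i j : Fin 3) : MemLp (fun z => B i j z - √(s.ρ z.1 z.2) * D i j z) 2 (strip dom c.T) :=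
  (hB i j).sub (h.memLp_sqrt_good (hD i j))

theorem good_symGrad {f : ℝ → E → E} (hf : ∀ i j, Good (strip dom c.T) (fun z => pd j (f z.1) z.2 i))
    (i j : Fin 3) : Good (strip dom c.T) (fun z => symGrad (f z.1) z.2 i j) := by
  simp only [symGrad_apply]
  exact ((hf i j).add (hf j i)).const_mul _

theorem good_skewGrad {f : ℝ → E → E} (hf : ∀ i j, Good (strip dom c.T) (fun z => pd j (f z.1) z.2 i))
    (i j : Fin 3) : Good (strip dom c.T) (fun z => skewGrad (f z.1) z.2 i j) := by
  simp only [skewGrad_apply]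
  exact ((hf i j).sub (hf j i)).const_mul _

namespace IsTestTriple

theorem good_pd_V (hq : IsTestTriple dom c q) (i j : Fin 3) :
    Good (strip dom c.T) (fun z => pd j (q.V z.1) z.2 i) := good_pd hq.smooth_V (hq.nice_V i) j

theorem good_pd_W (hq : IsTestTriple dom c q) (i j : Fin 3) :
    Good (strip dom c.T) (fun z => pd j (q.W z.1) z.2 i) := good_pd hq.smooth_W (hq.nice_W i) j

theorem good_pd_U (hq : IsTestTriple dom c q) (i j : Fin 3) :
    Good (strip dom c.T) (fun z => pd j (q.U c z.1) z.2 i) := good_pd hq.smooth_U (hq.nice_U i) j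

theorem good_divg_U (hq : IsTestTriple dom c q) :
    Good (strip dom c.T) (fun z => divg (q.U c z.1) z.2) := by
  simp only [divg_eq_sum]
  exact Good.sum fun i _ => hq.good_pd_U i i

theorem good_symVW (hq : IsTestTriple dom c q) (i j : Fin 3) :
    Good (strip dom c.T) (fun z => symVW c q z.1 z.2 i j) := by
  simp only [symVW, Matrix.sub_apply, Matrix.smul_apply, smul_eq_mul]
  exact ((good_symGrad hq.good_pd_V i j).const_mul _).sub ((good_symGrad hq.good_pd_W i j).const_mul _)

end IsTestTriple

theorem IsSolution.sq_good (h : IsSolution dom c G d s) {X : ℝ × E → ℝ}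
    (hX : Good (strip dom c.T) X) : SqDens dom c s X := h.memLp_sqrt_good hX

theorem integrable_viscous (h : IsSolution dom c G d s) (hq : IsTestTriple dom c q) :
    ∀ f ∈ viscousTerms c s q, StIntegrable dom c.T f := by
  have hA := memLp_matrix_sub h h.memLp_A (good_skewGrad hq.good_pd_V)
  have hS := memLp_matrix_sub h h.memLp_S hq.good_symVW
  simp only [viscousTerms, List.mem_cons, List.not_mem_nil, or_false, forall_eq_or_imp, forall_eq]
  constructor
  · refine Integrable.const_mul ((integrable_sum₂ fun i j =>
      integrable_mul_L2 (hA i j) (hA i j)).congr (Eventually.of_forall fun z => ?_)) _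
    simp [ddot, barSkew]
  · refine Integrable.const_mul ((integrable_sum₂ fun i j =>
      integrable_mul_L2 (hS i j) (hS i j)).congr (Eventually.of_forall fun z => ?_)) _
    simp [ddot, barSym]

theorem memLp_pow_sub (h : IsSolution dom c G d s) (hq : IsTestTriple dom c q) (i : Fin 3) :
    MemLp (fun z => s.ρ z.1 z.2 ^ (c.γ / 2) * (s.l z.1 z.2 i - gradLogR q z.1 z.2 i)) 2
      (strip dom c.T) := by
  simp only [mul_sub]
  exact (h.memLp_pow_l i).sub (h.memLp_pow_good (hq.good_gradLogR i))

/-- The two halves use different weights: the part with `p'(ϱ)` is a pairing with weights `ϱ^(γ/2)`,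
the part with `p'(r)∇log r = ∇P'(r)` one with weights `√ϱ`. -/
theorem integrable_pressureTerm (h : IsSolution dom c G d s) (hq : IsTestTriple dom c q) :
    StIntegrable dom c.T (pressureTerm c s q) := by
  have i1 := h.integrable_dissipation h.memLp_pow_l (memLp_pow_sub h hq)
  have i2 := integrable_quadratic h (fun i => h.sq_good (hq.good_gradPR i))
    (fun i => SqDens.sub (h.memLp_l i) (h.sq_good (hq.good_gradLogR i)))
  refine Integrable.const_mul ((i1.sub i2).congr (ae_strip_of_forall fun z hz _ => ?_)) _
  have e := fun i => hq.gradPR_apply (Ioo_subset_Icc_self hz) z.2 i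
  simp only [inner_eq_sum, Fin.sum_univ_three, PiLp.sub_apply, PiLp.smul_apply, smul_eq_mul, e,
    Pi.sub_apply]
  ring

theorem integrable_reducedPressureTerm (h : IsSolution dom c G d s) (hq : IsTestTriple dom c q) :
    StIntegrable dom c.T (reducedPressureTerm c s q) := by
  refine Integrable.const_mul ((h.integrable_dissipation (memLp_pow_sub h hq)
    (memLp_pow_sub h hq)).congr (Eventually.of_forall fun z => ?_)) _
  simp only [norm_sq_eq_sum, Fin.sum_univ_three, PiLp.sub_apply]

theorem integrable_symTerm (h : IsSolution dom c G d s) (hq : IsTestTriple dom c q) :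
    StIntegrable dom c.T (symTerm c s q) := by
  have hS := memLp_matrix_sub h h.memLp_S hq.good_symVW
  refine Integrable.const_mul ((integrable_sum₂ fun i j =>
    integrable_mul_L2 (h.memLp_sqrt_good (hq.good_symVW i j)) (hS i j)).neg.congr
      (Eventually.of_forall fun z => ?_)) _
  simp only [ddot, barSym, Fin.sum_univ_three, Pi.neg_apply, Matrix.neg_apply, Matrix.sub_apply,
    Matrix.smul_apply, smul_eq_mul]
  ring

theorem integrable_skewTerm (h : IsSolution dom c G d s) (hq : IsTestTriple dom c q) :
    StIntegrable dom c.T (skewTerm c s q) := by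
  have hS := memLp_matrix_sub h h.memLp_A (good_skewGrad hq.good_pd_V)
  refine Integrable.const_mul ((integrable_sum₂ fun i j =>
    integrable_mul_L2 (h.memLp_sqrt_good (good_skewGrad hq.good_pd_V i j)) (hS i j)).neg.congr
      (Eventually.of_forall fun z => ?_)) _
  simp only [ddot, barSkew, Fin.sum_univ_three, Pi.neg_apply, Matrix.neg_apply, Matrix.sub_apply,
    Matrix.smul_apply, smul_eq_mul]
  ring

theorem integrable_general (h : IsSolution dom c G d s) (hG : IsPotential dom G)
    (hq : IsTestTriple dom c q) : ∀ f ∈ generalTerms c G s q, StIntegrable dom c.T f := by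
  have sV : ∀ i, SqDens dom c s (fun z => q.V z.1 z.2 i - s.v z.1 z.2 i) := fun i =>
    SqDens.sub (h.sq_good (hq.nice_V i).good) (h.memLp_v i)
  have sW : ∀ i, SqDens dom c s (fun z => q.W z.1 z.2 i - s.w z.1 z.2 i) := fun i =>
    SqDens.sub (h.sq_good (hq.nice_W i).good) (h.memLp_w i)
  simp only [generalTerms, List.mem_cons, List.not_mem_nil, or_false, forall_eq_or_imp, forall_eq]
  refine ⟨?_, ?_, ?_, ?_, ?_, ?_, integrable_symTerm h hq, integrable_skewTerm h hq, ?_, ?_, ?_⟩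
  · refine ((integrable_convect h h.memLp_u sW hq.good_pd_W).add
      (integrable_convect h h.memLp_u sV hq.good_pd_V)).congr (Eventually.of_forall fun z => ?_)
    simp only [inner_eq_sum, convect_apply, PiLp.sub_apply, Pi.add_apply]
    ring
  · refine ((integrable_quadratic h
      (fun i => h.sq_good (IsTestTriple.good_dt hq.smooth_W (hq.nice_W i))) sW).add
      (integrable_quadratic h
      (fun i => h.sq_good (IsTestTriple.good_dt hq.smooth_V (hq.nice_V i))) sV)).congr
      (Eventually.of_forall fun z => ?_)
    simp only [inner_eq_sum, PiLp.sub_apply, Pi.add_apply]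
    ring
  · refine Integrable.const_mul (((integrable_mul_L2 hq.nice_sub_r.good.1 hq.good_dt_dP.1).sub
      (h.tame_ρ _ hq.good_dt_dP)).congr (Eventually.of_forall fun z => ?_)) _
    simp only [Pi.sub_apply]
    ring
  · refine Integrable.const_mul ((integrable_sum₁ fun j =>
      ((h.tame_ρ_mul (h.memLp_u j) _ (hq.good_gradPR j)).sub
        ((integrable_mul_L2 (hq.nice_sub_r.good.mul (hq.nice_U j).good).1 (hq.good_gradPR j).1).add
        ((integrable_mul_L2 (hq.nice_U j).good.1 (hq.good_gradPR j).1).const_mul c.ρbar)))).congr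
        (Eventually.of_forall fun z => ?_)) _
    simp only [inner_eq_sum, Fin.sum_univ_three, PiLp.sub_apply, PiLp.smul_apply, smul_eq_mul,
      Pi.sub_apply, Pi.add_apply]
    ring
  · refine Integrable.const_mul (((integrable_mul_L2 hq.nice_p.good.1 hq.good_divg_U.1).sub
      (h.tame_p _ hq.good_divg_U)).congr (Eventually.of_forall fun z => ?_)) _
    simp only [Pi.sub_apply]
    ring
  · refine Integrable.const_mul ((integrable_sum₁ fun i => h.tame_dp i _
      (((hq.good_gradLogR i).const_mul (2 * c.μ)).sub ((hq.nice_W i).good.const_mul (1 / c.θ)))).congr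
      (ae_strip_of_forall fun z hz _ => ?_)) _
    have e := fun i => hq.gradLogR_apply (Ioo_subset_Icc_self hz) z.2 i
    simp only [inner_eq_sum, Fin.sum_univ_three, PiLp.sub_apply, PiLp.smul_apply, smul_eq_mul, e,
      gradient_apply]
    ring
  · refine Integrable.const_mul ((integrable_quadratic h (fun i => h.sq_good (hq.good_gradPR i))
      (fun i => SqDens.sub (h.sq_good (hq.good_gradLogR i)) (h.memLp_l i))).congr
      (ae_strip_of_forall fun z hz _ => ?_)) _
    have e := fun i => hq.gradLogR_apply (Ioo_subset_Icc_self hz) z.2 i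
    have e2 := fun i => hq.gradPR_apply (Ioo_subset_Icc_self hz) z.2 i
    simp only [inner_eq_sum, Fin.sum_univ_three, PiLp.sub_apply, PiLp.smul_apply, smul_eq_mul, e2, e,
      gradient_apply]
    ring
  · refine Integrable.const_mul ((integrable_sum₂ fun i j =>
      integrable_mul_L2 (h.memLp_sqrt_good (good_skewGrad hq.good_pd_W i j)) (h.memLp_A i j)).congr
      (Eventually.of_forall fun z => ?_)) _
    simp only [ddot, Finset.mul_sum, mul_assoc]
  · refine Integrable.const_mul ((integrable_quadratic h
      (fun i => h.sq_good (nice_good_gradient hG c.T i))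
      (fun i => SqDens.sub (h.memLp_v i) (h.sq_good (hq.nice_V i).good))).congr
      (Eventually.of_forall fun z => ?_)) _
    simp only [inner_eq_sum, PiLp.sub_apply]

/-- All of `p(ϱ)`, `p(r)`, `ϱ`, `r`, `p'(r)` are expanded around their far-field values. The
constants cancel, and every product that remains pairs with `X`. -/
theorem integrable_relp (h : IsSolution dom c G d s) (hq : IsTestTriple dom c q) {X : ℝ × E → ℝ}
    (hX : Good (strip dom c.T) X) :
    Integrable (fun z => c.relp (s.ρ z.1 z.2) (q.r z.1 z.2) * X z) (strip dom c.T) := by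
  refine (((h.tame_p _ hX).sub (integrable_mul_L2 hq.nice_p.good.1 hX.1)).sub
    (((h.tame_ρ _ (hq.nice_dp.good.mul hX)).add ((h.tame_ρ _ hX).const_mul (c.dp c.ρbar))).sub
      ((integrable_mul_L2 (hq.nice_sub_r.good.mul hq.nice_dp.good).1 hX.1).add
      ((integrable_mul_L2 hq.nice_sub_r.good.1 hX.1).const_mul (c.dp c.ρbar))))).congr
    (Eventually.of_forall fun z => ?_)
  simp only [Pi.sub_apply, Pi.add_apply, Params.relp]
  ring

theorem integrable_reduced (h : IsSolution dom c G d s) (hG : IsPotential dom G)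
    (hq : IsTestTriple dom c q) : ∀ f ∈ reducedTerms c G s q, StIntegrable dom c.T f := by
  have sV : ∀ i, SqDens dom c s (fun z => q.V z.1 z.2 i - s.v z.1 z.2 i) := fun i =>
    SqDens.sub (h.sq_good (hq.nice_V i).good) (h.memLp_v i)
  have sW : ∀ i, SqDens dom c s (fun z => q.W z.1 z.2 i - s.w z.1 z.2 i) := fun i =>
    SqDens.sub (h.sq_good (hq.nice_W i).good) (h.memLp_w i)
  have sU : ∀ i, SqDens dom c s (fun z => s.u c z.1 z.2 i - q.U c z.1 z.2 i) := fun i =>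
    SqDens.sub (h.memLp_u i) (h.sq_good (hq.nice_U i).good)
  have gm : ∀ (D : Fin 3 → Fin 3 → ℝ × E → ℝ), (∀ i j, Good (strip dom c.T) (D i j)) → ∀ i,
      Good (strip dom c.T) (fun z => ∑ j, q.U c z.1 z.2 j * D i j z) := fun D hD i =>
    Good.sum fun j _ => (hq.nice_U j).good.mul (hD i j)
  simp only [reducedTerms, List.mem_cons, List.not_mem_nil, or_false, forall_eq_or_imp, forall_eq]
  refine ⟨?_, ?_, ?_, ?_, ?_, ?_, integrable_symTerm h hq, integrable_skewTerm h hq⟩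
  · refine (integrable_convect h sU sW hq.good_pd_W).congr (Eventually.of_forall fun z => ?_)
    simp only [inner_eq_sum, convect_apply, PiLp.sub_apply]
  · refine (integrable_convect h sU sV hq.good_pd_V).congr (Eventually.of_forall fun z => ?_)
    simp only [inner_eq_sum, convect_apply, PiLp.sub_apply]
  · refine (integrable_quadratic h sW (fun i => h.sq_good
      ((IsTestTriple.good_dt hq.smooth_W (hq.nice_W i)).add (gm _ hq.good_pd_W i)))).congr
      (Eventually.of_forall fun z => ?_)
    simp only [inner_eq_sum, convect_apply, PiLp.sub_apply, PiLp.add_apply]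
  · refine (integrable_quadratic h sV (fun i => h.sq_good
      ((IsTestTriple.good_dt hq.smooth_V (hq.nice_V i)).add (gm _ hq.good_pd_V i)))).congr
      (Eventually.of_forall fun z => ?_)
    simp only [inner_eq_sum, convect_apply, PiLp.sub_apply, PiLp.add_apply]
  · exact Integrable.const_mul (integrable_relp h hq hq.good_divg_U) _
  · refine Integrable.const_mul ((integrable_quadratic h
      (fun i => h.sq_good ((nice_good_gradient hG c.T i).sub (hq.good_gradPR i)))
      (fun i => SqDens.sub (h.memLp_v i) (h.sq_good (hq.nice_V i).good))).congr
      (Eventually.of_forall fun z => ?_)) _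
    simp only [inner_eq_sum, PiLp.sub_apply]

end Terms

end
end KEntropy

namespace KEntropy
noncomputable section
open scoped ContDiff ENNReal

/-! ### The relative entropy balance -/

namespace Bal

variable {dom : Dom} {T : ℝ} {F F' : ℝ × E → ℝ} {a a' : E → ℝ} {b b' : ℝ × E → ℝ}

theorem congr (h : Bal dom T F a b) (hF : ∀ z, F z = F' z) (ha : ∀ x, a x = a' x)
    (hb : ∀ z : ℝ × E, z.1 ∈ Ioo 0 T → z.2 ∈ dom.cell → b z = b' z) : Bal dom T F' a' b' := by
  obtain rfl : F = F' := funext hF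
  obtain rfl : a = a' := funext ha
  have hb' : b =ᵐ[strip dom T] b' := ae_strip_of_forall hb
  refine ⟨h.int_F, h.int_a, h.int_b.congr hb', ?_⟩
  filter_upwards [h.eq, ae_restrict_mem measurableSet_Ioo] with τ e hτ
  rw [e, integral_congr_ae (ae_mono (strip_mono dom hτ.2.le) hb')]

end Bal

section Balances

variable {dom : Dom} {c : Params} {G : E → ℝ} {d : Data} {s : Fields} {q : Triple}

namespace IsSolution

/-- On the whole space `ϱ` itself is not `Tame`; subtracting the constant solution does not change
the flux and makes square integrable tests admissible. -/
theorem weakEq_sub_ρ (h : IsSolution dom c G d s) :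
    WeakEq dom c.T (fun z => s.ρ z.1 z.2 - c.ρbar) (fun j z => s.ρ z.1 z.2 * s.u c z.1 z.2 j)
      (fun _ => 0) (fun x => d.ρ x - c.ρbar) := by
  have := h.weakEq_continuity.sub (WeakEq.one c.T_pos) c.ρbar
  simpa using this

theorem weakEq_sub_p (h : IsSolution dom c G d s) (i : Fin 3) :
    WeakEq dom c.T (fun _ => 0)
      (fun j z => (if j = i then 1 else 0) * (c.p (s.ρ z.1 z.2) - c.p c.ρbar))
      (fun z => c.dp (s.ρ z.1 z.2) * s.ρ z.1 z.2 * s.l z.1 z.2 i) (fun _ => 0) := by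
  have := (h.weakEq_grad_p i).sub (WeakEq.grad_one i) (c.p c.ρbar)
  have e : (fun (j : Fin 3) (z : ℝ × E) => (if j = i then (1 : ℝ) else 0) * c.p (s.ρ z.1 z.2) -
      c.p c.ρbar * (if j = i then 1 else 0)) =
      fun j z => (if j = i then 1 else 0) * (c.p (s.ρ z.1 z.2) - c.p c.ρbar) := by
    ext j z; ring
  rw [e] at this
  simpa using this

theorem weakEq_grad_sub_ρ (h : IsSolution dom c G d s) (i : Fin 3) :
    WeakEq dom c.T (fun _ => 0)
      (fun j z => (if j = i then 1 else 0) * (s.ρ z.1 z.2 - c.ρbar))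
      (fun z => s.ρ z.1 z.2 * s.l z.1 z.2 i) (fun _ => 0) := by
  have := (h.weakEq_grad_ρ i).sub (WeakEq.grad_one i) c.ρbar
  have e : (fun (j : Fin 3) (z : ℝ × E) => (if j = i then (1 : ℝ) else 0) * s.ρ z.1 z.2 -
      c.ρbar * (if j = i then 1 else 0)) =
      fun j z => (if j = i then 1 else 0) * (s.ρ z.1 z.2 - c.ρbar) := by
    ext j z; ring
  rw [e] at this
  simpa using this

theorem bal_sub_ρ (h : IsSolution dom c G d s) {ψ : ℝ × E → ℝ} (hψ : Nice dom c.T ψ) :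
    Bal dom c.T (fun z => (s.ρ z.1 z.2 - c.ρbar) * ψ z) (fun x => (d.ρ x - c.ρbar) * ψ (0, x))
      (fun z => (s.ρ z.1 z.2 - c.ρbar) * fderiv ℝ ψ z (1, 0)
        + ∑ j, s.ρ z.1 z.2 * s.u c z.1 z.2 j * fderiv ℝ ψ z (0, unitVec j)) :=
  (h.weakEq_sub_ρ.bal c.T_pos hψ h.tame_ρ (fun j => h.tame_ρ_mul (h.memLp_u j)) Tame.zero
    h.tame_data).congr (fun _ => rfl) (fun _ => rfl) fun z _ _ => by simp [wform]

end IsSolution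

theorem Nice.bal_mul {ψ φ : ℝ × E → ℝ} (hψ : Nice dom c.T ψ) (hφ : Nice dom c.T φ) :
    Bal dom c.T (fun z => ψ z * φ z) (fun x => ψ (0, x) * φ (0, x))
      (fun z => ψ z * fderiv ℝ φ z (1, 0) + φ z * fderiv ℝ ψ z (1, 0)) := by
  have hb : ∀ z : ℝ × E, z.1 ∈ Ioo 0 c.T →
      fderiv ℝ (fun z => ψ z * φ z) z (1, 0) =
        ψ z * fderiv ℝ φ z (1, 0) + φ z * fderiv ℝ ψ z (1, 0) := fun z hz => by
    rw [((Nice.differentiableAt hψ.smooth hz).hasFDerivAt.fun_mul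
      (Nice.differentiableAt hφ.smooth hz).hasFDerivAt).fderiv]
    simp
  refine (WeakEq.bal_one c.T_pos (hψ.mul hφ).smooth (hψ.mul hφ).per
    (integrable_mul_L2 hψ.good.1 hφ.good.1) ?_
    (integrable_mul_L2 (hψ.init c.T_pos).1 (hφ.init c.T_pos).1)).congr (fun _ => rfl) (fun _ => rfl)
    fun z hz _ => hb z hz
  refine ((integrable_mul_L2 hψ.good.1 (hφ.good_fderiv (1, 0)).1).add
    (integrable_mul_L2 hφ.good.1 (hψ.good_fderiv (1, 0)).1)).congr (ae_strip_of_forall fun z hz _ => ?_)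
  exact (hb z hz).symm

/-- Balance of `ϱ |f|²`. -/
theorem IsSolution.bal_ρ_sq (h : IsSolution dom c G d s) {f : ℝ → E → E}
    (hf : ContDiffOn ℝ 1 (fun z : ℝ × E => f z.1 z.2) (Icc 0 c.T ×ˢ univ))
    (hn : ∀ i, Nice dom c.T (fun z => f z.1 z.2 i)) :
    Bal dom c.T (fun z => s.ρ z.1 z.2 * ‖f z.1 z.2‖ ^ 2) (fun x => d.ρ x * ‖f 0 x‖ ^ 2)
      (fun z => 2 * (s.ρ z.1 z.2 * inner ℝ (dt f z.1 z.2) (f z.1 z.2)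
        + s.ρ z.1 z.2 * inner ℝ (convect (s.u c z.1 z.2) (f z.1) z.2) (f z.1 z.2))) := by
  have key : ∀ i, Bal dom c.T (fun z => s.ρ z.1 z.2 * (f z.1 z.2 i * f z.1 z.2 i))
      (fun x => d.ρ x * (f 0 x i * f 0 x i))
      (fun z => 2 * (s.ρ z.1 z.2 * (dt f z.1 z.2 i * f z.1 z.2 i)
        + s.ρ z.1 z.2 * ((∑ j, s.u c z.1 z.2 j * pd j (f z.1) z.2 i) * f z.1 z.2 i))) := by
    intro i
    -- The density is split as `(ϱ - ρbar) + ρbar`; the constant part contributes by the fundamental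
    -- theorem of calculus in time.
    refine ((h.bal_sub_ρ ((hn i).mul (hn i))).add
      (((hn i).bal_mul (hn i)).const_mul c.ρbar)).congr (fun z => by ring) (fun x => by ring) ?_
    intro z hz _
    have hd := (Nice.differentiableAt (hn i).smooth hz).hasFDerivAt
    rw [(hd.fun_mul hd).fderiv]
    simp only [_root_.add_apply, _root_.smul_apply, smul_eq_mul,
      IsTestTriple.fderiv_proj_time hf i hz, IsTestTriple.fderiv_proj_space hf i _ hz,
      Fin.sum_univ_three]
    ring
  refine (Bal.sum key).congr (fun z => ?_) (fun x => ?_) (fun z _ _ => ?_)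
  · rw [norm_sq_eq_sum, Finset.mul_sum]
  · rw [norm_sq_eq_sum, Finset.mul_sum]
  · simp only [inner_eq_sum, convect_apply, Fin.sum_univ_three]
    ring

theorem ddot_symGrad (A : Mat) (V : E → E) (x : E) :
    ddot A (symGrad V x) = ∑ i, ∑ j, IsSolution.symPart A i j * pd j V x i := by
  simp only [ddot, symGrad_apply, IsSolution.symPart, Fin.sum_univ_three]
  ring

theorem ddot_skewGrad (A : Mat) (V : E → E) (x : E) :
    ddot A (skewGrad V x) = ∑ i, ∑ j, IsSolution.skewPart A i j * pd j V x i := by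
  simp only [ddot, skewGrad_apply, IsSolution.skewPart, Fin.sum_univ_three]
  ring

/-- The momentum equation tested with `V`, component by component. The full pressure would not be
integrable against `div V`, so its far-field value is removed. -/
theorem IsSolution.bal_v (h : IsSolution dom c G d s) (hG : IsPotential dom G)
    (hq : IsTestTriple dom c q) :
    Bal dom c.T (fun z => s.ρ z.1 z.2 * inner ℝ (s.v z.1 z.2) (q.V z.1 z.2))
      (fun x => d.ρ x * inner ℝ (d.v x) (q.V 0 x))
      (fun z => s.ρ z.1 z.2 * inner ℝ (dt q.V z.1 z.2) (s.v z.1 z.2)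
        + s.ρ z.1 z.2 * inner ℝ (convect (s.u c z.1 z.2) (q.V z.1) z.2) (s.v z.1 z.2)
        + 1 / c.ε ^ 2 * ((c.p (s.ρ z.1 z.2) - c.p c.ρbar) * divg (q.V z.1) z.2)
        - 2 * c.μ * √(s.ρ z.1 z.2) * (√(1 - c.κ) * ddot (s.S z.1 z.2) (symGrad (q.V z.1) z.2)
          + c.κ * ddot (s.A z.1 z.2) (skewGrad (q.V z.1) z.2))
        + 1 / c.ε ^ 2 * (s.ρ z.1 z.2 * inner ℝ (gradient G z.2) (q.V z.1 z.2))) := by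
  have key : ∀ i, Bal dom c.T (fun z => s.ρ z.1 z.2 * s.v z.1 z.2 i * q.V z.1 z.2 i)
      (fun x => d.ρ x * d.v x i * q.V 0 x i)
      (fun z => s.ρ z.1 z.2 * (dt q.V z.1 z.2 i * s.v z.1 z.2 i)
        + s.ρ z.1 z.2 * ((∑ j, s.u c z.1 z.2 j * pd j (q.V z.1) z.2 i) * s.v z.1 z.2 i)
        + 1 / c.ε ^ 2 * ((c.p (s.ρ z.1 z.2) - c.p c.ρbar) * pd i (q.V z.1) z.2 i)
        - 2 * c.μ * √(s.ρ z.1 z.2) * (√(1 - c.κ) * (∑ j, symPart (s.S z.1 z.2) i j * pd j (q.V z.1) z.2 i)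
          + c.κ * (∑ j, skewPart (s.A z.1 z.2) i j * pd j (q.V z.1) z.2 i))
        + 1 / c.ε ^ 2 * (s.ρ z.1 z.2 * (gradient G z.2 i * q.V z.1 z.2 i))) := by
    intro i
    -- A constant pressure has no gradient, so subtracting it leaves the equation intact.
    have hw := (h.weakEq_v hG i).sub (WeakEq.grad_one i) (1 / c.ε ^ 2 * c.p c.ρbar)
    simp only [mul_zero, sub_zero] at hw
    refine (hw.bal c.T_pos (hq.nice_V i) (h.tame_ρ_mul (h.memLp_v i)) (fun j => ?_) ?_
      (h.tame_data_mul (h.memLp_data_v i))).congr (fun _ => rfl) (fun _ => rfl) (fun z hz _ => ?_)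
    · have t1 := Tame.of_L1 (h.integrable_ρ_mul_mul (h.memLp_v i) (h.memLp_u j))
      have t2 := (h.tame_p.const_mul (1 / c.ε ^ 2)).const_mul (if j = i then 1 else 0)
      have t3 := (h.tame_sqrt_mul (memLp_symPart h.memLp_S i j)).const_mul √(1 - c.κ)
      have t4 := (h.tame_sqrt_mul (memLp_skewPart h.memLp_A i j)).const_mul c.κ
      refine ((t1.add t2).sub ((t3.add t4).const_mul (2 * c.μ))).congr
        (Eventually.of_forall fun z => ?_)
      simp only; ring
    · exact (h.tame_ρ_mul (h.memLp_sqrt_good (nice_good_gradient hG c.T i))).const_mul _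
    · have e4 : ∑ j, (if j = i then (1 : ℝ) else 0) * pd j (q.V z.1) z.2 i = pd i (q.V z.1) z.2 i := by
        simp
      rw [wform, ← e4]
      simp only [IsTestTriple.fderiv_proj_time hq.smooth_V i hz,
        IsTestTriple.fderiv_proj_space hq.smooth_V i _ hz, Fin.sum_univ_three]
      ring
  refine (Bal.sum key).congr (fun z => ?_) (fun x => ?_) (fun z _ _ => ?_)
  · simp only [inner_eq_sum, Finset.mul_sum, mul_assoc]
  · simp only [inner_eq_sum, Finset.mul_sum, mul_assoc]
  · simp only [inner_eq_sum, convect_apply, ddot_symGrad, ddot_skewGrad, divg_eq_sum]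
    simp only [Finset.sum_add_distrib, Finset.sum_sub_distrib, ← Finset.mul_sum]

theorem IsSolution.bal_w (h : IsSolution dom c G d s) (hq : IsTestTriple dom c q) :
    Bal dom c.T (fun z => s.ρ z.1 z.2 * inner ℝ (s.w z.1 z.2) (q.W z.1 z.2))
      (fun x => d.ρ x * inner ℝ (d.w x) (q.W 0 x))
      (fun z => s.ρ z.1 z.2 * inner ℝ (dt q.W z.1 z.2) (s.w z.1 z.2)
        + s.ρ z.1 z.2 * inner ℝ (convect (s.u c z.1 z.2) (q.W z.1) z.2) (s.w z.1 z.2)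
        + 2 * c.μ * √(s.ρ z.1 z.2) * (√c.κ * ddot (s.S z.1 z.2) (symGrad (q.W z.1) z.2)
          - c.θ * ddot (s.A z.1 z.2) (skewGrad (q.W z.1) z.2))) := by
  have key : ∀ i, Bal dom c.T (fun z => s.ρ z.1 z.2 * s.w z.1 z.2 i * q.W z.1 z.2 i)
      (fun x => d.ρ x * d.w x i * q.W 0 x i)
      (fun z => s.ρ z.1 z.2 * (dt q.W z.1 z.2 i * s.w z.1 z.2 i)
        + s.ρ z.1 z.2 * ((∑ j, s.u c z.1 z.2 j * pd j (q.W z.1) z.2 i) * s.w z.1 z.2 i)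
        + 2 * c.μ * √(s.ρ z.1 z.2) * (√c.κ * (∑ j, symPart (s.S z.1 z.2) i j * pd j (q.W z.1) z.2 i)
          - c.θ * (∑ j, skewPart (s.A z.1 z.2) i j * pd j (q.W z.1) z.2 i))) := by
    intro i
    refine ((h.weakEq_w i).bal c.T_pos (hq.nice_W i) (h.tame_ρ_mul (h.memLp_w i)) (fun j => ?_)
      Tame.zero (h.tame_data_mul (h.memLp_data_w i))).congr (fun _ => rfl) (fun _ => rfl)
      (fun z hz _ => ?_)
    · have t1 := Tame.of_L1 (h.integrable_ρ_mul_mul (h.memLp_w i) (h.memLp_u j))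
      have t3 := (h.tame_sqrt_mul (memLp_symPart h.memLp_S i j)).const_mul √c.κ
      have t4 := (h.tame_sqrt_mul (memLp_skewPart h.memLp_A i j)).const_mul c.θ
      exact t1.add ((t3.sub t4).const_mul (2 * c.μ))
    · rw [wform]
      simp only [IsTestTriple.fderiv_proj_time hq.smooth_W i hz,
        IsTestTriple.fderiv_proj_space hq.smooth_W i _ hz, Fin.sum_univ_three]
      ring
  refine (Bal.sum key).congr (fun z => ?_) (fun x => ?_) (fun z _ _ => ?_)
  · simp only [inner_eq_sum, Finset.mul_sum, mul_assoc]
  · simp only [inner_eq_sum, Finset.mul_sum, mul_assoc]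
  · simp only [inner_eq_sum, convect_apply, ddot_symGrad, ddot_skewGrad]
    simp only [Finset.sum_add_distrib, Finset.sum_sub_distrib, ← Finset.mul_sum]

/-- Integration by parts of the pressure against a nice vector field. -/
theorem IsSolution.bal_p (h : IsSolution dom c G d s) {f : ℝ → E → E}
    (hf : ContDiffOn ℝ 1 (fun z : ℝ × E => f z.1 z.2) (Icc 0 c.T ×ˢ univ))
    (hn : ∀ i, Nice dom c.T (fun z => f z.1 z.2 i)) :
    Bal dom c.T (fun _ => 0) (fun _ => 0)
      (fun z => (c.p (s.ρ z.1 z.2) - c.p c.ρbar) * divg (f z.1) z.2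
        + c.dp (s.ρ z.1 z.2) * s.ρ z.1 z.2 * inner ℝ (s.l z.1 z.2) (f z.1 z.2)) := by
  have key : ∀ i, Bal dom c.T (fun _ => 0) (fun _ => 0)
      (fun z => (c.p (s.ρ z.1 z.2) - c.p c.ρbar) * pd i (f z.1) z.2 i
        + c.dp (s.ρ z.1 z.2) * s.ρ z.1 z.2 * (s.l z.1 z.2 i * f z.1 z.2 i)) := by
    intro i
    refine ((h.weakEq_sub_p i).bal c.T_pos (hn i) Tame.zero
      (fun j => h.tame_p.const_mul _) (h.tame_dp i) Tame.zero).congr (by simp) (by simp)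
      (fun z hz _ => ?_)
    simp only [wform, IsTestTriple.fderiv_proj_space hf i _ hz]
    simp [mul_assoc]
  refine (Bal.sum key).congr (by simp) (by simp) (fun z _ _ => ?_)
  simp only [inner_eq_sum, divg_eq_sum, Finset.sum_add_distrib, ← Finset.mul_sum]

theorem IsSolution.bal_grad_ρ (h : IsSolution dom c G d s) {f : Fin 3 → ℝ × E → ℝ}
    (hn : ∀ i, Nice dom c.T (f i)) :
    Bal dom c.T (fun _ => 0) (fun _ => 0)
      (fun z => ∑ i, ((s.ρ z.1 z.2 - c.ρbar) * fderiv ℝ (f i) z (0, unitVec i)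
        + s.ρ z.1 z.2 * s.l z.1 z.2 i * f i z)) := by
  have key : ∀ i, Bal dom c.T (fun _ => 0) (fun _ => 0)
      (fun z => (s.ρ z.1 z.2 - c.ρbar) * fderiv ℝ (f i) z (0, unitVec i)
        + s.ρ z.1 z.2 * s.l z.1 z.2 i * f i z) := by
    intro i
    refine ((h.weakEq_grad_sub_ρ i).bal c.T_pos (hn i) Tame.zero
      (fun j => h.tame_ρ.const_mul _) (h.tame_ρ_mul (h.memLp_l i)) Tame.zero).congr (by simp) (by simp)
      (fun z hz _ => ?_)
    simp [wform]
  exact (Bal.sum key).congr (by simp) (by simp) (fun z _ _ => rfl)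

/-- Integrals of divergences of products vanish. -/
theorem bal_div {ψ : ℝ × E → ℝ} {f : Fin 3 → ℝ × E → ℝ} (hψ : Nice dom c.T ψ)
    (hn : ∀ i, Nice dom c.T (f i)) :
    Bal dom c.T (fun _ => 0) (fun _ => 0)
      (fun z => ∑ i, (ψ z * fderiv ℝ (f i) z (0, unitVec i)
        + f i z * fderiv ℝ ψ z (0, unitVec i))) := by
  have key : ∀ i, Bal dom c.T (fun _ => 0) (fun _ => 0)
      (fun z => ψ z * fderiv ℝ (f i) z (0, unitVec i) + f i z * fderiv ℝ ψ z (0, unitVec i)) := by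
    intro i
    have hm := hψ.mul (hn i)
    have hb : ∀ z : ℝ × E, z.1 ∈ Ioo 0 c.T → fderiv ℝ (fun z => ψ z * f i z) z (0, unitVec i) =
        ψ z * fderiv ℝ (f i) z (0, unitVec i) + f i z * fderiv ℝ ψ z (0, unitVec i) := fun z hz => by
      rw [((Nice.differentiableAt hψ.smooth hz).hasFDerivAt.fun_mul
        (Nice.differentiableAt (hn i).smooth hz).hasFDerivAt).fderiv]
      simp
    have e : wform (fun _ => 0) (fun j _ => if j = i then 1 else 0) (fun _ => 0)
        (fderiv ℝ fun z => ψ z * f i z) (fun z => ψ z * f i z) =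
        fun z => fderiv ℝ (fun z => ψ z * f i z) z (0, unitVec i) := by
      ext z; simp [wform]
    have ib : Integrable (fun z => fderiv ℝ (fun z => ψ z * f i z) z (0, unitVec i))
        (strip dom c.T) := by
      refine ((integrable_mul_L2 hψ.good.1 ((hn i).good_fderiv (0, unitVec i)).1).add
        (integrable_mul_L2 (hn i).good.1 (hψ.good_fderiv (0, unitVec i)).1)).congr
        (ae_strip_of_forall fun z hz _ => (hb z hz).symm)
    have := (WeakEq.grad_one (dom := dom) (T := c.T) i).ae_eq c.T_pos hm.smooth hm.per (by simp)
      (fun j => (integrable_mul_L2 hψ.good.1 (hn i).good.1).const_mul _) (by rw [e]; exact ib)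
      (by simp)
    rw [e] at this
    have hB : Bal dom c.T (fun _ => 0) (fun _ => 0)
        (fun z => fderiv ℝ (fun z => ψ z * f i z) z (0, unitVec i)) :=
      ⟨by simp, by simp, ib, by simpa using this⟩
    exact hB.congr (fun _ => rfl) (fun _ => rfl) fun z hz _ => hb z hz
  exact (Bal.sum key).congr (by simp) (by simp) (fun z _ _ => rfl)

end Balances

end
end KEntropy

/-! ### Expansion of the relative entropy and summation of the balance laws -/

namespace KEntropy
noncomputable section
open scoped ContDiff ENNReal

namespace Params

variable (c : Params)

theorem hasDerivAt_relP {k r : ℝ} (hr : 0 < r) :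
    HasDerivAt (fun r => c.relP k r) (c.dp r / r * (r - k)) r := by
  have h1 := ((hasDerivAt_id r).const_sub k)
  have := (((c.hasDerivAt_P hr).const_sub (c.P k)).sub ((c.hasDerivAt_dP hr).mul h1))
  refine this.congr_deriv ?_
  simp only [id]
  ring

/-- The right-hand side is the sum of `relP k r` and `relP r k`. It is a product of two square
integrable functions when `r` is the density of a test triple and `k = ρbar`, which makes
`H(ρbar|r)` integrable. -/
theorem relP_le {k r : ℝ} (hk : 0 < k) (hr : 0 < r) :
    c.relP k r ≤ (c.dP r - c.dP k) * (r - k) := by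
  have := c.relP_nonneg hr.le hk
  unfold relP at *
  linarith

theorem θ_pos : 0 < c.θ := Real.sqrt_pos.2 (mul_pos c.κ_pos (sub_pos.2 c.κ_lt_one))

/-- The relation between the three constants on which all cancellations of the `w` and pressure
terms rest. -/
theorem θ_mul_β : c.θ * c.β = c.κ := by
  have h1 := sub_pos.2 c.κ_lt_one
  rw [θ, β, ← Real.sqrt_mul (mul_pos c.κ_pos h1).le,
    show c.κ * (1 - c.κ) * (c.κ / (1 - c.κ)) = c.κ * c.κ by field_simp,
    Real.sqrt_mul_self c.κ_pos.le]

end Params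

section Total

variable {dom : Dom} {c : Params} {G : E → ℝ} {d : Data} {s : Fields} {q : Triple}

namespace IsTestTriple

theorem bal_relP (hq : IsTestTriple dom c q) :
    Bal dom c.T (fun z => c.relP c.ρbar (q.r z.1 z.2)) (fun x => c.relP c.ρbar (q.r 0 x))
      (fun z => dt (fun t x => c.dP (q.r t x)) z.1 z.2 * (q.r z.1 z.2 - c.ρbar)) := by
  have hc : ContinuousOn (fun r => c.dp r / r * (r - c.ρbar)) (Ioi 0) :=
    (continuousOn_ddP c).mul (continuousOn_id.sub continuousOn_const)
  have hs := hq.smooth_comp_r (contDiffOn_of_hasDerivAt (fun r hr => c.hasDerivAt_relP (k := c.ρbar) hr) hc)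
  have hb : ∀ z : ℝ × E, z.1 ∈ Ioo 0 c.T → fderiv ℝ (fun z : ℝ × E => c.relP c.ρbar (q.r z.1 z.2)) z (1, 0)
      = dt (fun t x => c.dP (q.r t x)) z.1 z.2 * (q.r z.1 z.2 - c.ρbar) := fun z hz => by
    have hr := hq.pos z.1 (Ioo_subset_Icc_self hz) z.2
    rw [fderiv_scalar_time (f := fun t x => c.relP c.ρbar (q.r t x)) hs hz,
      hq.dt_comp_r hz (c.hasDerivAt_relP hr), hq.dt_comp_r hz (c.hasDerivAt_dP hr)]
    ring
  have hle : ∀ r, 0 < r → ‖c.relP c.ρbar r‖ ≤ (c.dP r - c.dP c.ρbar) * (r - c.ρbar) := fun r hr => by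
    rw [Real.norm_of_nonneg (c.relP_nonneg c.ρbar_pos.le hr)]
    exact c.relP_le c.ρbar_pos hr
  have h0 : (0 : ℝ) ∈ Icc 0 c.T := left_mem_Icc.2 c.T_pos.le
  refine (WeakEq.bal_one c.T_pos hs (fun t ht => IsSolution.per_map (hq.per t ht).1) ?_ ?_ ?_).congr
    (fun _ => rfl) (fun _ => rfl) fun z hz _ => hb z hz
  · refine (integrable_mul_L2 hq.nice_dP.good.1 hq.nice_sub_r.good.1).mono' (Nice.aesm hs)
      (ae_strip_of_forall fun z hz _ => hle _ (hq.pos _ (Ioo_subset_Icc_self hz) _))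
  · exact (integrable_mul_L2 hq.good_dt_dP.1 hq.nice_sub_r.good.1).congr
      (ae_strip_of_forall fun z hz _ => (hb z hz).symm)
  · refine (integrable_mul_L2 (hq.nice_dP.init c.T_pos).1 (hq.nice_sub_r.init c.T_pos).1).mono' ?_
      (Eventually.of_forall fun x => hle _ (hq.pos _ h0 _))
    exact (hs.continuousOn.comp_continuous (f := fun x : E => ((0 : ℝ), x)) (by fun_prop)
      fun x => ⟨h0, mem_univ _⟩).aestronglyMeasurable

/-- The integral of `div((p(r) - p(ρbar))U)` vanishes, and `∇p(r) = r ∇P'(r)`. It brings in the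
terms with `r U` and `p(r) div U`, in which the solution does not occur. -/
theorem bal_pU (hq : IsTestTriple dom c q) :
    Bal dom c.T (fun _ => 0) (fun _ => 0)
      (fun z => (c.p (q.r z.1 z.2) - c.p c.ρbar) * divg (q.U c z.1) z.2
        + q.r z.1 z.2 * inner ℝ (gradPR c q z.1 z.2) (q.U c z.1 z.2)) := by
  refine (bal_div hq.nice_p (fun i => hq.nice_U i)).congr (fun _ => rfl) (fun _ => rfl)
    fun z hz _ => ?_
  have hz' := Ioo_subset_Icc_self hz
  have hr := hq.pos z.1 hz' z.2
  have e : ∀ i, fderiv ℝ (fun z : ℝ × E => c.p (q.r z.1 z.2) - c.p c.ρbar) z (0, unitVec i) =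
      q.r z.1 z.2 * gradPR c q z.1 z.2 i := fun i => by
    rw [fderiv_sub_const, fderiv_scalar_space (f := fun t x => c.p (q.r t x))
      (hq.smooth_comp_r (contDiffOn_of_hasDerivAt (fun _ hr => c.hasDerivAt_p hr)
        (continuousOn_dp c))) i hz, hq.pd_comp_r hz' (c.hasDerivAt_p hr), hq.gradPR_apply hz',
      hq.gradLogR_apply hz']
    field_simp
  simp only [e, fderiv_proj_space hq.smooth_U _ _ hz, divg_eq_sum, inner_eq_sum, Fin.sum_univ_three]
  ring

end IsTestTriple

namespace IsSolution

theorem bal_dP (h : IsSolution dom c G d s) (hq : IsTestTriple dom c q) :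
    Bal dom c.T (fun z => (s.ρ z.1 z.2 - c.ρbar) * (c.dP (q.r z.1 z.2) - c.dP c.ρbar))
      (fun x => (d.ρ x - c.ρbar) * (c.dP (q.r 0 x) - c.dP c.ρbar))
      (fun z => (s.ρ z.1 z.2 - c.ρbar) * dt (fun t x => c.dP (q.r t x)) z.1 z.2
        + s.ρ z.1 z.2 * inner ℝ (gradPR c q z.1 z.2) (s.u c z.1 z.2)) := by
  refine (h.bal_sub_ρ hq.nice_dP).congr (fun _ => rfl) (fun _ => rfl) fun z hz _ => ?_
  have hs := hq.smooth_comp_r (IsTestTriple.contDiffOn_of_hasDerivAt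
    (fun _ hr => c.hasDerivAt_dP hr) (IsTestTriple.continuousOn_ddP c))
  rw [fderiv_sub_const]
  simp only [IsTestTriple.fderiv_scalar_time (f := fun t x => c.dP (q.r t x)) hs hz,
    IsTestTriple.fderiv_scalar_space (f := fun t x => c.dP (q.r t x)) hs _ hz, inner_eq_sum, gradPR,
    gradient_apply, Fin.sum_univ_three]
  ring

theorem integrable_entropy_rhs (h : IsSolution dom c G d s) (hG : IsPotential dom G) :
    Integrable (fun z => s.ρ z.1 z.2 * inner ℝ (gradient G z.2) (s.v z.1 z.2)) (strip dom c.T) ∧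
    Integrable (fun z => c.κ * ddot (s.A z.1 z.2) (s.A z.1 z.2) + ddot (s.S z.1 z.2) (s.S z.1 z.2))
      (strip dom c.T) ∧
    Integrable (fun z => s.ρ z.1 z.2 * c.dp (s.ρ z.1 z.2) * ‖s.l z.1 z.2‖ ^ 2) (strip dom c.T) := by
  refine ⟨?_, (Integrable.const_mul h.reg_A _).add h.reg_S, ?_⟩
  · simp only [inner_eq_sum]
    exact integrable_quadratic h (fun i => h.sq_good (nice_good_gradient hG c.T i)) h.memLp_v
  · simp only [norm_sq_eq_sum]
    exact h.integrable_dissipation h.memLp_pow_l h.memLp_pow_l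

theorem bal_entropyDens (h : IsSolution dom c G d s) (hG : IsPotential dom G) :
    BalLE dom c.T (fun z => entropyDens dom c (s.ρ z.1 z.2) (s.v z.1 z.2) (s.w z.1 z.2))
      (fun x => entropyDens dom c (d.ρ x) (d.v x) (d.w x))
      (fun z => 1 / c.ε ^ 2 * (s.ρ z.1 z.2 * inner ℝ (gradient G z.2) (s.v z.1 z.2))
        - 2 * c.μ * (c.κ * ddot (s.A z.1 z.2) (s.A z.1 z.2) + ddot (s.S z.1 z.2) (s.S z.1 z.2))
        - 2 * (c.κ * c.μ / c.ε ^ 2) *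
          (s.ρ z.1 z.2 * c.dp (s.ρ z.1 z.2) * ‖s.l z.1 z.2‖ ^ 2)) := by
  obtain ⟨i1, i2, i3⟩ := h.integrable_entropy_rhs hG
  have j1 := i1.const_mul (1 / c.ε ^ 2)
  have j2 := i2.const_mul (2 * c.μ)
  have j3 := i3.const_mul (2 * (c.κ * c.μ / c.ε ^ 2))
  refine ⟨?_, h.data_kin.add (h.data_pot.const_mul _), (j1.sub j2).sub j3, ?_⟩
  · refine Integrable.add ?_ (h.integrable_pot.const_mul _)
    refine (((h.integrable_kin h.meas.2.1 h.reg_v).add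
      (h.integrable_kin h.meas.2.2.1 h.reg_w)).const_mul (1 / 2)).congr
      (Eventually.of_forall fun z => ?_)
    simp only [Pi.add_apply]
    ring
  · filter_upwards [h.entropy, ae_restrict_mem measurableSet_Ioo] with τ e hτ
    have m := strip_mono dom hτ.2.le
    have e1 := integral_sub ((j1.mono_measure m).sub (j2.mono_measure m)) (j3.mono_measure m)
    simp only [Pi.sub_apply] at e1
    rw [e1, integral_sub (j1.mono_measure m) (j2.mono_measure m), integral_const_mul, integral_const_mul,
      integral_const_mul]
    simp only [stInt] at e
    linarith

/-- On the torus the assumed potential energy is `P(ϱ)`. It differs from `relP ϱ ρbar` by an affine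
function of `ϱ`, whose integral is conserved; hence one form serves both domains. -/
theorem bal_entropy (h : IsSolution dom c G d s) (hG : IsPotential dom G) :
    BalLE dom c.T (fun z => s.ρ z.1 z.2 * (‖s.v z.1 z.2‖ ^ 2 / 2 + ‖s.w z.1 z.2‖ ^ 2 / 2)
        + 1 / c.ε ^ 2 * c.relP (s.ρ z.1 z.2) c.ρbar)
      (fun x => d.ρ x * (‖d.v x‖ ^ 2 / 2 + ‖d.w x‖ ^ 2 / 2) + 1 / c.ε ^ 2 * c.relP (d.ρ x) c.ρbar)
      (fun z => 1 / c.ε ^ 2 * (s.ρ z.1 z.2 * inner ℝ (gradient G z.2) (s.v z.1 z.2))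
        - 2 * c.μ * (c.κ * ddot (s.A z.1 z.2) (s.A z.1 z.2) + ddot (s.S z.1 z.2) (s.S z.1 z.2))
        - 2 * (c.κ * c.μ / c.ε ^ 2) *
          (s.ρ z.1 z.2 * c.dp (s.ρ z.1 z.2) * ‖s.l z.1 z.2‖ ^ 2)) := by
  have h0 := h.bal_entropyDens hG
  cases dom with
  | space => exact h0
  | torus =>
    -- On the torus constants are admissible test functions, which is conservation of mass.
    have n : ∀ k : ℝ, Nice .torus c.T (fun _ => k) := fun k =>
      Nice.of_torus c.T_pos contDiffOn_const fun _ _ _ _ => rfl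
    have b1 := h.bal_sub_ρ (n (-(1 / c.ε ^ 2 * c.dP c.ρbar)))
    have b2 := (n (-(1 / c.ε ^ 2 * c.P c.ρbar))).bal_mul (n 1)
    refine (h0.add (b1.add b2).toLE).congr (Eventually.of_forall fun z => ?_)
      (Eventually.of_forall fun x => ?_) (Eventually.of_forall fun z => ?_)
    · simp only [entropyDens, Params.pot, Params.relP]; ring
    · simp only [entropyDens, Params.pot, Params.relP]; ring
    · simp

end IsSolution

theorem ddot_comm (A B : Mat) : ddot A B = ddot B A := by simp only [ddot, mul_comm]

theorem ddot_sub_smul (A B D : Mat) (k : ℝ) : ddot A (B - k • D) = ddot A B - k * ddot A D := by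
  simp only [ddot, Matrix.sub_apply, Matrix.smul_apply, smul_eq_mul, Fin.sum_univ_three]
  ring

theorem ddot_neg (A B : Mat) : ddot A (-B) = -ddot A B := by
  simp [ddot]

theorem ddot_sub_smul_left (A B D : Mat) (k : ℝ) : ddot (B - k • D) A = ddot B A - k * ddot D A := by
  simp only [ddot, Matrix.sub_apply, Matrix.smul_apply, smul_eq_mul, Fin.sum_univ_three]
  ring

theorem ddot_smul_left (A D : Mat) (k : ℝ) : ddot (k • D) A = k * ddot D A := by
  simp only [ddot, Matrix.smul_apply, smul_eq_mul, Fin.sum_univ_three]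
  ring

/-- With `B = S - √ϱ Q` one has `|B|² + √ϱ Q : B = B : S = |S|² - √ϱ Q : S`, and likewise for `A`
and `√ϱ 𝔸V`. So the relative dissipation together with the cross terms equals the dissipation in the
entropy inequality plus the viscous terms of the tested equations. -/
theorem viscous_identity (c : Params) (s : Fields) (q : Triple) (t : ℝ) (x : E) :
    symTerm c s q t x + skewTerm c s q t x - 2 * c.κ * c.μ * ddot (barSkew s q t x) (barSkew s q t x)
      - 2 * c.μ * ddot (barSym c s q t x) (barSym c s q t x) =
    - 2 * c.μ * (c.κ * ddot (s.A t x) (s.A t x) + ddot (s.S t x) (s.S t x))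
      + 2 * c.μ * √(s.ρ t x) * (√(1 - c.κ) * ddot (s.S t x) (symGrad (q.V t) x)
          - √c.κ * ddot (s.S t x) (symGrad (q.W t) x)
          + c.κ * ddot (s.A t x) (skewGrad (q.V t) x)) := by
  have e : ddot (symVW c q t x) (s.S t x) = √(1 - c.κ) * ddot (s.S t x) (symGrad (q.V t) x)
      - √c.κ * ddot (s.S t x) (symGrad (q.W t) x) := by
    rw [symVW, ddot_sub_smul_left, ddot_smul_left, ddot_comm (s.S t x), ddot_comm (s.S t x)]
  simp only [symTerm, skewTerm, barSkew, barSym, ddot_neg, ddot_sub_smul, ddot_sub_smul_left]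
  rw [ddot_comm (s.A t x) (skewGrad (q.V t) x), ddot_comm (s.S t x) (symVW c q t x), e]
  ring

theorem IsTestTriple.divg_U (hq : IsTestTriple dom c q) {t : ℝ} (ht : t ∈ Icc 0 c.T) (x : E) :
    divg (q.U c t) x = divg (q.V t) x - c.β * divg (q.W t) x := by
  have hd : ∀ {f : ℝ → E → E}, ContDiffOn ℝ 1 (fun z : ℝ × E => f z.1 z.2) (Icc 0 c.T ×ˢ univ) →
      DifferentiableAt ℝ (f t) x := fun {f} hf => by
    have h1 : ContDiffOn ℝ 1 (f t) univ :=
      hf.comp (f := fun y : E => (t, y)) (contDiffOn_const.prodMk contDiffOn_id)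
        fun y _ => ⟨ht, mem_univ _⟩
    exact (contDiffOn_univ.1 h1).differentiable one_ne_zero x
  have e : ∀ i, pd i (q.U c t) x = pd i (q.V t) x - c.β • pd i (q.W t) x := fun i => by
    have := ((hd hq.smooth_V).hasFDerivAt.sub ((hd hq.smooth_W).hasFDerivAt.const_smul c.β)).fderiv
    change fderiv ℝ (q.V t - c.β • q.W t) x _ = _
    rw [this]
    rfl
  simp only [divg_eq_sum, e, PiLp.sub_apply, PiLp.smul_apply, smul_eq_mul, Fin.sum_univ_three]
  ring

theorem IsTestTriple.gradient_r (hq : IsTestTriple dom c q) {t : ℝ} (ht : t ∈ Icc 0 c.T) (x : E) :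
    gradient (q.r t) x = q.r t x • gradLogR q t x := by
  ext i
  rw [PiLp.smul_apply, hq.gradLogR_apply ht, gradient_apply, smul_eq_mul,
    mul_div_cancel₀ _ (hq.pos t ht x).ne']

/-- Relative entropy inequality with all terms under one integral. -/
theorem IsSolution.bal_relDens (h : IsSolution dom c G d s) (hG : IsPotential dom G)
    (hq : IsTestTriple dom c q) :
    BalLE dom c.T (fun z => relDensAt c s q z.1 z.2) (relDensInit c d q)
      (fun z => ((generalTerms c G s q).map fun f => f z.1 z.2).sum
        - ((viscousTerms c s q ++ [pressureTerm c s q]).map fun f => f z.1 z.2).sum) := by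
  -- `b1` and `b2` complete the squares of the kinetic part. `b3` turns `H(ϱ|ρbar)` into `H(ϱ|r)`
  -- and adds the two vanishing divergences; the one of `p(ϱ)W` has weight `β`, because `div U = div
  -- V - β div W`.
  have b1 := ((h.bal_ρ_sq hq.smooth_V hq.nice_V).add (h.bal_ρ_sq hq.smooth_W hq.nice_W)).const_mul (1 / 2)
  have b2 := ((h.bal_v hG hq).add (h.bal_w hq)).const_mul (-1)
  have b3 := (((h.bal_dP hq).const_mul (-1)).add (hq.bal_relP.add
    (hq.bal_pU.add ((h.bal_p hq.smooth_W hq.nice_W).const_mul c.β)))).const_mul (1 / c.ε ^ 2)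
  refine ((h.bal_entropy hG).add (b1.add (b2.add b3)).toLE).congr (Eventually.of_forall fun z => ?_)
    (Eventually.of_forall fun x => ?_) (ae_strip_of_forall fun z hz _ => ?_)
  · simp only [relDensAt, relDens, norm_sq_eq_sum, inner_eq_sum, Fin.sum_univ_three, PiLp.sub_apply,
      Params.relP]
    ring
  · simp only [relDensInit, relDens, norm_sq_eq_sum, inner_eq_sum, Fin.sum_univ_three,
      PiLp.sub_apply, Params.relP]
    ring
  · obtain ⟨t, x⟩ := z
    have ht := Ioo_subset_Icc_self hz
    have hr := (hq.pos t ht x).ne'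
    -- The flux of `p(ϱ)` against `W` carries the factor `β` from `b3`, but the factor `κ/θ` in the
    -- stated inequality.
    have hθ : c.κ * (1 / c.θ) = c.β := by
      rw [← c.θ_mul_β]; field_simp [c.θ_pos.ne']
    have eV := viscous_identity c s q t x
    have e1 : (2 * c.μ / q.r t x) • gradient (q.r t) x = (2 * c.μ) • gradLogR q t x := by
      rw [hq.gradient_r ht, smul_smul, div_mul_cancel₀ _ hr]
    have e2 : (1 / q.r t x) • gradient (q.r t) x = gradLogR q t x := by
      rw [hq.gradient_r ht, smul_smul, div_mul_cancel₀ _ hr, one_smul]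
    have e3 : s.ρ t x / q.r t x * c.dp (q.r t x) * inner ℝ (gradient (q.r t) x)
        (gradLogR q t x - s.l t x) =
        s.ρ t x * c.dp (q.r t x) * inner ℝ (gradLogR q t x) (gradLogR q t x - s.l t x) := by
      rw [hq.gradient_r ht, real_inner_smul_left]
      field_simp
    simp only [generalTerms, viscousTerms, List.cons_append, List.nil_append, List.map_cons,
      List.map_nil, List.sum_cons, List.sum_nil, pressureTerm, e1, e2, e3]
    rw [ddot_comm (skewGrad (q.W t) x), hq.divg_U ht]
    simp only [inner_eq_sum, norm_sq_eq_sum, Fin.sum_univ_three, PiLp.sub_apply, PiLp.smul_apply,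
      smul_eq_mul]
    linear_combination -eV - (1 / c.ε ^ 2 * (c.dp (s.ρ t x) * s.ρ t x) * (s.l t x 0 * q.W t x 0
      + s.l t x 1 * q.W t x 1 + s.l t x 2 * q.W t x 2)) * hθ

end Total

end
end KEntropy

namespace KEntropy
noncomputable section
open scoped ContDiff ENNReal

/-! ### Test triples whose second velocity is a logarithmic gradient -/

section Reduced

variable {dom : Dom} {c : Params} {G : E → ℝ} {d : Data} {s : Fields} {q : Triple}

namespace IsReduced

theorem W_eq (hR : IsReduced c q) {t : ℝ} (ht : t ∈ Icc 0 c.T) (x : E) :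
    q.W t x = (2 * c.θ * c.μ) • gradLogR q t x := hR.logGrad t ht x

theorem coeff_pos (c : Params) : 0 < 2 * c.θ * c.μ :=
  mul_pos (mul_pos two_pos c.θ_pos) c.μ_pos

theorem differentiableAt_W (hq : IsTestTriple dom c q) {t : ℝ} (ht : t ∈ Icc 0 c.T) (x : E) :
    DifferentiableAt ℝ (q.W t) x := by
  have h1 : ContDiffOn ℝ 1 (q.W t) univ :=
    hq.smooth_W.comp (f := fun y : E => (t, y)) (contDiffOn_const.prodMk contDiffOn_id)
      fun y _ => ⟨ht, mem_univ _⟩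
  exact (contDiffOn_univ.1 h1).differentiable one_ne_zero x

/-- Expresses `∇W` through the Hessian of `log r`; its antisymmetric part and its trace are what is
needed. -/
theorem pd_W (hq : IsTestTriple dom c q) (hR : IsReduced c q) {t : ℝ} (ht : t ∈ Icc 0 c.T) (x : E)
    (i j : Fin 3) : pd j (q.W t) x i =
      (2 * c.θ * c.μ) * pd j (pd i fun y => Real.log (q.r t y)) x := by
  have h1 : (fun y => q.W t y i) = fun y => (2 * c.θ * c.μ) * pd i (fun y => Real.log (q.r t y)) y := by
    ext y
    rw [hR.W_eq ht, PiLp.smul_apply, gradLogR, gradient_apply, smul_eq_mul]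
  have h2 : pd j (q.W t) x i = pd j (fun y => q.W t y i) x := by
    have := ((EuclideanSpace.proj (𝕜 := ℝ) i).hasFDerivAt.comp x
      (differentiableAt_W hq ht x).hasFDerivAt).fderiv
    change _ = fderiv ℝ ((EuclideanSpace.proj (𝕜 := ℝ) i) ∘ q.W t) x _
    rw [this]; rfl
  have := invertibleOfNonzero (coeff_pos c).ne'
  rw [h2, h1]
  exact congrArg (fun L : E →L[ℝ] ℝ => L (unitVec j)) (fderiv_const_smul_of_invertible
    (f := pd i fun y => Real.log (q.r t y)) (2 * c.θ * c.μ))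

/-- `r` is assumed only `C¹`, but the gradient of `log r` is a multiple of `W`, which is
differentiable. So `log r` is twice differentiable in space and its Hessian is symmetric. -/
theorem pd_comm (hq : IsTestTriple dom c q) (hR : IsReduced c q) {t : ℝ} (ht : t ∈ Icc 0 c.T) (x : E)
    (i j : Fin 3) : pd j (pd i fun y => Real.log (q.r t y)) x =
      pd i (pd j fun y => Real.log (q.r t y)) x := by
  set f := fun y => Real.log (q.r t y) with hf
  have hd : ∀ y, HasFDerivAt f (fderiv ℝ f y) y := fun y =>
    ((IsTestTriple.differentiableAt_slice hq.smooth_r ht y).log (hq.pos t ht y).ne').hasFDerivAt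
  have h1 : fderiv ℝ f = fun y =>
      (InnerProductSpace.toDual ℝ E) ((2 * c.θ * c.μ)⁻¹ • q.W t y) := by
    ext1 y
    rw [hR.W_eq ht, inv_smul_smul₀ (coeff_pos c).ne', gradLogR, gradient,
      LinearIsometryEquiv.apply_symm_apply]
  have h2 : DifferentiableAt ℝ (fderiv ℝ f) x := by
    rw [h1]
    exact (InnerProductSpace.toDual ℝ E).toContinuousLinearEquiv.toContinuousLinearMap.differentiableAt.comp
      x ((differentiableAt_W hq ht x).fun_const_smul _)
  have h3 := second_derivative_symmetric hd h2.hasFDerivAt (unitVec i) (unitVec j)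
  have h4 : ∀ i j, pd j (pd i f) x = fderiv ℝ (fderiv ℝ f) x (unitVec j) (unitVec i) := fun i j => by
    have := (h2.hasFDerivAt.clm_apply (hasFDerivAt_const (unitVec i) x)).fderiv
    change fderiv ℝ (fun y => fderiv ℝ f y (unitVec i)) x _ = _
    rw [this]
    simp
  rw [h4, h4, h3]

theorem skewGrad_W (hq : IsTestTriple dom c q) (hR : IsReduced c q) {t : ℝ} (ht : t ∈ Icc 0 c.T)
    (x : E) : skewGrad (q.W t) x = 0 := by
  ext i j
  rw [skewGrad_apply, pd_W hq hR ht, pd_W hq hR ht, pd_comm hq hR ht]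
  simp

theorem divg_W (hq : IsTestTriple dom c q) (hR : IsReduced c q) {t : ℝ} (ht : t ∈ Icc 0 c.T)
    (x : E) : divg (q.W t) x = (2 * c.θ * c.μ) * lapl (fun y => Real.log (q.r t y)) x := by
  simp only [divg_eq_sum, lapl, Finset.mul_sum, pd_W hq hR ht]

theorem good_lapl (hq : IsTestTriple dom c q) (hR : IsReduced c q) :
    Good (strip dom c.T) (fun z => lapl (fun y => Real.log (q.r z.1 y)) z.2) := by
  refine ((Good.sum (s := Finset.univ) fun i _ => hq.good_pd_W i i).const_mul (2 * c.θ * c.μ)⁻¹).congr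
    (ae_strip_of_forall fun z hz _ => ?_)
  have := divg_W hq hR (Ioo_subset_Icc_self hz) z.2
  rw [divg_eq_sum] at this
  simp only [this, inv_mul_cancel_left₀ (coeff_pos c).ne']

/-- The continuity equation for `r` in the form `∂ₜr + r div U + ∇r·U = 0`, multiplied by `P''(r) =
p'(r)/r`. -/
theorem dt_dP (hq : IsTestTriple dom c q) (hR : IsReduced c q) {t : ℝ} (ht : t ∈ Ioo 0 c.T) (x : E) :
    dt (fun t x => c.dP (q.r t x)) t x =
      - c.dp (q.r t x) * divg (q.U c t) x - inner ℝ (gradPR c q t x) (q.U c t x) := by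
  have ht' := Ioo_subset_Icc_self ht
  have hr := (hq.pos t ht' x).ne'
  have hU : DifferentiableAt ℝ (q.U c t) x := by
    have h1 : ContDiffOn ℝ 1 (q.U c t) univ :=
      hq.smooth_U.comp (f := fun y : E => (t, y)) (contDiffOn_const.prodMk contDiffOn_id)
        fun y _ => ⟨ht', mem_univ _⟩
    exact (contDiffOn_univ.1 h1).differentiable one_ne_zero x
  have e1 : divg (fun y => q.r t y • q.U c t y) x = q.r t x * divg (q.U c t) x
      + q.r t x * inner ℝ (gradLogR q t x) (q.U c t x) := by
    have e : ∀ i, pd i (fun y => q.r t y • q.U c t y) x =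
        q.r t x • pd i (q.U c t) x + pd i (q.r t) x • q.U c t x := fun i => by
      have := ((IsTestTriple.differentiableAt_slice hq.smooth_r ht' x).hasFDerivAt.smul
        hU.hasFDerivAt).fderiv
      change fderiv ℝ (q.r t • q.U c t) x _ = _
      rw [this]; rfl
    simp only [divg_eq_sum, e, inner_eq_sum, hq.gradLogR_apply ht', PiLp.add_apply, PiLp.smul_apply,
      smul_eq_mul, Fin.sum_univ_three]
    field_simp
    ring
  have e2 := hR.continuity t ht x
  rw [hq.dt_comp_r (z := (t, x)) ht (c.hasDerivAt_dP (hq.pos t ht' x))]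
  have e3 : inner ℝ (gradPR c q t x) (q.U c t x) =
      c.dp (q.r t x) * inner ℝ (gradLogR q t x) (q.U c t x) := by
    simp only [inner_eq_sum, hq.gradPR_apply ht', Fin.sum_univ_three]
    ring
  rw [e3]
  rw [e1] at e2
  field_simp
  linear_combination c.dp (q.r t x) * e2

end IsReduced

/-- One more factor `√ϱ` gives the relation with weight `ϱ`, the form in which `w` and `∇log ϱ`
occur in the integrands. -/
theorem IsLogGradient.ae_strip (hl : IsLogGradient c s) (h : IsSolution dom c G d s) :
    ∀ᵐ z ∂(strip dom c.T), ∀ i, s.ρ z.1 z.2 * s.w z.1 z.2 i =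
      2 * c.θ * c.μ * (s.ρ z.1 z.2 * s.l z.1 z.2 i) := by
  have hl' : ∀ᵐ z ∂(strip dom c.T), _ :=
    ae_mono (Measure.restrict_mono (prod_mono_right (subset_univ _)) le_rfl) hl
  filter_upwards [hl'] with z hz i
  have h1 := congrArg (fun y : E => y i) hz
  simp only [PiLp.smul_apply, smul_eq_mul] at h1
  have h2 := Real.mul_self_sqrt (h.nonneg z.1 z.2)
  linear_combination √(s.ρ z.1 z.2) * h1 + (2 * c.θ * c.μ * s.l z.1 z.2 i - s.w z.1 z.2 i) * h2

/-- The two right-hand sides agree pointwise almost everywhere, so no integration by parts is needed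
here. The flux against `2μ∇r/r - W/θ` and the term with `𝔸W` vanish, `∂ₜP'(r)` turns the pressure
terms into `-h(ϱ|r) div U`, and the convective terms are regrouped around `U`. -/
theorem generalTerms_sum_eq (h : IsSolution dom c G d s) (hq : IsTestTriple dom c q)
    (hl : IsLogGradient c s) (hR : IsReduced c q) :
    ∀ᵐ z ∂(strip dom c.T), ((generalTerms c G s q).map fun f => f z.1 z.2).sum =
      ((reducedTerms c G s q).map fun f => f z.1 z.2).sum := by
  filter_upwards [hl.ae_strip h, ae_restrict_mem (measurableSet_strip dom c.T)] with z hw hz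
  obtain ⟨t, x⟩ := z
  have ht := Ioo_subset_Icc_self hz.1
  have hr := (hq.pos t ht x).ne'
  have e1 : (2 * c.μ / q.r t x) • gradient (q.r t) x - (1 / c.θ) • q.W t x = 0 := by
    rw [hq.gradient_r ht, smul_smul, div_mul_cancel₀ _ hr, hR.W_eq ht, smul_smul, sub_eq_zero]
    congr 1
    field_simp [c.θ_pos.ne']
  have e2 : (1 / q.r t x) • gradient (q.r t) x = gradLogR q t x := by
    rw [hq.gradient_r ht, smul_smul, div_mul_cancel₀ _ hr, one_smul]
  have e3 : s.ρ t x / q.r t x * c.dp (q.r t x) * inner ℝ (gradient (q.r t) x)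
      (gradLogR q t x - s.l t x) =
      s.ρ t x * inner ℝ (gradPR c q t x) (gradLogR q t x - s.l t x) := by
    rw [hq.gradient_r ht, real_inner_smul_left]
    simp only [inner_eq_sum, hq.gradPR_apply ht, Fin.sum_univ_three]
    field_simp
  have e4 : ddot 0 (s.A t x) = 0 := by simp [ddot]
  have e5 : ∀ i, q.W t x i = 2 * c.θ * c.μ * gradLogR q t x i := fun i => by
    rw [hR.W_eq ht, PiLp.smul_apply, smul_eq_mul]
  have hθ := c.θ_mul_β
  have h0 := hw 0
  have h1 := hw 1
  have h2 := hw 2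
  -- Passing from `u - U` to `v - V` in the term with `∇P'(r)` costs `β(w - W)`. Since both `w` and
  -- `W` are `2θμ` times logarithmic gradients and `θβ = κ`, this cancels the term with `∇log r -
  -- ∇log ϱ`.
  have key : c.β * s.ρ t x * inner ℝ (gradPR c q t x) (s.w t x - q.W t x) =
      2 * (c.κ * c.μ) * (s.ρ t x * inner ℝ (gradPR c q t x) (s.l t x - gradLogR q t x)) := by
    simp only [inner_eq_sum, Fin.sum_univ_three, PiLp.sub_apply, e5]
    rw [← hθ]
    linear_combination c.β * (gradPR c q t x 0 * h0 + gradPR c q t x 1 * h1 + gradPR c q t x 2 * h2)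
  simp only [generalTerms, reducedTerms, List.map_cons, List.map_nil, List.sum_cons, List.sum_nil, e1,
    e2, e3, IsReduced.skewGrad_W hq hR ht, e4, IsReduced.dt_dP hq hR hz.1, inner_zero_right, Params.relp]
  simp only [Fields.u, Triple.U, inner_eq_sum, convect_apply, Fin.sum_univ_three, PiLp.sub_apply,
    PiLp.smul_apply, smul_eq_mul, PiLp.add_apply] at key ⊢
  linear_combination (1 / c.ε ^ 2) * key

theorem integrable_extra (h : IsSolution dom c G d s) (hq : IsTestTriple dom c q)
    (hR : IsReduced c q) : ∀ f ∈ extraTerms c s q, StIntegrable dom c.T f := by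
  simp only [extraTerms, List.mem_cons, List.not_mem_nil, or_false, forall_eq_or_imp, forall_eq]
  constructor
  · exact Integrable.const_mul (integrable_relp h hq (IsReduced.good_lapl hq hR)) _
  · have i1 := h.integrable_dissipation (fun i => h.memLp_pow_good (hq.good_gradLogR i))
      (fun i => h.memLp_pow_good (hq.good_gradLogR i))
    have i2 := integrable_quadratic h (fun i => h.sq_good (hq.good_gradPR i))
      (fun i => h.sq_good (hq.good_gradLogR i))
    have i3 := (integrable_sum₁ fun i => (h.tame_ρ _ ((hq.good_gradPR i).mul (hq.good_gradLogR i))).sub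
      (integrable_mul_L2 hq.nice_sub_r.good.1
        ((hq.good_gradPR i).mul (hq.good_gradLogR i)).1)).const_mul (c.γ - 1)
    refine Integrable.const_mul (((i1.sub i2).sub i3).congr (ae_strip_of_forall fun z hz _ => ?_)) _
    have ht := Ioo_subset_Icc_self hz
    have hr := hq.pos z.1 ht z.2
    -- For the power law `r p''(r)` is a multiple of `p'(r)`, so integrability follows from that of
    -- `∇P'(r)·∇log r`.
    have e : c.ddp (q.r z.1 z.2) * q.r z.1 z.2 = (c.γ - 1) * c.dp (q.r z.1 z.2) := by
      have : q.r z.1 z.2 ^ (c.γ - 2) * q.r z.1 z.2 = q.r z.1 z.2 ^ (c.γ - 1) := by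
        rw [← Real.rpow_add_one hr.ne']; congr 1; ring
      rw [Params.ddp, Params.dp, mul_assoc, this]; ring
    simp only [Pi.sub_apply, norm_sq_eq_sum, hq.gradPR_apply ht, Fin.sum_univ_three, e]
    ring

/-- The integrand is a multiple of `div(h(ϱ|r)∇log r)`: the difference of the two dissipations is
`ϱ(p'(ϱ) - p'(r))∇log r·(∇log ϱ - ∇log r)`. To use only the known weak gradients, `h(ϱ|r)` is split
as `(p(ϱ) - p(ρbar)) - p'(r)(ϱ - ρbar) + h(ρbar|r)`. -/
theorem bal_extra (h : IsSolution dom c G d s) (hq : IsTestTriple dom c q) (hR : IsReduced c q) :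
    Bal dom c.T (fun _ => 0) (fun _ => 0)
      (fun z => pressureTerm c s q z.1 z.2 - reducedPressureTerm c s q z.1 z.2
        + ((extraTerms c s q).map fun f => f z.1 z.2).sum) := by
  have hF : ∀ r, 0 < r → HasDerivAt (fun r => c.relp c.ρbar r) (c.ddp r * (r - c.ρbar)) r :=
    fun r hr => by
      have h1 := (hasDerivAt_id r).const_sub c.ρbar
      refine (((c.hasDerivAt_p hr).const_sub (c.p c.ρbar)).sub
        ((c.hasDerivAt_dp hr).mul h1)).congr_deriv ?_
      simp only [id]; ring
  have hF' : ContinuousOn (fun r => c.ddp r * (r - c.ρbar)) (Ioi 0) :=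
    (IsTestTriple.continuousOn_ddp c).mul (continuousOn_id.sub continuousOn_const)
  -- No far-field constant has to be subtracted, since `h(ρbar|ρbar) = 0`.
  have nF : Nice dom c.T (fun z => c.relp c.ρbar (q.r z.1 z.2)) := by
    have := hq.nice_comp_r hF hF'
    simpa [Params.relp] using this
  have nW : ∀ i, Nice dom c.T (fun z => c.dp (q.r z.1 z.2) * q.W z.1 z.2 i) := fun i => by
    have := (hq.nice_dp.mul (hq.nice_W i)).add ((hq.nice_W i).const_mul (c.dp c.ρbar))
    simpa [sub_mul] using this
  have b := ((h.bal_p hq.smooth_W hq.nice_W).add (((h.bal_grad_ρ nW).const_mul (-1)).add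
    (bal_div nF hq.nice_W))).const_mul (2 * (c.κ * c.μ / c.ε ^ 2) * (2 * c.θ * c.μ)⁻¹)
  refine b.congr (by simp) (by simp) fun z hz _ => ?_
  have ht := Ioo_subset_Icc_self hz
  have hr := hq.pos z.1 ht z.2
  have hK := (IsReduced.coeff_pos c).ne'
  have eg : ∀ {F F' : ℝ → ℝ}, (∀ r, 0 < r → HasDerivAt F (F' r) r) → ContinuousOn F' (Ioi 0) → ∀ i,
      fderiv ℝ (fun z : ℝ × E => F (q.r z.1 z.2)) z (0, unitVec i) =
        F' (q.r z.1 z.2) * (q.r z.1 z.2 * gradLogR q z.1 z.2 i) := fun {F F'} hd hc i => by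
    rw [IsTestTriple.fderiv_scalar_space (f := fun t x => F (q.r t x))
      (hq.smooth_comp_r (IsTestTriple.contDiffOn_of_hasDerivAt hd hc)) i hz,
      hq.pd_comp_r ht (hd _ hr), hq.gradLogR_apply ht, mul_div_cancel₀ _ hr.ne']
  have ep : ∀ i, fderiv ℝ (fun z : ℝ × E => c.dp (q.r z.1 z.2) * q.W z.1 z.2 i) z (0, unitVec i) =
      c.dp (q.r z.1 z.2) * pd i (q.W z.1) z.2 i
        + q.W z.1 z.2 i * (c.ddp (q.r z.1 z.2) * (q.r z.1 z.2 * gradLogR q z.1 z.2 i)) := fun i => by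
    have d1 : DifferentiableAt ℝ (fun z : ℝ × E => c.dp (q.r z.1 z.2)) z :=
      Nice.differentiableAt (hq.smooth_comp_r (IsTestTriple.contDiffOn_of_hasDerivAt
        (fun _ hr => c.hasDerivAt_dp hr) (IsTestTriple.continuousOn_ddp c))) hz
    rw [(d1.hasFDerivAt.fun_mul (Nice.differentiableAt (hq.nice_W i).smooth hz).hasFDerivAt).fderiv,
      ← eg (fun _ hr => c.hasDerivAt_dp hr) (IsTestTriple.continuousOn_ddp c) i,
      ← IsTestTriple.fderiv_proj_space hq.smooth_W i i hz]
    simp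
  have e5 : ∀ i, q.W z.1 z.2 i = 2 * c.θ * c.μ * gradLogR q z.1 z.2 i := fun i => by
    rw [hR.W_eq ht, PiLp.smul_apply, smul_eq_mul]
  have eD := IsReduced.divg_W hq hR ht z.2
  have eS : pd 0 (q.W z.1) z.2 0 + pd 1 (q.W z.1) z.2 1 + pd 2 (q.W z.1) z.2 2 =
      (2 * c.θ * c.μ) * lapl (fun y => Real.log (q.r z.1 y)) z.2 := by
    rw [← eD, divg_eq_sum, Fin.sum_univ_three]
  simp only [ep, eg hF hF', eD, IsTestTriple.fderiv_proj_space hq.smooth_W _ _ hz, inner_eq_sum,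
    Fin.sum_univ_three, e5, pressureTerm, reducedPressureTerm, extraTerms, List.map_cons, List.map_nil,
    List.sum_cons, List.sum_nil, norm_sq_eq_sum, PiLp.sub_apply, PiLp.smul_apply, smul_eq_mul]
  simp only [Params.relp]
  have hKi := inv_mul_cancel₀ hK
  generalize (2 * c.θ * c.μ)⁻¹ = Ki at hKi ⊢
  -- The factor `2θμ` of `W` and its inverse become independent atoms; the identity is then
  -- polynomial modulo their product being 1.
  generalize 2 * c.θ * c.μ = K at hKi eS ⊢
  generalize 2 * (c.κ * c.μ / c.ε ^ 2) = M
  generalize lapl (fun y => Real.log (q.r z.1 y)) z.2 = D at eS ⊢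
  have e0 : pd 0 (q.W z.1) z.2 0 = K * D - pd 1 (q.W z.1) z.2 1 - pd 2 (q.W z.1) z.2 2 := by
    linear_combination eS
  rw [e0]
  linear_combination (M * (s.ρ z.1 z.2 * (c.dp (s.ρ z.1 z.2) - c.dp (q.r z.1 z.2)) *
      (gradLogR q z.1 z.2 0 * s.l z.1 z.2 0 + gradLogR q z.1 z.2 1 * s.l z.1 z.2 1
        + gradLogR q z.1 z.2 2 * s.l z.1 z.2 2)
    + (c.p (s.ρ z.1 z.2) - c.p (q.r z.1 z.2) - c.dp (q.r z.1 z.2) * (s.ρ z.1 z.2 - q.r z.1 z.2)) * D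
    - c.ddp (q.r z.1 z.2) * q.r z.1 z.2 * (s.ρ z.1 z.2 - q.r z.1 z.2) *
      (gradLogR q z.1 z.2 0 * gradLogR q z.1 z.2 0 + gradLogR q z.1 z.2 1 * gradLogR q z.1 z.2 1
        + gradLogR q z.1 z.2 2 * gradLogR q z.1 z.2 2))) * hKi

end Reduced

end
end KEntropy

namespace KEntropy
noncomputable section
open scoped ContDiff ENNReal

/-! ### Lower semicontinuity of the relative entropy -/

namespace Params

variable (c : Params)

theorem continuous_dP : Continuous c.dP :=
  continuous_const.mul (Real.continuous_rpow_const c.γ_sub_pos.le)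

theorem continuous_p : Continuous c.p :=
  continuous_const.mul (Real.continuous_rpow_const c.γ_pos.le)

theorem dP_mul_self {σ : ℝ} (h : 0 ≤ σ) : c.dP σ * σ = c.P σ + c.p σ := by
  have hγ := c.γ_sub_pos
  have e : σ ^ (c.γ - 1) * σ = σ ^ c.γ := by
    rcases h.eq_or_lt with rfl | h
    · rw [mul_zero, Real.zero_rpow c.γ_pos.ne']
    · rw [← Real.rpow_add_one h.ne', sub_add_cancel]
  rw [dP, P, p, mul_assoc, e]
  field_simp
  ring

theorem dP_mono {σ r : ℝ} (hσ : 0 ≤ σ) (h : σ ≤ r) : c.dP σ ≤ c.dP r :=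
  mul_le_mul_of_nonneg_left (Real.rpow_le_rpow hσ h c.γ_sub_pos.le)
    (mul_pos (div_pos c.a_pos c.γ_sub_pos) c.γ_pos).le

theorem dP_nonneg {σ : ℝ} (hσ : 0 ≤ σ) : 0 ≤ c.dP σ :=
  mul_nonneg (mul_pos (div_pos c.a_pos c.γ_sub_pos) c.γ_pos).le (Real.rpow_nonneg hσ _)

theorem p_mono {σ r : ℝ} (hσ : 0 ≤ σ) (h : σ ≤ r) : c.p σ ≤ c.p r :=
  mul_le_mul_of_nonneg_left (Real.rpow_le_rpow hσ h c.γ_pos.le) c.a_pos.le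

theorem p_nonneg {σ : ℝ} (hσ : 0 ≤ σ) : 0 ≤ c.p σ :=
  mul_nonneg c.a_pos.le (Real.rpow_nonneg hσ _)

/-- The point of tangency `σ` of a minorant may be zero, in the vacuum; then the tangent to `P` is
the zero function. -/
theorem relP_nonneg' {s r : ℝ} (hs : 0 ≤ s) (hr : 0 ≤ r) : 0 ≤ c.relP s r := by
  rcases hr.eq_or_lt with rfl | hr
  · have h1 : c.dP 0 = 0 := by rw [dP, Real.zero_rpow c.γ_sub_pos.ne', mul_zero]
    have h2 : c.P 0 = 0 := by rw [P, Real.zero_rpow c.γ_pos.ne', mul_zero]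
    rw [relP, h1, h2]
    have : 0 ≤ c.P s := mul_nonneg (div_pos c.a_pos c.γ_sub_pos).le (Real.rpow_nonneg hs _)
    linarith
  · exact c.relP_nonneg hs hr

/-- The coefficient of the density in the affine minorant of the relative entropy density. -/
def slope (b b' : E) (σ r : ℝ) (V W : E) : ℝ :=
  - inner ℝ V b - ‖b‖ ^ 2 / 2 - inner ℝ W b' - ‖b'‖ ^ 2 / 2 + 1 / c.ε ^ 2 * (c.dP σ - c.dP r)

/-- A minorant of the relative entropy density, affine in `(ϱ, ϱv, ϱw)`. -/
def minorant (b b' : E) (σ ρ : ℝ) (v w : E) (r : ℝ) (V W : E) : ℝ :=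
  inner ℝ (ρ • v) b + inner ℝ (ρ • w) b' + ρ * c.slope b b' σ r V W - 1 / c.ε ^ 2 * (c.p σ - c.p r)

/-- The defect is a sum of squares and a Bregman distance. Hence the minorant lies below and touches
for `b = v - V`, `b' = w - W`, `σ = ϱ`. Using relative velocities as parameters keeps the
coefficients of the momenta independent of the test triple, and so of time. -/
theorem relDens_sub_minorant (b b' : E) {σ : ℝ} (hσ : 0 ≤ σ) (ρ : ℝ) (v w : E) {r : ℝ} (hr : 0 ≤ r)
    (V W : E) : relDens c ρ v w r V W - c.minorant b b' σ ρ v w r V W =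
      1 / 2 * (ρ * (‖v - V - b‖ ^ 2 + ‖w - W - b'‖ ^ 2)) + 1 / c.ε ^ 2 * c.relP ρ σ := by
  have h1 := c.dP_mul_self hσ
  have h2 := c.dP_mul_self hr
  simp only [relDens, minorant, slope, relP, norm_sq_eq_sum, inner_eq_sum, Fin.sum_univ_three,
    PiLp.sub_apply, PiLp.smul_apply, smul_eq_mul]
  linear_combination (1 / c.ε ^ 2) * (h2 - h1)

theorem minorant_le (b b' : E) {σ ρ : ℝ} (hσ : 0 ≤ σ) (hρ : 0 ≤ ρ) (v w : E) {r : ℝ} (hr : 0 ≤ r)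
    (V W : E) : c.minorant b b' σ ρ v w r V W ≤ relDens c ρ v w r V W := by
  have := c.relDens_sub_minorant b b' hσ ρ v w hr V W
  have h1 := c.relP_nonneg' hρ hσ
  have : 0 ≤ 1 / 2 * (ρ * (‖v - V - b‖ ^ 2 + ‖w - W - b'‖ ^ 2)) + 1 / c.ε ^ 2 * c.relP ρ σ := by
    positivity
  linarith

theorem relDens_nonneg {ρ r : ℝ} (hρ : 0 ≤ ρ) (hr : 0 ≤ r) (v w V W : E) :
    0 ≤ relDens c ρ v w r V W := by
  have := c.relP_nonneg' hρ hr
  unfold relDens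
  positivity

theorem abs_slope_le {b b' : E} {σ r N : ℝ} {V W : E} (hb : ‖b‖ ≤ N) (hb' : ‖b'‖ ≤ N) (h0 : 0 ≤ σ)
    (hσ : σ ≤ N) (hr : 0 ≤ r) : |c.slope b b' σ r V W| ≤
      N * ‖V‖ + N * ‖W‖ + N ^ 2 + 1 / c.ε ^ 2 * (c.dP N + c.dP r) := by
  have h1 : |inner ℝ V b| ≤ N * ‖V‖ := (abs_real_inner_le_norm V b).trans (by
    rw [mul_comm]; exact mul_le_mul_of_nonneg_right hb (norm_nonneg _))
  have h2 : |inner ℝ W b'| ≤ N * ‖W‖ := (abs_real_inner_le_norm W b').trans (by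
    rw [mul_comm]; exact mul_le_mul_of_nonneg_right hb' (norm_nonneg _))
  have h3 := pow_le_pow_left₀ (norm_nonneg b) hb 2
  have h4 := pow_le_pow_left₀ (norm_nonneg b') hb' 2
  have h5 := sq_nonneg ‖b‖
  have h6 := sq_nonneg ‖b'‖
  have h7 : |1 / c.ε ^ 2 * (c.dP σ - c.dP r)| ≤ 1 / c.ε ^ 2 * (c.dP N + c.dP r) := by
    rw [abs_mul, abs_of_nonneg (by positivity : 0 ≤ 1 / c.ε ^ 2)]
    refine mul_le_mul_of_nonneg_left (abs_le.2 ?_) (by positivity)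
    have := c.dP_nonneg hr
    have := c.dP_nonneg h0
    have := c.dP_mono h0 hσ
    constructor <;> linarith
  unfold slope
  rw [abs_le] at *
  constructor <;> linarith

theorem abs_minorant_le {b b' : E} {σ ρ r N : ℝ} {v w V W : E} (hb : ‖b‖ ≤ N) (hb' : ‖b'‖ ≤ N)
    (h0 : 0 ≤ σ) (hσ : σ ≤ N) (hρ : 0 ≤ ρ) (hr : 0 ≤ r) : |c.minorant b b' σ ρ v w r V W| ≤
      N * ‖ρ • v‖ + N * ‖ρ • w‖
        + ρ * (N * ‖V‖ + N * ‖W‖ + N ^ 2 + 1 / c.ε ^ 2 * (c.dP N + c.dP r))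
        + 1 / c.ε ^ 2 * (c.p N + c.p r) := by
  have h1 : |inner ℝ (ρ • v) b| ≤ N * ‖ρ • v‖ := (abs_real_inner_le_norm _ b).trans (by
    rw [mul_comm]; exact mul_le_mul_of_nonneg_right hb (norm_nonneg _))
  have h2 : |inner ℝ (ρ • w) b'| ≤ N * ‖ρ • w‖ := (abs_real_inner_le_norm _ b').trans (by
    rw [mul_comm]; exact mul_le_mul_of_nonneg_right hb' (norm_nonneg _))
  have h3 : |ρ * c.slope b b' σ r V W| ≤ ρ * (N * ‖V‖ + N * ‖W‖ + N ^ 2 +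
      1 / c.ε ^ 2 * (c.dP N + c.dP r)) := by
    rw [abs_mul, abs_of_nonneg hρ]
    exact mul_le_mul_of_nonneg_left (c.abs_slope_le hb hb' h0 hσ hr) hρ
  have h7 : |1 / c.ε ^ 2 * (c.p σ - c.p r)| ≤ 1 / c.ε ^ 2 * (c.p N + c.p r) := by
    rw [abs_mul, abs_of_nonneg (by positivity : 0 ≤ 1 / c.ε ^ 2)]
    refine mul_le_mul_of_nonneg_left (abs_le.2 ?_) (by positivity)
    have := c.p_nonneg hr
    have := c.p_nonneg h0
    have := c.p_mono h0 hσ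
    constructor <;> linarith
  unfold minorant
  rw [abs_le] at *
  constructor <;> linarith

end Params

/-- A vector of norm at most `N` is kept, other vectors are replaced by zero. -/
def trunc (N : ℝ) (b : E) : E := if ‖b‖ ≤ N then b else 0

theorem norm_trunc_le {N : ℝ} (hN : 0 ≤ N) (b : E) : ‖trunc N b‖ ≤ N := by
  unfold trunc
  split_ifs with h
  · exact h
  · simpa using hN

theorem measurable_trunc (N : ℝ) : Measurable (trunc N) :=
  Measurable.ite (measurableSet_le measurable_norm measurable_const) measurable_id measurable_const

/-- The relative velocity `v - V` recovered from the momentum. -/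
def relVel (ρ : ℝ) (v V : E) : E := ρ⁻¹ • (ρ • v - ρ • V)

theorem relVel_eq {ρ : ℝ} (h : ρ ≠ 0) (v V : E) : relVel ρ v V = v - V := by
  rw [relVel, ← smul_sub, inv_smul_smul₀ h]

/-- Minorants may be negative in general. Truncating velocities to zero, and `σ` at a level above
`r`, leaves a defect of at most the whole density, so the minorant stays nonnegative, as Fatou's
lemma requires. -/
theorem Params.minorant_trunc_nonneg (c : Params) {N ρ r : ℝ} {v w V W : E} (hρ : 0 ≤ ρ) (hr : 0 ≤ r)
    (hN : r ≤ N) :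
    0 ≤ c.minorant (trunc N (relVel ρ v V)) (trunc N (relVel ρ w W)) (min ρ N) ρ v w r V W := by
  have hN0 := hr.trans hN
  have hσ : 0 ≤ min ρ N := le_min hρ hN0
  have h1 := c.relDens_sub_minorant (trunc N (relVel ρ v V)) (trunc N (relVel ρ w W)) hσ ρ v w hr V W
  have h2 : ∀ v V : E, ρ * ‖v - V - trunc N (relVel ρ v V)‖ ^ 2 ≤ ρ * ‖v - V‖ ^ 2 := fun v V => by
    rcases eq_or_ne ρ 0 with rfl | h
    · simp
    · rw [relVel_eq h, trunc]
      split_ifs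
      · simpa using mul_nonneg hρ (sq_nonneg _)
      · simp
  have h3 : c.relP ρ (min ρ N) ≤ c.relP ρ r := by
    rcases le_total ρ N with h | h
    · rw [min_eq_left h]
      have := c.relP_nonneg' hρ hr
      have e : c.relP ρ ρ = 0 := by simp [Params.relP]
      linarith
    · rw [min_eq_right h]
      have e1 := c.relP_nonneg' hN0 hr
      have e2 := mul_nonneg (sub_nonneg.2 (c.dP_mono hr hN)) (sub_nonneg.2 h)
      unfold Params.relP at *
      linarith
  have h4 := h2 v V
  have h5 := h2 w W
  have h6 := mul_le_mul_of_nonneg_left h3 (by positivity : 0 ≤ 1 / c.ε ^ 2)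
  unfold relDens at h1
  linarith

theorem Params.minorant_trunc_eq (c : Params) {N ρ r : ℝ} {v w V W : E} (hρ : 0 ≤ ρ) (hr : 0 ≤ r)
    (h1 : ρ ≤ N) (h2 : ‖v - V‖ ≤ N) (h3 : ‖w - W‖ ≤ N) :
    c.minorant (trunc N (relVel ρ v V)) (trunc N (relVel ρ w W)) (min ρ N) ρ v w r V W =
      relDens c ρ v w r V W := by
  rw [min_eq_left h1]
  have := c.relDens_sub_minorant (trunc N (relVel ρ v V)) (trunc N (relVel ρ w W)) hρ ρ v w hr V W
  have e : ∀ v V : E, ‖v - V‖ ≤ N → ρ * ‖v - V - trunc N (relVel ρ v V)‖ ^ 2 = 0 := fun v V h => by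
    rcases eq_or_ne ρ 0 with rfl | h0
    · simp
    · rw [relVel_eq h0, trunc, if_pos h]; simp
  rw [mul_add, e v V h2, e w W h3] at this
  simp only [Params.relP, sub_self, mul_zero, add_zero] at this
  linarith

/-! ### Weak convergence of time slices against continuous test functions -/

section Weak

variable {dom : Dom}

theorem cell_far {R : ℝ} (hR : 2 ≤ R) {φ : E → ℝ}
    (supp : dom = .space → ∀ x, R ≤ ‖x‖ → φ x = 0) {x : E} (hx : x ∈ dom.cell) (h : R < ‖x‖) :
    φ x = 0 := by
  cases dom with
  | space => exact supp rfl x h.le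
  | torus =>
    have := cell_torus_subset hx
    rw [mem_closedBall_zero_iff] at this
    linarith

theorem integrableOn_cell_mul {f φ : E → ℝ} (hf : LocallyIntegrable f) (hφ : Continuous φ) {R : ℝ}
    (hR : 2 ≤ R) (supp : dom = .space → ∀ x, R ≤ ‖x‖ → φ x = 0) :
    IntegrableOn (fun x => f x * φ x) dom.cell := by
  have h1 : IntegrableOn (fun x => f x * φ x) (Metric.closedBall 0 R) :=
    (hf.integrableOn_isCompact (isCompact_closedBall 0 R)).mul_continuousOn hφ.continuousOn
      (isCompact_closedBall 0 R)
  have h2 : IntegrableOn (fun x => f x * φ x) (dom.cell ∩ Metric.closedBall 0 R) :=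
    h1.mono_set inter_subset_right
  refine h2.of_forall_sdiff_eq_zero (cell_measurableSet dom) fun x hx => ?_
  rw [cell_far hR supp hx.1, mul_zero]
  by_contra h
  exact hx.2 ⟨hx.1, mem_closedBall_zero_iff.2 (not_lt.1 h)⟩

/-- Weak convergence of nonnegative densities extends from smooth test functions to uniformly
convergent continuous ones. -/
theorem tendsto_integral_of_weak {l : Filter ℝ} {f : ℝ → E → ℝ} {τ : ℝ} {S : Set ℝ}
    (hS : ∀ᶠ t in l, t ∈ S) (hτ : τ ∈ S) (h0 : ∀ t x, 0 ≤ f t x)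
    (hf : ∀ t ∈ S, LocallyIntegrable (f t))
    (hw : ∀ ψ : E → ℝ, IsSpaceTest dom ψ →
      Tendsto (fun t => ∫ x in dom.cell, f t x * ψ x) l (𝓝 (∫ x in dom.cell, f τ x * ψ x)))
    {ψ : ℝ → E → ℝ} {R : ℝ} (hR : 2 ≤ R) (hψ : ∀ t ∈ S, Continuous (ψ t)) (per : dom.Per (ψ τ))
    (supp : dom = .space → ∀ t ∈ S, ∀ x, R ≤ ‖x‖ → ψ t x = 0)
    (hu : ∀ δ > 0, ∀ᶠ t in l, ∀ x ∈ Metric.closedBall 0 (R + 1), |ψ t x - ψ τ x| ≤ δ) :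
    Tendsto (fun t => ∫ x in dom.cell, f t x * ψ t x) l (𝓝 (∫ x in dom.cell, f τ x * ψ τ x)) := by
  obtain ⟨χ, χs, χp, χz, χ01, χ1, -⟩ := exists_cutoff dom
  obtain ⟨m, hm⟩ := exists_nat_ge (R + 1)
  have hχ : IsSpaceTest dom (χ m) := ⟨χs m, χp m, χz m⟩
  set I := ∫ x in dom.cell, f τ x * χ m x with hI
  have I0 : 0 ≤ I := integral_nonneg fun x => mul_nonneg (h0 _ _) (χ01 m x).1
  rw [Metric.tendsto_nhds]
  intro η hη
  -- Three errors are summed: replacing `ψ t` by a smooth `g`, where the mass `∫ f χ` is at most `I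
  -- + 1` for late `t`; the weak convergence against `g`; and replacing `g` by `ψ τ`.
  obtain ⟨δ, hδ, hδη⟩ : ∃ δ > 0, 2 * δ * (I + 1) + δ + δ * I < η := by
    refine ⟨η / (2 * (3 * I + 3)), by positivity, ?_⟩
    have : 2 * (η / (2 * (3 * I + 3))) * (I + 1) + η / (2 * (3 * I + 3)) + η / (2 * (3 * I + 3)) * I
        = η / 2 := by field_simp; ring
    rw [this]; linarith
  -- a smooth test function close to `ψ τ`
  obtain ⟨n, hn⟩ : ∃ n, ∀ x ∈ Metric.closedBall (0 : E) (R + 1), |mollify n (ψ τ) x - ψ τ x| ≤ δ := by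
    have huc := (isCompact_closedBall (0 : E) (R + 2)).uniformContinuousOn_of_continuous
      (hψ τ hτ).continuousOn
    rw [Metric.uniformContinuousOn_iff_le] at huc
    obtain ⟨ν, hν, H⟩ := huc δ hδ
    obtain ⟨n, hn⟩ := ((bump_rOut_tendsto (X := E)).eventually (gt_mem_nhds hν)).exists
    refine ⟨n, fun x hx => norm_mollify_sub_le (hψ τ hτ).aestronglyMeasurable fun y hy => ?_⟩
    rw [mem_closedBall_zero_iff] at hx
    have hy1 := hy.trans_le (bump_rOut_le_one n)
    refine H y (mem_closedBall_zero_iff.2 ?_) x (mem_closedBall_zero_iff.2 (by linarith)) (hy.trans hn).le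
    have := norm_le_norm_add_norm_sub' y x
    rw [dist_eq_norm] at hy1
    linarith
  set g := mollify n (ψ τ) with hg
  have gz : dom = .space → ∀ x, R + 1 ≤ ‖x‖ → g x = 0 := fun hd x hx =>
    mollify_eq_zero fun y hy => supp hd τ hτ _ (by
      have := norm_sub_norm_le x y
      have := hy.trans_le (bump_rOut_le_one n)
      linarith)
  have gs : ContDiff ℝ ∞ g := mollify_contDiff (hψ τ hτ).locallyIntegrable
  have gt : IsSpaceTest dom g := by
    refine ⟨gs, ?_, fun hd => ⟨R + 1, gz hd⟩⟩
    cases dom with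
    | space => trivial
    | torus => exact fun j x => mollify_add_period (per j) x
  have supp' : dom = .space → ∀ t ∈ S, ∀ x, R + 1 ≤ ‖x‖ → ψ t x = 0 := fun hd t ht x hx =>
    supp hd t ht x (by linarith)
  have hR1 : 2 ≤ R + 1 := by linarith
  have iψ : ∀ t ∈ S, ∀ t' ∈ S, IntegrableOn (fun x => f t x * ψ t' x) dom.cell := fun t ht t' ht' =>
    integrableOn_cell_mul (hf t ht) (hψ t' ht') hR1 fun hd => supp' hd t' ht'
  have ig : ∀ t ∈ S, IntegrableOn (fun x => f t x * g x) dom.cell := fun t ht =>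
    integrableOn_cell_mul (hf t ht) gs.continuous hR1 gz
  have iχ : ∀ t ∈ S, IntegrableOn (fun x => f t x * χ m x) dom.cell := fun t ht => by
    by_cases hd : dom = .space
    · obtain ⟨R', hR'⟩ := χz m hd
      exact integrableOn_cell_mul (hf t ht) (χs m).continuous (le_max_left 2 R') fun _ x hx =>
        hR' x ((le_max_right _ _).trans hx)
    · exact integrableOn_cell_mul (hf t ht) (χs m).continuous le_rfl fun h => absurd h hd
  -- Nonnegativity of `f` is used here: the error is bounded by the mass of `f` on the common
  -- support, and `χ m` is a smooth test function that measures this mass.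
  have hcl : ∀ t ∈ S, ∀ k, (∀ x ∈ Metric.closedBall (0 : E) (R + 1), |ψ t x - g x| ≤ k) →
      |(∫ x in dom.cell, f t x * ψ t x) - ∫ x in dom.cell, f t x * g x| ≤
        k * ∫ x in dom.cell, f t x * χ m x := fun t ht k hk => by
    rw [← integral_sub (iψ t ht t ht) (ig t ht), ← integral_const_mul, ← Real.norm_eq_abs]
    refine norm_integral_le_of_norm_le ((iχ t ht).const_mul k) ?_
    filter_upwards [ae_restrict_mem (cell_measurableSet dom)] with x hx
    rw [← mul_sub, norm_mul, Real.norm_of_nonneg (h0 t x), Real.norm_eq_abs]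
    rcases le_or_gt ‖x‖ (R + 1) with h | h
    · rw [χ1 m x (h.trans hm)]
      have := mul_le_mul_of_nonneg_left (hk x (mem_closedBall_zero_iff.2 h)) (h0 t x)
      linarith
    · rw [cell_far hR1 (fun hd => supp' hd t ht) hx h, cell_far hR1 gz hx h]
      have hk0 : 0 ≤ k := (abs_nonneg _).trans (hk 0 (by simp; linarith))
      simpa using mul_nonneg hk0 (mul_nonneg (h0 t x) (χ01 m x).1)
  have e1 := (hw (χ m) hχ).eventually (gt_mem_nhds (lt_add_one I))
  have e2 := (hw g gt).eventually (Metric.ball_mem_nhds _ hδ)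
  filter_upwards [hS, hu δ hδ, e1, e2] with t ht h1 h2 h3
  have k1 := hcl t ht (2 * δ) fun x hx => by
    have a1 := h1 x hx
    have a2 := hn x hx
    rw [abs_le] at *
    constructor <;> linarith
  have k2 := hcl τ hτ δ fun x hx => by rw [abs_sub_comm]; exact hn x hx
  have k3 : 2 * δ * (∫ x in dom.cell, f t x * χ m x) ≤ 2 * δ * (I + 1) :=
    mul_le_mul_of_nonneg_left h2.le (by positivity)
  rw [Real.dist_eq] at h3
  rw [Real.dist_eq]
  rw [← hI] at k2
  have k4 := abs_add_three ((∫ x in dom.cell, f t x * ψ t x) - ∫ x in dom.cell, f t x * g x)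
    ((∫ x in dom.cell, f t x * g x) - ∫ x in dom.cell, f τ x * g x)
    ((∫ x in dom.cell, f τ x * g x) - ∫ x in dom.cell, f τ x * ψ τ x)
  rw [abs_sub_comm (∫ x in dom.cell, f τ x * g x)] at k4
  have k5 : (∫ x in dom.cell, f t x * ψ t x) - (∫ x in dom.cell, f τ x * ψ τ x) =
    ((∫ x in dom.cell, f t x * ψ t x) - ∫ x in dom.cell, f t x * g x) +
    ((∫ x in dom.cell, f t x * g x) - ∫ x in dom.cell, f τ x * g x) +
    ((∫ x in dom.cell, f τ x * g x) - ∫ x in dom.cell, f τ x * ψ τ x) := by ring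
  rw [k5]
  linarith

theorem uniform_close {T τ : ℝ} {F : ℝ × E → ℝ} (hF : ContinuousOn F (Icc 0 T ×ˢ univ))
    (hτ : τ ∈ Icc 0 T) {l : Filter ℝ} (hl : l ≤ 𝓝[Icc 0 T] τ) (R : ℝ) {δ : ℝ} (hδ : 0 < δ) :
    ∀ᶠ t in l, ∀ x ∈ Metric.closedBall 0 R, |F (t, x) - F (τ, x)| ≤ δ := by
  have huc := ((isCompact_Icc (a := (0 : ℝ)) (b := T)).prod
    (isCompact_closedBall (0 : E) R)).uniformContinuousOn_of_continuous
    (hF.mono (prod_mono_right (subset_univ _)))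
  rw [Metric.uniformContinuousOn_iff_le] at huc
  obtain ⟨ν, hν, H⟩ := huc δ hδ
  have h1 : ∀ᶠ t in 𝓝[Icc 0 T] τ, t ∈ Icc 0 T := self_mem_nhdsWithin
  have h2 : ∀ᶠ t in 𝓝[Icc 0 T] τ, dist t τ < ν := nhdsWithin_le_nhds (Metric.ball_mem_nhds τ hν)
  filter_upwards [hl h1, hl h2] with t ht ht' x hx
  refine H (t, x) ⟨ht, hx⟩ (τ, x) ⟨hτ, hx⟩ ?_
  simpa [Prod.dist_eq, hν.le] using ht'.le

end Weak

end
end KEntropy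

/-! ### Semicontinuity along weakly continuous solutions and the passage to every time -/

namespace KEntropy
noncomputable section
open scoped ContDiff ENNReal

theorem IsSpaceTest.exists_radius {dom : Dom} {χ : E → ℝ} (h : IsSpaceTest dom χ) :
    ∃ R, 2 ≤ R ∧ (dom = .space → ∀ x, R ≤ ‖x‖ → χ x = 0) := by
  by_cases hd : dom = .space
  · obtain ⟨R, hR⟩ := h.supp hd
    exact ⟨max 2 R, le_max_left _ _, fun _ x hx => hR x ((le_max_right _ _).trans hx)⟩
  · exact ⟨2, le_rfl, fun h => absurd h hd⟩

theorem IsSpaceTest.smul {dom : Dom} {χ : E → ℝ} (h : IsSpaceTest dom χ) {b : E → E}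
    (hb : ContDiff ℝ ∞ b) (per : dom.Per b) : IsSpaceTest dom (fun x => χ x • b x) where
  smooth := h.smooth.smul hb
  per := IsSolution.per_map₂' (k := fun a b : _ => (a : ℝ) • (b : E)) h.per per
  supp hd := by
    obtain ⟨R, hR⟩ := h.supp hd
    exact ⟨R, fun x hx => by rw [hR x hx, zero_smul]⟩

theorem per_mollify {dom : Dom} {F : Type*} [NormedAddCommGroup F] [NormedSpace ℝ F] [CompleteSpace F]
    {f : E → F} (hf : dom.Per f) (n : ℕ) : dom.Per (mollify n f) := by
  cases dom with
  | space => trivial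
  | torus => exact fun j x => mollify_add_period (hf j) x

theorem continuous_slice {F : Type*} [TopologicalSpace F] {T t : ℝ} {f : ℝ → E → F}
    (hf : ContinuousOn (fun z : ℝ × E => f z.1 z.2) (Icc 0 T ×ˢ univ)) (ht : t ∈ Icc 0 T) :
    Continuous (f t) :=
  hf.comp_continuous (f := fun x : E => (t, x)) (by fun_prop) fun _ => ⟨ht, mem_univ _⟩

section Lsc

variable {dom : Dom} {c : Params} {G : E → ℝ} {d : Data} {s : Fields} {q : Triple}

/-- The minorant of the relative entropy density at the time `t`. -/
def minorantAt (c : Params) (s : Fields) (q : Triple) (b b' : E → E) (σ : E → ℝ) (t : ℝ) (x : E) : ℝ :=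
  c.minorant (b x) (b' x) (σ x) (s.ρ t x) (s.v t x) (s.w t x) (q.r t x) (q.V t x) (q.W t x)

/-- The coefficient of the density in the minorant at the time `t`. -/
def slopeAt (c : Params) (q : Triple) (b b' : E → E) (σ : E → ℝ) (t : ℝ) (x : E) : ℝ :=
  c.slope (b x) (b' x) (σ x) (q.r t x) (q.V t x) (q.W t x)

theorem IsTestTriple.continuousOn_slope (hq : IsTestTriple dom c q) {χ σ : E → ℝ} {b b' : E → E}
    (hχ : Continuous χ) (hb : Continuous b) (hb' : Continuous b') (hσ : Continuous σ) :
    ContinuousOn (fun z : ℝ × E => χ z.2 * slopeAt c q b b' σ z.1 z.2) (Icc 0 c.T ×ˢ univ) := by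
  have cb : ContinuousOn (fun z : ℝ × E => b z.2) (Icc 0 c.T ×ˢ univ) :=
    (hb.comp continuous_snd).continuousOn
  have cb' : ContinuousOn (fun z : ℝ × E => b' z.2) (Icc 0 c.T ×ˢ univ) :=
    (hb'.comp continuous_snd).continuousOn
  have cσ : ContinuousOn (fun z : ℝ × E => σ z.2) (Icc 0 c.T ×ˢ univ) :=
    (hσ.comp continuous_snd).continuousOn
  refine (hχ.comp continuous_snd).continuousOn.mul ?_
  exact (((((hq.smooth_V.continuousOn.inner cb).neg.sub ((cb.norm.pow 2).div_const 2)).sub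
    (hq.smooth_W.continuousOn.inner cb')).sub ((cb'.norm.pow 2).div_const 2))).add
    (continuousOn_const.mul ((c.continuous_dP.comp_continuousOn cσ).sub
      (c.continuous_dP.comp_continuousOn hq.smooth_r.continuousOn)))

theorem IsTestTriple.continuousOn_level (hq : IsTestTriple dom c q) {χ σ : E → ℝ}
    (hχ : Continuous χ) (hσ : Continuous σ) :
    ContinuousOn (fun z : ℝ × E => χ z.2 * (1 / c.ε ^ 2 * (c.p (σ z.2) - c.p (q.r z.1 z.2))))
      (Icc 0 c.T ×ˢ univ) :=
  (hχ.comp continuous_snd).continuousOn.mul (continuousOn_const.mul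
    ((c.continuous_p.comp (hσ.comp continuous_snd)).continuousOn.sub
      (c.continuous_p.comp_continuousOn hq.smooth_r.continuousOn)))

theorem locallyIntegrable_norm {m : E → E} (hm : LocallyIntegrable m) :
    LocallyIntegrable fun x => ‖m x‖ := fun x => by
  obtain ⟨u, hu, hi⟩ := hm x
  exact ⟨u, hu, hi.norm⟩

theorem integrableOn_cell_inner {m g : E → E} (hm : LocallyIntegrable m) (hg : Continuous g) {R : ℝ}
    (hR : 2 ≤ R) (supp : dom = .space → ∀ x, R ≤ ‖x‖ → g x = 0) :
    IntegrableOn (fun x => inner ℝ (m x) (g x)) dom.cell := by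
  refine (integrableOn_cell_mul (locallyIntegrable_norm hm) hg.norm hR fun hd x hx => by rw [supp hd x hx, norm_zero]).mono'
    (hm.aestronglyMeasurable.inner hg.aestronglyMeasurable).restrict
    (Eventually.of_forall fun x => ?_)
  exact norm_inner_le_norm _ _

/-- Splits the minorant into the quantities controlled by weak continuity: both momenta against test
fields independent of time, the density against a continuous function depending on time, and a
remainder without the solution. -/
theorem integral_minorant_eq (hw : IsWeaklyContinuous dom c s) (hq : IsTestTriple dom c q) {t : ℝ}
    (ht : t ∈ Icc 0 c.T) {χ σ : E → ℝ} {b b' : E → E} (hχ : IsSpaceTest dom χ) (hb : Continuous b)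
    (hb' : Continuous b') (hσ : Continuous σ) :
    IntegrableOn (fun x => χ x * minorantAt c s q b b' σ t x) dom.cell ∧
    ∫ x in dom.cell, χ x * minorantAt c s q b b' σ t x =
      (∫ x in dom.cell, s.ρ t x * inner ℝ (s.v t x) (χ x • b x))
      + (∫ x in dom.cell, s.ρ t x * inner ℝ (s.w t x) (χ x • b' x))
      + (∫ x in dom.cell, s.ρ t x * (χ x * slopeAt c q b b' σ t x))
      - ∫ x in dom.cell, 1 * (χ x * (1 / c.ε ^ 2 * (c.p (σ x) - c.p (q.r t x)))) := by
  obtain ⟨R, hR, hz⟩ := hχ.exists_radius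
  have hχc := hχ.smooth.continuous
  have hinner : ∀ {v : E → E} {b : E → E}, LocallyIntegrable (fun x => s.ρ t x • v x) → Continuous b →
      IntegrableOn (fun x => s.ρ t x * inner ℝ (v x) (χ x • b x)) dom.cell := fun {v b} hv hb => by
    refine (integrableOn_cell_inner hv (g := fun x => χ x • b x) (hχc.smul hb) hR fun hd x hx => by
      rw [hz hd x hx, zero_smul]).congr (Eventually.of_forall fun x => ?_)
    simp only [real_inner_smul_left]
  have i1 := hinner (hw.loc t ht).2.1 hb
  have i2 := hinner (hw.loc t ht).2.2 hb'
  have i3 : IntegrableOn (fun x => s.ρ t x * (χ x * slopeAt c q b b' σ t x)) dom.cell :=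
    integrableOn_cell_mul (hw.loc t ht).1 (continuous_slice (f := fun t x => χ x * slopeAt c q b b' σ t x)
      (hq.continuousOn_slope hχc hb hb' hσ) ht) hR fun hd x hx => by rw [hz hd x hx, zero_mul]
  have i4 : IntegrableOn (fun x => 1 * (χ x * (1 / c.ε ^ 2 * (c.p (σ x) - c.p (q.r t x))))) dom.cell :=
    integrableOn_cell_mul (locallyIntegrable_const 1)
      (continuous_slice (f := fun t x => χ x * (1 / c.ε ^ 2 * (c.p (σ x) - c.p (q.r t x))))
      (hq.continuousOn_level hχc hσ) ht) hR fun hd x hx => by rw [hz hd x hx, zero_mul]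
  have e : (fun x => χ x * minorantAt c s q b b' σ t x) =
      fun x => s.ρ t x * inner ℝ (s.v t x) (χ x • b x) + s.ρ t x * inner ℝ (s.w t x) (χ x • b' x)
        + s.ρ t x * (χ x * slopeAt c q b b' σ t x)
        - 1 * (χ x * (1 / c.ε ^ 2 * (c.p (σ x) - c.p (q.r t x)))) := by
    ext x
    simp only [minorantAt, Params.minorant, slopeAt, real_inner_smul_left, real_inner_smul_right]
    ring
  have i12 := i1.add i2
  have i123 := i12.add i3
  rw [e]
  refine ⟨i123.sub i4, ?_⟩
  have e1 := integral_sub i123 i4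
  have e2 := integral_add i12 i3
  have e3 := integral_add i1 i2
  simp only [Pi.add_apply] at e1 e2 e3
  rw [e1, e2, e3]

/-- Times close to `τ` at which the relative entropy is controlled. -/
structure Approach (dom : Dom) (c : Params) (s : Fields) (q : Triple) (τ : ℝ) (l : Filter ℝ) (M : ℝ) :
    Prop where
  mem : τ ∈ Icc 0 c.T
  le : l ≤ 𝓝[Icc 0 c.T] τ
  neBot : l.NeBot
  bound : ∃ m : ℝ → ℝ, Tendsto m l (𝓝 M) ∧ ∀ᶠ t in l, IntegrableOn (relDensAt c s q t) dom.cell ∧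
    ∫ x in dom.cell, relDensAt c s q t x ≤ m t

/-- At nearby times the localized minorant is below the relative entropy density, whose integral is
at most `m t`; weak continuity passes to the limit on both sides. -/
theorem IsSolution.integral_minorant_le (h : IsSolution dom c G d s) (hw : IsWeaklyContinuous dom c s)
    (hq : IsTestTriple dom c q) {τ M : ℝ} {l : Filter ℝ} (hl : Approach dom c s q τ l M)
    {χ σ : E → ℝ} {b b' : E → E} (hχ : IsSpaceTest dom χ) (h01 : ∀ x, 0 ≤ χ x ∧ χ x ≤ 1)
    (hb : ContDiff ℝ ∞ b) (hb' : ContDiff ℝ ∞ b') (hσ : Continuous σ) (pb : dom.Per b)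
    (pb' : dom.Per b') (pσ : dom.Per σ) (σ0 : ∀ x, 0 ≤ σ x) :
    ∫ x in dom.cell, χ x * minorantAt c s q b b' σ τ x ≤ M := by
  obtain ⟨hτ, hle, hne, m, hm, hE⟩ := hl
  obtain ⟨R, hR, hz⟩ := hχ.exists_radius
  have hχc := hχ.smooth.continuous
  have hS : ∀ᶠ t in l, t ∈ Icc 0 c.T := hle self_mem_nhdsWithin
  have eq := fun t ht => integral_minorant_eq hw hq (t := t) ht hχ hb.continuous hb'.continuous hσ
  have t1 := ((hw.cont_v _ (hχ.smul hb pb)) τ hτ).tendsto.mono_left hle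
  have t2 := ((hw.cont_w _ (hχ.smul hb' pb')) τ hτ).tendsto.mono_left hle
  have cs := hq.continuousOn_slope hχc hb.continuous hb'.continuous hσ
  have cl := hq.continuousOn_level hχc hσ
  have pr := hq.per τ hτ
  have t3 := tendsto_integral_of_weak (f := s.ρ) (ψ := fun t x => χ x * slopeAt c q b b' σ t x) hS hτ
    h.nonneg (fun t ht => (hw.loc t ht).1)
    (fun ψ hψ => ((hw.cont_ρ ψ hψ) τ hτ).tendsto.mono_left hle) hR
    (fun t ht => continuous_slice (f := fun t x => χ x * slopeAt c q b b' σ t x) cs ht)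
    (by
      cases dom with
      | space => trivial
      | torus =>
        intro j x
        simp only [slopeAt, hχ.per j x, pb j x, pb' j x, pσ j x, pr.1 j x, pr.2.1 j x, pr.2.2 j x])
    (fun hd t _ x hx => by rw [hz hd x hx, zero_mul])
    (fun δ hδ => uniform_close cs hτ hle (R + 1) hδ)
  -- The term without the solution is treated as a pairing with the constant density 1.
  have t4 := tendsto_integral_of_weak (dom := dom) (f := fun _ _ => 1)
    (ψ := fun t x => χ x * (1 / c.ε ^ 2 * (c.p (σ x) - c.p (q.r t x)))) hS hτ
    (fun _ _ => zero_le_one) (fun t ht => locallyIntegrable_const 1)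
    (fun ψ hψ => tendsto_const_nhds) hR
    (fun t ht => continuous_slice
      (f := fun t x => χ x * (1 / c.ε ^ 2 * (c.p (σ x) - c.p (q.r t x)))) cl ht)
    (by
      cases dom with
      | space => trivial
      | torus =>
        intro j x
        simp only [hχ.per j x, pσ j x, pr.1 j x])
    (fun hd t _ x hx => by rw [hz hd x hx, zero_mul])
    (fun δ hδ => uniform_close cl hτ hle (R + 1) hδ)
  have t5 := ((t1.add t2).add t3).sub t4
  rw [← (eq τ hτ).2] at t5
  refine le_of_tendsto_of_tendsto t5 hm ?_
  filter_upwards [hS, hE] with t ht hEt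
  rw [← (eq t ht).2]
  refine le_trans (integral_mono (eq t ht).1 hEt.1 fun x => ?_) hEt.2
  have hr := (hq.pos t ht x).le
  have a1 := c.minorant_le (b x) (b' x) (σ0 x) (h.nonneg t x) (s.v t x) (s.w t x) hr (q.V t x) (q.W t x)
  have a2 := c.relDens_nonneg (h.nonneg t x) hr (s.v t x) (s.w t x) (q.V t x) (q.W t x)
  calc χ x * minorantAt c s q b b' σ t x ≤ χ x * relDensAt c s q t x :=
        mul_le_mul_of_nonneg_left a1 (h01 x).1
    _ ≤ relDensAt c s q t x := mul_le_of_le_one_left a2 (h01 x).2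

/-- The truncated relative velocity. -/
def truncVel (N : ℝ) (ρ : E → ℝ) (v V : E → E) (x : E) : E := trunc N (relVel (ρ x) (v x) (V x))

theorem locallyIntegrable_of_bounded {F : Type*} [NormedAddCommGroup F] {f : E → F} {N : ℝ}
    (hm : AEStronglyMeasurable f) (h : ∀ x, ‖f x‖ ≤ N) : LocallyIntegrable f :=
  (memLp_top_of_bound hm N (Eventually.of_forall h)).locallyIntegrable le_top

theorem locallyIntegrable_truncVel {ρ : E → ℝ} {v V : E → E} {N : ℝ} (hN : 0 ≤ N)
    (hρ : LocallyIntegrable ρ) (hv : LocallyIntegrable fun x => ρ x • v x) (hV : Continuous V) :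
    LocallyIntegrable (truncVel N ρ v V) := by
  refine locallyIntegrable_of_bounded ?_ fun x => norm_trunc_le hN _
  have hm := hρ.aestronglyMeasurable
  have h1 : AEStronglyMeasurable (fun x => relVel (ρ x) (v x) (V x)) :=
    hm.aemeasurable.inv.aestronglyMeasurable.smul
      (hv.aestronglyMeasurable.sub (hm.smul hV.aestronglyMeasurable))
  exact ((measurable_trunc N).comp_aemeasurable h1.aemeasurable).aestronglyMeasurable

/-- The optimal coefficients at the time `τ`, truncated, are bounded but only measurable. Their
mollifications are admissible, obey the same bounds and converge almost everywhere, so dominated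
convergence transfers the estimate. -/
theorem IsSolution.integral_truncated_le (h : IsSolution dom c G d s) (hw : IsWeaklyContinuous dom c s)
    (hq : IsTestTriple dom c q) {τ M : ℝ} {l : Filter ℝ} (hl : Approach dom c s q τ l M)
    {χ : E → ℝ} (hχ : IsSpaceTest dom χ) (h01 : ∀ x, 0 ≤ χ x ∧ χ x ≤ 1) {N : ℝ} (hN : 0 ≤ N) :
    IntegrableOn (fun x => χ x * minorantAt c s q (truncVel N (s.ρ τ) (s.v τ) (q.V τ))
      (truncVel N (s.ρ τ) (s.w τ) (q.W τ)) (fun x => min (s.ρ τ x) N) τ x) dom.cell ∧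
    ∫ x in dom.cell, χ x * minorantAt c s q (truncVel N (s.ρ τ) (s.v τ) (q.V τ))
      (truncVel N (s.ρ τ) (s.w τ) (q.W τ)) (fun x => min (s.ρ τ x) N) τ x ≤ M := by
  have hτ := hl.mem
  obtain ⟨lρ, lv, lw⟩ := hw.loc τ hτ
  have cV := continuous_slice hq.smooth_V.continuousOn hτ
  have cW := continuous_slice hq.smooth_W.continuousOn hτ
  have cr := continuous_slice hq.smooth_r.continuousOn hτ
  have hχc := hχ.smooth.continuous
  obtain ⟨R, hR, hz⟩ := hχ.exists_radius
  set b := truncVel N (s.ρ τ) (s.v τ) (q.V τ)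
  set b' := truncVel N (s.ρ τ) (s.w τ) (q.W τ)
  set σ : E → ℝ := fun x => min (s.ρ τ x) N
  have lb : LocallyIntegrable b := locallyIntegrable_truncVel hN lρ lv cV
  have lb' : LocallyIntegrable b' := locallyIntegrable_truncVel hN lρ lw cW
  have σ0 : ∀ x, 0 ≤ σ x := fun x => le_min (h.nonneg τ x) hN
  have σN : ∀ x, ‖σ x‖ ≤ N := fun x => by
    rw [Real.norm_of_nonneg (σ0 x)]; exact min_le_right _ _
  have lσ : LocallyIntegrable σ := locallyIntegrable_of_bounded
    (lρ.aestronglyMeasurable.inf aestronglyMeasurable_const) σN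
  have pr := hq.per τ hτ
  have ps := h.per τ
  have pb : dom.Per b := by
    cases dom with
    | space => trivial
    | torus => intro j x; simp only [b, truncVel, ps.1 j x, ps.2.1 j x, pr.2.1 j x]
  have pb' : dom.Per b' := by
    cases dom with
    | space => trivial
    | torus => intro j x; simp only [b', truncVel, ps.1 j x, ps.2.2.1 j x, pr.2.2 j x]
  have pσ : dom.Per σ := IsSolution.per_map (k := fun a => min a N) ps.1
  have nb : ∀ n x, ‖mollify n b x‖ ≤ N := fun n x => norm_mollify_le fun y _ => norm_trunc_le hN _
  have nb' : ∀ n x, ‖mollify n b' x‖ ≤ N := fun n x => norm_mollify_le fun y _ => norm_trunc_le hN _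
  have nσ : ∀ n x, mollify n σ x ≤ N := fun n x =>
    (Real.le_norm_self _).trans (norm_mollify_le fun y _ => σN _)
  have zσ : ∀ n x, 0 ≤ mollify n σ x := fun n x => mollify_nonneg σ0 x
  have sb : ∀ n, ContDiff ℝ ∞ (mollify n b) := fun n => mollify_contDiff lb
  have sb' : ∀ n, ContDiff ℝ ∞ (mollify n b') := fun n => mollify_contDiff lb'
  have sσ : ∀ n, Continuous (mollify n σ) := fun n => (mollify_contDiff lσ).continuous
  have hint := fun n => (integral_minorant_eq hw hq hτ hχ (sb n).continuous (sb' n).continuous (sσ n)).1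
  have hle := fun n => h.integral_minorant_le hw hq hl hχ h01 (sb n) (sb' n) (sσ n)
    (per_mollify pb n) (per_mollify pb' n) (per_mollify pσ n) (zσ n)
  set bound : E → ℝ := fun x => ‖s.ρ τ x • s.v τ x‖ * (χ x * N) + ‖s.ρ τ x • s.w τ x‖ * (χ x * N)
    + s.ρ τ x * (χ x * (N * ‖q.V τ x‖ + N * ‖q.W τ x‖ + N ^ 2
      + 1 / c.ε ^ 2 * (c.dP N + c.dP (q.r τ x))))
    + 1 * (χ x * (1 / c.ε ^ 2 * (c.p N + c.p (q.r τ x)))) with hbound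
  have cχN : Continuous fun x => χ x * N := hχc.mul continuous_const
  have zχ : ∀ f : E → ℝ, dom = .space → ∀ x, R ≤ ‖x‖ → χ x * f x = 0 := fun f hd x hx => by
    rw [hz hd x hx, zero_mul]
  have ib : IntegrableOn bound dom.cell := by
    refine (((integrableOn_cell_mul (locallyIntegrable_norm lv) cχN hR (zχ _)).add
      (integrableOn_cell_mul (locallyIntegrable_norm lw) cχN hR (zχ _))).add
      (integrableOn_cell_mul lρ (hχc.mul ?_) hR (zχ _))).add
      (integrableOn_cell_mul (locallyIntegrable_const 1) (hχc.mul ?_) hR (zχ _))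
    · exact (((continuous_const.mul cV.norm).add (continuous_const.mul cW.norm)).add
        continuous_const).add (continuous_const.mul (continuous_const.add (c.continuous_dP.comp cr)))
    · exact continuous_const.mul (continuous_const.add (c.continuous_p.comp cr))
  have hdom : ∀ {β β' : E} {κ : ℝ} {x : E}, ‖β‖ ≤ N → ‖β'‖ ≤ N → 0 ≤ κ → κ ≤ N →
      ‖χ x * c.minorant β β' κ (s.ρ τ x) (s.v τ x) (s.w τ x) (q.r τ x) (q.V τ x) (q.W τ x)‖ ≤ bound x :=
    fun {β β' κ x} h1 h2 h3 h4 => by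
      rw [norm_mul, Real.norm_of_nonneg (h01 x).1, Real.norm_eq_abs]
      refine (mul_le_mul_of_nonneg_left (c.abs_minorant_le h1 h2 h3 h4 (h.nonneg τ x)
        (hq.pos τ hτ x).le) (h01 x).1).trans (le_of_eq ?_)
      simp only [hbound]; ring
  have hlim : ∀ᵐ x ∂(volume.restrict dom.cell), Tendsto
      (fun n => χ x * minorantAt c s q (mollify n b) (mollify n b') (mollify n σ) τ x) atTop
      (𝓝 (χ x * minorantAt c s q b b' σ τ x)) := by
    filter_upwards [ae_restrict_of_ae (mollify_tendsto_ae lb), ae_restrict_of_ae (mollify_tendsto_ae lb'),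
      ae_restrict_of_ae (mollify_tendsto_ae lσ)] with x h1 h2 h3
    refine tendsto_const_nhds.mul ?_
    unfold minorantAt Params.minorant Params.slope
    refine (((tendsto_const_nhds.inner h1).add (tendsto_const_nhds.inner h2)).add
      (tendsto_const_nhds.mul ?_)).sub (tendsto_const_nhds.mul
        (((c.continuous_p.tendsto _).comp h3).sub tendsto_const_nhds))
    exact ((((tendsto_const_nhds.inner h1).neg.sub ((h1.norm.pow 2).div_const 2)).sub
      (tendsto_const_nhds.inner h2)).sub ((h2.norm.pow 2).div_const 2)).add
      (tendsto_const_nhds.mul (((c.continuous_dP.tendsto _).comp h3).sub tendsto_const_nhds))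
  refine ⟨ib.mono' (aestronglyMeasurable_of_tendsto_ae atTop
    (fun n => (hint n).aestronglyMeasurable) hlim) (Eventually.of_forall fun x =>
      hdom (norm_trunc_le hN _) (norm_trunc_le hN _) (σ0 x) (min_le_right _ _)), ?_⟩
  refine le_of_tendsto' (tendsto_integral_of_dominated_convergence bound
    (fun n => (hint n).aestronglyMeasurable) ib (fun n => Eventually.of_forall fun x =>
      hdom (nb n x) (nb' n x) (zσ n x) (nσ n x)) hlim) hle

/-- The relative entropy is lower semicontinuous in time along weakly continuous solutions. -/
theorem IsSolution.relDens_lsc (h : IsSolution dom c G d s) (hw : IsWeaklyContinuous dom c s)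
    (hq : IsTestTriple dom c q) {τ M : ℝ} {l : Filter ℝ} (hl : Approach dom c s q τ l M) :
    IntegrableOn (relDensAt c s q τ) dom.cell ∧ ∫ x in dom.cell, relDensAt c s q τ x ≤ M := by
  have hτ := hl.mem
  obtain ⟨r₀, r₁, hr₀, ⟨hρ₀, hρ₁⟩, hr⟩ := hq.exists_bounds
  obtain ⟨χ, χs, χp, χz, χ01, χ1, -⟩ := exists_cutoff dom
  have hr₁ : 0 ≤ r₁ := hr₀.le.trans (hρ₀.trans hρ₁)
  have hN : ∀ n : ℕ, 0 ≤ r₁ + n := fun n => by positivity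
  -- The truncation level `r₁ + n` always exceeds `r` on the cell, which keeps the minorant
  -- nonnegative. At each fixed point it eventually exceeds the density and the relative velocities,
  -- so that the minorant equals the relative entropy density.
  set f : ℕ → E → ℝ := fun n x => χ n x * minorantAt c s q
    (truncVel (r₁ + n) (s.ρ τ) (s.v τ) (q.V τ)) (truncVel (r₁ + n) (s.ρ τ) (s.w τ) (q.W τ))
    (fun x => min (s.ρ τ x) (r₁ + n)) τ x with hf
  have hi := fun n => h.integral_truncated_le hw hq hl ⟨χs n, χp n, χz n⟩ (χ01 n) (hN n)
  have f0 : ∀ n, ∀ᵐ x ∂(volume.restrict dom.cell), 0 ≤ f n x := fun n => by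
    filter_upwards [ae_restrict_mem (cell_measurableSet dom)] with x hx
    refine mul_nonneg (χ01 n x).1 (c.minorant_trunc_nonneg (h.nonneg τ x) (hq.pos τ hτ x).le ?_)
    have := (hr τ hτ x hx).2
    have : (0 : ℝ) ≤ n := by positivity
    linarith
  have hlim : ∀ x, ∀ᶠ n in atTop, f n x = relDensAt c s q τ x := fun x => by
    obtain ⟨k, hk⟩ := exists_nat_ge (‖x‖ + s.ρ τ x + ‖s.v τ x - q.V τ x‖ + ‖s.w τ x - q.W τ x‖)
    filter_upwards [eventually_ge_atTop k] with n hn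
    have hn' : (k : ℝ) ≤ n := Nat.cast_le.2 hn
    have a1 := norm_nonneg x
    have a2 := h.nonneg τ x
    have a3 := norm_nonneg (s.v τ x - q.V τ x)
    have a4 := norm_nonneg (s.w τ x - q.W τ x)
    have e := c.minorant_trunc_eq (N := r₁ + n) (v := s.v τ x) (V := q.V τ x) (w := s.w τ x)
      (W := q.W τ x) a2 (hq.pos τ hτ x).le (by linarith) (by linarith) (by linarith)
    simp only [hf, χ1 n x (by linarith), one_mul]
    exact e
  have hlim' : ∀ᵐ x ∂(volume.restrict dom.cell), Tendsto (fun n => f n x) atTop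
      (𝓝 (relDensAt c s q τ x)) := Eventually.of_forall fun x =>
    tendsto_const_nhds.congr' ((hlim x).mono fun n e => e.symm)
  have hm : AEStronglyMeasurable (relDensAt c s q τ) (volume.restrict dom.cell) :=
    aestronglyMeasurable_of_tendsto_ae atTop (fun n => (hi n).1.aestronglyMeasurable) hlim'
  have e0 : ∀ᵐ x ∂(volume.restrict dom.cell), 0 ≤ relDensAt c s q τ x := Eventually.of_forall fun x =>
    c.relDens_nonneg (h.nonneg τ x) (hq.pos τ hτ x).le _ _ _ _
  have M0 : 0 ≤ M := (integral_nonneg_of_ae (f0 0)).trans (hi 0).2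
  have hfat : ∫⁻ x in dom.cell, ENNReal.ofReal (relDensAt c s q τ x) ≤ ENNReal.ofReal M := by
    calc ∫⁻ x in dom.cell, ENNReal.ofReal (relDensAt c s q τ x)
        = ∫⁻ x in dom.cell, liminf (fun n => ENNReal.ofReal (f n x)) atTop := by
          refine lintegral_congr fun x => (Tendsto.liminf_eq ?_).symm
          exact tendsto_const_nhds.congr' ((hlim x).mono fun n e => by simp only [e])
      _ ≤ liminf (fun n => ∫⁻ x in dom.cell, ENNReal.ofReal (f n x)) atTop :=
          lintegral_liminf_le' fun n => (hi n).1.aestronglyMeasurable.aemeasurable.ennreal_ofReal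
      _ ≤ ENNReal.ofReal M := by
          refine liminf_le_of_frequently_le' (Frequently.of_forall fun n => ?_)
          rw [← ofReal_integral_eq_lintegral_ofReal (hi n).1 (f0 n)]
          exact ENNReal.ofReal_le_ofReal (hi n).2
  refine ⟨⟨hm, (hasFiniteIntegral_iff_ofReal e0).2 (hfat.trans_lt ENNReal.ofReal_lt_top)⟩, ?_⟩
  rw [integral_eq_lintegral_of_nonneg_ae e0 hm]
  exact ENNReal.toReal_le_of_le_ofReal M0 hfat

/-! ### From the balance law to the inequality -/

theorem sum_stInt {T τ : ℝ} (hτ : τ ≤ T) {L : List (ℝ → E → ℝ)}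
    (hL : ∀ f ∈ L, StIntegrable dom T f) :
    Integrable (fun z : ℝ × E => (L.map fun f => f z.1 z.2).sum) (strip dom T) ∧
    (L.map (stInt dom τ)).sum = ∫ z, (L.map fun f => f z.1 z.2).sum ∂(strip dom τ) := by
  induction L with
  | nil => simp
  | cons f L ih =>
    obtain ⟨i1, e1⟩ := ih fun g hg => hL g (List.mem_cons_of_mem _ hg)
    have i0 : Integrable (fun z : ℝ × E => f z.1 z.2) (strip dom T) := hL f List.mem_cons_self
    simp only [List.map_cons, List.sum_cons]
    refine ⟨i0.add i1, ?_⟩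
    rw [integral_add (i0.mono_measure (strip_mono dom hτ)) (i1.mono_measure (strip_mono dom hτ)), e1]
    rfl

theorem continuousOn_integral_strip {T : ℝ} {b : ℝ × E → ℝ} (hb : Integrable b (strip dom T)) :
    ContinuousOn (fun t => ∫ z, b z ∂(strip dom t)) (Icc 0 T) := by
  have h1 : IntegrableOn (fun t => ∫ x in dom.cell, b (t, x)) (Icc 0 T) := by
    rw [integrableOn_Icc_iff_integrableOn_Ioo]
    have := hb
    rw [strip, volume_restrict_prod] at this
    exact this.integral_prod_left
  refine (intervalIntegral.continuousOn_primitive h1).congr fun t ht => ?_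
  have h2 := hb.mono_measure (strip_mono dom ht.2)
  rw [strip, volume_restrict_prod] at h2
  beta_reduce
  rw [integral_Ioc_eq_integral_Ioo, strip, volume_restrict_prod, integral_prod _ h2]

/-- A neighbourhood of `τ` meets `(0,T)` in a nonempty open set, which has positive measure and so
cannot consist of exceptional times. -/
theorem mem_closure_of_ae {T τ : ℝ} (hT : 0 < T) (hτ : τ ∈ Icc 0 T) {p : ℝ → Prop}
    (hp : ∀ᵐ t ∂(volume.restrict (Ioo 0 T)), p t) : τ ∈ closure {t ∈ Ioo 0 T | p t} := by
  rw [mem_closure_iff]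
  intro o ho hτo
  rw [← closure_Ioo hT.ne] at hτ
  have hne := mem_closure_iff.1 hτ o ho hτo
  by_contra hemp
  rw [not_nonempty_iff_eq_empty] at hemp
  rw [ae_restrict_iff' measurableSet_Ioo] at hp
  have h0 : volume (o ∩ Ioo 0 T) = 0 := by
    refine measure_mono_null (fun t ht => ?_) (ae_iff.1 hp)
    intro hpt
    have : t ∈ o ∩ {t ∈ Ioo 0 T | p t} := ⟨ht.1, ht.2, hpt ht.2⟩
    rw [hemp] at this
    exact this
  exact ((ho.inter isOpen_Ioo).measure_pos volume hne).ne' h0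

/-- The inequality in all its forms follows from the balance law under one integral. -/
theorem RelIneq.of_balLE (h : IsSolution dom c G d s) (hq : IsTestTriple dom c q)
    {lhs rhs : List (ℝ → E → ℝ)} (hL : ∀ f ∈ lhs, StIntegrable dom c.T f)
    (hR : ∀ f ∈ rhs, StIntegrable dom c.T f)
    (hB : BalLE dom c.T (fun z => relDensAt c s q z.1 z.2) (relDensInit c d q)
      (fun z => (rhs.map fun f => f z.1 z.2).sum - (lhs.map fun f => f z.1 z.2).sum)) :
    RelIneq dom c d s q lhs rhs := by
  have heq : ∀ τ, τ ≤ c.T → (rhs.map (stInt dom τ)).sum - (lhs.map (stInt dom τ)).sum =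
      ∫ z, (rhs.map fun f => f z.1 z.2).sum - (lhs.map fun f => f z.1 z.2).sum ∂(strip dom τ) := by
    intro τ hτ
    obtain ⟨i1, e1⟩ := sum_stInt hτ hR
    obtain ⟨i2, e2⟩ := sum_stInt hτ hL
    rw [integral_sub (i1.mono_measure (strip_mono dom hτ)) (i2.mono_measure (strip_mono dom hτ)), e1, e2]
  have hae : ∀ᵐ τ ∂(volume.restrict (Ioo 0 c.T)), RelIneqAt dom c d s q lhs rhs τ := by
    filter_upwards [hB.le, integrable_slice hB.int_F, ae_restrict_mem measurableSet_Ioo] with τ h1 h2 hτ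
    refine ⟨h2, ?_⟩
    have := heq τ hτ.2.le
    linarith
  refine ⟨fun f hf => ?_, hB.int_a, hae, fun hw τ hτ => ?_⟩
  · rcases List.mem_append.1 hf with hf | hf
    exacts [hL f hf, hR f hf]
  -- Any `τ`, endpoints included, is a limit of times at which the inequality holds. At `τ = 0` the
  -- time integrals are empty, and the bound says that the slice at time 0 has at most the relative
  -- entropy of the data.
  have hcl := mem_closure_of_ae c.T_pos hτ hae
  have hsub : {t ∈ Ioo 0 c.T | RelIneqAt dom c d s q lhs rhs t} ⊆ Icc 0 c.T := fun t ht =>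
    Ioo_subset_Icc_self ht.1
  have hlsc := h.relDens_lsc hw hq (τ := τ)
    (l := 𝓝[{t ∈ Ioo 0 c.T | RelIneqAt dom c d s q lhs rhs t}] τ)
    (M := (∫ x in dom.cell, relDensInit c d q x) + ∫ z, (rhs.map fun f => f z.1 z.2).sum
      - (lhs.map fun f => f z.1 z.2).sum ∂(strip dom τ))
    ⟨hτ, nhdsWithin_mono τ hsub, mem_closure_iff_nhdsWithin_neBot.1 hcl,
      fun t => (∫ x in dom.cell, relDensInit c d q x) + ∫ z, (rhs.map fun f => f z.1 z.2).sum
      - (lhs.map fun f => f z.1 z.2).sum ∂(strip dom t),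
      tendsto_const_nhds.add ((continuousOn_integral_strip hB.int_b τ hτ).tendsto.mono_left
        (nhdsWithin_mono τ hsub)), by
      filter_upwards [self_mem_nhdsWithin] with t ht
      refine ⟨ht.2.1, ?_⟩
      have h1 := ht.2.2
      have h2 := heq t ht.1.2.le
      linarith⟩
  refine ⟨hlsc.1, ?_⟩
  have h1 := hlsc.2
  have h2 := heq τ hτ.2
  linarith

end Lsc

end
end KEntropy

/-! ### The theorem -/

theorem lemma3p1 (dom : KEntropy.Dom) (c : KEntropy.Params)
    (G : KEntropy.E → ℝ) (hG : KEntropy.IsPotential dom G)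
    (d : KEntropy.Data) (s : KEntropy.Fields) (hs : KEntropy.IsSolution dom c G d s)
    (q : KEntropy.Triple) (hq : KEntropy.IsTestTriple dom c q) :
    KEntropy.RelIneq dom c d s q
      (KEntropy.viscousTerms c s q ++ [KEntropy.pressureTerm c s q])
      (KEntropy.generalTerms c G s q) ∧
    (KEntropy.IsLogGradient c s → KEntropy.IsReduced c q →
      KEntropy.RelIneq dom c d s q
        (KEntropy.viscousTerms c s q ++ [KEntropy.pressureTerm c s q])
        (KEntropy.reducedTerms c G s q) ∧
      KEntropy.RelIneq dom c d s q
        (KEntropy.viscousTerms c s q ++ [KEntropy.reducedPressureTerm c s q])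
        (KEntropy.reducedTerms c G s q ++ KEntropy.extraTerms c s q)) := by
  have hV := KEntropy.integrable_viscous hs hq
  have hB := hs.bal_relDens hG hq
  have hL : ∀ f ∈ KEntropy.viscousTerms c s q ++ [KEntropy.pressureTerm c s q],
      KEntropy.StIntegrable dom c.T f := fun f hf => by
    rcases List.mem_append.1 hf with hf | hf
    · exact hV f hf
    · rw [List.mem_singleton.1 hf]
      exact KEntropy.integrable_pressureTerm hs hq
  refine ⟨KEntropy.RelIneq.of_balLE hs hq hL (KEntropy.integrable_general hs hG hq) hB,
    fun hl hR => ?_⟩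
  have hi := KEntropy.integrable_reduced hs hG hq
  have hB' := hB.congr (ae_eq_refl _) (ae_eq_refl _)
    ((KEntropy.generalTerms_sum_eq hs hq hl hR).mono fun z e => congrArg₂ (· - ·) e rfl)
  -- The second reduced inequality is the first one plus the balance `bal_extra`, which has zero
  -- left-hand side and exchanges one dissipation for the other.
  refine ⟨KEntropy.RelIneq.of_balLE hs hq hL hi hB', KEntropy.RelIneq.of_balLE hs hq (fun f hf => ?_)
    (fun f hf => ?_) ((hB'.add (KEntropy.bal_extra hs hq hR).toLE).congr
      (Eventually.of_forall fun z => add_zero _) (Eventually.of_forall fun x => add_zero _)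
      (Eventually.of_forall fun z => ?_))⟩
  · rcases List.mem_append.1 hf with hf | hf
    · exact hV f hf
    · rw [List.mem_singleton.1 hf]
      exact KEntropy.integrable_reducedPressureTerm hs hq
  · rcases List.mem_append.1 hf with hf | hf
    exacts [hi f hf, KEntropy.integrable_extra hs hq hR f hf]
  · simp only [List.map_append, List.sum_append, List.map_cons, List.map_nil, List.sum_cons,
      List.sum_nil]
    ring
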